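/- **Setting.** Let $c_0,\omega_0,a_0>0$ and $N\in\mathbb N$. Let $\mathcal A_0\subset\mathbb R^2$ be bounded and measurable with area $|\mathcal A_0|>0$. Let $K:\mathbb R^3\to\mathbb R$ be smooth with compact support contained in $\{y_3<0\}$, and let $\mathcal D\subset\mathbb R^3$ be bounded and measurable with $\overline{\mathcal D}\subset\{z_3>0\}$. For a real Schwartz function $\hat F_0$ on $\mathbb R$ and $B_H>0$ put $$\hat F(\omega)=\frac1{B_H}\Big(\hat F_0\big(\tfrac{\omega_0-\omega}{B_H}\big)+\hat F_0\big(\tfrac{\omega_0+\omega}{B_H}\big)\Big),\qquad F_0(t)=\frac1{2\pi}\int_{\mathbb R}\hat F_0(\omega)e^{-i\omega t}\,d\omega .$$ Let $\mu$ be a jointly measurable, square integrable, mean-zero, (second-order) stationary real random field on $\mathbb R^3$ whose covariance function $\Sigma(x)=\operatorname{Cov}(\mu(x),\mu(0))$ satisfies $|\Sigma(x)|\le C(1+|x|)^{-4-\eta}$ for some $C$ and some $\eta>0$. For $\ell_c>0$ let $\rho_\mu(z)=\mu(z/\ell_c)$, $z\in\mathcal D$. **Imaging functional.** With $\hat G_0(\omega,x,y)=\dfrac{e^{i\omega|x-y|/c_0}}{4\pi|x-y|}$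 and $\varepsilon>0$, let $C^{(1)}=C^{(1)}_{\rm I}+C^{(1)}_{\rm II}$ be the Born approximation of the scattered part of the theoretical cross-correlation, $$C^{(1)}_{\rm I}(\tau,x_1,x_2)=\frac1{2\pi c_0^2\varepsilon^2}\int_{\mathcal D}\!dz\,\rho_\mu(z)\!\int_{\mathbb R^3}\!\!dy\!\int_{\mathbb R}\!d\omega\;\omega^2K(y)\hat F(\omega)\,\hat G_0(\tfrac\omega\varepsilon,x_2,z)\,\hat G_0(\tfrac\omega\varepsilon,z,y)\,\overline{\hat G_0(\tfrac\omega\varepsilon,x_1,y)}\,e^{-i\omega\tau/\varepsilon},$$ $$C^{(1)}_{\rm II}(\tau,x_1,x_2)=\frac1{2\pi c_0^2\varepsilon^2}\int_{\mathcal D}\!dz\,\rho_\mu(z)\!\int_{\mathbb R^3}\!\!dy\!\int_{\mathbb R}\!d\omega\;\omega^2K(y)\hat F(\omega)\,\overline{\hat G_0(\tfrac\omega\varepsilon,x_1,z)\,\hat G_0(\tfrac\omega\varepsilon,z,y)}\,\hat G_0(\tfrac\omega\varepsilon,x_2,y)\,e^{-i\omega\tau/\varepsilon}.$$ The array is $\mathcal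 A=\varepsilon^{1/2}a_0\mathcal A_0$, placed in the plane $x_3=0$, and the daylight imaging functional (dense-array form) at a search point $z_s$ with search speed $c_s>0$ is $$\mathcal I(z_s,c_s)=\frac{N^2}{|\mathcal A|^2}\iint_{\mathcal A^2}C^{(1)}\Big(\frac{|z_s-x_2|+|z_s-x_1|}{c_s},x_1,x_2\Big)\,dx_1dx_2 .$$ Fix $t_g>0$ and $c_s>0$; let $z_s(c_s,t_g)=(0,0,c_st_g)$ and let the virtual guide star be $z_g=(0,0,c_0t_g)$, assumed to lie in the interior of $\mathcal D$. **Point spread function.** Put $$\mathcal G_{1,1}(\xi_1,\xi_2,\xi_3,\xi_4)=\frac1{|\mathcal A_0|}\int_{\mathcal A_0}\exp\Big(-i(u_1\xi_1+u_2\xi_2)-i\tfrac{u_1^2+u_2^2}2\xi_3-i\tfrac{u_1^2+u_2^2}2\xi_4\Big)du_1du_2,$$ $$\mathcal G^{(\omega)}(\boldsymbol\eta)=\mathcal G_{1,1}\Big(\tfrac{a_0\omega}{c_0|z_g|}\eta_1,\tfrac{a_0\omega}{c_0|z_g|}\eta_2,0,\tfrac{-a_0^2\omega}{c_0|z_g|}\big((\tfrac{c_0}{c_s})^2-1\big)\Big),\qquad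 \phi(\boldsymbol\eta)=2\eta_3+\frac{\eta_1^2+\eta_2^2}{|z_g|},$$ $$\mathcal P_\mu(t_g,\boldsymbol\eta,c_s)=\operatorname{Re}\int_{\mathbb R}\big(-i\omega\hat F(\omega)\big)\,e^{i\frac{\omega}{c_0}\phi(\boldsymbol\eta)}\;\mathcal G^{(\omega)}(\boldsymbol\eta)^2\,d\omega ,$$ $$A=\frac{N^2}{2^6\pi^3c_0}\,\frac{\mathcal K(\mathbf 0,z_g)}{|z_g|^2},\qquad \mathcal K(x,z)=\int_0^\infty K\Big(x+\frac{x-z}{|x-z|}\,l\Big)dl .$$ **Proposition (second order moment).** $\Sigma$ is integrable, and $\mathcal I(z_s(c_s,t_g),c_s)$ is a square integrable random variable for all $\varepsilon,\ell_c,B_H>0$. Moreover: 1. For every $B_H>0$ the function $|\mathcal P_\mu(t_g,\cdot,c_s)|^2$ is integrable on $\mathbb R^3$ and, as $\varepsilon\to0^+$ and $\ell_c/\varepsilon\to0^+$, $$\frac{\mathbb E|\mathcal I(z_s(c_s,t_g),c_s)|^2}{\ell_c^3}\;\longrightarrow\;A^2\Big(\int_{\mathbb R^3}\Sigma(x)\,dx\Big)\int_{\mathbb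 R^3}|\mathcal P_\mu(t_g,\boldsymbol\eta,c_s)|^2\,d\boldsymbol\eta .$$ If $\Sigma\ge0$, then $\int\Sigma=\|\Sigma\|_{L^1(\mathbb R^3)}$. 2. In the regime $B_H\ll\omega_0$ it is proportional to $$J(B_H)=\int_{\mathbb R^3}\Big|F_0\Big(\frac{B_H}{c_0}\,\phi(\boldsymbol\eta)\Big)\Big|^2\,\big|\mathcal G^{(\omega_0)}(\boldsymbol\eta)\big|^4\,d\boldsymbol\eta ,$$ in the following sense. For every $\theta>0$ there is $b>0$ such that, whenever $0<B_H/\omega_0<b$, the integrand of $J(B_H)$ is integrable, and for all $(\varepsilon,\ell_c)$ far enough in the regime $\varepsilon\to0^+$, $\ell_c/\varepsilon\to0^+$, $$\Big|\frac{\mathbb E|\mathcal I(z_s(c_s,t_g),c_s)|^2}{\ell_c^3}-8\pi^2\omega_0^2A^2\Big(\int_{\mathbb R^3}\Sigma(x)\,dx\Big)J(B_H)\Big|\le\theta\,J(B_H).$$ -/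

import Mathlib

open MeasureTheory Filter Topology

namespace PassiveImaging

noncomputable section

/-- The physical space. -/
abbrev E3 : Type := EuclideanSpace ℝ (Fin 3)

/-- The plane of the sensor array. -/
abbrev E2 : Type := EuclideanSpace ℝ (Fin 2)

/-- Data of the daylight configuration: background speed `c₀`, centre frequency `ω₀`, array scale
`a₀`, number of sensors `N`, reference geometry `A₀` of the array, spatial density `K` of the noise
sources, support `D` of the random medium, and spectral profile `Fhat₀` of the sources. -/
structure Setup where
  c₀ : ℝ
  ω₀ : ℝ
  a₀ : ℝ
  N : ℕ
  A₀ : Set E2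
  K : E3 → ℝ
  D : Set E3
  Fhat₀ : SchwartzMap ℝ ℝ

/-- Standing assumptions: positive parameters, a bounded array of positive area, smooth compactly
supported source density, and the daylight geometry: the plane `x₃ = 0` of the array separates the
sources (in `x₃ < 0`) from the bounded region occupied by the medium (in `x₃ > 0`). -/
structure Setup.Admissible (S : Setup) : Prop where
  c₀_pos : 0 < S.c₀
  ω₀_pos : 0 < S.ω₀
  a₀_pos : 0 < S.a₀
  A₀_meas : MeasurableSet S.A₀
  A₀_bdd : Bornology.IsBounded S.A₀
  A₀_pos : 0 < volume S.A₀
  K_smooth : ContDiff ℝ (⊤ : ℕ∞) S.K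
  K_compact : HasCompactSupport S.K
  K_behind : tsupport S.K ⊆ {y | y 2 < 0}
  D_meas : MeasurableSet S.D
  D_bdd : Bornology.IsBounded S.D
  D_ahead : closure S.D ⊆ {z | 0 < z 2}

/-- Outgoing time-harmonic Green's function of the homogeneous medium: the solution of
`Δₓ G + (ω/c₀)² G = - δ(x - y)` with the Sommerfeld radiation condition. -/
def greenHat (c₀ ω : ℝ) (x y : E3) : ℂ :=
  Complex.exp (Complex.I * ((ω / c₀ * ‖x - y‖ : ℝ) : ℂ)) / ((4 * Real.pi * ‖x - y‖ : ℝ) : ℂ)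

/-- The scaled spectral density `F̂(ω)` of the sources, with bandwidth parameter `B`. -/
def Setup.Fhat (S : Setup) (B ω : ℝ) : ℝ :=
  (1 / B) * (S.Fhat₀ ((S.ω₀ - ω) / B) + S.Fhat₀ ((S.ω₀ + ω) / B))

/-- The time profile `F₀`, i.e. the inverse Fourier transform of `F̂₀` for the convention
`F̂(ω) = ∫ F(t) e^{iωt} dt`. -/
def Setup.F₀ (S : Setup) (t : ℝ) : ℂ :=
  (1 / (2 * Real.pi : ℝ) : ℂ) *
    ∫ ω : ℝ, (S.Fhat₀ ω : ℂ) * Complex.exp (-Complex.I * ((ω * t : ℝ) : ℂ))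

/-- First scattered (Born) contribution to the theoretical cross-correlation, for a perturbation
`ρ` supported in `D`. -/
def Setup.crossCorrI (S : Setup) (B ε : ℝ) (ρ : E3 → ℝ) (τ : ℝ) (x₁ x₂ : E3) : ℂ :=
  ((1 / (2 * Real.pi * S.c₀ ^ 2 * ε ^ 2) : ℝ) : ℂ) *
    ∫ z in S.D, (ρ z : ℂ) * ∫ y : E3, ∫ ω : ℝ,
      ((ω ^ 2 * S.K y * S.Fhat B ω : ℝ) : ℂ) *
        greenHat S.c₀ (ω / ε) x₂ z * greenHat S.c₀ (ω / ε) z y *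
        (starRingEnd ℂ) (greenHat S.c₀ (ω / ε) x₁ y) *
        Complex.exp (-Complex.I * ((ω * τ / ε : ℝ) : ℂ))

/-- Second scattered (Born) contribution to the theoretical cross-correlation. -/
def Setup.crossCorrII (S : Setup) (B ε : ℝ) (ρ : E3 → ℝ) (τ : ℝ) (x₁ x₂ : E3) : ℂ :=
  ((1 / (2 * Real.pi * S.c₀ ^ 2 * ε ^ 2) : ℝ) : ℂ) *
    ∫ z in S.D, (ρ z : ℂ) * ∫ y : E3, ∫ ω : ℝ,
      ((ω ^ 2 * S.K y * S.Fhat B ω : ℝ) : ℂ) *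
        (starRingEnd ℂ) (greenHat S.c₀ (ω / ε) x₁ z) *
        (starRingEnd ℂ) (greenHat S.c₀ (ω / ε) z y) *
        greenHat S.c₀ (ω / ε) x₂ y *
        Complex.exp (-Complex.I * ((ω * τ / ε : ℝ) : ℂ))

/-- The theoretical cross-correlation of the scattered waves. -/
def Setup.crossCorr (S : Setup) (B ε : ℝ) (ρ : E3 → ℝ) (τ : ℝ) (x₁ x₂ : E3) : ℂ :=
  S.crossCorrI B ε ρ τ x₁ x₂ + S.crossCorrII B ε ρ τ x₁ x₂

/-- The array `𝒜 = ε^{1/2} a₀ 𝒜₀`, as a subset of its plane. -/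
def Setup.array (S : Setup) (ε : ℝ) : Set E2 :=
  (fun u : E2 => (Real.sqrt ε * S.a₀) • u) '' S.A₀

/-- Inclusion of the plane of the array in space. -/
def embed (x : E2) : E3 := !₂[x 0, x 1, 0]

/-- Travel time from `x` to `z` at the migration speed `cs`. -/
def travelTime (cs : ℝ) (z x : E3) : ℝ := ‖z - x‖ / cs

/-- The generalized daylight migration imaging functional, in the dense-array form. -/
def Setup.imaging (S : Setup) (B ε : ℝ) (ρ : E3 → ℝ) (zs : E3) (cs : ℝ) : ℂ :=
  (((S.N : ℝ) ^ 2 / (volume.real (S.array ε)) ^ 2 : ℝ) : ℂ) *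
    ∫ x₁ in S.array ε, ∫ x₂ in S.array ε,
      S.crossCorr B ε ρ (travelTime cs zs (embed x₂) + travelTime cs zs (embed x₁))
        (embed x₁) (embed x₂)

/-- The search point `z_s(c_s, t_g) = (0, 0, c_s t_g)`. -/
def searchPoint (cs tg : ℝ) : E3 := !₂[0, 0, cs * tg]

/-- The virtual guide star `z_g = (0, 0, c₀ t_g)`. -/
def Setup.guideStar (S : Setup) (tg : ℝ) : E3 := !₂[0, 0, S.c₀ * tg]

/-- Integral of the source density over the ray issued from `x` in the direction of `x - z`. -/
def Setup.rayIntegral (S : Setup) (x z : E3) : ℝ :=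
  ∫ l in Set.Ioi (0 : ℝ), S.K (x + (l / ‖x - z‖) • (x - z))

/-- The normalized point spread function `𝒢_{α_r, α_f}(ξ₁, ξ₂, ξ₃, ξ₄)`. -/
def Setup.G (S : Setup) (αr αf ξ₁ ξ₂ ξ₃ ξ₄ : ℝ) : ℂ :=
  ((1 / volume.real S.A₀ : ℝ) : ℂ) * ∫ u in S.A₀,
    Complex.exp (-Complex.I * ((αf * u 0 * ξ₁ + u 1 * ξ₂ : ℝ) : ℂ)
      - Complex.I * (((u 0 ^ 2 * αr ^ 2 + u 1 ^ 2) / 2 * ξ₃ : ℝ) : ℂ)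
      - Complex.I * (((u 0 ^ 2 + u 1 ^ 2) / 2 * ξ₄ : ℝ) : ℂ))

/-- The factor `𝒢_{1,1}` at frequency `ω` and offset `η` from the virtual guide star. -/
def Setup.Gη (S : Setup) (tg cs ω : ℝ) (η : E3) : ℂ :=
  S.G 1 1 (S.a₀ * ω / (S.c₀ * ‖S.guideStar tg‖) * η 0) (S.a₀ * ω / (S.c₀ * ‖S.guideStar tg‖) * η 1)
    0 (-(S.a₀ ^ 2 * ω) / (S.c₀ * ‖S.guideStar tg‖) * ((S.c₀ / cs) ^ 2 - 1))

/-- The phase `2 η₃ + (η₁² + η₂²) / |z_g|`. -/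
def Setup.phase (S : Setup) (tg : ℝ) (η : E3) : ℝ :=
  2 * η 2 + (η 0 ^ 2 + η 1 ^ 2) / ‖S.guideStar tg‖

/-- The point spread function `𝒫_μ(t_g, η, c_s)`. -/
def Setup.psf (S : Setup) (B tg cs : ℝ) (η : E3) : ℝ :=
  (∫ ω : ℝ, (-Complex.I * ((ω * S.Fhat B ω : ℝ) : ℂ)) *
    Complex.exp (Complex.I * ((ω / S.c₀ * S.phase tg η : ℝ) : ℂ)) * S.Gη tg cs ω η ^ 2).re

/-- The integrand `|F₀(…)|² |𝒢_{1,1}(…)|⁴` of the regime `B ≪ ω₀`. -/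
def Setup.narrowIntegrand (S : Setup) (B tg cs : ℝ) (η : E3) : ℝ :=
  ‖S.F₀ (B / S.c₀ * S.phase tg η)‖ ^ 2 * ‖S.Gη tg cs S.ω₀ η‖ ^ 4

/-- The constant `N² 𝒦(0, z_g) / (2⁶ π³ c₀ |z_g|²)`. -/
def Setup.amplitude (S : Setup) (tg : ℝ) : ℝ :=
  (S.N : ℝ) ^ 2 / (2 ^ 6 * Real.pi ^ 3 * S.c₀) *
    (S.rayIntegral 0 (S.guideStar tg) / ‖S.guideStar tg‖ ^ 2)

/-- Covariance function `Σ(x) = Cov(μ(x), μ(0))` of a random field. -/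
def covFun {Ω : Type*} [MeasurableSpace Ω] (P : Measure Ω) (μ : E3 → Ω → ℝ) (x : E3) : ℝ :=
  ProbabilityTheory.covariance (μ x) (μ 0) P

/-- A (jointly measurable) square integrable, mean-zero, second-order stationary random field whose
covariance function is `O((1 + |x|)^{-4-η})` for some `η > 0`. -/
structure IsFluctuation {Ω : Type*} [MeasurableSpace Ω] (P : Measure Ω) (μ : E3 → Ω → ℝ) :
    Prop where
  measurable : Measurable (Function.uncurry μ)
  memLp : ∀ x, MemLp (μ x) 2 P
  mean_zero : ∀ x, ∫ w, μ x w ∂P = 0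
  stationary : ∀ x y h, ProbabilityTheory.covariance (μ (x + h)) (μ (y + h)) P
    = ProbabilityTheory.covariance (μ x) (μ y) P
  decay : ∃ C η : ℝ, 0 < η ∧ ∀ x, |covFun P μ x| ≤ C * (1 + ‖x‖) ^ (-4 - η)

/-- The random variable `ℐ(z_s(c_s, t_g), c_s)` for the medium `ρ_μ(z) = μ(z / ℓ)`, `z ∈ D`. -/
def Setup.randomImage (S : Setup) {Ω : Type*} (μ : E3 → Ω → ℝ) (B tg cs ε ℓ : ℝ) (w : Ω) : ℂ :=
  S.imaging B ε (fun z => μ (ℓ⁻¹ • z) w) (searchPoint cs tg) cs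

/-- The second moment `𝔼 |ℐ(z_s(c_s, t_g), c_s)|²`. -/
def Setup.secondMoment (S : Setup) {Ω : Type*} [MeasurableSpace Ω] (P : Measure Ω)
    (μ : E3 → Ω → ℝ) (B tg cs ε ℓ : ℝ) : ℝ :=
  ∫ w, ‖S.randomImage μ B tg cs ε ℓ w‖ ^ 2 ∂P

/-- The asymptotic regime for pairs `(ε, ℓ)`: `ε → 0⁺` and `ℓ / ε → 0⁺`, i.e. the correlation length
is much smaller than the wavelength, which is proportional to `ε`. -/
def regime : Filter (ℝ × ℝ) :=
  comap (fun p : ℝ × ℝ => p.1) (𝓝[>] 0) ⊓ comap (fun p : ℝ × ℝ => p.2 / p.1) (𝓝[>] 0)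

end

end PassiveImaging

/-! Put δ = √ε. The image is a linear functional of the medium, ℐ = ∫_D ρ_μ(z) k_δ(z) dz with a
deterministic kernel k_δ (`imagingKernel`, `imaging_eq`). Stationarity then gives 𝔼|ℐ|² / ℓ³ = ∫
Σ(x) R_δ(ℓx) dx, with R_δ the autocorrelation of k_δ. In the coordinates z = z_g + (δη_⊥, δ²η₃) the
Jacobian is δ⁴, so δ² k_δ (`localKernel`) keeps the L² norm of k_δ, and the shift ℓx becomes
(ℓx_⊥/δ, ℓx₃/δ²), which tends to 0 because ℓ/ε and ε do. Once `localKernel` converges in L²,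
continuity of translations in L² and dominated convergence against |Σ| yield (∫Σ) times the squared
norm of the limit (`secondMoment_eq`, `tendsto_secondMoment`). Only integrability of Σ matters here;
no pointwise control of the kernel far from the guide star is needed.

The work lies in the L² convergence (`tendsto_localKernel`). Integrating over the sources in
spherical coordinates about the receiver x₁, with axis along x₁ - z, the oscillating factor is an
exact derivative in the polar angle. One integration by parts (`polar_angle_integral`,
`source_integral`) leaves a boundary term, carrying the source density on the ray behind x₁, and a
remainder containing the angular derivative of K. The boundary term is a `slice` with path excess σ
= 1; the remainder is a superposition of slices with σ = `pathExcess`. The second Born term has a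
path length bounded below, and is negligible by rapid decay (`kernelII_bound`).

Two facts about slices carry the argument. First, their energy is tight in the transverse direction,
uniformly in δ, the sensor and σ (`slice_energy`): in conical coordinates about the sensor the phase
is linear up to a function that is smooth down to δ = 0. The resulting amplitude is written, by the
fundamental theorem of calculus, as a superposition of truncations to quadrants, and Plancherel in
the radius and in the direction gives an integrable majorant free of δ. Secondly, on bounded
transverse regions a slice has the quadratically decaying profile of `localSlice_le`, centred where
(1 + σ)(η₃ + c₀t_g/δ²) = 2c₀t_g/δ². For σ = 1 the centre stays put and dominated convergence applies
(`tendsto_mainKernel`). For the remainder, different σ have centres drifting apart as δ → 0, so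
cross terms vanish and the superposition tends to 0 in L² although the single slices do not become
small (`tendsto_dispersion`, `tendsto_remainder`).

The limit is the amplitude times the complex point spread function with the opposite sign of the
defocusing (`limitKernel_eq`). Its energy is computed by Plancherel in η₃ and a dilation in η_⊥
(`lintegral_psfC`); it involves only the fourth moment `quarticMass` of array averages, which is
even in the defocusing, so the sign is immaterial.

For the narrow band regime, the integral of |F₀|²|𝒢|⁴ is computed in the same way. As B → 0, B times
the weighted integral of F̂² concentrates at ±ω₀ (`tendsto_bandwidth`); since `quarticMass` is
continuous, bounded and positive, the ratio of the two energies tends to 8π²ω₀²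
(`exists_bandwidth_energy_close`). -/

namespace PassiveImaging

noncomputable section

/-! ### Plancherel's theorem for Fourier integrals. -/

open scoped FourierTransform ENNReal SchwartzMap in
/-- The `L²` Fourier transform of an integrable function is its Fourier integral. -/
theorem fourier_toLp_ae_eq {V : Type*} [NormedAddCommGroup V] [InnerProductSpace ℝ V]
    [FiniteDimensional ℝ V] [MeasurableSpace V] [BorelSpace V] {f : V → ℂ}
    (hf : Integrable f) (hf2 : MemLp f 2) :
    ((𝓕 (hf2.toLp f) : Lp ℂ 2 (volume : Measure V)) : V → ℂ) =ᵐ[volume] 𝓕 f := by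
  have hcont : Continuous (𝓕 f) :=
    VectorFourier.fourierIntegral_continuous Real.continuous_fourierChar
      (by exact continuous_inner) hf
  -- Both transforms are tested against smooth compactly supported functions. Duality moves the
  -- transform onto the test function, through tempered distributions for the L² transform and
  -- through Fubini for the integral.
  refine ae_eq_of_integral_contDiff_smul_eq
    ((Lp.memLp _).locallyIntegrable (by norm_num)) hcont.locallyIntegrable ?_
  intro g hg hgc
  set gc : V → ℂ := fun x => (g x : ℂ) with hgcdef
  have h1 : ContDiff ℝ (⊤ : ℕ∞) gc := Complex.ofRealCLM.contDiff.comp hg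
  have h2 : HasCompactSupport gc := hgc.comp_left (g := fun x : ℝ => (x : ℂ)) (by simp)
  set φ : 𝓢(V, ℂ) := h2.toSchwartzMap h1 with hφ
  have hφ' : ∀ x, φ x = gc x := fun x => rfl
  have key := congrArg (fun T => T φ) (Lp.fourier_toTemperedDistribution_eq (hf2.toLp f))
  simp only [TemperedDistribution.fourier_apply, Lp.toTemperedDistribution_apply] at key
  have e1 : ∫ x, g x • ((𝓕 (hf2.toLp f) : Lp ℂ 2 (volume : Measure V)) : V → ℂ) x
      = ∫ x, φ x • ((𝓕 (hf2.toLp f) : Lp ℂ 2 (volume : Measure V)) : V → ℂ) x := by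
    refine integral_congr_ae (Eventually.of_forall fun x => ?_)
    simp [hφ', hgcdef]
  rw [e1, ← key]
  have e2 : ∫ x, (𝓕 φ) x • (hf2.toLp f : V → ℂ) x = ∫ x, (𝓕 φ) x • f x := by
    refine integral_congr_ae ?_
    filter_upwards [hf2.coeFn_toLp] with x hx
    rw [hx]
  rw [e2]
  have e3 := VectorFourier.integral_fourierIntegral_smul_eq_flip (μ := (volume : Measure V))
    (ν := (volume : Measure V)) (L := innerₗ V) (f := fun x => φ x) (g := f)
    Real.continuous_fourierChar (by exact continuous_inner) φ.integrable hf
  have e4 : ∫ x, (𝓕 φ) x • f x = ∫ x, φ x • 𝓕 f x := by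
    rw [flip_innerₗ] at e3
    exact e3
  rw [e4]
  refine integral_congr_ae (Eventually.of_forall fun x => ?_)
  simp [hφ', hgcdef]

open scoped FourierTransform ENNReal in
/-- Plancherel's theorem on `L¹ ∩ L²`. -/
theorem lintegral_enorm_sq_fourier {V : Type*} [NormedAddCommGroup V] [InnerProductSpace ℝ V]
    [FiniteDimensional ℝ V] [MeasurableSpace V] [BorelSpace V] {f : V → ℂ}
    (hf : Integrable f) (hf2 : MemLp f 2) :
    ∫⁻ ξ, ‖𝓕 f ξ‖ₑ ^ 2 = ∫⁻ x, ‖f x‖ₑ ^ 2 := by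
  have key : ∀ g : V → ℂ, ∫⁻ ξ, ‖g ξ‖ₑ ^ 2 = eLpNorm g 2 volume ^ 2 := by
    intro g
    rw [eLpNorm_eq_lintegral_rpow_enorm_toReal (by norm_num) (by norm_num),
      ← ENNReal.rpow_natCast, ← ENNReal.rpow_mul]
    norm_num
  rw [key, key, ← eLpNorm_congr_ae (fourier_toLp_ae_eq hf hf2), ← Lp.enorm_def,
    ← Lp.enorm_toLp hf2, ← ofReal_norm, ← ofReal_norm, Lp.norm_fourier_eq]

open scoped FourierTransform ENNReal in
/-- Plancherel's theorem for the exponentials `e^{i b ⟨u, ζ⟩}`. -/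
theorem lintegral_enorm_sq_integral_exp {V : Type*} [NormedAddCommGroup V] [InnerProductSpace ℝ V]
    [FiniteDimensional ℝ V] [MeasurableSpace V] [BorelSpace V] {f : V → ℂ}
    (hf : Integrable f) (hf2 : MemLp f 2) {b : ℝ} (hb : b ≠ 0) :
    ∫⁻ ζ : V, ‖∫ u, f u * Complex.exp (Complex.I * ((b * inner ℝ u ζ : ℝ) : ℂ))‖ₑ ^ 2
      = ENNReal.ofReal ((2 * Real.pi / |b|) ^ (Module.finrank ℝ V)) * ∫⁻ x, ‖f x‖ₑ ^ 2 := by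
  have h1 : ∀ ζ : V, ∫ u, f u * Complex.exp (Complex.I * ((b * inner ℝ u ζ : ℝ) : ℂ))
      = 𝓕 f ((-b / (2 * Real.pi)) • ζ) := by
    intro ζ
    rw [Real.fourier_eq']
    refine integral_congr_ae (Eventually.of_forall fun u => ?_)
    simp only [smul_eq_mul, inner_smul_right]
    rw [mul_comm]
    congr 2
    have : (Real.pi : ℂ) ≠ 0 := by exact_mod_cast Real.pi_ne_zero
    push_cast
    field_simp
  simp_rw [h1]
  have hb' : -b / (2 * Real.pi) ≠ 0 := by
    have := Real.pi_ne_zero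
    simp [hb, this]
  rw [← lintegral_enorm_sq_fourier hf hf2]
  have := Measure.map_addHaar_smul (volume : Measure V) hb'
  have h2 : ∫⁻ ζ : V, ‖𝓕 f ((-b / (2 * Real.pi)) • ζ)‖ₑ ^ 2
      = ∫⁻ ζ, ‖𝓕 f ζ‖ₑ ^ 2 ∂(Measure.map ((-b / (2 * Real.pi)) • ·) (volume : Measure V)) := by
    exact (lintegral_map_equiv (μ := (volume : Measure V)) (fun ζ => ‖𝓕 f ζ‖ₑ ^ 2)
      (Homeomorph.smulOfNeZero _ hb').toMeasurableEquiv).symm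
  rw [h2, this, lintegral_smul_measure, smul_eq_mul]
  congr 2
  rw [abs_inv, abs_pow, ← inv_pow]
  congr 1
  rw [abs_div, abs_neg, inv_div, abs_of_pos (by positivity : (0 : ℝ) < 2 * Real.pi)]

/-! ### Coordinates -/

/-- The point of `ℝ³` with horizontal part `x` and height `t`. -/
def mk3 (x : E2) (t : ℝ) : E3 := !₂[x 0, x 1, t]

@[simp] theorem mk3_zero (x : E2) (t : ℝ) : mk3 x t 0 = x 0 := rfl
@[simp] theorem mk3_one (x : E2) (t : ℝ) : mk3 x t 1 = x 1 := rfl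
@[simp] theorem mk3_two (x : E2) (t : ℝ) : mk3 x t 2 = t := rfl

/-- The horizontal part of a point of `ℝ³`. -/
def hor (z : E3) : E2 := !₂[z 0, z 1]

@[simp] theorem hor_zero (z : E3) : hor z 0 = z 0 := rfl
@[simp] theorem hor_one (z : E3) : hor z 1 = z 1 := rfl

@[simp] theorem hor_mk3 (x : E2) (t : ℝ) : hor (mk3 x t) = x := by
  ext i; fin_cases i <;> rfl

@[simp] theorem mk3_hor (z : E3) : mk3 (hor z) (z 2) = z := by
  ext i; fin_cases i <;> rfl

theorem continuous_hor : Continuous hor := by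
  unfold hor; fun_prop

theorem continuous_mk3 : Continuous (fun p : E2 × ℝ => mk3 p.1 p.2) := by
  unfold mk3; fun_prop

/-- `ℝ² × ℝ ≃ ℝ³`. -/
def mk3Equiv : E2 × ℝ ≃ᵐ E3 where
  toFun p := mk3 p.1 p.2
  invFun z := (hor z, z 2)
  left_inv p := by simp
  right_inv z := by simp
  measurable_toFun := continuous_mk3.measurable
  measurable_invFun := (continuous_hor.prodMk (by fun_prop)).measurable

/-- `ℝ × ℝ ≃ ℝ²`. -/
def mk2Equiv : ℝ × ℝ ≃ᵐ E2 where
  toFun p := !₂[p.1, p.2]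
  invFun z := (z 0, z 1)
  left_inv p := by simp
  right_inv z := by ext i; fin_cases i <;> rfl
  measurable_toFun := (by fun_prop : Continuous fun p : ℝ × ℝ => (!₂[p.1, p.2] : E2)).measurable
  measurable_invFun := (by fun_prop : Continuous fun z : E2 => (z 0, z 1)).measurable

theorem mk2Equiv_volume_preserving : MeasurePreserving mk2Equiv := by
  have h := (volume_preserving_finTwoArrow ℝ).symm
  exact (PiLp.volume_preserving_toLp (Fin 2)).comp h

theorem mk3Equiv_volume_preserving : MeasurePreserving mk3Equiv := by
  have h1 : MeasurePreserving (fun p : E2 × ℝ => (p.2, WithLp.ofLp p.1))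
      (volume.prod volume) (volume.prod volume) :=
    Measure.measurePreserving_swap.comp
      ((PiLp.volume_preserving_ofLp (Fin 2)).prod (MeasurePreserving.id volume))
  have h2 := (volume_preserving_piFinSuccAbove (fun _ : Fin 3 => ℝ) 2).symm
  have h3 := (PiLp.volume_preserving_toLp (Fin 3)).comp (h2.comp h1)
  rw [← Measure.volume_eq_prod] at h3
  convert h3 using 1
  ext p i
  simp only [MeasurableEquiv.piFinSuccAbove, Function.comp]
  fin_cases i <;> rfl

theorem lintegral_mk3 {F : E3 → ENNReal} (hF : Measurable F) :
    ∫⁻ z, F z = ∫⁻ x : E2, ∫⁻ t : ℝ, F (mk3 x t) := by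
  rw [← mk3Equiv_volume_preserving.lintegral_comp_emb mk3Equiv.measurableEmbedding]
  rw [Measure.volume_eq_prod, lintegral_prod _ (by fun_prop)]
  rfl

theorem integrable_comp_mk3 {F : E3 → ℂ} (hF : Integrable F) :
    Integrable (fun p : E2 × ℝ => F (mk3 p.1 p.2)) :=
  (mk3Equiv_volume_preserving.integrable_comp_emb mk3Equiv.measurableEmbedding).2 hF

theorem integral_mk3 {E : Type*} [NormedAddCommGroup E] [NormedSpace ℝ E] (F : E3 → E) :
    ∫ z, F z = ∫ p : E2 × ℝ, F (mk3 p.1 p.2) :=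
  (mk3Equiv_volume_preserving.integral_comp' (g := F)).symm

theorem integral_mk2 {E : Type*} [NormedAddCommGroup E] [NormedSpace ℝ E] (F : E2 → E) :
    ∫ z, F z = ∫ p : ℝ × ℝ, F !₂[p.1, p.2] :=
  (mk2Equiv_volume_preserving.integral_comp' (g := F)).symm

theorem norm_sq_E3 (z : E3) : ‖z‖ ^ 2 = z 0 ^ 2 + z 1 ^ 2 + z 2 ^ 2 := by
  rw [EuclideanSpace.norm_sq_eq, Fin.sum_univ_three]; simp [sq_abs]

theorem norm_sq_E2 (z : E2) : ‖z‖ ^ 2 = z 0 ^ 2 + z 1 ^ 2 := by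
  rw [EuclideanSpace.norm_sq_eq, Fin.sum_univ_two]; simp [sq_abs]

theorem norm_sq_mk3 (x : E2) (t : ℝ) : ‖mk3 x t‖ ^ 2 = ‖x‖ ^ 2 + t ^ 2 := by
  simp [norm_sq_E3, norm_sq_E2]

theorem abs_coord_le (z : E3) (i : Fin 3) : |z i| ≤ ‖z‖ := by
  simpa using PiLp.norm_apply_le z i

/-- Spherical coordinates about the third axis. -/
def sph (t α β : ℝ) : E3 :=
  !₂[t * (Real.sin α * Real.cos β), t * (Real.sin α * Real.sin β), t * Real.cos α]

theorem continuous_sph : Continuous (fun p : ℝ × ℝ × ℝ => sph p.1 p.2.1 p.2.2) := by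
  unfold sph; fun_prop

theorem norm_sph {t : ℝ} (ht : 0 ≤ t) (α β : ℝ) : ‖sph t α β‖ = t := by
  rw [← sq_eq_sq₀ (norm_nonneg _) ht, norm_sq_E3]
  simp only [sph, Fin.isValue, PiLp.toLp_apply, Matrix.cons_val_zero, Matrix.cons_val_one,
    Matrix.cons_val]
  have h1 := Real.sin_sq_add_cos_sq α
  have h2 := Real.sin_sq_add_cos_sq β
  linear_combination t ^ 2 * h1 + t ^ 2 * Real.sin α ^ 2 * h2

/-- Integration in cylindrical coordinates. -/
theorem integral_cylindrical {F : E3 → ℂ} (hF : Continuous F) (hc : HasCompactSupport F) :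
    ∫ z, F z = ∫ β in Set.Ioo (-Real.pi) Real.pi, ∫ p : ℝ × ℝ,
      (Set.univ ×ˢ Set.Ioi 0).indicator
        (fun p => p.2 • F !₂[p.2 * Real.cos β, p.2 * Real.sin β, p.1]) p := by
  obtain ⟨R, hR⟩ := hc.isCompact.isBounded.exists_norm_le
  have hint : Integrable F := hF.integrable_of_hasCompactSupport hc
  rw [integral_mk3, Measure.volume_eq_prod, integral_prod_symm _ (by
    simpa [Measure.volume_eq_prod] using integrable_comp_mk3 hint)]
  have step : ∀ c : ℝ, ∫ x : E2, F (mk3 x c) = ∫ q in Set.Ioi (0 : ℝ) ×ˢ Set.Ioo (-Real.pi) Real.pi,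
      q.1 • F !₂[q.1 * Real.cos q.2, q.1 * Real.sin q.2, c] := by
    intro c
    rw [integral_mk2, ← integral_comp_polarCoord_symm]
    rfl
  simp_rw [step]
  set H : ℝ × ℝ × ℝ → ℂ :=
    fun q => q.2.1 • F !₂[q.2.1 * Real.cos q.2.2, q.2.1 * Real.sin q.2.2, q.1] with hH
  have hHc : Continuous H := by
    rw [hH]
    exact Continuous.smul (f := fun q : ℝ × ℝ × ℝ => q.2.1) (by fun_prop) (hF.comp (by fun_prop))
  have hz : ∀ q : ℝ × ℝ × ℝ, H q ≠ 0 → q.2.1 ∈ Set.Icc (-R) R ∧ q.1 ∈ Set.Icc (-R) R := by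
    intro q hq
    have h1 : F !₂[q.2.1 * Real.cos q.2.2, q.2.1 * Real.sin q.2.2, q.1] ≠ 0 := by
      intro h; exact hq (by simp [hH, h])
    have h2 := hR _ (subset_tsupport _ h1)
    have h3 := norm_sq_E3 !₂[q.2.1 * Real.cos q.2.2, q.2.1 * Real.sin q.2.2, q.1]
    simp only [Fin.isValue, Matrix.cons_val_zero, Matrix.cons_val_one,
      Matrix.cons_val] at h3
    have h4 : (q.2.1 * Real.cos q.2.2) ^ 2 + (q.2.1 * Real.sin q.2.2) ^ 2 = q.2.1 ^ 2 := by
      have := Real.sin_sq_add_cos_sq q.2.2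
      linear_combination q.2.1 ^ 2 * this
    have hR0 : 0 ≤ R := (norm_nonneg _).trans h2
    have h5 : q.2.1 ^ 2 + q.1 ^ 2 ≤ R ^ 2 := by
      rw [← h4, ← h3]; gcongr
    exact ⟨abs_le.1 (abs_le_of_sq_le_sq (by nlinarith) hR0),
      abs_le.1 (abs_le_of_sq_le_sq (by nlinarith) hR0)⟩
  have hHi : IntegrableOn H (Set.univ ×ˢ (Set.Ioi (0 : ℝ) ×ˢ Set.Ioo (-Real.pi) Real.pi))
      ((volume : Measure ℝ).prod ((volume : Measure ℝ).prod (volume : Measure ℝ))) := by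
    have hk : IsCompact (Set.Icc (-R) R ×ˢ (Set.Icc (-R) R ×ˢ Set.Icc (-Real.pi) Real.pi)) :=
      isCompact_Icc.prod (isCompact_Icc.prod isCompact_Icc)
    refine IntegrableOn.of_forall_sdiff_eq_zero
      (hHc.continuousOn.integrableOn_compact hk) (by measurability) ?_
    rintro q ⟨⟨-, -, hq⟩, hq2⟩
    by_contra h
    obtain ⟨h1, h2⟩ := hz q h
    exact hq2 ⟨h2, h1, ⟨hq.1.le, hq.2.le⟩⟩
  rw [← setIntegral_univ]
  rw [Measure.volume_eq_prod] at *
  have e1 := (setIntegral_prod (μ := (volume : Measure ℝ))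
    (ν := (volume : Measure ℝ).prod (volume : Measure ℝ)) H hHi).symm
  rw [show (∫ c in Set.univ, ∫ q in Set.Ioi (0 : ℝ) ×ˢ Set.Ioo (-Real.pi) Real.pi,
      q.1 • F !₂[q.1 * Real.cos q.2, q.1 * Real.sin q.2, c]
      ∂((volume : Measure ℝ).prod (volume : Measure ℝ))) = _ from e1]
  have hmp : MeasurePreserving (MeasurableEquiv.prodAssoc : (ℝ × ℝ) × ℝ ≃ᵐ ℝ × ℝ × ℝ)
      (((volume : Measure ℝ).prod volume).prod volume)
      ((volume : Measure ℝ).prod ((volume : Measure ℝ).prod volume)) := volume_preserving_prodAssoc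
  rw [← hmp.setIntegral_preimage_emb (MeasurableEquiv.measurableEmbedding _)]
  have hpre : (MeasurableEquiv.prodAssoc : (ℝ × ℝ) × ℝ ≃ᵐ ℝ × ℝ × ℝ) ⁻¹'
      (Set.univ ×ˢ (Set.Ioi (0 : ℝ) ×ˢ Set.Ioo (-Real.pi) Real.pi))
      = (Set.univ ×ˢ Set.Ioi (0 : ℝ)) ×ˢ Set.Ioo (-Real.pi) Real.pi := by
    ext ⟨⟨a, b⟩, c⟩
    simp [MeasurableEquiv.prodAssoc]
  rw [hpre, ← Measure.prod_restrict, integral_prod_symm]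
  · refine integral_congr_ae (Eventually.of_forall fun β => ?_)
    simp only
    rw [integral_indicator (by measurability)]
    rfl
  · rw [Measure.prod_restrict, ← hpre]
    exact (hmp.integrableOn_comp_preimage (MeasurableEquiv.measurableEmbedding _)).2 hHi

/-- Integration in spherical coordinates. -/
theorem integral_spherical {F : E3 → ℂ} (hF : Continuous F) (hc : HasCompactSupport F) :
    ∫ z, F z = ∫ β in Set.Ioo (-Real.pi) Real.pi, ∫ t in Set.Ioi (0 : ℝ),
      ∫ α in Set.Ioo 0 Real.pi, ((t ^ 2 * Real.sin α : ℝ) : ℂ) * F (sph t α β) := by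
  obtain ⟨R, hR⟩ := hc.isCompact.isBounded.exists_norm_le
  rw [integral_cylindrical hF hc]
  refine integral_congr_ae (Eventually.of_forall fun β => ?_)
  simp only
  rw [← integral_comp_polarCoord_symm]
  set H : ℝ × ℝ → ℂ := fun q => ((q.1 ^ 2 * Real.sin q.2 : ℝ) : ℂ) * F (sph q.1 q.2 β) with hH
  have hHc : Continuous H := by
    rw [hH]
    refine Continuous.mul (by fun_prop) (hF.comp (by unfold sph; fun_prop))
  -- Second use of polar coordinates, now in the half plane (height, radius): a positive radius
  -- corresponds to polar angles in (0, π), and on the rest of the chart both indicators vanish.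
  have e0 : ∫ p in polarCoord.target, p.1 •
      (Set.univ ×ˢ Set.Ioi 0).indicator
        (fun p : ℝ × ℝ => p.2 • F !₂[p.2 * Real.cos β, p.2 * Real.sin β, p.1]) (polarCoord.symm p)
      = ∫ p in polarCoord.target, (Set.univ ×ˢ Set.Ioo 0 Real.pi).indicator H p := by
    refine setIntegral_congr_fun polarCoord.open_target.measurableSet ?_
    rintro ⟨t, α⟩ ⟨ht, hα⟩
    simp only [Set.mem_Ioi, Set.mem_Ioo] at ht hα
    by_cases h : 0 < α
    · have hs : 0 < Real.sin α := Real.sin_pos_of_pos_of_lt_pi h hα.2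
      have m1 : polarCoord.symm (t, α) ∈ (Set.univ ×ˢ Set.Ioi 0 : Set (ℝ × ℝ)) := by
        simp only [polarCoord_symm_apply, Set.mem_prod, Set.mem_univ, Set.mem_Ioi, true_and]
        positivity
      have m2 : (t, α) ∈ (Set.univ ×ˢ Set.Ioo 0 Real.pi : Set (ℝ × ℝ)) := by
        simp [h, hα.2]
      beta_reduce
      rw [Set.indicator_of_mem m1, Set.indicator_of_mem m2]
      simp only [hH, polarCoord_symm_apply, sph, Complex.real_smul]
      push_cast
      simp only [mul_assoc]
      ring_nf
    · have hs : Real.sin α ≤ 0 := Real.sin_nonpos_of_nonpos_of_neg_pi_le (by linarith) hα.1.le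
      have m1 : polarCoord.symm (t, α) ∉ (Set.univ ×ˢ Set.Ioi 0 : Set (ℝ × ℝ)) := by
        simp only [polarCoord_symm_apply, Set.mem_prod, Set.mem_univ, Set.mem_Ioi, true_and, not_lt]
        exact mul_nonpos_of_nonneg_of_nonpos ht.le hs
      have m2 : (t, α) ∉ (Set.univ ×ˢ Set.Ioo 0 Real.pi : Set (ℝ × ℝ)) := by
        simp [h]
      simp only [Set.indicator_of_notMem m1, Set.indicator_of_notMem m2, smul_zero]
  rw [e0, setIntegral_indicator (by measurability)]
  have e1 : polarCoord.target ∩ (Set.univ ×ˢ Set.Ioo 0 Real.pi)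
      = Set.Ioi (0 : ℝ) ×ˢ Set.Ioo 0 Real.pi := by
    ext ⟨t, α⟩
    simp only [polarCoord_target, Set.mem_inter_iff, Set.mem_prod, Set.mem_Ioi, Set.mem_Ioo,
      Set.mem_univ, true_and]
    have := Real.pi_pos
    constructor
    · rintro ⟨⟨a, b⟩, c⟩; exact ⟨a, c⟩
    · rintro ⟨a, c⟩; exact ⟨⟨a, by linarith [c.1], c.2⟩, c⟩
  rw [e1, Measure.volume_eq_prod, setIntegral_prod]
  have hk : IsCompact (Set.Icc 0 R ×ˢ Set.Icc 0 Real.pi : Set (ℝ × ℝ)) :=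
      isCompact_Icc.prod isCompact_Icc
  refine IntegrableOn.of_forall_sdiff_eq_zero
    (hHc.continuousOn.integrableOn_compact hk) (by measurability) ?_
  rintro ⟨t, α⟩ ⟨⟨ht, hα⟩, hq2⟩
  by_contra h
  have h1 : F (sph t α β) ≠ 0 := by
    intro h'; exact h (by simp [hH, h'])
  have h2 := hR _ (subset_tsupport _ h1)
  rw [norm_sph (le_of_lt ht)] at h2
  exact hq2 ⟨⟨le_of_lt ht, h2⟩, ⟨hα.1.le, hα.2.le⟩⟩

/-! ### The integral over the sources -/

/-- The derivative of `sph` with respect to the polar angle. -/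
def dsph (t α β : ℝ) : E3 :=
  !₂[t * (Real.cos α * Real.cos β), t * (Real.cos α * Real.sin β), -(t * Real.sin α)]

theorem hasDerivAt_sph (t α β : ℝ) : HasDerivAt (fun α => sph t α β) (dsph t α β) α := by
  have h : HasDerivAt (fun α => ![t * (Real.sin α * Real.cos β), t * (Real.sin α * Real.sin β),
      t * Real.cos α]) ![t * (Real.cos α * Real.cos β), t * (Real.cos α * Real.sin β),
      -(t * Real.sin α)] α := ?_
  · exact (PiLp.continuousLinearEquiv 2 ℝ
      (fun _ : Fin 3 => ℝ)).symm.toContinuousLinearMap.hasFDerivAt.comp_hasDerivAt α h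
  rw [hasDerivAt_pi]
  intro i
  fin_cases i
  · exact (((Real.hasDerivAt_sin α).mul_const (Real.cos β)).const_mul t)
  · exact (((Real.hasDerivAt_sin α).mul_const (Real.sin β)).const_mul t)
  · simpa using ((Real.hasDerivAt_cos α).const_mul t)

theorem continuous_dsph : Continuous (fun p : ℝ × ℝ × ℝ => dsph p.1 p.2.1 p.2.2) := by
  unfold dsph; fun_prop

theorem norm_dsph {t : ℝ} (ht : 0 ≤ t) (α β : ℝ) : ‖dsph t α β‖ = t := by
  rw [← sq_eq_sq₀ (norm_nonneg _) ht, norm_sq_E3]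
  simp only [dsph, Fin.isValue, Matrix.cons_val_zero, Matrix.cons_val_one,
    Matrix.cons_val]
  have h1 := Real.sin_sq_add_cos_sq α
  have h2 := Real.sin_sq_add_cos_sq β
  linear_combination t ^ 2 * h1 + t ^ 2 * Real.cos α ^ 2 * h2

/-- The vertical unit vector. -/
def vert : E3 := !₂[0, 0, 1]

theorem norm_vert : ‖vert‖ = 1 := by
  rw [← sq_eq_sq₀ (norm_nonneg _) zero_le_one, norm_sq_E3]; simp [vert]

/-- Distance from `-r e₃` to the point with spherical coordinates `(t, α, ·)`. -/
def sideLength (r t α : ℝ) : ℝ := Real.sqrt (r ^ 2 + t ^ 2 + 2 * r * t * Real.cos α)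

theorem norm_sph_add (r t α β : ℝ) : ‖sph t α β + r • vert‖ = sideLength r t α := by
  unfold sideLength
  rw [eq_comm, Real.sqrt_eq_iff_eq_sq _ (norm_nonneg _), norm_sq_E3]
  · simp only [sph, vert, Fin.isValue, PiLp.add_apply, PiLp.smul_apply, Matrix.cons_val_zero,
      Matrix.cons_val_one, Matrix.cons_val, smul_eq_mul]
    have h1 := Real.sin_sq_add_cos_sq α
    have h2 := Real.sin_sq_add_cos_sq β
    linear_combination -t ^ 2 * h1 - t ^ 2 * Real.sin α ^ 2 * h2
  · have := Real.cos_sq_add_sin_sq α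
    nlinarith [sq_nonneg (r + t * Real.cos α), sq_nonneg (t * Real.sin α)]

theorem sideLength_sq (r t α : ℝ) :
    sideLength r t α ^ 2 = r ^ 2 + t ^ 2 + 2 * r * t * Real.cos α := by
  rw [← norm_sph_add r t α 0, norm_sq_E3]
  simp only [sph, vert, Fin.isValue, PiLp.add_apply, PiLp.smul_apply, Matrix.cons_val_zero,
      Matrix.cons_val_one, Matrix.cons_val, smul_eq_mul, Real.cos_zero, Real.sin_zero]
  have h1 := Real.sin_sq_add_cos_sq α
  linear_combination t ^ 2 * h1

theorem continuous_sideLength :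
    Continuous (fun p : ℝ × ℝ × ℝ => sideLength p.1 p.2.1 p.2.2) := by
  unfold sideLength; fun_prop

theorem sideLength_pos {r t α : ℝ} (hr : 0 < r) (ht : 0 < t) (hα : α ∈ Set.Ico 0 Real.pi) :
    0 < sideLength r t α := by
  unfold sideLength
  apply Real.sqrt_pos.2
  have hc : -1 < Real.cos α := by
    rw [← Real.cos_pi]
    exact Real.cos_lt_cos_of_nonneg_of_le_pi hα.1 le_rfl hα.2
  nlinarith [mul_pos hr ht, sq_nonneg (r - t)]

theorem hasDerivAt_sideLength {r t α : ℝ} (h : 0 < sideLength r t α) :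
    HasDerivAt (fun α => sideLength r t α) (-(r * t * Real.sin α / sideLength r t α)) α := by
  have h0 : r ^ 2 + t ^ 2 + 2 * r * t * Real.cos α ≠ 0 := by
    rw [← sideLength_sq]; positivity
  refine ((((Real.hasDerivAt_cos α).const_mul (2 * r * t)).const_add
    (r ^ 2 + t ^ 2)).sqrt h0).congr_deriv ?_
  rw [show √(r ^ 2 + t ^ 2 + 2 * r * t * Real.cos α) = sideLength r t α from rfl]
  field_simp

/-- The Green's functions are singular at their poles, but the poles lie off the support of the
source density; the product is then continuous everywhere. -/
theorem continuous_mul_of_tsupport {X : Type*} [TopologicalSpace X] {f g : X → ℂ}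
    (hf : Continuous f) (hg : ∀ y ∈ tsupport f, ContinuousAt g y) :
    Continuous fun y => f y * g y := by
  rw [continuous_iff_continuousAt]
  intro y
  by_cases hy : y ∈ tsupport f
  · exact hf.continuousAt.mul (hg y hy)
  · have h0 : f =ᶠ[𝓝 y] 0 := notMem_tsupport_iff_eventuallyEq.1 hy
    refine (continuousAt_const (y := (0 : ℂ))).congr ?_
    filter_upwards [h0] with u hu
    simp [hu]

/-- There is an isometry sending the vertical direction to the one from `z` to `x`. -/
theorem exists_frame {x z : E3} (h : z ≠ x) :
    ∃ U : E3 ≃ₗᵢ[ℝ] E3, z = x - ‖z - x‖ • U vert := by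
  have hr : ‖z - x‖ ≠ 0 := by simpa [sub_eq_zero] using h
  set w : E3 := ‖z - x‖⁻¹ • (x - z) with hw
  have hn : ‖vert‖ = ‖w‖ := by
    rw [norm_vert, hw, norm_smul, norm_inv, norm_norm, norm_sub_rev x z, inv_mul_cancel₀ hr]
  -- The reflection in the hyperplane orthogonal to the difference of two vectors of equal norm
  -- exchanges them.
  refine ⟨Submodule.reflection (Submodule.span ℝ {vert - w})ᗮ, ?_⟩
  rw [Submodule.reflection_sub hn, hw, smul_smul, mul_inv_cancel₀ hr]
  simp

/-- The derivative of the source density along the polar angle. -/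
def dsource (K : E3 → ℝ) (x : E3) (U : E3 ≃ₗᵢ[ℝ] E3) (t α β : ℝ) : ℝ :=
  fderiv ℝ K (x + U (sph t α β)) (U (dsph t α β))

theorem continuous_dsource {K : E3 → ℝ} (hK : ContDiff ℝ 1 K) (x : E3) (U : E3 ≃ₗᵢ[ℝ] E3) :
    Continuous (fun p : ℝ × ℝ × ℝ => dsource K x U p.1 p.2.1 p.2.2) := by
  unfold dsource
  have h1 : Continuous (fderiv ℝ K) := hK.continuous_fderiv (by norm_num)
  exact (h1.comp (continuous_const.add (U.continuous.comp continuous_sph))).clm_apply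
    (U.continuous.comp continuous_dsph)

theorem dsource_eq_zero {K : E3 → ℝ} {x : E3} {U : E3 ≃ₗᵢ[ℝ] E3} {t α β : ℝ}
    (h : x + U (sph t α β) ∉ tsupport K) : dsource K x U t α β = 0 := by
  unfold dsource
  have : fderiv ℝ K (x + U (sph t α β)) = 0 := by
    by_contra h'
    exact h (support_fderiv_subset ℝ h')
  simp [this]

theorem hasDerivAt_source {K : E3 → ℝ} (hK : ContDiff ℝ 1 K) (x : E3) (U : E3 ≃ₗᵢ[ℝ] E3)
    (t α β : ℝ) :
    HasDerivAt (fun α => K (x + U (sph t α β))) (dsource K x U t α β) α := by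
  have h1 : HasFDerivAt K (fderiv ℝ K (x + U (sph t α β))) (x + U (sph t α β)) :=
    (hK.differentiable (by norm_num) _).hasFDerivAt
  have h2 : HasDerivAt (fun α => x + U (sph t α β)) (U (dsph t α β)) α :=
    ((U.toContinuousLinearEquiv.toContinuousLinearMap.hasFDerivAt.comp_hasDerivAt α
      (hasDerivAt_sph t α β))).const_add x
  exact h1.comp_hasDerivAt α h2

/-- Integration by parts in the polar angle. By `hasDerivAt_sideLength`, the Jacobian t² sin α
divided by the two distances is, up to the factor -r·lam, what the chain rule produces when `G` of
the phase is differentiated in α. The endpoint α = 0 lies on the ray from x away from z and gives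
the main term; the endpoint α = π lies on the side of z, where K vanishes. -/
theorem polar_angle_integral {K : E3 → ℝ} (hK : ContDiff ℝ 1 K) (x : E3) (U : E3 ≃ₗᵢ[ℝ] E3)
    {r t β : ℝ} (hr : 0 < r) (ht : 0 < t) (hKr : x - r • U vert ∉ tsupport K)
    (hahead : K (x - t • U vert) = 0)
    {g G : ℝ → ℂ} (hG : ∀ s, HasDerivAt G (g s) s) (hg : Continuous g) {lam : ℝ} (hlam : 0 < lam)
    (S : ℝ) :
    ∫ α in Set.Ioo 0 Real.pi, ((t ^ 2 * Real.sin α : ℝ) : ℂ) *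
        ((K (x + U (sph t α β)) : ℂ) * (((sideLength r t α * t : ℝ) : ℂ)⁻¹ *
          g (lam * (S + sideLength r t α - t))))
      = ((1 / (r * lam) : ℝ) : ℂ) * ((K (x + t • U vert) : ℂ) * G (lam * (S + r)) +
        ∫ α in Set.Ioo 0 Real.pi, (dsource K x U t α β : ℂ) *
          G (lam * (S + sideLength r t α - t))) := by
  have hpi := Real.pi_pos
  set u : ℝ → ℂ := fun α => (K (x + U (sph t α β)) : ℂ) with hu
  set v : ℝ → ℂ := fun α => G (lam * (S + sideLength r t α - t)) with hv
  have hGc : Continuous G := continuous_iff_continuousAt.2 fun s => (hG s).continuousAt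
  have hcu : Continuous u := by
    rw [hu]
    refine Complex.continuous_ofReal.comp (hK.continuous.comp
      (continuous_const.add (U.continuous.comp ?_)))
    unfold sph; fun_prop
  have hsl : Continuous fun α => sideLength r t α := by unfold sideLength; fun_prop
  have hcv : Continuous v := by rw [hv]; fun_prop
  have hcu' : Continuous fun α => (dsource K x U t α β : ℂ) := by
    refine Complex.continuous_ofReal.comp ((continuous_dsource hK x U).comp ?_ (g := fun p : ℝ × ℝ × ℝ => _)
      (f := fun α => (t, α, β)))
    fun_prop
  -- the derivative of the profile
  set w : ℝ → ℂ := fun α => ((-(r * lam) : ℝ) : ℂ) *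
    (((t ^ 2 * Real.sin α : ℝ) : ℂ) * (((sideLength r t α * t : ℝ) : ℂ)⁻¹ *
          g (lam * (S + sideLength r t α - t)))) with hw
  have hpos : ∀ α ∈ Set.Ioo 0 Real.pi, 0 < sideLength r t α := fun α hα =>
    sideLength_pos hr ht ⟨hα.1.le, hα.2⟩
  have hdv : ∀ α ∈ Set.Ioo 0 Real.pi, HasDerivAt v (w α) α := by
    intro α hα
    have h1 := hpos α hα
    have h2 : HasDerivAt (fun α => lam * (S + sideLength r t α - t))
        (lam * (-(r * t * Real.sin α / sideLength r t α))) α :=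
      (((hasDerivAt_sideLength h1).const_add S).sub_const t).const_mul lam
    refine ((hG (lam * (S + sideLength r t α - t))).scomp α h2).congr_deriv ?_
    rw [hw, Complex.real_smul]
    have h4 : (sideLength r t α : ℂ) ≠ 0 := by exact_mod_cast h1.ne'
    have h5 : (t : ℂ) ≠ 0 := by exact_mod_cast ht.ne'
    push_cast
    field_simp
  -- continuity of `u w`
  have hcuw : Continuous fun α => u α * w α := by
    refine continuous_mul_of_tsupport hcu fun α hα => ?_
    have hα' : x + U (sph t α β) ∈ tsupport K := by
      have : tsupport u ⊆ (fun α => x + U (sph t α β)) ⁻¹' tsupport K := by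
        refine closure_minimal ?_ ((isClosed_tsupport K).preimage ?_)
        · intro α hα
          apply subset_tsupport
          intro h0
          exact hα (by simp [hu, h0])
        · refine continuous_const.add (U.continuous.comp ?_)
          unfold sph; fun_prop
      exact this hα
    have hne : sideLength r t α ≠ 0 := by
      rw [← norm_sph_add r t α β, norm_ne_zero_iff]
      intro h0
      apply hKr
      have : sph t α β = -(r • vert) := eq_neg_of_add_eq_zero_left h0
      rw [this] at hα'
      simpa [sub_eq_add_neg] using hα'
    have hne' : ((sideLength r t α * t : ℝ) : ℂ) ≠ 0 := by
      exact_mod_cast mul_ne_zero hne ht.ne'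
    rw [hw]
    refine continuousAt_const.mul (ContinuousAt.mul (by fun_prop) (ContinuousAt.mul ?_ (by fun_prop)))
    exact ContinuousAt.inv₀ (by fun_prop) hne'
  have hdu : ∀ α, HasDerivAt u (dsource K x U t α β : ℂ) α := fun α =>
    (hasDerivAt_source hK x U t α β).ofReal_comp
  have hu0 : u 0 = (K (x + t • U vert) : ℂ) := by
    have : sph t 0 β = t • vert := by
      ext i; fin_cases i <;> simp [sph, vert]
    simp [hu, this]
  have hupi : u Real.pi = 0 := by
    have : sph t Real.pi β = -(t • vert) := by
      ext i; fin_cases i <;> simp [sph, vert]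
    simp only [hu, this, map_neg, map_smul, ← sub_eq_add_neg, hahead, Complex.ofReal_zero]
  have hv0 : v 0 = G (lam * (S + r)) := by
    have : sideLength r t 0 = r + t := by
      unfold sideLength
      rw [Real.cos_zero, show r ^ 2 + t ^ 2 + 2 * r * t * 1 = (r + t) ^ 2 by ring,
        Real.sqrt_sq (by positivity)]
    simp only [hv, this]
    congr 2; ring
  have key := intervalIntegral.integral_eq_sub_of_hasDerivAt_of_le (f := fun α => u α * v α)
    (f' := fun α => (dsource K x U t α β : ℂ) * v α + u α * w α) hpi.le
    (hcu.mul hcv).continuousOn (fun α hα => (hdu α).mul (hdv α hα))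
    (((hcu'.mul hcv).add hcuw).intervalIntegrable _ _)
  rw [intervalIntegral.integral_add (f := fun α => (dsource K x U t α β : ℂ) * v α)
    ((hcu'.mul hcv).intervalIntegrable _ _) (hcuw.intervalIntegrable _ _), hupi, hu0, hv0] at key
  rw [← integral_Ioc_eq_integral_Ioo, ← intervalIntegral.integral_of_le hpi.le,
    ← integral_Ioc_eq_integral_Ioo, ← intervalIntegral.integral_of_le hpi.le]
  have e1 : ∫ α in (0 : ℝ)..Real.pi, u α * w α = ((-(r * lam) : ℝ) : ℂ) *
      ∫ α in (0 : ℝ)..Real.pi, ((t ^ 2 * Real.sin α : ℝ) : ℂ) *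
        ((K (x + U (sph t α β)) : ℂ) * (((sideLength r t α * t : ℝ) : ℂ)⁻¹ *
          g (lam * (S + sideLength r t α - t)))) := by
    rw [← intervalIntegral.integral_const_mul]
    refine intervalIntegral.integral_congr fun α _ => ?_
    simp only [hu, hw]; ring
  rw [e1] at key
  have hr' : (r : ℂ) ≠ 0 := by exact_mod_cast hr.ne'
  have hl' : (lam : ℂ) ≠ 0 := by exact_mod_cast hlam.ne'
  have key2 : ((-(r * lam) : ℝ) : ℂ) * _ = _ := eq_sub_of_add_eq' key
  rw [eq_comm, one_div, Complex.ofReal_inv, inv_mul_eq_iff_eq_mul₀ (by push_cast; positivity)]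
  push_cast at key2 ⊢
  linear_combination key2

/-- Spherical coordinates about x with polar axis along x - z reduce the integral to
`polar_angle_integral`. The boundary term does not depend on the azimuth, whence the 2π. This is an
identity, not an asymptotic expansion: the last term is kept exactly, since it becomes small only in
mean square over z. -/
theorem source_integral {K : E3 → ℝ} (hK : ContDiff ℝ 1 K) (hKc : HasCompactSupport K) {x z : E3}
    (hx : x ∉ tsupport K) (hz : z ∉ tsupport K) {U : E3 ≃ₗᵢ[ℝ] E3} {r : ℝ} (hr : 0 < r)
    (hU : z = x - r • U vert) (hahead : ∀ t : ℝ, 0 < t → K (x - t • U vert) = 0)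
    {g G : ℝ → ℂ} (hG : ∀ s, HasDerivAt G (g s) s) (hg : Continuous g) {lam : ℝ} (hlam : 0 < lam)
    (S : ℝ) :
    ∫ y, (K y : ℂ) * (((‖z - y‖ * ‖x - y‖ : ℝ) : ℂ)⁻¹ * g (lam * (S + ‖z - y‖ - ‖x - y‖)))
      = ((1 / (r * lam) : ℝ) : ℂ) *
        (((2 * Real.pi * ∫ t in Set.Ioi (0 : ℝ), K (x + t • U vert) : ℝ) : ℂ) * G (lam * (S + r)) +
          ∫ β in Set.Ioo (-Real.pi) Real.pi, ∫ t in Set.Ioi (0 : ℝ), ∫ α in Set.Ioo 0 Real.pi,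
            (dsource K x U t α β : ℂ) * G (lam * (S + sideLength r t α - t))) := by
  obtain ⟨R, hR⟩ := hKc.isCompact.isBounded.exists_norm_le
  have hGc : Continuous G := continuous_iff_continuousAt.2 fun s => (hG s).continuousAt
  set F : E3 → ℂ := fun y =>
    (K y : ℂ) * (((‖z - y‖ * ‖x - y‖ : ℝ) : ℂ)⁻¹ * g (lam * (S + ‖z - y‖ - ‖x - y‖))) with hF
  have hKs : tsupport (fun y => (K y : ℂ)) ⊆ tsupport K :=
    closure_mono fun y hy h0 => hy (by simp [h0])
  have hFc : Continuous F := by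
    refine continuous_mul_of_tsupport (Complex.continuous_ofReal.comp hK.continuous)
      fun y hy => ?_
    have h1 : ‖z - y‖ ≠ 0 := by
      rw [norm_ne_zero_iff, sub_ne_zero]; rintro rfl; exact hz (hKs hy)
    have h2 : ‖x - y‖ ≠ 0 := by
      rw [norm_ne_zero_iff, sub_ne_zero]; rintro rfl; exact hx (hKs hy)
    refine ContinuousAt.mul (ContinuousAt.inv₀ (by fun_prop) ?_) (by fun_prop)
    exact_mod_cast mul_ne_zero h1 h2
  have hFs : HasCompactSupport F := by
    refine hKc.mono' (subset_trans ?_ hKs)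
    exact fun y hy => subset_tsupport _ fun h0 => hy (by simp only [hF, h0, zero_mul])
  have hz' : x - r • U vert ∉ tsupport K := hU ▸ hz
  set e : E3 ≃ₜ E3 := U.toHomeomorph.trans (Homeomorph.addLeft x) with he
  have e1 : ∫ y, F y = ∫ Y, F (x + U Y) := by
    rw [← integral_add_left_eq_self F x]
    exact (U.measurePreserving.integral_comp' (f := U.toMeasurableEquiv)
      (fun y => F (x + y))).symm
  have hF1 : Continuous fun Y => F (x + U Y) :=
    hFc.comp (continuous_const.add U.continuous)
  have hF2 : HasCompactSupport fun Y => F (x + U Y) := hFs.comp_homeomorph e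
  rw [e1, integral_spherical hF1 hF2]
  have hzx : ∀ Y : E3, ‖z - (x + U Y)‖ = ‖Y + r • vert‖ := by
    intro Y
    rw [hU, ← U.norm_map (Y + r • vert), ← norm_neg]
    congr 1
    simp only [map_add, map_smul]
    abel
  set A : ℝ → ℂ := fun t => (K (x + t • U vert) : ℂ) * G (lam * (S + r)) with hA
  set B : ℝ → ℝ → ℝ → ℂ := fun β t α =>
    (dsource K x U t α β : ℂ) * G (lam * (S + sideLength r t α - t)) with hB
  have hstep : ∫ β in Set.Ioo (-Real.pi) Real.pi, ∫ t in Set.Ioi (0 : ℝ),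
        ∫ α in Set.Ioo 0 Real.pi, ((t ^ 2 * Real.sin α : ℝ) : ℂ) * F (x + U (sph t α β))
      = ∫ β in Set.Ioo (-Real.pi) Real.pi, ((1 / (r * lam) : ℝ) : ℂ) * ∫ t in Set.Ioi (0 : ℝ),
        (A t + ∫ α in Set.Ioo 0 Real.pi, B β t α) := by
    refine integral_congr_ae (Eventually.of_forall fun β => ?_)
    beta_reduce
    rw [← integral_const_mul]
    refine setIntegral_congr_fun measurableSet_Ioi fun t ht => ?_
    rw [← polar_angle_integral hK x U hr ht hz' (hahead t ht) hG hg hlam S]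
    refine setIntegral_congr_fun measurableSet_Ioo fun α hα => ?_
    simp only [hF, hzx, norm_sph_add]
    have : ‖x - (x + U (sph t α β))‖ = t := by
      simp [norm_sph (le_of_lt ht)]
    rw [this]
  rw [hstep, integral_const_mul]
  congr 1
  -- Beyond this radius the sphere about x misses the support of K, so that all radial integrals are
  -- over a bounded interval.
  set T : ℝ := max (R + ‖x‖) 0 with hT
  have hTK : ∀ t α β, T < t → x + U (sph t α β) ∉ tsupport K := by
    intro t α β ht hmem
    have h0 : 0 ≤ t := (le_max_right _ _).trans ht.le
    have h1 := hR _ hmem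
    have h2 : t ≤ ‖x + U (sph t α β)‖ + ‖x‖ := by
      have := norm_sub_le (x + U (sph t α β)) x
      simpa [norm_sph h0] using this
    have := le_max_left (R + ‖x‖) 0
    linarith
  have hBc : Continuous fun q : (ℝ × ℝ) × ℝ => B q.1.1 q.1.2 q.2 := by
    have h1 := (continuous_dsource hK x U).comp
      (f := fun q : (ℝ × ℝ) × ℝ => (q.1.2, q.2, q.1.1)) (by fun_prop)
    have h2 := continuous_sideLength.comp
      (f := fun q : (ℝ × ℝ) × ℝ => (r, q.1.2, q.2)) (by fun_prop)
    simp only [Function.comp_def] at h1 h2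
    have h3 : Continuous fun q : (ℝ × ℝ) × ℝ =>
      G (lam * (S + sideLength r q.1.2 q.2 - q.1.2)) := by fun_prop
    exact (Complex.continuous_ofReal.comp h1).mul h3
  set B1 : ℝ → ℝ → ℂ := fun β t => ∫ α in Set.Icc 0 Real.pi, B β t α with hB1
  have hB1c : Continuous fun q : ℝ × ℝ => B1 q.1 q.2 :=
    continuous_parametric_integral_of_continuous (f := fun q : ℝ × ℝ => fun α => B q.1 q.2 α)
      hBc isCompact_Icc
  have hB1e : ∀ β t, ∫ α in Set.Ioo 0 Real.pi, B β t α = B1 β t := fun β t =>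
    (integral_Icc_eq_integral_Ioo).symm
  have hB0 : ∀ β t, T < t → B1 β t = 0 := by
    intro β t ht
    refine integral_eq_zero_of_ae (Eventually.of_forall fun α => ?_)
    simp [hB, dsource_eq_zero (hTK t α β ht)]
  have hA0 : ∀ t, T < t → A t = 0 := by
    intro t ht
    have hs : sph t 0 0 = t • vert := by
      ext i; fin_cases i <;> simp [sph, vert]
    have := hTK t 0 0 ht
    rw [hs, map_smul] at this
    simp [hA, image_eq_zero_of_notMem_tsupport this]
  have hAc : Continuous A := by
    refine Continuous.mul (Complex.continuous_ofReal.comp (hK.continuous.comp ?_)) continuous_const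
    fun_prop
  have hint : ∀ {f : ℝ → ℂ}, Continuous f → (∀ t, T < t → f t = 0) →
      IntegrableOn f (Set.Ioi 0) := by
    intro f hf hf0
    refine IntegrableOn.of_forall_sdiff_eq_zero
      (hf.continuousOn.integrableOn_compact (isCompact_Icc (a := 0) (b := T))) measurableSet_Ioi ?_
    rintro t ⟨ht, ht2⟩
    refine hf0 t ?_
    by_contra h
    exact ht2 ⟨le_of_lt ht, not_lt.1 h⟩
  have hres : ∀ β, ∫ t in Set.Ioi (0 : ℝ), B1 β t = ∫ t in Set.Icc 0 T, B1 β t := by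
    intro β
    rw [integral_Icc_eq_integral_Ioc]
    refine (setIntegral_eq_of_subset_of_forall_sdiff_eq_zero measurableSet_Ioi
      Set.Ioc_subset_Ioi_self ?_)
    rintro t ⟨ht, ht2⟩
    refine hB0 β t ?_
    by_contra h
    exact ht2 ⟨ht, not_lt.1 h⟩
  simp_rw [hB1e]
  have hJ : Continuous fun β => ∫ t in Set.Ioi (0 : ℝ), B1 β t := by
    simp_rw [hres]
    exact continuous_parametric_integral_of_continuous (f := fun β t => B1 β t)
      hB1c isCompact_Icc
  have hsplit : ∀ β, ∫ t in Set.Ioi (0 : ℝ), (A t + B1 β t)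
      = (∫ t in Set.Ioi (0 : ℝ), A t) + ∫ t in Set.Ioi (0 : ℝ), B1 β t := by
    intro β
    have h1 : Continuous (B1 β) := by
      clear_value B1
      exact hB1c.comp (Continuous.prodMk_right β)
    have i1 := hint hAc hA0
    have i2 := hint h1 (hB0 β)
    clear_value A B1
    exact integral_add i1 i2
  simp_rw [hsplit]
  rw [integral_add (integrable_const _) ((hJ.continuousOn.integrableOn_compact
    (isCompact_Icc (a := -Real.pi) (b := Real.pi))).mono_set Set.Ioo_subset_Icc_self)]
  congr 1
  swap
  · simp_rw [← hB1e, hB]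
  rw [setIntegral_const, hA, integral_mul_const]
  have hv : volume.real (Set.Ioo (-Real.pi) Real.pi) = 2 * Real.pi := by
    rw [Real.volume_real_Ioo_of_le (by linarith [Real.pi_pos])]; ring
  rw [hv, integral_complex_ofReal, Complex.real_smul]
  push_cast
  ring

open scoped SchwartzMap FourierTransform

/-! ### Time profiles -/

/-- The oscillatory integral `∫ f(ω) e^{iωs} dω`. -/
def osc (f : ℝ → ℂ) (s : ℝ) : ℂ := ∫ ω, f ω * Complex.exp (Complex.I * ((ω * s : ℝ) : ℂ))

theorem norm_exp_I_mul (x : ℝ) : ‖Complex.exp (Complex.I * (x : ℂ))‖ = 1 := by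
  rw [mul_comm]; exact Complex.norm_exp_ofReal_mul_I x

theorem osc_eq_fourier (f : ℝ → ℂ) (s : ℝ) : osc f s = 𝓕 f (-s / (2 * Real.pi)) := by
  rw [Real.fourier_eq', osc]
  refine integral_congr_ae (Eventually.of_forall fun u => ?_)
  simp only [smul_eq_mul]
  rw [mul_comm]
  congr 2
  have : (Real.pi : ℂ) ≠ 0 := by exact_mod_cast Real.pi_ne_zero
  rw [show inner ℝ u (-s / (2 * Real.pi)) = -s / (2 * Real.pi) * u from rfl]
  push_cast
  field_simp

theorem osc_decay (f : 𝓢(ℝ, ℂ)) (k : ℕ) : ∃ C : ℝ, 0 < C ∧ ∀ s, |s| ^ k * ‖osc f s‖ ≤ C := by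
  obtain ⟨C, hC, h⟩ := (𝓕 f).decay k 0
  have hpi := Real.pi_pos
  refine ⟨(2 * Real.pi) ^ k * C, by positivity, fun s => ?_⟩
  have h1 := h (-s / (2 * Real.pi))
  rw [norm_iteratedFDeriv_zero] at h1
  rw [osc_eq_fourier, ← SchwartzMap.fourier_coe]
  rw [Real.norm_eq_abs, abs_div, abs_neg, abs_of_pos (by positivity : 0 < 2 * Real.pi), div_pow,
    div_mul_eq_mul_div, div_le_iff₀ (by positivity)] at h1
  linarith

/-- Quadratic decay suffices for the mean square estimates, and this profile keeps its form under
bounded shifts of the phase. -/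
theorem osc_le (f : 𝓢(ℝ, ℂ)) : ∃ C : ℝ, 0 < C ∧ ∀ s, ‖osc f s‖ ≤ C / (1 + s ^ 2) := by
  obtain ⟨C0, h0, H0⟩ := osc_decay f 0
  obtain ⟨C2, h2, H2⟩ := osc_decay f 2
  refine ⟨C0 + C2, by positivity, fun s => ?_⟩
  rw [le_div_iff₀ (by positivity)]
  have := H0 s
  have := H2 s
  rw [sq_abs] at this
  simp only [pow_zero, one_mul] at *
  linarith

theorem hasDerivAt_osc (f : 𝓢(ℝ, ℂ)) (s : ℝ) :
    HasDerivAt (osc f) (osc (fun ω => Complex.I * ω * f ω) s) s := by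
  have hfi := f.integrable (μ := (volume : Measure ℝ))
  have hb : Integrable (fun ω : ℝ => |ω| * ‖f ω‖) := by
    simpa using f.integrable_pow_mul (volume : Measure ℝ) 1
  refine (hasDerivAt_integral_of_dominated_loc_of_deriv_le (s := Set.univ)
    (F := fun s ω => f ω * Complex.exp (Complex.I * ((ω * s : ℝ) : ℂ)))
    (F' := fun s ω => (Complex.I * ω * f ω) * Complex.exp (Complex.I * ((ω * s : ℝ) : ℂ)))
    (bound := fun ω => |ω| * ‖f ω‖) Filter.univ_mem ?_ ?_ ?_ ?_ hb ?_).2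
  · exact Eventually.of_forall fun s => (f.continuous.mul (by fun_prop)).aestronglyMeasurable
  · refine hfi.mono (f.continuous.mul (by fun_prop)).aestronglyMeasurable
      (Eventually.of_forall fun ω => ?_)
    rw [norm_mul, norm_exp_I_mul, mul_one]
  · exact ((by fun_prop : Continuous fun ω : ℝ => Complex.I * (ω : ℂ)).mul
      f.continuous |>.mul (by fun_prop)).aestronglyMeasurable
  · refine Eventually.of_forall fun ω s _ => ?_
    rw [norm_mul, norm_exp_I_mul, mul_one, norm_mul, norm_mul, Complex.norm_I, one_mul,
      Complex.norm_real, Real.norm_eq_abs]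
  · refine Eventually.of_forall fun ω s _ => ?_
    have h1 : HasDerivAt (fun s : ℝ => Complex.I * ((ω * s : ℝ) : ℂ)) (Complex.I * (ω : ℂ)) s := by
      have := ((hasDerivAt_id s).const_mul ω).ofReal_comp.const_mul Complex.I
      simpa using this
    refine (h1.cexp.const_mul (f ω)).congr_deriv ?_
    ring

/-- `F̂` as a complex Schwartz function. -/
theorem exists_schwartz_Fhat (S : Setup) {B : ℝ} (hB : 0 < B) :
    ∃ f : 𝓢(ℝ, ℂ), ∀ ω, f ω = (S.Fhat B ω : ℂ) := by
  have hlin : ∀ a b : ℝ, ∃ f : 𝓢(ℝ, ℝ), b ≠ 0 → ∀ ω, f ω = S.Fhat₀ (a + b * ω) := by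
    intro a b
    by_cases hb : b = 0
    · exact ⟨0, fun h => (h hb).elim⟩
    have h1 : (fun ω : ℝ => a + b * ω).HasTemperateGrowth := by
      exact (Function.HasTemperateGrowth.const a).add
        ((Function.HasTemperateGrowth.const b).mul Function.HasTemperateGrowth.id')
    have h2 : AntilipschitzWith (Real.toNNReal |b|⁻¹) (fun ω : ℝ => a + b * ω) := by
      refine AntilipschitzWith.of_le_mul_dist fun x y => ?_
      have : |b| ≠ 0 := abs_ne_zero.2 hb
      rw [Real.dist_eq, Real.dist_eq, show a + b * x - (a + b * y) = b * (x - y) by ring, abs_mul]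
      rw [Real.coe_toNNReal _ (by positivity), ← mul_assoc, inv_mul_cancel₀ this, one_mul]
    exact ⟨SchwartzMap.compCLMOfAntilipschitz ℝ h1 h2 S.Fhat₀, fun _ ω => rfl⟩
  obtain ⟨f1, h1⟩ := hlin (S.ω₀ / B) (-(1 / B))
  obtain ⟨f2, h2⟩ := hlin (S.ω₀ / B) (1 / B)
  refine ⟨((1 / B) • (f1 + f2)).postcompCLM (𝕜 := ℝ) Complex.ofRealCLM, fun ω => ?_⟩
  rw [SchwartzMap.postcompCLM_apply]
  simp only [smul_apply, add_apply, Complex.ofRealCLM_apply, smul_eq_mul,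
    Setup.Fhat]
  rw [h1 (by simp [hB.ne']), h2 (by simp [hB.ne'])]
  congr 5 <;> ring

theorem exists_schwartz_mul (f : 𝓢(ℝ, ℂ)) : ∃ g : 𝓢(ℝ, ℂ), ∀ ω, g ω = (ω : ℂ) * f ω :=
  ⟨SchwartzMap.smulLeftCLM ℂ (fun ω : ℝ => (ω : ℂ)) f, fun ω => by
    rw [SchwartzMap.smulLeftCLM_apply_apply Function.Complex.hasTemperateGrowth_ofReal]; rfl⟩

theorem Fhat_neg (S : Setup) (B ω : ℝ) : S.Fhat B (-ω) = S.Fhat B ω := by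
  simp only [Setup.Fhat, sub_neg_eq_add, ← sub_eq_add_neg]; ring

/-- The spectrum `-iω F̂(ω)` of the derivative of the source profile. -/
def dspec (S : Setup) (B ω : ℝ) : ℂ := -Complex.I * ((ω * S.Fhat B ω : ℝ) : ℂ)

/-- The spectrum `ω² F̂(ω)`. -/
def ddspec (S : Setup) (B ω : ℝ) : ℂ := ((ω ^ 2 * S.Fhat B ω : ℝ) : ℂ)

theorem exists_schwartz_dspec (S : Setup) {B : ℝ} (hB : 0 < B) :
    ∃ f : 𝓢(ℝ, ℂ), (f : ℝ → ℂ) = dspec S B := by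
  obtain ⟨f, hf⟩ := exists_schwartz_Fhat S hB
  obtain ⟨g, hg⟩ := exists_schwartz_mul f
  refine ⟨-Complex.I • g, funext fun ω => ?_⟩
  simp [dspec, hg, hf]

theorem exists_schwartz_ddspec (S : Setup) {B : ℝ} (hB : 0 < B) :
    ∃ f : 𝓢(ℝ, ℂ), (f : ℝ → ℂ) = ddspec S B := by
  obtain ⟨f, hf⟩ := exists_schwartz_Fhat S hB
  obtain ⟨g, hg⟩ := exists_schwartz_mul f
  obtain ⟨h, hh⟩ := exists_schwartz_mul g
  refine ⟨h, funext fun ω => ?_⟩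
  rw [hh, hg, hf, ddspec]; push_cast; ring

/-- Since iω · (-iω) = ω², the profile with spectrum ω²F̂ of the Born formula is a derivative. This
is what makes the integration by parts over the sources available. -/
theorem hasDerivAt_osc_dspec (S : Setup) {B : ℝ} (hB : 0 < B) (s : ℝ) :
    HasDerivAt (osc (dspec S B)) (osc (ddspec S B) s) s := by
  obtain ⟨f, hf⟩ := exists_schwartz_dspec S hB
  have h := hasDerivAt_osc f s
  rw [hf] at h
  convert h using 2
  ext ω
  rw [dspec, ddspec]
  push_cast
  linear_combination ((ω : ℂ) ^ 2 * S.Fhat B ω) * Complex.I_sq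

theorem continuous_osc (f : 𝓢(ℝ, ℂ)) : Continuous (osc f) :=
  continuous_iff_continuousAt.2 fun s => (hasDerivAt_osc f s).continuousAt

theorem continuous_osc_ddspec (S : Setup) {B : ℝ} (hB : 0 < B) :
    Continuous (osc (ddspec S B)) := by
  obtain ⟨f, hf⟩ := exists_schwartz_ddspec S hB
  rw [← hf]; exact continuous_osc f

theorem continuous_osc_dspec (S : Setup) {B : ℝ} (hB : 0 < B) :
    Continuous (osc (dspec S B)) := by
  obtain ⟨f, hf⟩ := exists_schwartz_dspec S hB
  rw [← hf]; exact continuous_osc f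

/-! ### Oscillatory amplitudes -/

section Amplitude

variable {V : Type*} [NormedAddCommGroup V] [NormedSpace ℝ V]

/-- Amplitudes `e^{iωM(p)} ∑_{j ≤ N} ω^j c_j(p)` with smooth coefficients. -/
def IsAmplitude (M : V → ℝ) (N : ℕ) (h : ℝ → V → ℂ) : Prop :=
  ∃ c : ℕ → V → ℂ, (∀ j, ContDiff ℝ (⊤ : ℕ∞) (c j)) ∧ ∀ ω p, h ω p =
    Complex.exp (Complex.I * ((ω * M p : ℝ) : ℂ)) * ∑ j ∈ Finset.range (N + 1), (ω : ℂ) ^ j * c j p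

theorem IsAmplitude.contDiff {M : V → ℝ} (hM : ContDiff ℝ (⊤ : ℕ∞) M) {N : ℕ} {h : ℝ → V → ℂ}
    (hh : IsAmplitude M N h) (ω : ℝ) : ContDiff ℝ (⊤ : ℕ∞) (h ω) := by
  obtain ⟨c, hc, he⟩ := hh
  rw [show h ω = _ from funext (he ω)]
  refine ContDiff.mul ?_ (ContDiff.sum fun j _ => contDiff_const.mul (hc j))
  exact (contDiff_const.mul (Complex.ofRealCLM.contDiff.comp (contDiff_const.mul hM))).cexp

theorem IsAmplitude.continuous {M : V → ℝ} (hM : ContDiff ℝ (⊤ : ℕ∞) M) {N : ℕ} {h : ℝ → V → ℂ}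
    (hh : IsAmplitude M N h) : Continuous fun q : ℝ × V => h q.1 q.2 := by
  obtain ⟨c, hc, he⟩ := hh
  simp_rw [he]
  have h1 := hM.continuous
  have h2 := fun j => (hc j).continuous
  fun_prop

/-- Differentiating the exponential brings down one factor iω times the derivative of M, so the
degree in ω grows by one and the exponential is unchanged. -/
theorem IsAmplitude.directional {M : V → ℝ} (hM : ContDiff ℝ (⊤ : ℕ∞) M) {N : ℕ} {h : ℝ → V → ℂ}
    (hh : IsAmplitude M N h) (e : V) : IsAmplitude M (N + 1) (fun ω p => fderiv ℝ (h ω) p e) := by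
  obtain ⟨c, hc, he⟩ := hh
  have hM' : ContDiff ℝ (⊤ : ℕ∞) fun p => (fderiv ℝ M p e : ℂ) :=
    Complex.ofRealCLM.contDiff.comp ((hM.fderiv_right (by simp)).clm_apply contDiff_const)
  have hc' : ∀ j, ContDiff ℝ (⊤ : ℕ∞) fun p => fderiv ℝ (c j) p e := fun j =>
    ((hc j).fderiv_right (by simp)).clm_apply contDiff_const
  obtain ⟨d, hd0, hds⟩ : ∃ d : ℕ → V → ℂ, d 0 = 0 ∧
      ∀ j, d (j + 1) = fun p => Complex.I * (fderiv ℝ M p e : ℂ) * c j p :=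
    ⟨fun j => match j with
      | 0 => 0
      | j + 1 => fun p => Complex.I * (fderiv ℝ M p e : ℂ) * c j p, rfl, fun _ => rfl⟩
  -- The family c may be nonzero beyond index N, where it does not enter the amplitude; the
  -- truncation removes its contribution in the new top degree N + 1.
  refine ⟨fun j => (fun p => if j ≤ N then fderiv ℝ (c j) p e else 0) + d j, fun j => ?_,
    fun ω p => ?_⟩
  · refine ContDiff.add ?_ ?_
    · by_cases h : j ≤ N
      · simpa [h] using hc' j
      · simpa [h] using contDiff_const
    · cases j with
      | zero => rw [hd0]; exact contDiff_const
      | succ j => rw [hds]; exact (contDiff_const.mul hM').mul (hc j)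
  · have d1 : HasFDerivAt (fun p => Complex.exp (Complex.I * ((ω * M p : ℝ) : ℂ))) _ p :=
      ((Complex.ofRealCLM.hasFDerivAt.comp p
        ((hM.differentiable (by simp) p).hasFDerivAt.const_mul ω)).const_mul Complex.I).cexp
    have d2 : HasFDerivAt (fun p => ∑ j ∈ Finset.range (N + 1), (ω : ℂ) ^ j * c j p) _ p :=
      HasFDerivAt.fun_sum fun j _ =>
        ((hc j).differentiable (by simp) p).hasFDerivAt.const_mul ((ω : ℂ) ^ j)
    have d3 := d1.mul d2
    have hfe : h ω = (fun p => Complex.exp (Complex.I * ((ω * M p : ℝ) : ℂ))) *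
        fun p => ∑ j ∈ Finset.range (N + 1), (ω : ℂ) ^ j * c j p := funext (he ω)
    rw [← hfe] at d3
    beta_reduce
    rw [d3.fderiv]
    have s1 : ∑ j ∈ Finset.range (N + 1 + 1), (ω : ℂ) ^ j *
        ((fun p => if j ≤ N then fderiv ℝ (c j) p e else 0) p)
        = ∑ j ∈ Finset.range (N + 1), (ω : ℂ) ^ j * fderiv ℝ (c j) p e := by
      rw [Finset.sum_range_succ]
      simp only [add_le_iff_nonpos_right, nonpos_iff_eq_zero, one_ne_zero, if_false, mul_zero,
        add_zero]
      refine Finset.sum_congr rfl fun j hj => ?_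
      rw [if_pos (Nat.lt_succ_iff.1 (Finset.mem_range.1 hj))]
    simp only [Pi.add_apply, mul_add, Finset.sum_add_distrib]
    have s2 : ∑ j ∈ Finset.range (N + 1 + 1), (ω : ℂ) ^ j * d j p
        = ∑ j ∈ Finset.range (N + 1),
          (ω : ℂ) ^ (j + 1) * (Complex.I * (fderiv ℝ M p e : ℂ) * c j p) := by
      rw [Finset.sum_range_succ']
      simp [hd0, hds]
    rw [s1, s2]
    simp only [add_apply, smul_apply, smul_eq_mul, sum_apply, ContinuousLinearMap.comp_apply,
      Complex.ofRealCLM_apply, Finset.mul_sum, Complex.ofReal_mul, Function.comp_apply]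
    rw [Finset.sum_mul]
    congr 1
    refine Finset.sum_congr rfl fun j _ => ?_
    ring

/-- The exponential has modulus one, so the phase M costs nothing and only the polynomial in ω is
felt. -/
theorem IsAmplitude.bound {M : V → ℝ} {N : ℕ} {h : ℝ → V → ℂ}
    (hh : IsAmplitude M N h) {k : Set V} (hk : IsCompact k) :
    ∃ C : ℝ, 0 ≤ C ∧ ∀ ω, ∀ p ∈ k, ‖h ω p‖ ≤ C * (1 + |ω|) ^ N := by
  obtain ⟨c, hc, he⟩ := hh
  choose C hC using fun j => hk.exists_bound_of_continuousOn (hc j).continuous.continuousOn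
  refine ⟨∑ j ∈ Finset.range (N + 1), |C j|, by positivity, fun ω p hp => ?_⟩
  rw [he, norm_mul, norm_exp_I_mul, one_mul, Finset.sum_mul]
  refine (norm_sum_le _ _).trans (Finset.sum_le_sum fun j hj => ?_)
  rw [norm_mul, norm_pow, Complex.norm_real, Real.norm_eq_abs, mul_comm]
  refine mul_le_mul ((hC j p hp).trans (le_abs_self _)) ?_ (by positivity) (by positivity)
  calc |ω| ^ j ≤ (1 + |ω|) ^ j := by gcongr; linarith
    _ ≤ (1 + |ω|) ^ N :=
      pow_le_pow_right₀ (by linarith [abs_nonneg ω]) (Nat.lt_succ_iff.1 (Finset.mem_range.1 hj))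

theorem isAmplitude_exp (M : V → ℝ) {B : V → ℝ} (hB : ContDiff ℝ (⊤ : ℕ∞) B) :
    IsAmplitude M 0 (fun ω p => (B p : ℂ) * Complex.exp (Complex.I * ((ω * M p : ℝ) : ℂ))) := by
  refine ⟨fun _ p => (B p : ℂ), fun _ => Complex.ofRealCLM.contDiff.comp hB, fun ω p => ?_⟩
  simp [mul_comm]

end Amplitude

/-- Fundamental theorem of calculus in three variables, for a function vanishing on three
coordinate hyperplanes. -/
theorem exists_box_representation {W : Type*} [NormedAddCommGroup W] [NormedSpace ℝ W]
    {M B : ℝ × ℝ × ℝ × W → ℝ} (hM : ContDiff ℝ (⊤ : ℕ∞) M) (hB : ContDiff ℝ (⊤ : ℕ∞) B) {a b r : ℝ}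
    (ha : ∀ y s w, B (a, y, s, w) = 0) (hb : ∀ x s w, B (x, b, s, w) = 0)
    (hr : ∀ x y w, B (x, y, r, w) = 0) :
    ∃ h : ℝ → ℝ × ℝ × ℝ × W → ℂ, IsAmplitude M 3 h ∧ ∀ ω x y s w,
      (B (x, y, s, w) : ℂ) * Complex.exp (Complex.I * ((ω * M (x, y, s, w) : ℝ) : ℂ))
        = ∫ x' in a..x, ∫ y' in b..y, ∫ s' in r..s, h ω (x', y', s', w) := by
  set h0 : ℝ → ℝ × ℝ × ℝ × W → ℂ :=
    fun ω p => (B p : ℂ) * Complex.exp (Complex.I * ((ω * M p : ℝ) : ℂ)) with hh0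
  have A0 : IsAmplitude M 0 h0 := isAmplitude_exp M hB
  set h1 : ℝ → ℝ × ℝ × ℝ × W → ℂ := fun ω p => fderiv ℝ (h0 ω) p (1, 0, 0, 0) with hh1
  have A1 : IsAmplitude M 1 h1 := A0.directional hM _
  set h2 : ℝ → ℝ × ℝ × ℝ × W → ℂ := fun ω p => fderiv ℝ (h1 ω) p (0, 1, 0, 0) with hh2
  have A2 : IsAmplitude M 2 h2 := A1.directional hM _
  set h3 : ℝ → ℝ × ℝ × ℝ × W → ℂ := fun ω p => fderiv ℝ (h2 ω) p (0, 0, 1, 0) with hh3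
  have A3 : IsAmplitude M 3 h3 := A2.directional hM _
  have D1 : ∀ ω x y s w, HasDerivAt (fun x => h0 ω (x, y, s, w)) (h1 ω (x, y, s, w)) x :=
    fun ω x y s w => HasFDerivAt.comp_hasDerivAt x (f := fun x => (x, y, s, w))
      (f' := (1, 0, 0, 0)) ((A0.contDiff hM ω).differentiable (by simp) (x, y, s, w)).hasFDerivAt
      ((hasDerivAt_id x).prodMk (hasDerivAt_const x (y, s, w)))
  have D2 : ∀ ω x y s w, HasDerivAt (fun y => h1 ω (x, y, s, w)) (h2 ω (x, y, s, w)) y :=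
    fun ω x y s w => HasFDerivAt.comp_hasDerivAt y (f := fun y => (x, y, s, w))
      (f' := (0, 1, 0, 0)) ((A1.contDiff hM ω).differentiable (by simp) (x, y, s, w)).hasFDerivAt
      ((hasDerivAt_const y x).prodMk ((hasDerivAt_id y).prodMk (hasDerivAt_const y (s, w))))
  have D3 : ∀ ω x y s w, HasDerivAt (fun s => h2 ω (x, y, s, w)) (h3 ω (x, y, s, w)) s :=
    fun ω x y s w => HasFDerivAt.comp_hasDerivAt s (f := fun s => (x, y, s, w))
      (f' := (0, 0, 1, 0)) ((A2.contDiff hM ω).differentiable (by simp) (x, y, s, w)).hasFDerivAt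
      ((hasDerivAt_const s x).prodMk ((hasDerivAt_const s y).prodMk
        ((hasDerivAt_id s).prodMk (hasDerivAt_const s w))))
  -- Vanishing on a coordinate hyperplane is inherited by derivatives tangent to it; this
  -- annihilates the lower endpoint in each of the three integrations.
  have Z1 : ∀ ω x s w, h1 ω (x, b, s, w) = 0 := fun ω x s w =>
    (D1 ω x b s w).unique ((hasDerivAt_const x (0 : ℂ)).congr_of_eventuallyEq
      (Eventually.of_forall fun x => by simp [hh0, hb]))
  have Z1' : ∀ ω x y w, h1 ω (x, y, r, w) = 0 := fun ω x y w =>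
    (D1 ω x y r w).unique ((hasDerivAt_const x (0 : ℂ)).congr_of_eventuallyEq
      (Eventually.of_forall fun x => by simp [hh0, hr]))
  have Z2 : ∀ ω x y w, h2 ω (x, y, r, w) = 0 := fun ω x y w =>
    (D2 ω x y r w).unique ((hasDerivAt_const y (0 : ℂ)).congr_of_eventuallyEq
      (Eventually.of_forall fun y => Z1' ω x y w))
  have C : ∀ {N : ℕ} {h : ℝ → ℝ × ℝ × ℝ × W → ℂ}, IsAmplitude M N h → ∀ ω, Continuous (h ω) :=
    fun hA ω => (hA.contDiff hM ω).continuous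
  refine ⟨h3, A3, fun ω x y s w => ?_⟩
  have I3 : ∀ x y, ∫ s' in r..s, h3 ω (x, y, s', w) = h2 ω (x, y, s, w) := by
    intro x y
    rw [intervalIntegral.integral_eq_sub_of_hasDerivAt (fun s _ => D3 ω x y s w)
      (((C A3 ω).comp (by fun_prop)).intervalIntegrable _ _), Z2, sub_zero]
  have I2 : ∀ x, ∫ y' in b..y, h2 ω (x, y', s, w) = h1 ω (x, y, s, w) := by
    intro x
    rw [intervalIntegral.integral_eq_sub_of_hasDerivAt (fun y _ => D2 ω x y s w)
      (((C A2 ω).comp (by fun_prop)).intervalIntegrable _ _), Z1, sub_zero]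
  simp_rw [I3, I2]
  rw [intervalIntegral.integral_eq_sub_of_hasDerivAt (fun x _ => D1 ω x y s w)
      (((C A1 ω).comp (by fun_prop)).intervalIntegrable _ _)]
  simp [hh0, ha]

/-! ### The slice estimate -/

theorem enorm_integral_sq_le {X : Type*} [MeasurableSpace X] (m : Measure X) {g : X → ℂ}
    (hg : AEMeasurable g m) :
    ‖∫ x, g x ∂m‖ₑ ^ 2 ≤ m Set.univ * ∫⁻ x, ‖g x‖ₑ ^ 2 ∂m := by
  have h1 : ‖∫ x, g x ∂m‖ₑ ≤ ∫⁻ x, ‖g x‖ₑ ∂m := enorm_integral_le_lintegral_enorm _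
  have h2 := ENNReal.lintegral_mul_le_Lp_mul_Lq m Real.HolderConjugate.two_two
    hg.enorm (aemeasurable_const (b := (1 : ENNReal)))
  simp only [Pi.mul_apply, mul_one, ENNReal.one_rpow, lintegral_one] at h2
  have h3 : ∀ y : ENNReal, (y ^ (1 / 2 : ℝ)) ^ 2 = y := by
    intro y
    rw [← ENNReal.rpow_natCast, ← ENNReal.rpow_mul]; norm_num
  calc ‖∫ x, g x ∂m‖ₑ ^ 2 ≤ (∫⁻ x, ‖g x‖ₑ ∂m) ^ 2 := by gcongr
    _ ≤ _ := pow_le_pow_left' h2 2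
    _ = _ := by
      rw [mul_pow, h3, h3, mul_comm]
      simp

/-- The weight `1/((u₀ - a)(u₁ - b))`. -/
def cornerWeight (a b : ℝ) (u : E2) : ℝ := ((u 0 - a) * (u 1 - b))⁻¹

/-- Fourier integrals of the truncations of the array to quadrants. -/
def quadrantFourier (A : Set E2) (a b : ℝ) (x : ℝ × ℝ × ℝ) (ξ : E2) : ℂ :=
  ∫ u in A, ({u : E2 | x.1 ≤ u 0 ∧ x.2.1 ≤ u 1}.indicator (fun _ => (1 : ℂ)) u *
    (cornerWeight a b u : ℂ)) * Complex.exp (Complex.I * ((-inner ℝ u ξ : ℝ) : ℂ))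

theorem measurable_cornerWeight (a b : ℝ) : Measurable (cornerWeight a b) := by
  unfold cornerWeight; fun_prop

theorem measurableSet_quadrant : MeasurableSet
    {p : (ℝ × ℝ × ℝ) × E2 | p.1.1 ≤ p.2 0 ∧ p.1.2.1 ≤ p.2 1} := by
  have h1 : MeasurableSet {p : (ℝ × ℝ × ℝ) × E2 | p.1.1 ≤ p.2 0} :=
    measurableSet_le (by fun_prop) (by fun_prop)
  have h2 : MeasurableSet {p : (ℝ × ℝ × ℝ) × E2 | p.1.2.1 ≤ p.2 1} :=
    measurableSet_le (by fun_prop) (by fun_prop)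
  exact h1.inter h2

theorem measurable_quadrant : Measurable fun p : (ℝ × ℝ × ℝ) × E2 =>
    {u : E2 | p.1.1 ≤ u 0 ∧ p.1.2.1 ≤ u 1}.indicator (fun _ => (1 : ℂ)) p.2 := by
  have h : Measurable ({p : (ℝ × ℝ × ℝ) × E2 | p.1.1 ≤ p.2 0 ∧ p.1.2.1 ≤ p.2 1}.indicator
      fun _ => (1 : ℂ)) := measurable_const.indicator measurableSet_quadrant
  exact h

theorem norm_quadrant_le (x : ℝ × ℝ × ℝ) (u : E2) :
    ‖{u : E2 | x.1 ≤ u 0 ∧ x.2.1 ≤ u 1}.indicator (fun _ => (1 : ℂ)) u‖ ≤ 1 := by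
  refine (norm_indicator_le_norm_self _ _).trans (by simp)

theorem measurable_quadrantFourier (A : Set E2) (a b : ℝ) :
    Measurable fun p : (ℝ × ℝ × ℝ) × E2 => quadrantFourier A a b p.1 p.2 := by
  unfold quadrantFourier
  refine (StronglyMeasurable.integral_prod_right (f := fun p : (ℝ × ℝ × ℝ) × E2 => fun u : E2 =>
    ({u : E2 | p.1.1 ≤ u 0 ∧ p.1.2.1 ≤ u 1}.indicator (fun _ => (1 : ℂ)) u *
    (cornerWeight a b u : ℂ)) * Complex.exp (Complex.I * ((-inner ℝ u p.2 : ℝ) : ℂ)))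
    (Measurable.stronglyMeasurable ?_)).measurable
  have h1 := measurable_quadrant.comp (g := fun p : (ℝ × ℝ × ℝ) × E2 => _)
    (f := fun q : ((ℝ × ℝ × ℝ) × E2) × E2 => (q.1.1, q.2)) (by fun_prop)
  have h2 := (measurable_cornerWeight a b).comp
    (measurable_snd : Measurable fun q : ((ℝ × ℝ × ℝ) × E2) × E2 => q.2)
  have h3 : Measurable fun q : ((ℝ × ℝ × ℝ) × E2) × E2 =>
      Complex.exp (Complex.I * ((-inner ℝ q.2 q.1.2 : ℝ) : ℂ)) :=
    Continuous.measurable (by fun_prop)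
  exact (h1.mul (Complex.measurable_ofReal.comp h2)).mul h3

/-- A bounded planar set, with the data of a box containing it away from the lower sides. -/
structure InBox (A : Set E2) (a a' b b' : ℝ) : Prop where
  meas : MeasurableSet A
  fin : volume A < ⊤
  mem : ∀ u ∈ A, a + 1 ≤ u 0 ∧ u 0 ≤ a' ∧ b + 1 ≤ u 1 ∧ u 1 ≤ b'

theorem InBox.weight_le {A : Set E2} {a a' b b' : ℝ} (hA : InBox A a a' b b') {u : E2}
    (hu : u ∈ A) : ‖(cornerWeight a b u : ℂ)‖ ≤ 1 := by
  obtain ⟨h1, -, h3, -⟩ := hA.mem u hu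
  rw [Complex.norm_real, cornerWeight, Real.norm_eq_abs, abs_inv]
  refine inv_le_one_of_one_le₀ ((?_ : (1 : ℝ) ≤ _).trans (le_abs_self _))
  nlinarith

theorem norm_quadrantFourier_le {A : Set E2} {a a' b b' : ℝ} (hA : InBox A a a' b b')
    (x : ℝ × ℝ × ℝ) (ξ : E2) : ‖quadrantFourier A a b x ξ‖ ≤ volume.real A := by
  unfold quadrantFourier
  rw [← one_mul (volume.real A)]
  refine norm_setIntegral_le_of_norm_le_const hA.fin fun u hu => ?_
  rw [norm_mul, norm_exp_I_mul, mul_one, norm_mul]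
  exact mul_le_one₀ (norm_quadrant_le x u) (norm_nonneg _) (hA.weight_le hu)

/-- The box of parameters. -/
def pbox (a a' b b' r r' : ℝ) : Set (ℝ × ℝ × ℝ) :=
  Set.Ioc a a' ×ˢ (Set.Ioc b b' ×ˢ Set.Ioc r r')

theorem measurableSet_pbox (a a' b b' r r' : ℝ) : MeasurableSet (pbox a a' b b' r r') :=
  measurableSet_Ioc.prod (measurableSet_Ioc.prod measurableSet_Ioc)

theorem volume_pbox_lt_top (a a' b b' r r' : ℝ) : volume (pbox a a' b b' r r') < ⊤ := by
  unfold pbox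
  rw [Measure.volume_eq_prod, Measure.volume_eq_prod, Measure.prod_prod, Measure.prod_prod]
  exact ENNReal.mul_lt_top measure_Ioc_lt_top
    (ENNReal.mul_lt_top measure_Ioc_lt_top measure_Ioc_lt_top)

/-- The variable endpoints are moved into an indicator on a fixed box. The corner then becomes a
parameter independent of the point, and can be integrated last. -/
theorem triple_integral_eq {a a' b b' r r' : ℝ} {g : ℝ × ℝ × ℝ → ℂ} (hg : Continuous g)
    {x y s : ℝ} (hx : x ∈ Set.Ioc a a') (hy : y ∈ Set.Ioc b b') (hs : s ∈ Set.Ioc r r') :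
    ∫ x' in a..x, ∫ y' in b..y, ∫ s' in r..s, g (x', y', s')
      = ∫ p in pbox a a' b b' r r', {p : ℝ × ℝ × ℝ | p.1 ≤ x ∧ p.2.1 ≤ y ∧ p.2.2 ≤ s}.indicator
        g p := by
  have hset : pbox a a' b b' r r' ∩ {p : ℝ × ℝ × ℝ | p.1 ≤ x ∧ p.2.1 ≤ y ∧ p.2.2 ≤ s}
      = Set.Ioc a x ×ˢ (Set.Ioc b y ×ˢ Set.Ioc r s) := by
    ext ⟨p, q, o⟩
    simp only [pbox, Set.mem_inter_iff, Set.mem_prod, Set.mem_Ioc, Set.mem_ofPred_eq]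
    constructor
    · rintro ⟨⟨⟨h1, -⟩, ⟨h2, -⟩, h3, -⟩, h4, h5, h6⟩
      exact ⟨⟨h1, h4⟩, ⟨h2, h5⟩, h3, h6⟩
    · rintro ⟨⟨h1, h4⟩, ⟨h2, h5⟩, h3, h6⟩
      exact ⟨⟨⟨h1, h4.trans hx.2⟩, ⟨h2, h5.trans hy.2⟩, h3, h6.trans hs.2⟩, h4, h5, h6⟩
  have hm : MeasurableSet {p : ℝ × ℝ × ℝ | p.1 ≤ x ∧ p.2.1 ≤ y ∧ p.2.2 ≤ s} := by
    have h1 : MeasurableSet {p : ℝ × ℝ × ℝ | p.1 ≤ x} :=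
      measurableSet_le (by fun_prop) (by fun_prop)
    have h2 : MeasurableSet {p : ℝ × ℝ × ℝ | p.2.1 ≤ y} :=
      measurableSet_le (by fun_prop) (by fun_prop)
    have h3 : MeasurableSet {p : ℝ × ℝ × ℝ | p.2.2 ≤ s} :=
      measurableSet_le (by fun_prop) (by fun_prop)
    exact h1.inter (h2.inter h3)
  rw [setIntegral_indicator hm, hset]
  have hint : IntegrableOn g (Set.Icc a x ×ˢ (Set.Icc b y ×ˢ Set.Icc r s)) :=
    hg.continuousOn.integrableOn_compact (isCompact_Icc.prod (isCompact_Icc.prod isCompact_Icc))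
  have hint' := hint.mono_set (Set.prod_mono Set.Ioc_subset_Icc_self
    (Set.prod_mono Set.Ioc_subset_Icc_self Set.Ioc_subset_Icc_self))
  rw [Measure.volume_eq_prod] at hint' ⊢
  rw [setIntegral_prod _ hint', intervalIntegral.integral_of_le hx.1.le]
  refine integral_congr_ae (Eventually.of_forall fun x' => ?_)
  beta_reduce
  have hint2 : IntegrableOn (fun q => g (x', q)) (Set.Ioc b y ×ˢ Set.Ioc r s)
      ((volume : Measure ℝ).prod volume) :=
    ((by fun_prop : Continuous fun q => g (x', q)).continuousOn.integrableOn_compact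
      (isCompact_Icc.prod isCompact_Icc)).mono_set
      (Set.prod_mono Set.Ioc_subset_Icc_self Set.Ioc_subset_Icc_self)
  rw [Measure.volume_eq_prod, setIntegral_prod _ hint2, intervalIntegral.integral_of_le hy.1.le]
  refine integral_congr_ae (Eventually.of_forall fun y' => ?_)
  beta_reduce
  rw [intervalIntegral.integral_of_le hs.1.le]

/-- Plancherel for `osc`, at frequency scale `κ`. -/
theorem lintegral_osc_sq {f : ℝ → ℂ} (hf : Integrable f) (hf2 : MemLp f 2) {κ : ℝ} (hκ : 0 < κ) :
    ∫⁻ s, ‖osc f (κ * s)‖ₑ ^ 2 = ENNReal.ofReal (2 * Real.pi / κ) * ∫⁻ ω, ‖f ω‖ₑ ^ 2 := by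
  have h := lintegral_enorm_sq_integral_exp hf hf2 hκ.ne'
  rw [Module.finrank_self, pow_one, abs_of_pos hκ] at h
  rw [← h]
  refine lintegral_congr fun s => ?_
  unfold osc
  congr 2
  refine integral_congr_ae (Eventually.of_forall fun ω => ?_)
  beta_reduce
  congr 3
  rw [show inner ℝ ω s = s * ω from rfl]
  push_cast; ring

/-- The factor of the frequency integrand attached to a corner `x` of the parameter box. -/
def sliceSpec (A : Set E2) (a b : ℝ) (f : ℝ → ℂ) (h : ℝ → ℝ × ℝ × ℝ → ℂ) (β c : ℝ) (ζ : E2)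
    (x : ℝ × ℝ × ℝ) (ω : ℝ) : ℂ :=
  f ω * Complex.exp (Complex.I * ((ω * c : ℝ) : ℂ)) * h ω x *
    quadrantFourier A a b x ((ω * β) • ζ)

theorem measurable_sliceSpec (A : Set E2) (a b : ℝ) {f : ℝ → ℂ} (hf : Continuous f)
    {h : ℝ → ℝ × ℝ × ℝ → ℂ} (hh : Continuous fun p : ℝ × ℝ × ℝ × ℝ => h p.1 p.2) (β c : ℝ) (ζ : E2) :
    Measurable fun p : (ℝ × ℝ × ℝ) × ℝ => sliceSpec A a b f h β c ζ p.1 p.2 := by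
  unfold sliceSpec
  have h1 := (measurable_quadrantFourier A a b).comp
    (f := fun p : (ℝ × ℝ × ℝ) × ℝ => (p.1, (p.2 * β) • ζ)) (by fun_prop)
  have h2 := (hh.comp (by fun_prop : Continuous fun p : (ℝ × ℝ × ℝ) × ℝ => (p.2, p.1))).measurable
  simp only [Function.comp_def] at h1 h2
  have h3 : Measurable fun p : (ℝ × ℝ × ℝ) × ℝ =>
      f p.2 * Complex.exp (Complex.I * ((p.2 * c : ℝ) : ℂ)) := Continuous.measurable (by fun_prop)
  exact (h3.mul h2).mul h1

/-- Fubini, with the corner x as the outermost variable. For a fixed corner the amplitude no longer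
depends on u and s except through indicators, so the integral over the array is the Fourier integral
of a truncated set and the integral over ω is a Fourier integral in κs. -/
theorem slice_identity {A : Set E2} {a a' b b' r r' : ℝ} (hA : InBox A a a' b b')
    {f : ℝ → ℂ} (hf : Continuous f) (hf1 : Integrable fun ω => ‖f ω‖ * (1 + |ω|) ^ 3)
    {h : ℝ → ℝ × ℝ × ℝ → ℂ} (hh : Continuous fun p : ℝ × ℝ × ℝ × ℝ => h p.1 p.2)
    {C : ℝ} (hC : ∀ ω, ∀ x ∈ pbox a a' b b' r r', ‖h ω x‖ ≤ C * (1 + |ω|) ^ 3)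
    (κ β c : ℝ) (ζ : E2) {s : ℝ} (hs : s ∈ Set.Ioc r r') :
    ∫ u in A, ∫ ω, f ω * Complex.exp (Complex.I * ((ω * (κ * s - β * inner ℝ u ζ + c) : ℝ) : ℂ)) *
        ((cornerWeight a b u : ℂ) *
          ∫ x' in a..u 0, ∫ y' in b..u 1, ∫ s' in r..s, h ω (x', y', s'))
      = ∫ x in pbox a a' b b' r r', {x : ℝ × ℝ × ℝ | x.2.2 ≤ s}.indicator
          (fun x => osc (sliceSpec A a b f h β c ζ x) (κ * s)) x := by
  have hms : MeasurableSet {x : ℝ × ℝ × ℝ | x.2.2 ≤ s} := measurableSet_le (by fun_prop) (by fun_prop)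
  set Φ : (E2 × ℝ) × (ℝ × ℝ × ℝ) → ℂ := fun q =>
    {x : ℝ × ℝ × ℝ | x.2.2 ≤ s}.indicator (fun _ => (1 : ℂ)) q.2 *
      {u : E2 | q.2.1 ≤ u 0 ∧ q.2.2.1 ≤ u 1}.indicator (fun _ => (1 : ℂ)) q.1.1 *
      (f q.1.2 * Complex.exp (Complex.I *
        ((q.1.2 * (κ * s - β * inner ℝ q.1.1 ζ + c) : ℝ) : ℂ)) *
      ((cornerWeight a b q.1.1 : ℂ) * h q.1.2 q.2)) with hΦ
  have hΦm : Measurable Φ := by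
    rw [hΦ]
    have m1 : Measurable fun q : (E2 × ℝ) × (ℝ × ℝ × ℝ) =>
        {x : ℝ × ℝ × ℝ | x.2.2 ≤ s}.indicator (fun _ => (1 : ℂ)) q.2 :=
      (measurable_const.indicator hms).comp measurable_snd
    have m2 := measurable_quadrant.comp (f := fun q : (E2 × ℝ) × (ℝ × ℝ × ℝ) => (q.2, q.1.1))
      (by fun_prop)
    have m3 : Measurable fun q : (E2 × ℝ) × (ℝ × ℝ × ℝ) => f q.1.2 * Complex.exp (Complex.I *
        ((q.1.2 * (κ * s - β * inner ℝ q.1.1 ζ + c) : ℝ) : ℂ)) :=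
      Continuous.measurable (by fun_prop)
    have m4 := (Complex.measurable_ofReal.comp (measurable_cornerWeight a b)).comp
      (f := fun q : (E2 × ℝ) × (ℝ × ℝ × ℝ) => q.1.1) (by fun_prop)
    have m5 := (hh.comp (by fun_prop :
      Continuous fun q : (E2 × ℝ) × (ℝ × ℝ × ℝ) => (q.1.2, q.2))).measurable
    exact (m1.mul m2).mul (m3.mul (m4.mul m5))
  have hone : ∀ x : ℝ × ℝ × ℝ,
      ‖{x : ℝ × ℝ × ℝ | x.2.2 ≤ s}.indicator (fun _ => (1 : ℂ)) x‖ ≤ 1 := fun x =>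
    (norm_indicator_le_norm_self _ _).trans (by simp)
  have hΦb : ∀ q : (E2 × ℝ) × (ℝ × ℝ × ℝ), q.1.1 ∈ A → q.2 ∈ pbox a a' b b' r r' →
      ‖Φ q‖ ≤ C * (‖f q.1.2‖ * (1 + |q.1.2|) ^ 3) := by
    intro q h1 h2
    simp only [hΦ, norm_mul, norm_exp_I_mul, mul_one]
    calc _ ≤ 1 * 1 * (‖f q.1.2‖ * (1 * (C * (1 + |q.1.2|) ^ 3))) := by
          gcongr
          · exact hone _
          · exact norm_quadrant_le _ _
          · exact hA.weight_le h1
          · exact hC _ _ h2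
      _ = _ := by ring
  have : IsFiniteMeasure (volume.restrict A) := ⟨by simpa using hA.fin⟩
  have : IsFiniteMeasure (volume.restrict (pbox a a' b b' r r')) :=
    ⟨by simpa using volume_pbox_lt_top a a' b b' r r'⟩
  have hint : Integrable Φ (((volume.restrict A).prod (volume : Measure ℝ)).prod
      (volume.restrict (pbox a a' b b' r r'))) := by
    have hdom : Integrable (fun q : (E2 × ℝ) × (ℝ × ℝ × ℝ) =>
        C * (‖f q.1.2‖ * (1 + |q.1.2|) ^ 3)) (((volume.restrict A).prod (volume : Measure ℝ)).prod
      (volume.restrict (pbox a a' b b' r r'))) :=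
      ((hf1.comp_snd (volume.restrict A)).comp_fst _).const_mul C
    refine hdom.mono' hΦm.aestronglyMeasurable ?_
    have h1 : ∀ᵐ q ∂((volume.restrict A).prod (volume : Measure ℝ)).prod
        (volume.restrict (pbox a a' b b' r r')), q.1.1 ∈ A ∧ q.2 ∈ pbox a a' b b' r r' := by
      have e : ((volume.restrict A).prod (volume : Measure ℝ)).prod
          (volume.restrict (pbox a a' b b' r r')) = (((volume : Measure E2).prod
          (volume : Measure ℝ)).prod (volume : Measure (ℝ × ℝ × ℝ))).restrict
            ((A ×ˢ Set.univ) ×ˢ pbox a a' b b' r r') := by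
        rw [← Measure.prod_restrict, ← Measure.prod_restrict, Measure.restrict_univ]
      rw [e]
      filter_upwards [ae_restrict_mem ((hA.meas.prod MeasurableSet.univ).prod
        (measurableSet_pbox a a' b b' r r'))] with q hq
      exact ⟨hq.1.1, hq.2⟩
    filter_upwards [h1] with q hq
    exact hΦb q hq.1 hq.2
  -- left-hand side
  have hL : ∫ u in A, ∫ ω, f ω *
        Complex.exp (Complex.I * ((ω * (κ * s - β * inner ℝ u ζ + c) : ℝ) : ℂ)) *
        ((cornerWeight a b u : ℂ) *
          ∫ x' in a..u 0, ∫ y' in b..u 1, ∫ s' in r..s, h ω (x', y', s'))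
      = ∫ u in A, ∫ ω, ∫ x in pbox a a' b b' r r', Φ ((u, ω), x) := by
    refine setIntegral_congr_fun hA.meas fun u hu => ?_
    refine integral_congr_ae (Eventually.of_forall fun ω => ?_)
    beta_reduce
    obtain ⟨h1, h2, h3, h4⟩ := hA.mem u hu
    have hhω : Continuous (h ω) := hh.comp (Continuous.prodMk_right ω)
    rw [triple_integral_eq (a' := a') (b' := b') hhω ⟨by linarith, h2⟩ ⟨by linarith, h4⟩ hs,
      ← mul_assoc, ← integral_const_mul]
    refine integral_congr_ae (Eventually.of_forall fun x => ?_)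
    simp only [hΦ]
    by_cases hx1 : x.1 ≤ u 0 <;> by_cases hx2 : x.2.1 ≤ u 1 <;> by_cases hx3 : x.2.2 ≤ s <;>
      simp [Set.indicator, hx1, hx2, hx3, mul_assoc]
  rw [hL]
  have i1 := hint.integral_prod_left
  have e1 : ∫ u in A, ∫ ω, ∫ x in pbox a a' b b' r r', Φ ((u, ω), x)
      = ∫ q : E2 × ℝ, (∫ x in pbox a a' b b' r r', Φ (q, x)) ∂((volume.restrict A).prod volume) :=
    (integral_prod _ i1).symm
  rw [e1, integral_integral_swap hint]
  refine integral_congr_ae ?_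
  filter_upwards [hint.prod_left_ae] with x hx
  rw [integral_prod_symm _ hx]
  by_cases hx3 : x.2.2 ≤ s
  · rw [Set.indicator_of_mem (show x ∈ {x : ℝ × ℝ × ℝ | x.2.2 ≤ s} from hx3)]
    unfold osc
    refine integral_congr_ae (Eventually.of_forall fun ω => ?_)
    simp only [sliceSpec, quadrantFourier]
    rw [mul_assoc, ← integral_mul_const, ← integral_const_mul]
    refine integral_congr_ae (Eventually.of_forall fun u => ?_)
    simp only [hΦ, Set.indicator_of_mem (show x ∈ {x : ℝ × ℝ × ℝ | x.2.2 ≤ s} from hx3)]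
    have : Complex.exp (Complex.I * ((ω * (κ * s - β * inner ℝ u ζ + c) : ℝ) : ℂ))
        = Complex.exp (Complex.I * ((ω * c : ℝ) : ℂ)) *
          Complex.exp (Complex.I * ((-inner ℝ u ((ω * β) • ζ) : ℝ) : ℂ)) *
          Complex.exp (Complex.I * ((ω * (κ * s) : ℝ) : ℂ)) := by
      rw [← Complex.exp_add, ← Complex.exp_add]
      congr 1
      rw [inner_smul_right]
      push_cast; ring
    rw [this]
    ring
  · rw [Set.indicator_of_notMem (show x ∉ {x : ℝ × ℝ × ℝ | x.2.2 ≤ s} from hx3)]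
    simp [hΦ, hx3]

/-- The density, in the transverse variable, of the energy carried by the slices. -/
def sliceTail (A : Set E2) (a a' b b' r r' : ℝ) (f : ℝ → ℂ) (β : ℝ) (ζ : E2) : ENNReal :=
  ∫⁻ x in pbox a a' b b' r r', ∫⁻ ω, ‖f ω * ((1 + |ω|) ^ 3 : ℝ)‖ₑ ^ 2 *
    ‖quadrantFourier A a b x ((ω * β) • ζ)‖ₑ ^ 2

/-- Cauchy–Schwarz over the box of corners, then Plancherel in s for each corner. The phase constant
c and the phase hidden in h disappear; only the cubic growth of h in ω survives, as a weight on the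
spectrum. -/
theorem slice_bound {A : Set E2} {a a' b b' r r' : ℝ} (hA : InBox A a a' b b')
    {f : ℝ → ℂ} (hf : Continuous f) (hf1 : Integrable fun ω => ‖f ω‖ * (1 + |ω|) ^ 3)
    (hf2 : MemLp (fun ω => f ω * ((1 + |ω|) ^ 3 : ℝ)) 2)
    {h : ℝ → ℝ × ℝ × ℝ → ℂ} (hh : Continuous fun p : ℝ × ℝ × ℝ × ℝ => h p.1 p.2)
    {C : ℝ} (hC : ∀ ω, ∀ x ∈ pbox a a' b b' r r', ‖h ω x‖ ≤ C * (1 + |ω|) ^ 3)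
    {κ : ℝ} (hκ : 0 < κ) (β c : ℝ) (ζ : E2) :
    ∫⁻ s in Set.Ioc r r', ‖∫ u in A, ∫ ω, f ω *
        Complex.exp (Complex.I * ((ω * (κ * s - β * inner ℝ u ζ + c) : ℝ) : ℂ)) *
        ((cornerWeight a b u : ℂ) *
          ∫ x' in a..u 0, ∫ y' in b..u 1, ∫ s' in r..s, h ω (x', y', s'))‖ₑ ^ 2
      ≤ volume (pbox a a' b b' r r') * ENNReal.ofReal (2 * Real.pi / κ) * ‖C‖ₑ ^ 2 *
        sliceTail A a a' b b' r r' f β ζ := by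
  have hms : ∀ s, MeasurableSet {x : ℝ × ℝ × ℝ | x.2.2 ≤ s} := fun s =>
    measurableSet_le (by fun_prop) (by fun_prop)
  have hm := measurable_sliceSpec A a b hf hh β c ζ
  have hosc : Measurable fun p : ℝ × (ℝ × ℝ × ℝ) => osc (sliceSpec A a b f h β c ζ p.2) (κ * p.1) := by
    unfold osc
    refine (StronglyMeasurable.integral_prod_right (f := fun p : ℝ × (ℝ × ℝ × ℝ) => fun ω : ℝ =>
      sliceSpec A a b f h β c ζ p.2 ω * Complex.exp (Complex.I * ((ω * (κ * p.1) : ℝ) : ℂ)))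
      (Measurable.stronglyMeasurable ?_)).measurable
    have m1 := hm.comp (f := fun q : (ℝ × (ℝ × ℝ × ℝ)) × ℝ => (q.1.2, q.2)) (by fun_prop)
    have m2 : Measurable fun q : (ℝ × (ℝ × ℝ × ℝ)) × ℝ =>
      Complex.exp (Complex.I * ((q.2 * (κ * q.1.1) : ℝ) : ℂ)) := Continuous.measurable (by fun_prop)
    exact m1.mul m2
  have hbd : ∀ x ∈ pbox a a' b b' r r', ∀ ω, ‖sliceSpec A a b f h β c ζ x ω‖ ≤
      ‖C‖ * ‖f ω * ((1 + |ω|) ^ 3 : ℝ)‖ * ‖quadrantFourier A a b x ((ω * β) • ζ)‖ := by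
    intro x hx ω
    unfold sliceSpec
    rw [norm_mul]
    gcongr
    rw [norm_mul, norm_mul, norm_exp_I_mul, mul_one, norm_mul, mul_left_comm]
    gcongr
    refine (hC ω x hx).trans ?_
    rw [Complex.norm_real, Real.norm_of_nonneg (by positivity : (0 : ℝ) ≤ (1 + |ω|) ^ 3)]
    gcongr
    exact le_abs_self _
  have hpl : ∀ x ∈ pbox a a' b b' r r', ∫⁻ s, ‖osc (sliceSpec A a b f h β c ζ x) (κ * s)‖ₑ ^ 2
      ≤ ENNReal.ofReal (2 * Real.pi / κ) * (‖C‖ₑ ^ 2 * ∫⁻ ω, ‖f ω * ((1 + |ω|) ^ 3 : ℝ)‖ₑ ^ 2 *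
        ‖quadrantFourier A a b x ((ω * β) • ζ)‖ₑ ^ 2) := by
    intro x hx
    have hmx : Measurable (sliceSpec A a b f h β c ζ x) := by
      have := hm.comp (f := fun ω : ℝ => (x, ω)) (by fun_prop)
      simpa only [Function.comp_def] using this
    have hb' : ∀ ω, ‖sliceSpec A a b f h β c ζ x ω‖ ≤
        ‖(‖C‖ * volume.real A : ℝ) * ‖f ω * ((1 + |ω|) ^ 3 : ℝ)‖‖ := by
      intro ω
      rw [Real.norm_of_nonneg (by positivity)]
      refine (hbd x hx ω).trans ?_
      rw [mul_right_comm]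
      gcongr
      exact norm_quadrantFourier_le hA _ _
    have hi : Integrable fun ω => ‖f ω * ((1 + |ω|) ^ 3 : ℝ)‖ := by
      refine hf1.congr (Eventually.of_forall fun ω => ?_)
      beta_reduce
      rw [norm_mul, Complex.norm_real, Real.norm_of_nonneg (by positivity)]
    have j1 : Integrable (sliceSpec A a b f h β c ζ x) :=
      (hi.const_mul (‖C‖ * volume.real A)).mono hmx.aestronglyMeasurable (Eventually.of_forall hb')
    have j2 : MemLp (sliceSpec A a b f h β c ζ x) 2 :=
      (hf2.norm.const_mul (‖C‖ * volume.real A)).mono hmx.aestronglyMeasurable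
        (Eventually.of_forall hb')
    rw [lintegral_osc_sq j1 j2 hκ]
    have hC2 : ‖C‖ₑ ^ 2 ≠ ⊤ := ENNReal.pow_ne_top enorm_ne_top
    refine mul_le_mul_right ((lintegral_mono fun ω => ?_).trans_eq
      (lintegral_const_mul' (‖C‖ₑ ^ 2) _ hC2)) _
    rw [← mul_assoc, ← mul_pow, ← mul_pow]
    refine pow_le_pow_left' ?_ 2
    have := hbd x hx ω
    rw [← ofReal_norm, ← ofReal_norm C, ← ofReal_norm (f ω * _),
      ← ofReal_norm (quadrantFourier A a b x ((ω * β) • ζ)),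
      ← ENNReal.ofReal_mul (norm_nonneg _), ← ENNReal.ofReal_mul (by positivity)]
    exact ENNReal.ofReal_le_ofReal this
  calc _ ≤ ∫⁻ s in Set.Ioc r r', volume (pbox a a' b b' r r') *
        ∫⁻ x in pbox a a' b b' r r', ‖osc (sliceSpec A a b f h β c ζ x) (κ * s)‖ₑ ^ 2 := by
        refine setLIntegral_mono' measurableSet_Ioc fun s hs => ?_
        rw [slice_identity hA hf hf1 hh hC κ β c ζ hs]
        have m1 : Measurable fun x => osc (sliceSpec A a b f h β c ζ x) (κ * s) :=
          hosc.comp (f := fun x => (s, x)) (by fun_prop)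
        refine (enorm_integral_sq_le _ (m1.indicator (hms s)).aemeasurable).trans ?_
        rw [Measure.restrict_apply_univ]
        gcongr with x
        exact enorm_indicator_le_enorm_self _ _
    _ = volume (pbox a a' b b' r r') * ∫⁻ x in pbox a a' b b' r r', ∫⁻ s in Set.Ioc r r',
          ‖osc (sliceSpec A a b f h β c ζ x) (κ * s)‖ₑ ^ 2 := by
        rw [lintegral_const_mul' _ _ (volume_pbox_lt_top _ _ _ _ _ _).ne, lintegral_lintegral_swap]
        exact (hosc.enorm.pow_const 2).aemeasurable
    _ ≤ volume (pbox a a' b b' r r') * ∫⁻ x in pbox a a' b b' r r',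
          ENNReal.ofReal (2 * Real.pi / κ) * (‖C‖ₑ ^ 2 * ∫⁻ ω, ‖f ω * ((1 + |ω|) ^ 3 : ℝ)‖ₑ ^ 2 *
        ‖quadrantFourier A a b x ((ω * β) • ζ)‖ₑ ^ 2) := by
        refine mul_le_mul_right ?_ _
        refine setLIntegral_mono' (measurableSet_pbox _ _ _ _ _ _) fun x hx => ?_
        exact (setLIntegral_le_lintegral _ _).trans (hpl x hx)
    _ = _ := by
        have hC2 : ‖C‖ₑ ^ 2 ≠ ⊤ := ENNReal.pow_ne_top enorm_ne_top
        rw [lintegral_const_mul' _ _ ENNReal.ofReal_ne_top,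
          lintegral_const_mul' (‖C‖ₑ ^ 2) _ hC2, sliceTail]
        ring

theorem measurable_sliceTail_integrand (A : Set E2) (a b : ℝ) {f : ℝ → ℂ} (hf : Continuous f)
    (β : ℝ) : Measurable fun p : (E2 × (ℝ × ℝ × ℝ)) × ℝ => ‖f p.2 * ((1 + |p.2|) ^ 3 : ℝ)‖ₑ ^ 2 *
      ‖quadrantFourier A a b p.1.2 ((p.2 * β) • p.1.1)‖ₑ ^ 2 := by
  have m1 := (measurable_quadrantFourier A a b).comp
    (f := fun p : (E2 × (ℝ × ℝ × ℝ)) × ℝ => (p.1.2, (p.2 * β) • p.1.1)) (by fun_prop)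
  have m2 : Measurable fun p : (E2 × (ℝ × ℝ × ℝ)) × ℝ => f p.2 * ((1 + |p.2|) ^ 3 : ℝ) :=
    Continuous.measurable (by fun_prop)
  exact (m2.enorm.pow_const 2).mul (m1.enorm.pow_const 2)

theorem measurable_sliceTail (A : Set E2) (a a' b b' r r' : ℝ) {f : ℝ → ℂ} (hf : Continuous f)
    (β : ℝ) : Measurable (sliceTail A a a' b b' r r' f β) :=
  ((measurable_sliceTail_integrand A a b hf β).lintegral_prod_right').lintegral_prod_right'

/-- Plancherel in ζ at frequency ωβ costs (ωβ)⁻², which is not integrable at ω = 0 by itself; the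
assumption that f vanishes there at least linearly compensates it. For the spectrum -iωF̂ this is
the factor ω. -/
theorem lintegral_sliceTail_lt_top {A : Set E2} {a a' b b' : ℝ} (r r' : ℝ) (hA : InBox A a a' b b')
    {f g : ℝ → ℂ} (hf : Continuous f) (hfg : ∀ ω, ‖f ω‖ ≤ |ω| * ‖g ω‖)
    (hg : MemLp (fun ω => g ω * ((1 + |ω|) ^ 3 : ℝ)) 2) {β : ℝ} (hβ : β ≠ 0) :
    ∫⁻ ζ, sliceTail A a a' b b' r r' f β ζ < ⊤ := by
  have hm := measurable_sliceTail_integrand A a b hf β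
  have hpl : ∀ x, ∀ ω : ℝ, ∫⁻ ζ, ‖f ω * ((1 + |ω|) ^ 3 : ℝ)‖ₑ ^ 2 *
      ‖quadrantFourier A a b x ((ω * β) • ζ)‖ₑ ^ 2
      ≤ ENNReal.ofReal ((2 * Real.pi / |β|) ^ 2) * volume A *
        ‖g ω * ((1 + |ω|) ^ 3 : ℝ)‖ₑ ^ 2 := by
    intro x ω
    rw [lintegral_const_mul' _ _ (ENNReal.pow_ne_top enorm_ne_top)]
    -- At zero frequency the dilation in ζ degenerates, but there f vanishes by `hfg`.
    by_cases hω : ω = 0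
    · have : f ω = 0 := by
        have := hfg ω
        rw [hω, abs_zero, zero_mul] at this
        rw [hω]; exact norm_le_zero_iff.1 this
      simp [this]
    set F : E2 → ℂ := A.indicator fun u =>
      {u : E2 | x.1 ≤ u 0 ∧ x.2.1 ≤ u 1}.indicator (fun _ => (1 : ℂ)) u * (cornerWeight a b u : ℂ)
      with hF
    have hFm : Measurable F := by
      have m1 := measurable_quadrant.comp (f := fun u : E2 => (x, u)) (by fun_prop)
      exact (m1.mul (Complex.measurable_ofReal.comp (measurable_cornerWeight a b))).indicator hA.meas
    have hFb : ∀ u, ‖F u‖ ≤ ‖A.indicator (fun _ => (1 : ℝ)) u‖ := by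
      intro u
      rw [hF]
      by_cases hu : u ∈ A
      · rw [Set.indicator_of_mem hu, Set.indicator_of_mem hu, norm_mul, norm_one]
        exact mul_le_one₀ (norm_quadrant_le x u) (norm_nonneg _) (hA.weight_le hu)
      · simp [hu]
    have hF1 : Integrable F := ((integrable_indicator_iff hA.meas).2
      (integrableOn_const (μ := volume) (C := (1 : ℝ)) (by exact hA.fin.ne))).mono hFm.aestronglyMeasurable (Eventually.of_forall hFb)
    have hF2 : MemLp F 2 := (memLp_indicator_const 2 hA.meas 1 (Or.inr hA.fin.ne)).mono
      hFm.aestronglyMeasurable (Eventually.of_forall hFb)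
    have h := lintegral_enorm_sq_integral_exp hF1 hF2 (b := -(ω * β)) (by
      simpa using ⟨hω, hβ⟩)
    have e : ∀ ζ : E2, quadrantFourier A a b x ((ω * β) • ζ)
        = ∫ u, F u * Complex.exp (Complex.I * ((-(ω * β) * inner ℝ u ζ : ℝ) : ℂ)) := by
      intro ζ
      rw [quadrantFourier, ← integral_indicator hA.meas]
      refine integral_congr_ae (Eventually.of_forall fun u => ?_)
      simp only [hF, Set.indicator]
      split_ifs <;> simp [inner_smul_right, mul_assoc]
    simp_rw [e]
    rw [h]
    have hF3 : ∫⁻ u, ‖F u‖ₑ ^ 2 ≤ volume A := by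
      calc _ ≤ ∫⁻ u, A.indicator (fun _ => (1 : ENNReal)) u := by
            refine lintegral_mono fun u => ?_
            have := enorm_le_iff_norm_le.2 (hFb u)
            refine (pow_le_pow_left' this 2).trans_eq ?_
            by_cases hu : u ∈ A <;> simp [hu]
        _ = _ := by rw [lintegral_indicator hA.meas]; simp
    have hfin : Module.finrank ℝ E2 = 2 := by simp
    rw [hfin, abs_neg, abs_mul]
    calc _ ≤ ‖f ω * ((1 + |ω|) ^ 3 : ℝ)‖ₑ ^ 2 *
          (ENNReal.ofReal ((2 * Real.pi / (|ω| * |β|)) ^ 2) * volume A) := by gcongr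
      _ ≤ (ENNReal.ofReal |ω| * ‖g ω * ((1 + |ω|) ^ 3 : ℝ)‖ₑ) ^ 2 *
          (ENNReal.ofReal ((2 * Real.pi / (|ω| * |β|)) ^ 2) * volume A) := by
          gcongr
          rw [enorm_mul, enorm_mul, ← mul_assoc, ← ofReal_norm (f ω),
            ← ofReal_norm (g ω), ← ENNReal.ofReal_mul (abs_nonneg _)]
          gcongr
          exact hfg ω
      _ = _ := by
          rw [mul_pow, ← ENNReal.ofReal_pow (abs_nonneg _)]
          have : ENNReal.ofReal ((2 * Real.pi / |β|) ^ 2) = ENNReal.ofReal (|ω| ^ 2) *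
              ENNReal.ofReal ((2 * Real.pi / (|ω| * |β|)) ^ 2) := by
            rw [← ENNReal.ofReal_mul (by positivity)]
            congr 1
            have := abs_pos.2 hω
            have := abs_pos.2 hβ
            field_simp
          rw [this]; ring
  have hswap : ∫⁻ ζ, sliceTail A a a' b b' r r' f β ζ
      = ∫⁻ x in pbox a a' b b' r r', ∫⁻ ω, ∫⁻ ζ, ‖f ω * ((1 + |ω|) ^ 3 : ℝ)‖ₑ ^ 2 *
      ‖quadrantFourier A a b x ((ω * β) • ζ)‖ₑ ^ 2 := by
    unfold sliceTail
    rw [lintegral_lintegral_swap hm.lintegral_prod_right'.aemeasurable]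
    refine lintegral_congr fun x => ?_
    rw [lintegral_lintegral_swap]
    exact (hm.comp (f := fun p : E2 × ℝ => ((p.1, x), p.2)) (by fun_prop)).aemeasurable
  rw [hswap]
  calc _ ≤ ∫⁻ x in pbox a a' b b' r r', ∫⁻ ω,
      ENNReal.ofReal ((2 * Real.pi / |β|) ^ 2) * volume A *
        ‖g ω * ((1 + |ω|) ^ 3 : ℝ)‖ₑ ^ 2 := by
        gcongr with x ω
        exact hpl x ω
    _ < ⊤ := by
        rw [setLIntegral_const, lintegral_const_mul' _ _ (ENNReal.mul_lt_top (by simp) hA.fin).ne]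
        refine ENNReal.mul_lt_top (ENNReal.mul_lt_top (ENNReal.mul_lt_top (by simp) hA.fin) ?_)
          (volume_pbox_lt_top _ _ _ _ _ _)
        have := lintegral_rpow_enorm_lt_top_of_eLpNorm_lt_top (by simp) (by simp) hg.2
        simpa using this

/-! ### Conical coordinates -/

/-- The substitution t = √(r² - a²), which trades the height of a point for its distance r to the
origin when its horizontal part has norm a. -/
theorem lintegral_Ioi_sqrt (G : ℝ → ENNReal) {a : ℝ} (ha : 0 ≤ a) :
    ∫⁻ t in Set.Ioi 0, G t = ∫⁻ r in Set.Ioi a,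
      ENNReal.ofReal (r / Real.sqrt (r ^ 2 - a ^ 2)) * G (Real.sqrt (r ^ 2 - a ^ 2)) := by
  have hpos : ∀ r ∈ Set.Ioi a, 0 < r ^ 2 - a ^ 2 := fun r hr => by
    have : a < r := hr
    nlinarith
  have himg : (fun r : ℝ => Real.sqrt (r ^ 2 - a ^ 2)) '' Set.Ioi a = Set.Ioi 0 := by
    ext t
    constructor
    · rintro ⟨r, hr, rfl⟩
      exact Real.sqrt_pos.2 (hpos r hr)
    · intro ht
      have ht : 0 < t := ht
      refine ⟨Real.sqrt (t ^ 2 + a ^ 2), ?_, ?_⟩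
      · exact Real.lt_sqrt_of_sq_lt (by nlinarith)
      · beta_reduce
        rw [Real.sq_sqrt (by positivity), add_sub_cancel_right, Real.sqrt_sq ht.le]
  have hinj : Set.InjOn (fun r : ℝ => Real.sqrt (r ^ 2 - a ^ 2)) (Set.Ioi a) := by
    intro x hx y hy h
    have hx' : a < x := hx
    have hy' : a < y := hy
    have := (Real.sqrt_inj (hpos x hx).le (hpos y hy).le).1 h
    exact (sq_eq_sq₀ (by linarith) (by linarith)).1 (by linarith)
  rw [← himg, lintegral_image_eq_lintegral_abs_deriv_mul
    (f' := fun r => r / Real.sqrt (r ^ 2 - a ^ 2)) measurableSet_Ioi ?_ hinj]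
  · refine setLIntegral_congr_fun measurableSet_Ioi fun r hr => ?_
    have hr' : a < r := hr
    rw [abs_of_nonneg (div_nonneg (by linarith) (Real.sqrt_nonneg _))]
  · intro r hr
    have h1 : HasDerivAt (fun r : ℝ => r ^ 2 - a ^ 2) (2 * r) r := by
      simpa using (hasDerivAt_pow 2 r).sub_const (a ^ 2)
    have h2 := h1.sqrt (hpos r hr).ne'
    refine (h2.congr_deriv ?_).hasDerivWithinAt
    have := Real.sqrt_pos.2 (hpos r hr)
    field_simp

theorem lintegral_comp_smul_E2 (H : E2 → ENNReal) {c : ℝ} (hc : 0 < c) :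
    ∫⁻ x, H x = ENNReal.ofReal (c ^ 2) * ∫⁻ ζ, H (c • ζ) := by
  have hemb : MeasurableEmbedding (fun x : E2 => c • x) :=
    (Homeomorph.smulOfNeZero c hc.ne').measurableEmbedding
  rw [← hemb.lintegral_map, Measure.map_addHaar_smul volume hc.ne', lintegral_smul_measure,
    smul_eq_mul, ← mul_assoc, ← ENNReal.ofReal_mul (by positivity)]
  have : Module.finrank ℝ E2 = 2 := by simp
  rw [this, abs_of_pos (by positivity), mul_inv_cancel₀ (by positivity)]
  simp

/-- Integration over a half space in the coordinates `z = r (δζ, √(1 - δ²|ζ|²))`. -/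
theorem lintegral_cone {F : E3 → ENNReal} (hF : Measurable F) {δ : ℝ} (hδ : 0 < δ) :
    ∫⁻ z in {z : E3 | 0 < z 2}, F z = ∫⁻ ζ in {ζ : E2 | δ * ‖ζ‖ < 1}, ∫⁻ r in Set.Ioi 0,
      ENNReal.ofReal (r ^ 2 * δ ^ 2 / Real.sqrt (1 - δ ^ 2 * ‖ζ‖ ^ 2)) *
        F (mk3 ((r * δ) • ζ) (r * Real.sqrt (1 - δ ^ 2 * ‖ζ‖ ^ 2))) := by
  have hset : MeasurableSet {z : E3 | 0 < z 2} :=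
    measurableSet_lt measurable_const (by fun_prop)
  have hset2 : MeasurableSet {p : E2 × ℝ | ‖p.1‖ < p.2} :=
    measurableSet_lt (by fun_prop) (by fun_prop)
  have hset3 : MeasurableSet {ζ : E2 | δ * ‖ζ‖ < 1} :=
    measurableSet_lt (by fun_prop) (by fun_prop)
  set J : E2 × ℝ → ENNReal := {p : E2 × ℝ | ‖p.1‖ < p.2}.indicator fun p =>
    ENNReal.ofReal (p.2 / Real.sqrt (p.2 ^ 2 - ‖p.1‖ ^ 2)) *
      F (mk3 p.1 (Real.sqrt (p.2 ^ 2 - ‖p.1‖ ^ 2))) with hJ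
  have hJm : Measurable J := by
    refine Measurable.indicator ?_ hset2
    have m1 : Measurable fun p : E2 × ℝ => Real.sqrt (p.2 ^ 2 - ‖p.1‖ ^ 2) := by fun_prop
    refine (measurable_snd.div m1).ennreal_ofReal.mul (hF.comp ?_)
    exact continuous_mk3.measurable.comp (measurable_fst.prodMk m1)
  calc ∫⁻ z in {z : E3 | 0 < z 2}, F z
      = ∫⁻ x : E2, ∫⁻ r, J (x, r) := by
        rw [← lintegral_indicator hset, lintegral_mk3 (hF.indicator hset)]
        refine lintegral_congr fun x => ?_
        have e1 : ∫⁻ t, {z : E3 | 0 < z 2}.indicator F (mk3 x t)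
            = ∫⁻ t in Set.Ioi 0, F (mk3 x t) := by
          rw [← lintegral_indicator measurableSet_Ioi]
          refine lintegral_congr fun t => ?_
          by_cases ht : 0 < t <;> simp [ht]
        rw [e1, lintegral_Ioi_sqrt _ (norm_nonneg x), ← lintegral_indicator measurableSet_Ioi]
        refine lintegral_congr fun r => ?_
        simp [hJ, Set.indicator]
    _ = ∫⁻ r, ∫⁻ x : E2, J (x, r) := by
        rw [lintegral_lintegral_swap]
        exact hJm.aemeasurable
    _ = ∫⁻ r in Set.Ioi (0 : ℝ), ∫⁻ x : E2, J (x, r) := by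
        refine (setLIntegral_eq_of_support_subset ?_).symm
        intro r hr
        by_contra h
        refine hr ?_
        beta_reduce
        rw [← lintegral_zero]
        refine lintegral_congr fun x => ?_
        have : ¬ ‖x‖ < r := fun h' => h ((norm_nonneg x).trans_lt h')
        simp [hJ, this]
    _ = ∫⁻ r in Set.Ioi (0 : ℝ), ∫⁻ ζ in {ζ : E2 | δ * ‖ζ‖ < 1},
          ENNReal.ofReal (r ^ 2 * δ ^ 2 / Real.sqrt (1 - δ ^ 2 * ‖ζ‖ ^ 2)) *
          F (mk3 ((r * δ) • ζ) (r * Real.sqrt (1 - δ ^ 2 * ‖ζ‖ ^ 2))) := by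
        refine setLIntegral_congr_fun measurableSet_Ioi fun r hr => ?_
        beta_reduce
        have hr : 0 < r := hr
        rw [lintegral_comp_smul_E2 _ (by positivity : 0 < r * δ),
          ← lintegral_const_mul' _ _ ENNReal.ofReal_ne_top, ← lintegral_indicator hset3]
        refine lintegral_congr fun ζ => ?_
        have hn : ‖(r * δ) • ζ‖ = r * (δ * ‖ζ‖) := by
          rw [norm_smul, Real.norm_of_nonneg (by positivity), mul_assoc]
        by_cases hζ : δ * ‖ζ‖ < 1
        · have h1 : ‖(r * δ) • ζ‖ < r := by rw [hn]; nlinarith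
          have hs : Real.sqrt (r ^ 2 - ‖(r * δ) • ζ‖ ^ 2) = r * Real.sqrt (1 - δ ^ 2 * ‖ζ‖ ^ 2) := by
            rw [hn, show r ^ 2 - (r * (δ * ‖ζ‖)) ^ 2 = r ^ 2 * (1 - δ ^ 2 * ‖ζ‖ ^ 2) by ring,
              Real.sqrt_mul (by positivity), Real.sqrt_sq hr.le]
          rw [Set.indicator_of_mem (show ζ ∈ {ζ : E2 | δ * ‖ζ‖ < 1} from hζ)]
          simp only [hJ]
          rw [Set.indicator_of_mem (show ((r * δ) • ζ, r) ∈ {p : E2 × ℝ | ‖p.1‖ < p.2} from h1)]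
          simp only [hs]
          rw [← mul_assoc, ← ENNReal.ofReal_mul (by positivity)]
          congr 2
          rw [mul_pow]
          by_cases h0 : Real.sqrt (1 - δ ^ 2 * ‖ζ‖ ^ 2) = 0
          · simp [h0]
          field_simp
        · have h1 : ¬ ‖(r * δ) • ζ‖ < r := by rw [hn]; nlinarith
          simp [hJ, h1, hζ]
    _ = _ := by
        rw [lintegral_lintegral_swap]
        refine Measurable.aemeasurable ?_
        have m1 : Measurable fun p : ℝ × E2 => Real.sqrt (1 - δ ^ 2 * ‖p.2‖ ^ 2) := by fun_prop
        refine (Measurable.div (by fun_prop) m1).ennreal_ofReal.mul (hF.comp ?_)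
        exact continuous_mk3.measurable.comp
          (Measurable.prodMk (by fun_prop) (measurable_fst.mul m1))

/-! ### A smooth positive function extending the square root -/

/-- A smooth positive function on `ℝ` which equals `√x` for `x ≥ d`. -/
def smoothSqrt (d x : ℝ) : ℝ :=
  Real.sqrt (d / 2 + Real.smoothTransition ((x - d / 2) / (d / 2)) * (x - d / 2))

theorem smoothSqrt_arg_pos {d : ℝ} (hd : 0 < d) (x : ℝ) :
    0 < d / 2 + Real.smoothTransition ((x - d / 2) / (d / 2)) * (x - d / 2) := by
  by_cases hx : x ≤ d / 2
  · rw [Real.smoothTransition.zero_of_nonpos (div_nonpos_of_nonpos_of_nonneg (by linarith)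
      (by linarith))]
    linarith
  · have := Real.smoothTransition.nonneg ((x - d / 2) / (d / 2))
    nlinarith

theorem smoothSqrt_pos {d : ℝ} (hd : 0 < d) (x : ℝ) : 0 < smoothSqrt d x :=
  Real.sqrt_pos.2 (smoothSqrt_arg_pos hd x)

theorem smoothSqrt_eq {d x : ℝ} (hd : 0 < d) (hx : d ≤ x) : smoothSqrt d x = Real.sqrt x := by
  unfold smoothSqrt
  rw [Real.smoothTransition.one_of_one_le ((one_le_div (by linarith)).2 (by linarith))]
  congr 1; ring

theorem contDiff_smoothSqrt {d : ℝ} (hd : 0 < d) : ContDiff ℝ (⊤ : ℕ∞) (smoothSqrt d) := by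
  unfold smoothSqrt
  refine ContDiff.sqrt ?_ fun x => (smoothSqrt_arg_pos hd x).ne'
  refine contDiff_const.add (ContDiff.mul (Real.smoothTransition.contDiff.comp ?_) (by fun_prop))
  fun_prop

/-! ### The reduced phase -/

/-- Position in space of the element `u` of the reference array, at array scale `δ = √ε`. -/
def sensor (S : Setup) (δ : ℝ) (u : E2) : E3 := embed ((δ * S.a₀) • u)

/-- The sum over the receivers of the spherical waves with travel-path excess `σ‖z - x₁‖`. -/
def slice (S : Setup) (B tg cs δ σ : ℝ) (u₁ : E2) (z : E3) : ℂ :=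
  ∫ u₂ in S.A₀, ((‖sensor S δ u₂ - z‖⁻¹ : ℝ) : ℂ) * osc (dspec S B)
    ((‖z - sensor S δ u₁‖ * σ + ‖sensor S δ u₂ - z‖ -
      S.c₀ / cs * (‖searchPoint cs tg - sensor S δ u₁‖ + ‖searchPoint cs tg - sensor S δ u₂‖)) /
        (S.c₀ * δ ^ 2))

/-- Excess of the distance from the search point to the array. -/
def distExcess (a₀ l δ : ℝ) (u : E2) : ℝ :=
  a₀ ^ 2 * ‖u‖ ^ 2 / (Real.sqrt (l ^ 2 + δ ^ 2 * a₀ ^ 2 * ‖u‖ ^ 2) + l)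

/-- A smooth extension of the distance between a point of the medium and a receiver. -/
def farDist (a₀ d r δ : ℝ) (n u₁ u₂ : E2) : ℝ :=
  smoothSqrt (d ^ 2) (r ^ 2 - 2 * r * δ * inner ℝ (a₀ • (u₂ - u₁)) n +
    δ ^ 2 * ‖a₀ • (u₂ - u₁)‖ ^ 2)

def reducedPhase (c₀ a₀ cs tg d r δ : ℝ) (n u₁ u₂ : E2) : ℝ :=
  (‖a₀ • (u₂ - u₁)‖ ^ 2 / (farDist a₀ d r δ n u₁ u₂ + smoothSqrt (d ^ 2) (r ^ 2)) +
    inner ℝ (a₀ • (u₂ - u₁)) n *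
      (-2 * r * inner ℝ (a₀ • (u₂ - u₁)) n + δ * ‖a₀ • (u₂ - u₁)‖ ^ 2) /
      (farDist a₀ d r δ n u₁ u₂ + smoothSqrt (d ^ 2) (r ^ 2)) ^ 2 -
    c₀ / cs * (distExcess a₀ (cs * tg) δ u₁ + distExcess a₀ (cs * tg) δ u₂)) / c₀

theorem norm_searchPoint_sub_sensor (S : Setup) {cs tg : ℝ} (h : 0 < cs * tg) (δ : ℝ) (u : E2) :
    ‖searchPoint cs tg - sensor S δ u‖ = cs * tg + δ ^ 2 * distExcess S.a₀ (cs * tg) δ u := by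
  have h1 : ‖searchPoint cs tg - sensor S δ u‖ ^ 2
      = (cs * tg) ^ 2 + δ ^ 2 * S.a₀ ^ 2 * ‖u‖ ^ 2 := by
    rw [norm_sq_E3, norm_sq_E2]
    simp [searchPoint, sensor, embed]
    ring
  have h2 : ‖searchPoint cs tg - sensor S δ u‖
      = Real.sqrt ((cs * tg) ^ 2 + δ ^ 2 * S.a₀ ^ 2 * ‖u‖ ^ 2) := by
    rw [← h1, Real.sqrt_sq (norm_nonneg _)]
  have h3 := Real.sq_sqrt (by positivity : 0 ≤ (cs * tg) ^ 2 + δ ^ 2 * S.a₀ ^ 2 * ‖u‖ ^ 2)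
  have h4 := Real.sqrt_nonneg ((cs * tg) ^ 2 + δ ^ 2 * S.a₀ ^ 2 * ‖u‖ ^ 2)
  rw [h2, distExcess]
  generalize Real.sqrt ((cs * tg) ^ 2 + δ ^ 2 * S.a₀ ^ 2 * ‖u‖ ^ 2) = q at h3 h4 ⊢
  have : 0 < q + cs * tg := by linarith
  field_simp
  linarith

/-- The point at distance `r` from the sensor `u₁` in the direction of horizontal part `δζ`. -/
def conePoint (S : Setup) (δ : ℝ) (u₁ : E2) (r : ℝ) (ζ : E2) : E3 :=
  sensor S δ u₁ + mk3 ((r * δ) • ζ) (r * Real.sqrt (1 - δ ^ 2 * ‖ζ‖ ^ 2))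

theorem norm_conePoint_sub (S : Setup) {δ : ℝ} (hδ : 0 < δ) (u₁ : E2) {r : ℝ} (hr : 0 ≤ r) {ζ : E2}
    (hζ : δ * ‖ζ‖ < 1) : ‖conePoint S δ u₁ r ζ - sensor S δ u₁‖ = r := by
  have h1 : 0 ≤ 1 - δ ^ 2 * ‖ζ‖ ^ 2 := by nlinarith [mul_nonneg hδ.le (norm_nonneg ζ)]
  rw [← sq_eq_sq₀ (norm_nonneg _) hr, conePoint, add_sub_cancel_left, norm_sq_mk3, norm_smul, mul_pow,
    mul_pow, Real.sq_sqrt h1, Real.norm_eq_abs, sq_abs]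
  ring

theorem norm_sq_sensor_sub_conePoint (S : Setup) {δ : ℝ} (hδ : 0 < δ) (u₁ u₂ : E2) (r : ℝ) {ζ : E2}
    (hζ : δ * ‖ζ‖ < 1) : ‖sensor S δ u₂ - conePoint S δ u₁ r ζ‖ ^ 2 =
      r ^ 2 - 2 * r * δ * inner ℝ (S.a₀ • (u₂ - u₁)) (δ • ζ) + δ ^ 2 * ‖S.a₀ • (u₂ - u₁)‖ ^ 2 := by
  have h1 : 0 ≤ 1 - δ ^ 2 * ‖ζ‖ ^ 2 := by nlinarith [mul_nonneg hδ.le (norm_nonneg ζ)]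
  have h2 : sensor S δ u₂ - conePoint S δ u₁ r ζ
      = mk3 (δ • (S.a₀ • (u₂ - u₁)) - r • (δ • ζ)) (-(r * Real.sqrt (1 - δ ^ 2 * ‖ζ‖ ^ 2))) := by
    ext i
    fin_cases i <;> simp [conePoint, sensor, embed, mk3] <;> ring
  rw [h2, norm_sq_mk3, norm_sub_sq_real, norm_smul, norm_smul, norm_smul r,
    norm_smul δ ζ, neg_sq, mul_pow, mul_pow,
    mul_pow, mul_pow r (Real.sqrt _), Real.sq_sqrt h1, inner_smul_left, inner_smul_right]
  simp only [Real.norm_eq_abs, sq_abs, mul_pow]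
  simp
  ring

theorem phase_identity (S : Setup) (hc : S.c₀ ≠ 0) {cs tg d δ r : ℝ} (hcs : 0 < cs) (htg : 0 < tg)
    (hd : 0 < d) (hδ : 0 < δ) (hr : d ≤ r) (u₁ u₂ : E2) {ζ : E2} (hζ : δ * ‖ζ‖ < 1)
    (hX : d ≤ ‖sensor S δ u₂ - conePoint S δ u₁ r ζ‖) (σ : ℝ) :
    farDist S.a₀ d r δ (δ • ζ) u₁ u₂ = ‖sensor S δ u₂ - conePoint S δ u₁ r ζ‖ ∧
    (‖conePoint S δ u₁ r ζ - sensor S δ u₁‖ * σ + ‖sensor S δ u₂ - conePoint S δ u₁ r ζ‖ -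
      S.c₀ / cs * (‖searchPoint cs tg - sensor S δ u₁‖ + ‖searchPoint cs tg - sensor S δ u₂‖)) /
        (S.c₀ * δ ^ 2) = (1 + σ) / (S.c₀ * δ ^ 2) * r - S.a₀ / S.c₀ * inner ℝ u₂ ζ +
          (S.a₀ / S.c₀ * inner ℝ u₁ ζ - 2 * (S.c₀ * tg) / (S.c₀ * δ ^ 2)) +
          reducedPhase S.c₀ S.a₀ cs tg d r δ (δ • ζ) u₁ u₂ := by
  have hsq := norm_sq_sensor_sub_conePoint S hδ u₁ u₂ r hζ
  have hfar : farDist S.a₀ d r δ (δ • ζ) u₁ u₂ = ‖sensor S δ u₂ - conePoint S δ u₁ r ζ‖ := by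
    rw [farDist, ← hsq, smoothSqrt_eq (by positivity) (by gcongr), Real.sqrt_sq (norm_nonneg _)]
  refine ⟨hfar, ?_⟩
  have hR : smoothSqrt (d ^ 2) (r ^ 2) = r := by
    rw [smoothSqrt_eq (by positivity) (by gcongr), Real.sqrt_sq (by linarith)]
  rw [norm_searchPoint_sub_sensor S (by positivity), norm_searchPoint_sub_sensor S (by positivity),
    norm_conePoint_sub S hδ u₁ (by linarith) hζ, reducedPhase, hfar, hR]
  have hv : inner ℝ (S.a₀ • (u₂ - u₁)) (δ • ζ) = δ * (S.a₀ * inner ℝ u₂ ζ - S.a₀ * inner ℝ u₁ ζ) := by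
    rw [inner_smul_left, inner_smul_right, inner_sub_left]; simp; ring
  rw [hv] at hsq ⊢
  set X := ‖sensor S δ u₂ - conePoint S δ u₁ r ζ‖
  set V := ‖S.a₀ • (u₂ - u₁)‖ ^ 2
  set p := inner ℝ u₂ ζ
  set q := inner ℝ u₁ ζ
  set e₁ := distExcess S.a₀ (cs * tg) δ u₁
  set e₂ := distExcess S.a₀ (cs * tg) δ u₂
  have hXr : X + r ≠ 0 := by linarith
  -- With X the distance from the second sensor, X - r = (X² - r²)/(X + r) exhibits a factor δ²;
  -- writing 2r/(X + r) = 1 - (X - r)/(X + r) and using the formula again isolates the term linear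
  -- in ζ.
  have key : X - r = δ ^ 2 * (V / (X + r) - (S.a₀ * p - S.a₀ * q) +
      δ * (S.a₀ * p - S.a₀ * q) * (-2 * r * (δ * (S.a₀ * p - S.a₀ * q)) + δ * V) / (X + r) ^ 2) := by
    have h0 : X - r = (-2 * r * δ * (δ * (S.a₀ * p - S.a₀ * q)) + δ ^ 2 * V) / (X + r) := by
      field_simp
      linarith
    have h1 : 2 * r / (X + r) = 1 - (X - r) / (X + r) := by field_simp; ring
    have h2 : X - r = δ ^ 2 * (V / (X + r) - (S.a₀ * p - S.a₀ * q) * (2 * r / (X + r))) := by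
      rw [h0]; field_simp; ring
    rw [h1, h0] at h2
    rw [h0, h2]
    field_simp
    ring
  have hX' : X = r + (X - r) := by ring
  generalize hM : V / (X + r) = m1 at key ⊢
  generalize hM2 : δ * (S.a₀ * p - S.a₀ * q) * (-2 * r * (δ * (S.a₀ * p - S.a₀ * q)) + δ * V) / (X + r) ^ 2 = m2 at key ⊢
  rw [hX', key]
  field_simp
  ring

/-! ### Smoothness of the reduced phase -/

theorem ContDiff.vec2 {V : Type*} [NormedAddCommGroup V] [NormedSpace ℝ V] {f g : V → ℝ} {n : WithTop ℕ∞}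
    (hf : ContDiff ℝ n f) (hg : ContDiff ℝ n g) : ContDiff ℝ n fun p => (!₂[f p, g p] : E2) := by
  rw [contDiff_euclidean]
  intro i
  fin_cases i
  · exact hf
  · exact hg

section Smooth

variable {V : Type*} [NormedAddCommGroup V] [NormedSpace ℝ V] {r δ : V → ℝ} {n u₁ u₂ : V → E2}

theorem contDiff_distExcess {a₀ l : ℝ} (hl : 0 < l) (hδ : ContDiff ℝ (⊤ : ℕ∞) δ)
    (hu : ContDiff ℝ (⊤ : ℕ∞) u₁) : ContDiff ℝ (⊤ : ℕ∞) fun p => distExcess a₀ l (δ p) (u₁ p) := by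
  unfold distExcess
  have h1 : ContDiff ℝ (⊤ : ℕ∞) fun p => ‖u₁ p‖ ^ 2 := hu.norm_sq ℝ
  have h2 : ContDiff ℝ (⊤ : ℕ∞) fun p => Real.sqrt (l ^ 2 + δ p ^ 2 * a₀ ^ 2 * ‖u₁ p‖ ^ 2) := by
    refine ContDiff.sqrt ?_ fun p => by positivity
    exact contDiff_const.add (((hδ.pow 2).mul contDiff_const).mul h1)
  refine (contDiff_const.mul h1).div (h2.add contDiff_const) fun p => ?_
  have := Real.sqrt_nonneg (l ^ 2 + δ p ^ 2 * a₀ ^ 2 * ‖u₁ p‖ ^ 2)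
  linarith

theorem contDiff_farDist {a₀ d : ℝ} (hd : 0 < d) (hr : ContDiff ℝ (⊤ : ℕ∞) r)
    (hδ : ContDiff ℝ (⊤ : ℕ∞) δ) (hn : ContDiff ℝ (⊤ : ℕ∞) n) (h1 : ContDiff ℝ (⊤ : ℕ∞) u₁)
    (h2 : ContDiff ℝ (⊤ : ℕ∞) u₂) :
    ContDiff ℝ (⊤ : ℕ∞) fun p => farDist a₀ d (r p) (δ p) (n p) (u₁ p) (u₂ p) := by
  unfold farDist
  refine (contDiff_smoothSqrt (by positivity)).comp ?_
  have h3 : ContDiff ℝ (⊤ : ℕ∞) fun p => a₀ • (u₂ p - u₁ p) := (h2.sub h1).const_smul a₀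
  exact ((hr.pow 2).sub (((contDiff_const.mul hr).mul hδ).mul (h3.inner ℝ hn))).add
    ((hδ.pow 2).mul (h3.norm_sq ℝ))

theorem contDiff_reducedPhase {c₀ a₀ cs tg d : ℝ} (hd : 0 < d) (hl : 0 < cs * tg)
    (hr : ContDiff ℝ (⊤ : ℕ∞) r)
    (hδ : ContDiff ℝ (⊤ : ℕ∞) δ) (hn : ContDiff ℝ (⊤ : ℕ∞) n) (h1 : ContDiff ℝ (⊤ : ℕ∞) u₁)
    (h2 : ContDiff ℝ (⊤ : ℕ∞) u₂) : ContDiff ℝ (⊤ : ℕ∞) fun p =>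
      reducedPhase c₀ a₀ cs tg d (r p) (δ p) (n p) (u₁ p) (u₂ p) := by
  unfold reducedPhase
  have h3 : ContDiff ℝ (⊤ : ℕ∞) fun p => a₀ • (u₂ p - u₁ p) := (h2.sub h1).const_smul a₀
  have h4 := h3.inner ℝ hn
  have h5 : ContDiff ℝ (⊤ : ℕ∞) fun p => ‖a₀ • (u₂ p - u₁ p)‖ ^ 2 := h3.norm_sq ℝ
  have hX : ContDiff ℝ (⊤ : ℕ∞) fun p => farDist a₀ d (r p) (δ p) (n p) (u₁ p) (u₂ p) +
      smoothSqrt (d ^ 2) (r p ^ 2) := (contDiff_farDist hd hr hδ hn h1 h2).add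
    ((contDiff_smoothSqrt (by positivity)).comp (hr.pow 2))
  have hX0 : ∀ p, farDist a₀ d (r p) (δ p) (n p) (u₁ p) (u₂ p) + smoothSqrt (d ^ 2) (r p ^ 2) ≠ 0 := by
    intro p
    have h6 := smoothSqrt_pos (d := d ^ 2) (by positivity) (r p ^ 2)
    have h7 := smoothSqrt_pos (d := d ^ 2) (by positivity) (r p ^ 2 - 2 * r p * δ p *
      inner ℝ (a₀ • (u₂ p - u₁ p)) (n p) + δ p ^ 2 * ‖a₀ • (u₂ p - u₁ p)‖ ^ 2)
    exact (add_pos h7 h6).ne'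
  refine ContDiff.div_const (((h5.div hX hX0).add (ContDiff.div (h4.mul
    (((contDiff_const.mul hr).mul h4).add (hδ.mul h5))) (hX.pow 2) fun p => pow_ne_zero 2 (hX0 p))).sub
    (contDiff_const.mul ((contDiff_distExcess hl hδ h1).add (contDiff_distExcess hl hδ h2)))) _

end Smooth

/-! ### The energy of the slices away from the axis -/

/-- Bounds on the geometry of the medium and of the array. -/
structure Bounds (S : Setup) (d ρ a a' b b' U : ℝ) : Prop where
  d_pos : 0 < d
  U_nonneg : 0 ≤ U
  height : ∀ z ∈ S.D, d ≤ z 2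
  norm_le : ∀ z ∈ S.D, ‖z‖ ≤ ρ
  box : InBox S.A₀ a a' b b'
  array : ∀ u ∈ S.A₀, ‖u‖ ≤ U

theorem exists_bounds {S : Setup} (hS : S.Admissible) : ∃ d ρ a a' b b' U, Bounds S d ρ a a' b b' U := by
  obtain ⟨ρ, hρ⟩ := hS.D_bdd.exists_norm_le
  obtain ⟨U, hU⟩ := hS.A₀_bdd.exists_norm_le
  have hcomp : IsCompact (closure S.D) := hS.D_bdd.isCompact_closure
  obtain ⟨d, hd, hdz⟩ : ∃ d, 0 < d ∧ ∀ z ∈ closure S.D, d ≤ z 2 := by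
    by_cases hne : (closure S.D).Nonempty
    · obtain ⟨z, hz, hmin⟩ := hcomp.exists_isMinOn hne
        (f := fun z : E3 => z 2) (by fun_prop)
      exact ⟨z 2, hS.D_ahead hz, fun w hw => hmin hw⟩
    · exact ⟨1, one_pos, fun z hz => (hne ⟨z, hz⟩).elim⟩
  have hco : ∀ u ∈ S.A₀, ∀ i, |u i| ≤ |U| := fun u hu i => by
    have := PiLp.norm_apply_le u i
    rw [Real.norm_eq_abs] at this
    exact this.trans ((hU u hu).trans (le_abs_self _))
  refine ⟨d, ρ, -|U| - 1, |U|, -|U| - 1, |U|, |U|, hd, abs_nonneg _,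
    fun z hz => hdz z (subset_closure hz), hρ, ⟨hS.A₀_meas, hS.A₀_bdd.measure_lt_top, ?_⟩,
    fun u hu => (hU u hu).trans (le_abs_self _)⟩
  intro u hu
  have h0 := abs_le.1 (hco u hu 0)
  have h1 := abs_le.1 (hco u hu 1)
  exact ⟨by linarith, h0.2, by linarith, h1.2⟩

theorem measurable_slice (S : Setup) {B : ℝ} (hB : 0 < B) (tg cs δ : ℝ) :
    Measurable fun p : ℝ × E2 × E3 => slice S B tg cs δ p.1 p.2.1 p.2.2 := by
  unfold slice
  refine (StronglyMeasurable.integral_prod_right (f := fun p : ℝ × E2 × E3 => fun u₂ : E2 =>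
    ((‖sensor S δ u₂ - p.2.2‖⁻¹ : ℝ) : ℂ) * osc (dspec S B)
    ((‖p.2.2 - sensor S δ p.2.1‖ * p.1 + ‖sensor S δ u₂ - p.2.2‖ -
      S.c₀ / cs * (‖searchPoint cs tg - sensor S δ p.2.1‖ + ‖searchPoint cs tg - sensor S δ u₂‖)) /
        (S.c₀ * δ ^ 2))) (Measurable.stronglyMeasurable ?_)).measurable
  have hs : Continuous (sensor S δ) := by unfold sensor embed; fun_prop
  have h1 : Measurable fun q : (ℝ × E2 × E3) × E2 => ‖sensor S δ q.2 - q.1.2.2‖ :=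
    Continuous.measurable (by fun_prop)
  refine (Complex.measurable_ofReal.comp h1.inv).mul ?_
  exact (continuous_osc_dspec S hB).measurable.comp (Continuous.measurable (by fun_prop))

theorem norm_sensor (S : Setup) (ha : 0 < S.a₀) {δ : ℝ} (hδ : 0 ≤ δ) (u : E2) :
    ‖sensor S δ u‖ = δ * S.a₀ * ‖u‖ := by
  rw [← sq_eq_sq₀ (norm_nonneg _) (by positivity), norm_sq_E3, mul_pow, norm_sq_E2]
  simp [sensor, embed]; ring

theorem sensor_two (S : Setup) (δ : ℝ) (u : E2) : sensor S δ u 2 = 0 := rfl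

theorem exists_schwartz_pow_mul (q : SchwartzMap ℝ ℂ) (k : ℕ) :
    ∃ g : SchwartzMap ℝ ℂ, ∀ ω, g ω = (ω : ℂ) ^ k * q ω := by
  induction k with
  | zero => exact ⟨q, by simp⟩
  | succ k ih =>
    obtain ⟨g, hg⟩ := ih
    obtain ⟨g', hg'⟩ := exists_schwartz_mul g
    exact ⟨g', fun ω => by rw [hg', hg]; ring⟩

/-- In conical coordinates about the first sensor the phase is linear up to `reducedPhase`, which
together with 1/`farDist` forms an amplitude with bounds uniform in δ. After
`exists_box_representation`, `slice_bound` applies on each ray. One factor δ² comes from the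
Jacobian, the other from Plancherel in the radius at frequency scale κ, bounded below by c/(c₀δ²).
The majorant T is free of δ, u₁ and σ, so the energy is tight in the transverse direction. -/
theorem slice_energy {S : Setup} (hS : S.Admissible) {B tg cs c : ℝ} (hB : 0 < B) (htg : 0 < tg)
    (hcs : 0 < cs) (hc : 0 < c) : ∃ (T : E2 → ENNReal) (C : ENNReal) (m : ℝ), 0 < m ∧ Measurable T ∧
      ∫⁻ ζ, T ζ < ⊤ ∧ C ≠ ⊤ ∧ ∀ δ, 0 < δ → δ ≤ 1 → ∀ u₁ ∈ S.A₀, ∀ σ, c ≤ 1 + σ → ∀ R,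
      ∫⁻ z in S.D ∩ {z | R * δ < ‖hor (z - sensor S δ u₁)‖}, ‖slice S B tg cs δ σ u₁ z‖ₑ ^ 2
        ≤ C * ENNReal.ofReal (δ ^ 4) * ∫⁻ ζ in {ζ | R < m * ‖ζ‖}, T ζ := by
  obtain ⟨d, ρ, a, a', b, b', U, hb⟩ := exists_bounds hS
  have hd := hb.d_pos
  have hc0 := hS.c₀_pos
  have ha0 := hS.a₀_pos
  -- An upper bound for the distance from any sensor to the medium, valid for δ ≤ 1.
  obtain ⟨m, hm1, hm0⟩ : ∃ m, ρ + S.a₀ * U ≤ m ∧ 0 < m := ⟨|ρ + S.a₀ * U| + 1,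
    by linarith [le_abs_self (ρ + S.a₀ * U)], by positivity⟩
  obtain ⟨f, hf⟩ := exists_schwartz_dspec S hB
  obtain ⟨g, hg⟩ := exists_schwartz_Fhat S hB
  have hfc : Continuous (dspec S B) := hf ▸ f.continuous
  have hpow : ∀ q : SchwartzMap ℝ ℂ, MemLp (fun ω => q ω * ((1 + |ω|) ^ 3 : ℝ)) 2 := by
    intro q
    have h1 : ∀ k : ℕ, MemLp (fun ω : ℝ => |ω| ^ k * ‖q ω‖) 2 := by
      intro k
      obtain ⟨p, hp⟩ := exists_schwartz_pow_mul q k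
      have e : (fun ω : ℝ => |ω| ^ k * ‖q ω‖) = fun ω => ‖p ω‖ := by
        ext ω; rw [hp]; simp
      rw [e]; exact (p.memLp 2).norm
    have h2 : MemLp (fun ω : ℝ => (1 + |ω|) ^ 3 * ‖q ω‖) 2 := by
      have := (((h1 0).add ((h1 1).const_mul 3)).add ((h1 2).const_mul 3)).add (h1 3)
      refine this.congr_norm ?_ ?_
      · exact Continuous.aestronglyMeasurable (by fun_prop)
      · refine Eventually.of_forall fun ω => ?_
        simp only [Pi.add_apply]
        congr 1
        ring
    refine h2.congr_norm (Continuous.aestronglyMeasurable (by fun_prop)) ?_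
    refine Eventually.of_forall fun ω => ?_
    rw [norm_mul, norm_mul, Complex.norm_real, norm_norm, mul_comm]
  have hf1 : Integrable fun ω => ‖dspec S B ω‖ * (1 + |ω|) ^ 3 := by
    rw [← hf]
    have h1 := fun k => f.integrable_pow_mul (volume : Measure ℝ) k
    have := (((h1 0).add ((h1 1).const_mul 3)).add ((h1 2).const_mul 3)).add (h1 3)
    refine this.congr (Eventually.of_forall fun ω => ?_)
    simp only [Pi.add_apply, Real.norm_eq_abs]
    ring
  have hf2 : MemLp (fun ω => dspec S B ω * ((1 + |ω|) ^ 3 : ℝ)) 2 := hf ▸ hpow f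
  have hfg : ∀ ω, ‖dspec S B ω‖ ≤ |ω| * ‖g ω‖ := by
    intro ω
    rw [hg, dspec, norm_mul, norm_neg, Complex.norm_I, one_mul, Complex.norm_real, Complex.norm_real,
      norm_mul, Real.norm_eq_abs ω]
  -- the representation of the amplitude
  set M : ℝ × ℝ × ℝ × (ℝ × E2 × E2) → ℝ := fun p => reducedPhase S.c₀ S.a₀ cs tg d p.2.2.1 p.2.2.2.1
    p.2.2.2.2.1 p.2.2.2.2.2 !₂[p.1, p.2.1] with hM
  -- The linear factors make the amplitude vanish on the three lower faces of the box, so the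
  -- fundamental theorem of calculus leaves no boundary terms. They are divided out by
  -- `cornerWeight` and by r - d/2, which are harmless since r ≥ d on the medium and the array stays
  -- at distance 1 from the lower sides.
  set Am : ℝ × ℝ × ℝ × (ℝ × E2 × E2) → ℝ := fun p => (p.1 - a) * (p.2.1 - b) * (p.2.2.1 - d / 2) *
    (farDist S.a₀ d p.2.2.1 p.2.2.2.1 p.2.2.2.2.1 p.2.2.2.2.2 !₂[p.1, p.2.1])⁻¹ with hAm
  have hvec : ContDiff ℝ (⊤ : ℕ∞) fun p : ℝ × ℝ × ℝ × (ℝ × E2 × E2) => (!₂[p.1, p.2.1] : E2) :=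
    ContDiff.vec2 (by fun_prop) (by fun_prop)
  have hMs : ContDiff ℝ (⊤ : ℕ∞) M :=
    contDiff_reducedPhase hd (by positivity) (by fun_prop) (by fun_prop) (by fun_prop) (by fun_prop) hvec
  have hAs : ContDiff ℝ (⊤ : ℕ∞) Am := by
    refine ContDiff.mul (by fun_prop) (ContDiff.inv (contDiff_farDist hd (by fun_prop) (by fun_prop)
      (by fun_prop) (by fun_prop) hvec) fun p => ?_)
    exact (smoothSqrt_pos (by positivity) _).ne'
  obtain ⟨h, hamp, hrep⟩ := exists_box_representation (a := a) (b := b) (r := d / 2) hMs hAs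
    (by simp [hAm]) (by simp [hAm]) (by simp [hAm])
  have hcont := hamp.continuous hMs
  -- The parameters δ, δζ and u₁ are included in the compact set, which makes the constant uniform
  -- in all of them.
  obtain ⟨C₀, hC₀, hbd⟩ := hamp.bound (k := Set.Icc a a' ×ˢ (Set.Icc b b' ×ˢ (Set.Icc (d / 2) m ×ˢ
    (Set.Icc (0 : ℝ) 1 ×ˢ (Metric.closedBall (0 : E2) 1 ×ˢ Metric.closedBall (0 : E2) U)))))
    (isCompact_Icc.prod (isCompact_Icc.prod (isCompact_Icc.prod (isCompact_Icc.prod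
      ((isCompact_closedBall _ _).prod (isCompact_closedBall _ _))))))
  set T : E2 → ENNReal := sliceTail S.A₀ a a' b b' (d / 2) m (dspec S B) (S.a₀ / S.c₀) with hT
  have hTm : Measurable T := measurable_sliceTail _ _ _ _ _ _ _ hfc _
  set Vp := volume (pbox a a' b b' (d / 2) m) with hVp
  set C : ENNReal := ENNReal.ofReal (m ^ 3 / d * (2 / d) ^ 2) * (Vp *
    ENNReal.ofReal (2 * Real.pi * S.c₀ / c) * ‖C₀‖ₑ ^ 2) with hCdef
  refine ⟨T, C, m, hm0, hTm, lintegral_sliceTail_lt_top _ _ hb.box hfc hfg (g := g) (hpow g)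
    (div_pos ha0 hc0).ne', ?_, ?_⟩
  · rw [hCdef]
    exact ENNReal.mul_ne_top ENNReal.ofReal_ne_top (ENNReal.mul_ne_top (ENNReal.mul_ne_top
      (volume_pbox_lt_top _ _ _ _ _ _).ne ENNReal.ofReal_ne_top) (ENNReal.pow_ne_top enorm_ne_top))
  intro δ hδ hδ1 u₁ hu₁ σ hσ R
  clear_value M Am T C
  -- the integrand
  set E : Set E3 := S.D ∩ {z | R * δ < ‖hor (z - sensor S δ u₁)‖} with hE
  have hEm : MeasurableSet E := by
    refine hS.D_meas.inter (measurableSet_lt measurable_const ?_)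
    exact (continuous_hor.comp (by fun_prop)).norm.measurable
  have hQm : Measurable fun z => ‖slice S B tg cs δ σ u₁ z‖ₑ ^ 2 :=
    (((measurable_slice S hB tg cs δ).comp (f := fun z : E3 => (σ, u₁, z))
      (by fun_prop)).enorm.pow_const 2)
  set G : E3 → ENNReal := E.indicator fun z => ‖slice S B tg cs δ σ u₁ z‖ₑ ^ 2 with hG
  have hGm : Measurable G := hQm.indicator hEm
  set κ := (1 + σ) / (S.c₀ * δ ^ 2) with hκ
  have hκ0 : 0 < κ := div_pos (hc.trans_le hσ) (by positivity)
  set Q : E2 → ℝ → ℂ := fun ζ r => ∫ u in S.A₀, ∫ ω, dspec S B ω *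
        Complex.exp (Complex.I * ((ω * (κ * r - S.a₀ / S.c₀ * inner ℝ u ζ +
          (S.a₀ / S.c₀ * inner ℝ u₁ ζ - 2 * (S.c₀ * tg) / (S.c₀ * δ ^ 2))) : ℝ) : ℂ)) *
        ((cornerWeight a b u : ℂ) *
          ∫ x' in a..u 0, ∫ y' in b..u 1, ∫ s' in d / 2..r, h ω (x', y', s', (δ, δ • ζ, u₁)))
    with hQ
  have hheight : ∀ ζ : E2, δ * ‖ζ‖ < 1 → ∀ r, 0 < r → conePoint S δ u₁ r ζ ∈ S.D →
      d ≤ r ∧ d ≤ r * Real.sqrt (1 - δ ^ 2 * ‖ζ‖ ^ 2) := by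
    intro ζ hζ r hr hz
    have h1 := hb.height _ hz
    have h2 : conePoint S δ u₁ r ζ 2 = r * Real.sqrt (1 - δ ^ 2 * ‖ζ‖ ^ 2) := by
      simp [conePoint, sensor_two]
    rw [h2] at h1
    refine ⟨h1.trans ?_, h1⟩
    have : Real.sqrt (1 - δ ^ 2 * ‖ζ‖ ^ 2) ≤ 1 := by
      rw [Real.sqrt_le_one]; nlinarith [sq_nonneg (δ * ‖ζ‖)]
    nlinarith
  have hslice : ∀ ζ : E2, δ * ‖ζ‖ < 1 → ∀ r, 0 < r → conePoint S δ u₁ r ζ ∈ S.D →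
      slice S B tg cs δ σ u₁ (conePoint S δ u₁ r ζ) = ((r - d / 2 : ℝ) : ℂ)⁻¹ * Q ζ r := by
    intro ζ hζ r hr hz
    obtain ⟨h1, h2⟩ := hheight ζ hζ r hr hz
    have hvec2 : ∀ u : E2, (!₂[u 0, u 1] : E2) = u := fun u => by ext i; fin_cases i <;> rfl
    rw [slice, ← integral_const_mul]
    refine setIntegral_congr_fun hS.A₀_meas fun u hu => ?_
    beta_reduce
    have hX : d ≤ ‖sensor S δ u - conePoint S δ u₁ r ζ‖ := by
      have h3 := abs_coord_le (sensor S δ u - conePoint S δ u₁ r ζ) 2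
      have h4 : (sensor S δ u - conePoint S δ u₁ r ζ) 2 = -(conePoint S δ u₁ r ζ 2) := by
        simp [sensor_two]
      rw [h4, abs_neg] at h3
      exact (hb.height _ hz).trans ((le_abs_self _).trans h3)
    obtain ⟨e1, e2⟩ := phase_identity S hc0.ne' hcs htg hd hδ h1 u₁ u hζ hX σ
    rw [e2, ← e1, osc, ← integral_const_mul, ← integral_const_mul]
    refine integral_congr_ae (Eventually.of_forall fun ω => ?_)
    beta_reduce
    rw [← hrep ω (u 0) (u 1) r (δ, δ • ζ, u₁), hAm, hM]
    simp only [hvec2]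
    obtain ⟨g1, -, g3, -⟩ := hb.box.mem u hu
    have n1 : ((u 0 - a : ℝ) : ℂ) ≠ 0 :=
      Complex.ofReal_ne_zero.2 (by linarith : (0 : ℝ) < u 0 - a).ne'
    have n2 : ((u 1 - b : ℝ) : ℂ) ≠ 0 :=
      Complex.ofReal_ne_zero.2 (by linarith : (0 : ℝ) < u 1 - b).ne'
    have n3 : ((r - d / 2 : ℝ) : ℂ) ≠ 0 :=
      Complex.ofReal_ne_zero.2 (by linarith : (0 : ℝ) < r - d / 2).ne'
    have n4 : ((farDist S.a₀ d r δ (δ • ζ) u₁ u : ℝ) : ℂ) ≠ 0 := by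
      rw [e1]; exact_mod_cast (hd.trans_le hX).ne'
    have e3 : Complex.exp (Complex.I * ((ω * (κ * r - S.a₀ / S.c₀ * inner ℝ u ζ +
        (S.a₀ / S.c₀ * inner ℝ u₁ ζ - 2 * (S.c₀ * tg) / (S.c₀ * δ ^ 2)) +
        reducedPhase S.c₀ S.a₀ cs tg d r δ (δ • ζ) u₁ u) : ℝ) : ℂ)) =
        Complex.exp (Complex.I * ((ω * (κ * r - S.a₀ / S.c₀ * inner ℝ u ζ +
        (S.a₀ / S.c₀ * inner ℝ u₁ ζ - 2 * (S.c₀ * tg) / (S.c₀ * δ ^ 2))) : ℝ) : ℂ)) *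
        Complex.exp (Complex.I *
          ((ω * reducedPhase S.c₀ S.a₀ cs tg d r δ (δ • ζ) u₁ u : ℝ) : ℂ)) := by
      rw [← Complex.exp_add]; congr 1; push_cast; ring
    rw [e3]
    simp only [cornerWeight, Complex.ofReal_mul, Complex.ofReal_inv]
    generalize Complex.exp _ = z1
    generalize Complex.exp _ = z2
    generalize ((r - d / 2 : ℝ) : ℂ) = w at n3 ⊢
    field_simp
  have hpt : ∀ ζ : E2, δ * ‖ζ‖ < 1 → ∀ r, 0 < r →
      ENNReal.ofReal (r ^ 2 * δ ^ 2 / Real.sqrt (1 - δ ^ 2 * ‖ζ‖ ^ 2)) * G (conePoint S δ u₁ r ζ) ≤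
      {ζ : E2 | R < m * ‖ζ‖}.indicator (fun _ => 1) ζ * (Set.Ioc (d / 2) m).indicator (fun r =>
        ENNReal.ofReal (m ^ 3 / d * (2 / d) ^ 2 * δ ^ 2) * ‖Q ζ r‖ₑ ^ 2) r := by
    intro ζ hζ r hr
    by_cases hz : conePoint S δ u₁ r ζ ∈ E
    swap
    · simp [hG, hz]
    obtain ⟨h1, h2⟩ := hheight ζ hζ r hr hz.1
    have hrm : r ≤ m := by
      refine le_trans ?_ hm1
      have e1 := norm_conePoint_sub S hδ u₁ hr.le hζ
      rw [← e1]
      refine (norm_sub_le _ _).trans (add_le_add (hb.norm_le _ hz.1) ?_)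
      rw [norm_sensor S ha0 hδ.le]
      have := hb.array u₁ hu₁
      calc δ * S.a₀ * ‖u₁‖ ≤ 1 * S.a₀ * U := by gcongr
        _ = _ := by ring
    have hR : R < m * ‖ζ‖ := by
      have h3 : R * δ < ‖hor (conePoint S δ u₁ r ζ - sensor S δ u₁)‖ := hz.2
      rw [conePoint, add_sub_cancel_left, hor_mk3, norm_smul, Real.norm_of_nonneg (by positivity)] at h3
      have h4 : R < r * ‖ζ‖ := by
        by_contra h5
        nlinarith
      exact h4.trans_le (by gcongr)
    rw [Set.indicator_of_mem (show ζ ∈ {ζ : E2 | R < m * ‖ζ‖} from hR), one_mul,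
      Set.indicator_of_mem (show r ∈ Set.Ioc (d / 2) m from ⟨by linarith, hrm⟩), hG,
      Set.indicator_of_mem hz, hslice ζ hζ r hr hz.1, enorm_mul, mul_pow, ← mul_assoc]
    gcongr
    rw [← ofReal_norm, ← ENNReal.ofReal_pow (norm_nonneg _), ← ENNReal.ofReal_mul (by positivity)]
    refine ENNReal.ofReal_le_ofReal ?_
    rw [norm_inv, Complex.norm_real, Real.norm_of_nonneg (by linarith)]
    have hs : 0 < Real.sqrt (1 - δ ^ 2 * ‖ζ‖ ^ 2) := by
      by_contra h3
      nlinarith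
    have h5 : (r - d / 2)⁻¹ ≤ 2 / d := by
      rw [show 2 / d = (d / 2)⁻¹ by rw [inv_div]]
      exact inv_anti₀ (by positivity) (by linarith)
    -- The Jacobian is singular only for grazing directions; r√(1 - δ²|ζ|²) is the height of the
    -- point, at least d on the medium.
    have h6 : r ^ 2 * δ ^ 2 / Real.sqrt (1 - δ ^ 2 * ‖ζ‖ ^ 2) ≤ m ^ 3 / d * δ ^ 2 := by
      rw [div_mul_eq_mul_div, div_le_div_iff₀ hs hd]
      calc r ^ 2 * δ ^ 2 * d ≤ r ^ 2 * δ ^ 2 * (r * Real.sqrt (1 - δ ^ 2 * ‖ζ‖ ^ 2)) := by gcongr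
        _ = r ^ 3 * δ ^ 2 * Real.sqrt (1 - δ ^ 2 * ‖ζ‖ ^ 2) := by ring
        _ ≤ _ := by gcongr
    have h7 : 0 ≤ (r - d / 2)⁻¹ := inv_nonneg.2 (by linarith)
    calc _ ≤ (m ^ 3 / d * δ ^ 2) * (2 / d) ^ 2 := by gcongr
      _ = _ := by ring
  have hfib : ∀ ζ : E2, δ * ‖ζ‖ < 1 → ∫⁻ r in Set.Ioc (d / 2) m, ‖Q ζ r‖ₑ ^ 2 ≤
      Vp * ENNReal.ofReal (2 * Real.pi * S.c₀ / c * δ ^ 2) * ‖C₀‖ₑ ^ 2 * T ζ := by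
    intro ζ hζ
    have h1 : Continuous fun p : ℝ × ℝ × ℝ × ℝ => (fun (ω : ℝ) (x : ℝ × ℝ × ℝ) =>
        h ω (x.1, x.2.1, x.2.2, (δ, δ • ζ, u₁))) p.1 p.2 :=
      hcont.comp (f := fun p : ℝ × ℝ × ℝ × ℝ => (p.1, (p.2.1, p.2.2.1, p.2.2.2, (δ, δ • ζ, u₁))))
        (by fun_prop)
    have h2 := slice_bound hb.box hfc hf1 hf2
      (h := fun (ω : ℝ) (x : ℝ × ℝ × ℝ) => h ω (x.1, x.2.1, x.2.2, (δ, δ • ζ, u₁))) h1 (C := C₀) (a := a) (b := b) (r := d / 2) (r' := m) ?_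
      hκ0 (S.a₀ / S.c₀) (S.a₀ / S.c₀ * inner ℝ u₁ ζ - 2 * (S.c₀ * tg) / (S.c₀ * δ ^ 2)) ζ
    · refine h2.trans ?_
      have h3 : 2 * Real.pi / κ ≤ 2 * Real.pi * S.c₀ / c * δ ^ 2 := by
        have : 0 < 1 + σ := hc.trans_le hσ
        calc 2 * Real.pi / κ = 2 * Real.pi * S.c₀ * δ ^ 2 / (1 + σ) := by rw [hκ]; field_simp
          _ ≤ 2 * Real.pi * S.c₀ * δ ^ 2 / c := by gcongr
          _ = _ := by ring
      rw [hT]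
      gcongr
    · intro ω x hx
      refine hbd ω _ ⟨⟨hx.1.1.le, hx.1.2⟩, ⟨hx.2.1.1.le, hx.2.1.2⟩, ⟨hx.2.2.1.le, hx.2.2.2⟩,
        ⟨hδ.le, hδ1⟩, ?_, ?_⟩
      · rw [mem_closedBall_zero_iff, norm_smul, Real.norm_of_nonneg hδ.le]
        exact hζ.le
      · rw [mem_closedBall_zero_iff]; exact hb.array u₁ hu₁
  have hζm : MeasurableSet {ζ : E2 | R < m * ‖ζ‖} := measurableSet_lt (by fun_prop) (by fun_prop)
  have hζ1 : MeasurableSet {ζ : E2 | δ * ‖ζ‖ < 1} := measurableSet_lt (by fun_prop) (by fun_prop)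
  have hup : MeasurableSet {z : E3 | 0 < z 2} := measurableSet_lt measurable_const (by fun_prop)
  calc ∫⁻ z in E, ‖slice S B tg cs δ σ u₁ z‖ₑ ^ 2 = ∫⁻ z, G (sensor S δ u₁ + z) := by
        rw [lintegral_add_left_eq_self, hG, lintegral_indicator hEm]
    _ = ∫⁻ z in {z : E3 | 0 < z 2}, G (sensor S δ u₁ + z) := by
        refine (setLIntegral_eq_of_support_subset ?_).symm
        intro z hz
        have h1 : sensor S δ u₁ + z ∈ E := by
          by_contra h1
          exact hz (by simp [hG, h1])
        have h2 := hb.height _ h1.1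
        have h3 : (sensor S δ u₁ + z) 2 = z 2 := by simp [sensor_two]
        rw [h3] at h2
        exact hd.trans_le h2
    _ = ∫⁻ ζ in {ζ : E2 | δ * ‖ζ‖ < 1}, ∫⁻ r in Set.Ioi 0,
          ENNReal.ofReal (r ^ 2 * δ ^ 2 / Real.sqrt (1 - δ ^ 2 * ‖ζ‖ ^ 2)) *
          G (conePoint S δ u₁ r ζ) :=
        lintegral_cone (F := fun z => G (sensor S δ u₁ + z)) (hGm.comp (by fun_prop)) hδ
    _ ≤ ∫⁻ ζ in {ζ : E2 | δ * ‖ζ‖ < 1}, {ζ : E2 | R < m * ‖ζ‖}.indicator (fun _ => 1) ζ *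
          (C * ENNReal.ofReal (δ ^ 4) * T ζ) := by
        refine setLIntegral_mono' hζ1 fun ζ hζ => ?_
        calc _ ≤ ∫⁻ r in Set.Ioi 0, {ζ : E2 | R < m * ‖ζ‖}.indicator (fun _ => 1) ζ *
                (Set.Ioc (d / 2) m).indicator (fun r =>
                ENNReal.ofReal (m ^ 3 / d * (2 / d) ^ 2 * δ ^ 2) * ‖Q ζ r‖ₑ ^ 2) r :=
              setLIntegral_mono' measurableSet_Ioi fun r hr => hpt ζ hζ r hr
          _ ≤ ∫⁻ r, {ζ : E2 | R < m * ‖ζ‖}.indicator (fun _ => 1) ζ *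
                (Set.Ioc (d / 2) m).indicator (fun r =>
                ENNReal.ofReal (m ^ 3 / d * (2 / d) ^ 2 * δ ^ 2) * ‖Q ζ r‖ₑ ^ 2) r :=
              setLIntegral_le_lintegral _ _
          _ = {ζ : E2 | R < m * ‖ζ‖}.indicator (fun _ => 1) ζ *
                (ENNReal.ofReal (m ^ 3 / d * (2 / d) ^ 2 * δ ^ 2) *
                ∫⁻ r in Set.Ioc (d / 2) m, ‖Q ζ r‖ₑ ^ 2) := by
              rw [lintegral_const_mul', lintegral_indicator measurableSet_Ioc,
                lintegral_const_mul' _ _ ENNReal.ofReal_ne_top]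
              exact ((Set.indicator_le_self' (by simp) ζ).trans_lt ENNReal.one_lt_top).ne
          _ ≤ {ζ : E2 | R < m * ‖ζ‖}.indicator (fun _ => 1) ζ *
                (ENNReal.ofReal (m ^ 3 / d * (2 / d) ^ 2 * δ ^ 2) *
                (Vp * ENNReal.ofReal (2 * Real.pi * S.c₀ / c * δ ^ 2) * ‖C₀‖ₑ ^ 2 * T ζ)) :=
              mul_le_mul_right (mul_le_mul_right (hfib ζ hζ) _) _
          _ = _ := by
              rw [hCdef, ENNReal.ofReal_mul (by positivity : 0 ≤ m ^ 3 / d * (2 / d) ^ 2),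
                ENNReal.ofReal_mul (by positivity : 0 ≤ 2 * Real.pi * S.c₀ / c),
                show δ ^ 4 = δ ^ 2 * δ ^ 2 by ring, ENNReal.ofReal_mul (by positivity : 0 ≤ δ ^ 2)]
              ring
    _ ≤ ∫⁻ ζ, {ζ : E2 | R < m * ‖ζ‖}.indicator (fun _ => 1) ζ *
          (C * ENNReal.ofReal (δ ^ 4) * T ζ) := setLIntegral_le_lintegral _ _
    _ = _ := by
        have h1 : ∀ ζ, {ζ : E2 | R < m * ‖ζ‖}.indicator (fun _ => (1 : ENNReal)) ζ *
            (C * ENNReal.ofReal (δ ^ 4) * T ζ) = C * ENNReal.ofReal (δ ^ 4) *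
              {ζ : E2 | R < m * ‖ζ‖}.indicator T ζ := by
          intro ζ
          by_cases hζ : R < m * ‖ζ‖ <;> simp [hζ]
        simp_rw [h1]
        rw [lintegral_const_mul _ (hTm.indicator hζm), lintegral_indicator hζm]

/-! ### The first kernel -/

/-- The travel time attached to a pair of sensors, multiplied by `c₀`. -/
def searchPath (S : Setup) (tg cs δ : ℝ) (u₁ u₂ : E2) : ℝ :=
  S.c₀ / cs * (‖searchPoint cs tg - sensor S δ u₁‖ + ‖searchPoint cs tg - sensor S δ u₂‖)

/-- The kernel of the first scattered contribution, up to a constant factor. -/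
def kernelI (S : Setup) (B tg cs δ : ℝ) (u₁ u₂ : E2) (z : E3) : ℂ :=
  ((‖sensor S δ u₂ - z‖⁻¹ : ℝ) : ℂ) * ∫ y, (S.K y : ℂ) *
    (((‖z - y‖ * ‖sensor S δ u₁ - y‖ : ℝ) : ℂ)⁻¹ * osc (ddspec S B)
      ((S.c₀ * δ ^ 2)⁻¹ * (‖sensor S δ u₂ - z‖ - searchPath S tg cs δ u₁ u₂ + ‖z - y‖ -
        ‖sensor S δ u₁ - y‖)))

/-- Relative path excess through a source in polar position `(τ, α)`. -/
def pathExcess (τ α : ℝ) : ℝ := sideLength 1 τ α - τ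

theorem continuous_pathExcess : Continuous fun p : ℝ × ℝ => pathExcess p.1 p.2 := by
  unfold pathExcess sideLength; fun_prop

theorem sideLength_mul {r : ℝ} (hr : 0 ≤ r) (τ α : ℝ) :
    sideLength r (r * τ) α = r * sideLength 1 τ α := by
  unfold sideLength
  rw [show r ^ 2 + (r * τ) ^ 2 + 2 * r * (r * τ) * Real.cos α
    = r ^ 2 * (1 ^ 2 + τ ^ 2 + 2 * 1 * τ * Real.cos α) by ring, Real.sqrt_mul (by positivity),
    Real.sqrt_sq hr]

/-- Bounds on the sources. -/
structure SourceBounds (S : Setup) (d ρ k : ℝ) : Prop where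
  d_pos : 0 < d
  depth : ∀ y ∈ tsupport S.K, y 2 ≤ -d
  norm_le : ∀ y ∈ tsupport S.K, ‖y‖ ≤ ρ
  ρ_pos : 0 < ρ
  deriv : ∀ y, ‖fderiv ℝ S.K y‖ ≤ k
  k_nonneg : 0 ≤ k

theorem exists_sourceBounds {S : Setup} (hS : S.Admissible) : ∃ d ρ k, SourceBounds S d ρ k := by
  have hcomp : IsCompact (tsupport S.K) := hS.K_compact
  obtain ⟨ρ, hρ⟩ := hcomp.isBounded.exists_norm_le
  obtain ⟨d, hd, hdz⟩ : ∃ d, 0 < d ∧ ∀ z ∈ tsupport S.K, z 2 ≤ -d := by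
    by_cases hne : (tsupport S.K).Nonempty
    · obtain ⟨z, hz, hmax⟩ := hcomp.exists_isMaxOn hne (f := fun z : E3 => z 2) (by fun_prop)
      have h1 : z 2 < 0 := hS.K_behind hz
      exact ⟨-z 2, by linarith, fun w hw => by rw [neg_neg]; exact hmax hw⟩
    · exact ⟨1, one_pos, fun z hz => (hne ⟨z, hz⟩).elim⟩
  have hK1 : ContDiff ℝ 1 S.K := hS.K_smooth.of_le (by exact_mod_cast le_top)
  obtain ⟨k, hk⟩ := (hS.K_compact.fderiv ℝ).exists_bound_of_continuous
    (hK1.continuous_fderiv (by norm_num))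
  refine ⟨d, |ρ| + 1, k, hd, hdz, fun y hy => ?_, by positivity, hk, (norm_nonneg _).trans (hk 0)⟩
  linarith [hρ y hy, le_abs_self ρ]

/-- Quantitative triangle inequality for broken paths crossing the plane of the array. -/
theorem path_excess_le {x y z : E3} (hx : x 2 = 0) (hy : y 2 ≤ 0) (hz : 0 ≤ z 2) :
    z 2 ^ 2 ≤ (‖z - x‖ + ‖z - y‖ - ‖x - y‖) * (‖z - y‖ + ‖z - y‖) := by
  set w : E3 := mk3 (hor z) 0 with hw
  -- Here w is the foot of z in the plane of the array. Replacing z by w shortens both legs, and the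
  -- triangle inequality at w leaves an excess of at least |z - y| - |w - y|.
  have e1 : ‖z - y‖ ^ 2 = ‖w - y‖ ^ 2 + z 2 ^ 2 - 2 * z 2 * y 2 := by
    rw [norm_sq_E3, norm_sq_E3]; simp [hw]; ring
  have e2 : ‖w - x‖ ≤ ‖z - x‖ := by
    rw [← sq_le_sq₀ (norm_nonneg _) (norm_nonneg _), norm_sq_E3, norm_sq_E3]
    simp [hw, hx]; positivity
  have e3 : ‖x - y‖ ≤ ‖w - x‖ + ‖w - y‖ := by
    have := norm_sub_le_norm_sub_add_norm_sub x w y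
    rwa [norm_sub_rev x w] at this
  have e4 : ‖w - y‖ ≤ ‖z - y‖ := by
    rw [← sq_le_sq₀ (norm_nonneg _) (norm_nonneg _), e1]; nlinarith [sq_nonneg (z 2)]
  have h1 := norm_nonneg (w - y)
  have h2 := norm_nonneg (z - y)
  calc z 2 ^ 2 ≤ ‖z - y‖ ^ 2 - ‖w - y‖ ^ 2 := by rw [e1]; nlinarith
    _ = (‖z - y‖ - ‖w - y‖) * (‖z - y‖ + ‖w - y‖) := by ring
    _ ≤ (‖z - x‖ + ‖z - y‖ - ‖x - y‖) * (‖z - y‖ + ‖z - y‖) := by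
      apply mul_le_mul <;> linarith

/-- An application of `source_integral` at the scale (c₀δ²)⁻¹. Rescaling the source distance as t =
rτ, with r the distance from z to the first sensor, turns the path excess into r · `pathExcess`; the
remainder then has the phase of the main term with 1 replaced by `pathExcess`. -/
theorem kernelI_eq {S : Setup} (hS : S.Admissible) {B : ℝ} (hB : 0 < B) (tg cs : ℝ) {δ : ℝ}
    (hδ : 0 < δ) (u₁ u₂ : E2) {z : E3} (hz : 0 < z 2) {U : E3 ≃ₗᵢ[ℝ] E3}
    (hU : z = sensor S δ u₁ - ‖z - sensor S δ u₁‖ • U vert) :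
    kernelI S B tg cs δ u₁ u₂ z = ((S.c₀ * δ ^ 2 : ℝ) : ℂ) * (
      ((2 * Real.pi * S.rayIntegral (sensor S δ u₁) z / ‖z - sensor S δ u₁‖ : ℝ) : ℂ) *
        (((‖sensor S δ u₂ - z‖⁻¹ : ℝ) : ℂ) * osc (dspec S B) ((‖z - sensor S δ u₁‖ * 1 +
          ‖sensor S δ u₂ - z‖ - searchPath S tg cs δ u₁ u₂) / (S.c₀ * δ ^ 2))) +
      ((‖sensor S δ u₂ - z‖⁻¹ : ℝ) : ℂ) * ∫ β in Set.Ioo (-Real.pi) Real.pi,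
        ∫ τ in Set.Ioi (0 : ℝ), ∫ α in Set.Ioo 0 Real.pi,
          (dsource S.K (sensor S δ u₁) U (‖z - sensor S δ u₁‖ * τ) α β : ℂ) * osc (dspec S B)
            ((‖z - sensor S δ u₁‖ * pathExcess τ α + ‖sensor S δ u₂ - z‖ -
              searchPath S tg cs δ u₁ u₂) / (S.c₀ * δ ^ 2))) := by
  set x := sensor S δ u₁ with hx
  set r := ‖z - x‖ with hr
  have hx2 : x 2 = 0 := sensor_two S δ u₁
  have hr0 : 0 < r := by
    rw [hr, norm_pos_iff, sub_ne_zero]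
    rintro rfl
    linarith
  have hK1 : ContDiff ℝ 1 S.K := hS.K_smooth.of_le (by exact_mod_cast le_top)
  have hxs : x ∉ tsupport S.K := fun h => by
    have : x 2 < 0 := hS.K_behind h
    linarith
  have hzs : z ∉ tsupport S.K := fun h => by
    have : z 2 < 0 := hS.K_behind h
    linarith
  have hUv : r • U vert = x - z := by
    rw [hU]; simp
  have hUz : U vert 2 = -(z 2) / r := by
    have : (r • U vert) 2 = (x - z) 2 := by rw [hUv]
    simp [hx2] at this
    field_simp
    linarith
  have hahead : ∀ t : ℝ, 0 < t → S.K (x - t • U vert) = 0 := by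
    intro t ht
    refine image_eq_zero_of_notMem_tsupport fun h => ?_
    have h1 : (x - t • U vert) 2 < 0 := hS.K_behind h
    have h2 : (x - t • U vert) 2 = t * (z 2 / r) := by simp [hx2, hUz]; ring
    rw [h2] at h1
    have : 0 < t * (z 2 / r) := by positivity
    linarith
  have hlam : 0 < (S.c₀ * δ ^ 2)⁻¹ := by have := hS.c₀_pos; positivity
  rw [kernelI, source_integral hK1 hS.K_compact hxs hzs hr0 hU hahead (hasDerivAt_osc_dspec S hB)
    (continuous_osc_ddspec S hB) hlam]
  have hray : ∫ t in Set.Ioi (0 : ℝ), S.K (x + t • U vert) = S.rayIntegral x z := by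
    unfold Setup.rayIntegral
    refine setIntegral_congr_fun measurableSet_Ioi fun l hl => ?_
    beta_reduce
    rw [norm_sub_rev x z, ← hr, ← hUv, smul_smul, div_mul_cancel₀ _ hr0.ne']
  have hT : ∀ β : ℝ, ∫ t in Set.Ioi (0 : ℝ), ∫ α in Set.Ioo 0 Real.pi,
      (dsource S.K x U t α β : ℂ) * osc (dspec S B) ((S.c₀ * δ ^ 2)⁻¹ *
        (‖sensor S δ u₂ - z‖ - searchPath S tg cs δ u₁ u₂ + sideLength r t α - t))
      = r * ∫ τ in Set.Ioi (0 : ℝ), ∫ α in Set.Ioo 0 Real.pi,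
          (dsource S.K x U (r * τ) α β : ℂ) * osc (dspec S B)
            ((r * pathExcess τ α + ‖sensor S δ u₂ - z‖ -
              searchPath S tg cs δ u₁ u₂) / (S.c₀ * δ ^ 2)) := by
    intro β
    have h := integral_comp_mul_left_Ioi (fun t => ∫ α in Set.Ioo 0 Real.pi,
      (dsource S.K x U t α β : ℂ) * osc (dspec S B) ((S.c₀ * δ ^ 2)⁻¹ *
        (‖sensor S δ u₂ - z‖ - searchPath S tg cs δ u₁ u₂ + sideLength r t α - t))) 0 hr0
    rw [mul_zero] at h
    have hrc : (r : ℂ) ≠ 0 := Complex.ofReal_ne_zero.2 hr0.ne'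
    rw [eq_comm, ← eq_inv_mul_iff_mul_eq₀ hrc, ← Complex.ofReal_inv, ← Complex.real_smul, ← h]
    refine integral_congr_ae (Eventually.of_forall fun τ => ?_)
    refine integral_congr_ae (Eventually.of_forall fun α => ?_)
    beta_reduce
    rw [sideLength_mul hr0.le, pathExcess]
    congr 2
    rw [div_eq_inv_mul]; ring
  simp_rw [hT]
  rw [integral_const_mul, hray]
  have hrc : (r : ℂ) ≠ 0 := Complex.ofReal_ne_zero.2 hr0.ne'
  have hcc : ((S.c₀ * δ ^ 2 : ℝ) : ℂ) ≠ 0 := Complex.ofReal_ne_zero.2 (inv_pos.1 hlam).ne'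
  rw [show (S.c₀ * δ ^ 2)⁻¹ * (‖sensor S δ u₂ - z‖ - searchPath S tg cs δ u₁ u₂ + r)
    = (r * 1 + ‖sensor S δ u₂ - z‖ - searchPath S tg cs δ u₁ u₂) / (S.c₀ * δ ^ 2) by
      rw [div_eq_inv_mul]; ring]
  have hcoef : ((1 / (r * (S.c₀ * δ ^ 2)⁻¹) : ℝ) : ℂ) = ((S.c₀ * δ ^ 2 : ℝ) : ℂ) * (r : ℂ)⁻¹ := by
    rw [one_div, mul_inv, inv_inv, mul_comm, Complex.ofReal_mul, Complex.ofReal_inv]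
  rw [hcoef, Complex.ofReal_div _ r]
  field_simp

/-- Where the angular derivative does not vanish there is a source, hence behind the array and at
bounded distance, while z is at height at least d. The lower bound for the total excess 1 +
`pathExcess` is `path_excess_le`; it provides the constant c required by `slice_energy`. -/
theorem dsource_bound {S : Setup} (hS : S.Admissible) {d ρ a a' b b' U : ℝ}
    (hb : Bounds S d ρ a a' b b' U) {e ρ' k : ℝ} (hs : SourceBounds S e ρ' k) {δ : ℝ} (hδ : 0 < δ)
    (hδ1 : δ ≤ 1) {u₁ : E2} (hu₁ : u₁ ∈ S.A₀) {z : E3} (hz : z ∈ S.D) {V : E3 ≃ₗᵢ[ℝ] E3}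
    (hV : z = sensor S δ u₁ - ‖z - sensor S δ u₁‖ • V vert) {τ : ℝ} (hτ : 0 < τ) (α β : ℝ)
    (hne : dsource S.K (sensor S δ u₁) V (‖z - sensor S δ u₁‖ * τ) α β ≠ 0) :
    |dsource S.K (sensor S δ u₁) V (‖z - sensor S δ u₁‖ * τ) α β| ≤ k * (ρ' + S.a₀ * U) ∧
    τ ≤ (ρ' + S.a₀ * U) / d ∧
    d ^ 2 / (2 * (ρ + S.a₀ * U) * (ρ + ρ')) ≤ 1 + pathExcess τ α := by
  set x := sensor S δ u₁ with hx
  set r := ‖z - x‖ with hr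
  have hx2 : x 2 = 0 := sensor_two S δ u₁
  have hz2 := hb.height z hz
  have hd := hb.d_pos
  have hU := hb.U_nonneg
  have ha0 := hS.a₀_pos
  have hxn : ‖x‖ ≤ S.a₀ * U := by
    rw [hx, norm_sensor S ha0 hδ.le]
    calc δ * S.a₀ * ‖u₁‖ ≤ 1 * S.a₀ * U := by gcongr; exact hb.array u₁ hu₁
      _ = _ := by ring
  have hdr : d ≤ r := by
    refine hz2.trans ?_
    have := abs_coord_le (z - x) 2
    simp only [PiLp.sub_apply, hx2, sub_zero] at this
    exact (le_abs_self _).trans this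
  have hr0 : 0 < r := hd.trans_le hdr
  have hrm : r ≤ ρ + S.a₀ * U := (norm_sub_le _ _).trans (add_le_add (hb.norm_le z hz) hxn)
  set y := x + V (sph (r * τ) α β) with hy
  have hyK : y ∈ tsupport S.K := by
    by_contra h
    exact hne (dsource_eq_zero h)
  have hrτ : 0 < r * τ := by positivity
  have hxy : ‖x - y‖ = r * τ := by
    rw [hy, sub_add_cancel_left, norm_neg, V.norm_map, norm_sph hrτ.le]
  have hzy : ‖z - y‖ = r * sideLength 1 τ α := by
    have e : z - y = -V (sph (r * τ) α β + r • vert) := by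
      rw [map_add, map_smul, hy]
      nth_rw 1 [hV]
      abel
    rw [← sideLength_mul hr0.le, ← norm_sph_add r (r * τ) α β, e, norm_neg, V.norm_map]
  have hτm : r * τ ≤ ρ' + S.a₀ * U := by
    rw [← hxy]
    have := norm_sub_le x y
    linarith [hs.norm_le y hyK]
  refine ⟨?_, ?_, ?_⟩
  · unfold dsource
    rw [← Real.norm_eq_abs]
    refine (ContinuousLinearMap.le_opNorm _ _).trans ?_
    rw [V.norm_map, norm_dsph hrτ.le]
    exact mul_le_mul (hs.deriv _) hτm hrτ.le hs.k_nonneg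
  · rw [le_div_iff₀ hd]
    nlinarith
  · have h1 := path_excess_le hx2 (by linarith [hs.depth y hyK, hs.d_pos] : y 2 ≤ 0)
      (by linarith : 0 ≤ z 2)
    rw [← hr, hzy, hxy] at h1
    have h2 : ‖z - y‖ ≤ ρ + ρ' :=
      (norm_sub_le _ _).trans (add_le_add (hb.norm_le z hz) (hs.norm_le y hyK))
    have h3 : 0 ≤ 1 + pathExcess τ α := by
      have := norm_sub_le_norm_sub_add_norm_sub x z y
      rw [norm_sub_rev x z, ← hr, hzy, hxy] at this
      unfold pathExcess
      by_contra h
      nlinarith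
    have hpos : 0 < 2 * (ρ + S.a₀ * U) * (ρ + ρ') := by
      have h5 : 0 < ρ := hd.trans_le (hz2.trans ((le_abs_self _).trans
        ((abs_coord_le z 2).trans (hb.norm_le z hz))))
      have := hs.ρ_pos
      positivity
    rw [div_le_iff₀ hpos]
    rw [hzy] at h2
    calc d ^ 2 ≤ z 2 ^ 2 := by gcongr
      _ ≤ (r + r * sideLength 1 τ α - r * τ) * (r * sideLength 1 τ α + r * sideLength 1 τ α) := h1
      _ = (1 + pathExcess τ α) * (2 * r * (r * sideLength 1 τ α)) := by unfold pathExcess; ring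
      _ ≤ (1 + pathExcess τ α) * (2 * (ρ + S.a₀ * U) * (ρ + ρ')) := by
        have : 0 ≤ 2 * (ρ + S.a₀ * U) := by linarith
        gcongr
        rw [← hzy]; positivity

/-- Polar positions of the sources which contribute to the remainder. -/
def remSet (c T : ℝ) : Set (ℝ × ℝ) :=
  (Set.Ioc 0 T ×ˢ Set.Ioo 0 Real.pi) ∩ {p | c ≤ 1 + pathExcess p.1 p.2}

theorem measurableSet_remSet (c T : ℝ) : MeasurableSet (remSet c T) :=
  (measurableSet_Ioc.prod measurableSet_Ioo).inter
    (measurableSet_le measurable_const (continuous_const.add continuous_pathExcess).measurable)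

theorem volume_remSet_lt_top (c T : ℝ) : volume (remSet c T) < ⊤ := by
  refine (measure_mono Set.inter_subset_left).trans_lt ?_
  rw [Measure.volume_eq_prod, Measure.prod_prod]
  exact ENNReal.mul_lt_top measure_Ioc_lt_top measure_Ioo_lt_top

theorem continuous_sensor (S : Setup) (δ : ℝ) : Continuous (sensor S δ) := by
  unfold sensor embed; fun_prop

theorem le_norm_sensor_sub {S : Setup} {d ρ a a' b b' U : ℝ}
    (hb : Bounds S d ρ a a' b b' U) (δ : ℝ) (u : E2) {z : E3} (hz : z ∈ S.D) :
    d ≤ ‖sensor S δ u - z‖ := by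
  refine (hb.height z hz).trans ?_
  have := abs_coord_le (sensor S δ u - z) 2
  simp only [PiLp.sub_apply, sensor_two, zero_sub, abs_neg] at this
  exact (le_abs_self _).trans this

theorem exists_osc_dspec_bound (S : Setup) {B : ℝ} (hB : 0 < B) :
    ∃ C : ℝ, 0 < C ∧ ∀ s, ‖osc (dspec S B) s‖ ≤ C / (1 + s ^ 2) := by
  obtain ⟨f, hf⟩ := exists_schwartz_dspec S hB
  rw [← hf]; exact osc_le f

/-- Integrating `kernelI_eq` over the second sensor inside the integral over source positions turns
the remainder into a superposition of slices. The weight is bounded by `dsource_bound`, and the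
azimuth only contributes 2π since the slices do not depend on it. -/
theorem kernelI_remainder {S : Setup} (hS : S.Admissible) {B : ℝ} (hB : 0 < B) (tg cs : ℝ) :
    ∃ (C : ENNReal) (c T : ℝ), C ≠ ⊤ ∧ 0 < c ∧ ∀ δ, 0 < δ → δ ≤ 1 → ∀ u₁ ∈ S.A₀, ∀ z ∈ S.D,
      ‖(∫ u₂ in S.A₀, kernelI S B tg cs δ u₁ u₂ z) - ((S.c₀ * δ ^ 2 : ℝ) : ℂ) *
        (((2 * Real.pi * S.rayIntegral (sensor S δ u₁) z / ‖z - sensor S δ u₁‖ : ℝ) : ℂ) *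
          slice S B tg cs δ 1 u₁ z)‖ₑ ≤
      C * ENNReal.ofReal (δ ^ 2) *
        ∫⁻ p in remSet c T, ‖slice S B tg cs δ (pathExcess p.1 p.2) u₁ z‖ₑ := by
  obtain ⟨d, ρ, a, a', b, b', U, hb⟩ := exists_bounds hS
  obtain ⟨e, ρ', k, hs⟩ := exists_sourceBounds hS
  obtain ⟨Co, hCo, hosc⟩ := exists_osc_dspec_bound S hB
  have hd := hb.d_pos
  have hc0 := hS.c₀_pos
  have ha0 := hS.a₀_pos
  have hpi := Real.pi_pos
  have hosc' : ∀ s, ‖osc (dspec S B) s‖ ≤ Co := fun s => (hosc s).trans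
    (div_le_self hCo.le (by nlinarith [sq_nonneg s]))
  have hoscc := continuous_osc_dspec S hB
  by_cases hDe : S.D.Nonempty
  swap
  · exact ⟨0, 1, 1, by simp, one_pos, fun δ _ _ u _ z hz => (hDe ⟨z, hz⟩).elim⟩
  have hρ : 0 < ρ := by
    obtain ⟨z, hz⟩ := hDe
    exact hd.trans_le ((hb.height z hz).trans ((le_abs_self _).trans
      ((abs_coord_le z 2).trans (hb.norm_le z hz))))
  have hU := hb.U_nonneg
  have hρ' := hs.ρ_pos
  set c := d ^ 2 / (2 * (ρ + S.a₀ * U) * (ρ + ρ')) with hc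
  set T := (ρ' + S.a₀ * U) / d with hT
  set k' := k * (ρ' + S.a₀ * U) with hk'
  have hk0 : 0 ≤ k' := mul_nonneg hs.k_nonneg (by positivity)
  refine ⟨ENNReal.ofReal S.c₀ * (ENNReal.ofReal (2 * Real.pi) * ENNReal.ofReal k'), c, T,
    ENNReal.mul_ne_top ENNReal.ofReal_ne_top (ENNReal.mul_ne_top ENNReal.ofReal_ne_top
      ENNReal.ofReal_ne_top), by positivity, fun δ hδ hδ1 u₁ hu₁ z hz => ?_⟩
  set x := sensor S δ u₁ with hx
  set r := ‖z - x‖ with hr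
  have hz2 : 0 < z 2 := hd.trans_le (hb.height z hz)
  have hzx : z ≠ x := by
    rintro rfl
    have : x 2 = 0 := sensor_two S δ u₁
    linarith
  obtain ⟨V, hV⟩ := exists_frame hzx
  have hds : ∀ τ, 0 < τ → ∀ α β, dsource S.K x V (r * τ) α β ≠ 0 → _ := fun τ hτ α β h =>
    dsource_bound hS hb hs hδ hδ1 hu₁ hz hV hτ α β h
  have hK1 : ContDiff ℝ 1 S.K := hS.K_smooth.of_le (by exact_mod_cast le_top)
  have hdsc := continuous_dsource hK1 x V
  -- the integrand of the remainder
  set ph : ℝ → E2 → ℝ := fun σ u₂ => (r * σ + ‖sensor S δ u₂ - z‖ - searchPath S tg cs δ u₁ u₂) /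
    (S.c₀ * δ ^ 2) with hph
  have hphc : Continuous fun p : ℝ × E2 => ph p.1 p.2 := by
    have := continuous_sensor S δ
    simp only [hph, searchPath]
    fun_prop
  set F : E2 × (ℝ × ℝ × ℝ) → ℂ := fun q => ((‖sensor S δ q.1 - z‖⁻¹ : ℝ) : ℂ) *
    ((dsource S.K x V (r * q.2.2.1) q.2.2.2 q.2.1 : ℂ) *
      osc (dspec S B) (ph (pathExcess q.2.2.1 q.2.2.2) q.1)) with hF
  have hinv : Continuous fun u : E2 => ‖sensor S δ u - z‖⁻¹ := by
    have := continuous_sensor S δ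
    exact Continuous.inv₀ (by fun_prop) fun u => (hd.trans_le (le_norm_sensor_sub hb δ u hz)).ne'
  have hFc : Continuous F := by
    have h1 := hdsc.comp (f := fun q : E2 × (ℝ × ℝ × ℝ) => (r * q.2.2.1, q.2.2.2, q.2.1)) (by fun_prop)
    have h2 := continuous_pathExcess.comp
      (f := fun q : E2 × (ℝ × ℝ × ℝ) => (q.2.2.1, q.2.2.2)) (by fun_prop)
    have h3 := hoscc.comp (hphc.comp (h2.prodMk continuous_fst))
    have h4 := hinv.comp (continuous_fst (X := E2) (Y := ℝ × ℝ × ℝ))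
    exact (Complex.continuous_ofReal.comp h4).mul ((Complex.continuous_ofReal.comp h1).mul h3)
  set W : Set (ℝ × ℝ × ℝ) := Set.Ioo (-Real.pi) Real.pi ×ˢ (Set.Ioc 0 T ×ˢ Set.Ioo 0 Real.pi) with hW
  have hWm : MeasurableSet W := measurableSet_Ioo.prod (measurableSet_Ioc.prod measurableSet_Ioo)
  have hWfin : volume W < ⊤ := by
    rw [hW, Measure.volume_eq_prod, Measure.volume_eq_prod, Measure.prod_prod, Measure.prod_prod]
    exact ENNReal.mul_lt_top measure_Ioo_lt_top
      (ENNReal.mul_lt_top measure_Ioc_lt_top measure_Ioo_lt_top)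
  have hFb : ∀ u, ∀ q ∈ W, ‖F (u, q)‖ ≤ d⁻¹ * (k' * Co) := by
    intro u q hq
    simp only [hF, norm_mul, Complex.norm_real, Real.norm_eq_abs]
    have h1 : |‖sensor S δ u - z‖⁻¹| ≤ d⁻¹ := by
      rw [abs_of_nonneg (by positivity)]
      exact inv_anti₀ hd (le_norm_sensor_sub hb δ u hz)
    have h2 : |dsource S.K x V (r * q.2.1) q.2.2 q.1| ≤ k' := by
      by_cases h : dsource S.K x V (r * q.2.1) q.2.2 q.1 = 0
      · rw [h, abs_zero]; exact hk0
      · exact (hds _ hq.2.1.1 _ _ h).1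
    have h3 := hosc' (ph (pathExcess q.2.1 q.2.2) u)
    gcongr
  have hA : IsFiniteMeasure (volume.restrict S.A₀) := ⟨by simpa using hb.box.fin⟩
  have hWF : IsFiniteMeasure (volume.restrict W) := ⟨by simpa using hWfin⟩
  have hint : Integrable F ((volume.restrict S.A₀).prod (volume.restrict W)) := by
    refine Integrable.of_bound hFc.aestronglyMeasurable (d⁻¹ * (k' * Co)) ?_
    rw [Measure.prod_restrict]
    filter_upwards [ae_restrict_mem (hS.A₀_meas.prod hWm)] with q hq
    exact hFb q.1 q.2 hq.2
  have hFI : ∀ u₂, ((‖sensor S δ u₂ - z‖⁻¹ : ℝ) : ℂ) * ∫ β in Set.Ioo (-Real.pi) Real.pi,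
        ∫ τ in Set.Ioi (0 : ℝ), ∫ α in Set.Ioo 0 Real.pi,
          (dsource S.K x V (r * τ) α β : ℂ) * osc (dspec S B) (ph (pathExcess τ α) u₂)
      = ∫ q in W, F (u₂, q) := by
    intro u₂
    have hc1 : Continuous fun q : ℝ × ℝ × ℝ => F (u₂, q) := hFc.comp (by fun_prop)
    have hi1 : IntegrableOn (fun q : ℝ × ℝ × ℝ => F (u₂, q)) W (volume.prod volume) :=
      (hc1.continuousOn.integrableOn_compact
        (isCompact_Icc.prod (isCompact_Icc.prod isCompact_Icc))).mono_set
        (Set.prod_mono Set.Ioo_subset_Icc_self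
        (Set.prod_mono Set.Ioc_subset_Icc_self Set.Ioo_subset_Icc_self))
    rw [Measure.volume_eq_prod, setIntegral_prod _ hi1, ← integral_const_mul]
    refine integral_congr_ae (Eventually.of_forall fun β => ?_)
    beta_reduce
    have hi2 : IntegrableOn (fun q : ℝ × ℝ => F (u₂, (β, q))) (Set.Ioc 0 T ×ˢ Set.Ioo 0 Real.pi)
        (volume.prod volume) :=
      ((hc1.comp (Continuous.prodMk_right β)).continuousOn.integrableOn_compact
        (isCompact_Icc.prod isCompact_Icc)).mono_set
        (Set.prod_mono Set.Ioc_subset_Icc_self Set.Ioo_subset_Icc_self)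
    rw [Measure.volume_eq_prod, setIntegral_prod _ hi2,
      setIntegral_eq_of_subset_of_forall_sdiff_eq_zero measurableSet_Ioi
        (fun τ (hτ : τ ∈ Set.Ioc 0 T) => hτ.1) ?_, ← integral_const_mul]
    · refine integral_congr_ae (Eventually.of_forall fun τ => ?_)
      beta_reduce
      rw [← integral_const_mul]
    · intro τ hτ
      rw [← integral_zero ℝ ℂ (μ := volume.restrict (Set.Ioo 0 Real.pi))]
      refine integral_congr_ae (Eventually.of_forall fun α => ?_)
      beta_reduce
      have : dsource S.K x V (r * τ) α β = 0 := by
        by_contra h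
        exact hτ.2 ⟨hτ.1, (hds τ hτ.1 α β h).2.1⟩
      rw [this]; simp
  have hmain : Integrable (fun u₂ => ((‖sensor S δ u₂ - z‖⁻¹ : ℝ) : ℂ) *
      osc (dspec S B) (ph 1 u₂)) (volume.restrict S.A₀) := by
    refine Integrable.of_bound (Continuous.aestronglyMeasurable ?_) (d⁻¹ * Co) ?_
    · exact (Complex.continuous_ofReal.comp hinv).mul
        (hoscc.comp (hphc.comp (Continuous.prodMk_right 1)))
    · refine Eventually.of_forall fun u => ?_
      rw [norm_mul, Complex.norm_real, Real.norm_eq_abs, abs_of_nonneg (by positivity)]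
      have h1 := inv_anti₀ hd (le_norm_sensor_sub hb δ u hz)
      have h3 := hosc' (ph 1 u)
      gcongr
  have hslice : ∀ σ, slice S B tg cs δ σ u₁ z = ∫ u₂ in S.A₀,
      ((‖sensor S δ u₂ - z‖⁻¹ : ℝ) : ℂ) * osc (dspec S B) (ph σ u₂) := fun σ => rfl
  have hker : ∀ u₂, kernelI S B tg cs δ u₁ u₂ z = ((S.c₀ * δ ^ 2 : ℝ) : ℂ) * (
      ((2 * Real.pi * S.rayIntegral x z / r : ℝ) : ℂ) *
        (((‖sensor S δ u₂ - z‖⁻¹ : ℝ) : ℂ) * osc (dspec S B) (ph 1 u₂)) + ∫ q in W, F (u₂, q)) := by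
    intro u₂
    rw [kernelI_eq hS hB tg cs hδ u₁ u₂ hz2 hV, ← hFI]
  have e1 : (∫ u₂ in S.A₀, kernelI S B tg cs δ u₁ u₂ z) - ((S.c₀ * δ ^ 2 : ℝ) : ℂ) *
        (((2 * Real.pi * S.rayIntegral x z / r : ℝ) : ℂ) * slice S B tg cs δ 1 u₁ z)
      = ((S.c₀ * δ ^ 2 : ℝ) : ℂ) * ∫ q in W, (dsource S.K x V (r * q.2.1) q.2.2 q.1 : ℂ) *
          slice S B tg cs δ (pathExcess q.2.1 q.2.2) u₁ z := by
    simp_rw [hker]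
    rw [integral_const_mul, integral_add (hmain.const_mul _) hint.integral_prod_left,
      integral_const_mul, ← hslice, mul_add, add_sub_cancel_left, integral_integral_swap hint]
    congr 1
    refine integral_congr_ae (Eventually.of_forall fun q => ?_)
    beta_reduce
    rw [hslice, ← integral_const_mul]
    refine integral_congr_ae (Eventually.of_forall fun u => ?_)
    simp only [hF]
    ring
  rw [e1, enorm_mul]
  have hsm : Measurable fun p : ℝ × ℝ => ‖slice S B tg cs δ (pathExcess p.1 p.2) u₁ z‖ₑ :=
    ((measurable_slice S hB tg cs δ).comp
      (f := fun p : ℝ × ℝ => (pathExcess p.1 p.2, u₁, z))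
      (continuous_pathExcess.measurable.prodMk measurable_const)).enorm
  have hrm := measurableSet_remSet c T
  have e2 : ‖∫ q in W, (dsource S.K x V (r * q.2.1) q.2.2 q.1 : ℂ) *
          slice S B tg cs δ (pathExcess q.2.1 q.2.2) u₁ z‖ₑ ≤ ENNReal.ofReal (2 * Real.pi) *
      (ENNReal.ofReal k' * ∫⁻ p in remSet c T, ‖slice S B tg cs δ (pathExcess p.1 p.2) u₁ z‖ₑ) := by
    calc _ ≤ ∫⁻ q in W, ‖(dsource S.K x V (r * q.2.1) q.2.2 q.1 : ℂ) *
          slice S B tg cs δ (pathExcess q.2.1 q.2.2) u₁ z‖ₑ := enorm_integral_le_lintegral_enorm _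
      _ ≤ ∫⁻ q in W, (remSet c T).indicator (fun p => ENNReal.ofReal k' *
          ‖slice S B tg cs δ (pathExcess p.1 p.2) u₁ z‖ₑ) q.2 := by
          refine setLIntegral_mono' hWm fun q hq => ?_
          by_cases h : dsource S.K x V (r * q.2.1) q.2.2 q.1 = 0
          · simp [h]
          · obtain ⟨h1, h2, h3⟩ := hds _ hq.2.1.1 _ _ h
            rw [Set.indicator_of_mem (show q.2 ∈ remSet c T from ⟨hq.2, h3⟩), enorm_mul]
            gcongr
            rw [← ofReal_norm, Complex.norm_real, Real.norm_eq_abs]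
            exact ENNReal.ofReal_le_ofReal h1
      _ = ∫⁻ β in Set.Ioo (-Real.pi) Real.pi, ∫⁻ p in Set.Ioc 0 T ×ˢ Set.Ioo 0 Real.pi,
          (remSet c T).indicator (fun p => ENNReal.ofReal k' *
          ‖slice S B tg cs δ (pathExcess p.1 p.2) u₁ z‖ₑ) p := by
          rw [hW, Measure.volume_eq_prod, ← Measure.prod_restrict, lintegral_prod]
          exact (((hsm.const_mul _).indicator hrm).comp measurable_snd).aemeasurable
      _ ≤ ∫⁻ β in Set.Ioo (-Real.pi) Real.pi, (ENNReal.ofReal k' * ∫⁻ p in remSet c T,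
          ‖slice S B tg cs δ (pathExcess p.1 p.2) u₁ z‖ₑ) := by
          refine lintegral_mono fun β => ?_
          rw [← lintegral_const_mul _ hsm, ← lintegral_indicator hrm]
          exact setLIntegral_le_lintegral _ _
      _ = _ := by
          rw [setLIntegral_const, Real.volume_Ioo, mul_comm]
          congr 2; ring
  have e3 : ‖((S.c₀ * δ ^ 2 : ℝ) : ℂ)‖ₑ = ENNReal.ofReal S.c₀ * ENNReal.ofReal (δ ^ 2) := by
    rw [← ofReal_norm, Complex.norm_real, Real.norm_of_nonneg (by positivity),
      ENNReal.ofReal_mul hc0.le]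
  calc _ ≤ ENNReal.ofReal S.c₀ * ENNReal.ofReal (δ ^ 2) * (ENNReal.ofReal (2 * Real.pi) *
      (ENNReal.ofReal k' *
        ∫⁻ p in remSet c T, ‖slice S B tg cs δ (pathExcess p.1 p.2) u₁ z‖ₑ)) := by
        rw [e3]; exact mul_le_mul_right e2 _
    _ = _ := by ring

/-! ### The second kernel and the imaging kernel -/

/-- The kernel of the second scattered contribution, up to a constant factor. -/
def kernelII (S : Setup) (B tg cs δ : ℝ) (u₁ u₂ : E2) (z : E3) : ℂ :=
  ((‖sensor S δ u₁ - z‖⁻¹ : ℝ) : ℂ) * ∫ y, (S.K y : ℂ) *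
    (((‖z - y‖ * ‖sensor S δ u₂ - y‖ : ℝ) : ℂ)⁻¹ * osc (ddspec S B)
      ((S.c₀ * δ ^ 2)⁻¹ * (-(‖sensor S δ u₁ - z‖ + searchPath S tg cs δ u₁ u₂ + ‖z - y‖ -
        ‖sensor S δ u₂ - y‖))))

theorem crossCorrI_inner (S : Setup) (B ε τ : ℝ) (x₁ x₂ z y : E3) :
    ∫ ω : ℝ, ((ω ^ 2 * S.K y * S.Fhat B ω : ℝ) : ℂ) *
        greenHat S.c₀ (ω / ε) x₂ z * greenHat S.c₀ (ω / ε) z y *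
        (starRingEnd ℂ) (greenHat S.c₀ (ω / ε) x₁ y) *
        Complex.exp (-Complex.I * ((ω * τ / ε : ℝ) : ℂ))
      = (((4 * Real.pi) ^ 3)⁻¹ : ℝ) * (((‖x₂ - z‖⁻¹ : ℝ) : ℂ) * ((S.K y : ℂ) *
        (((‖z - y‖ * ‖x₁ - y‖ : ℝ) : ℂ)⁻¹ * osc (ddspec S B)
          ((‖x₂ - z‖ + ‖z - y‖ - ‖x₁ - y‖) / (S.c₀ * ε) - τ / ε)))) := by
  rw [osc, ← integral_const_mul, ← integral_const_mul, ← integral_const_mul, ← integral_const_mul]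
  refine integral_congr_ae (Eventually.of_forall fun ω => ?_)
  beta_reduce
  have e1 : Complex.exp (Complex.I * ((ω * ((‖x₂ - z‖ + ‖z - y‖ - ‖x₁ - y‖) / (S.c₀ * ε) - τ / ε) : ℝ) : ℂ))
      = Complex.exp (Complex.I * ((ω / ε / S.c₀ * ‖x₂ - z‖ : ℝ) : ℂ)) *
        Complex.exp (Complex.I * ((ω / ε / S.c₀ * ‖z - y‖ : ℝ) : ℂ)) *
        Complex.exp (-Complex.I * ((ω / ε / S.c₀ * ‖x₁ - y‖ : ℝ) : ℂ)) *
        Complex.exp (-Complex.I * ((ω * τ / ε : ℝ) : ℂ)) := by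
    rw [← Complex.exp_add, ← Complex.exp_add, ← Complex.exp_add]
    congr 1
    push_cast
    ring
  have e2 : (starRingEnd ℂ) (greenHat S.c₀ (ω / ε) x₁ y) =
      Complex.exp (-Complex.I * ((ω / ε / S.c₀ * ‖x₁ - y‖ : ℝ) : ℂ)) /
        ((4 * Real.pi * ‖x₁ - y‖ : ℝ) : ℂ) := by
    rw [greenHat, map_div₀, ← Complex.exp_conj, map_mul, Complex.conj_I, Complex.conj_ofReal,
      Complex.conj_ofReal]
  rw [e1, e2, greenHat, greenHat, ddspec]
  push_cast
  simp only [div_eq_mul_inv, mul_inv]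
  ring

theorem crossCorrII_inner (S : Setup) (B ε τ : ℝ) (x₁ x₂ z y : E3) :
    ∫ ω : ℝ, ((ω ^ 2 * S.K y * S.Fhat B ω : ℝ) : ℂ) *
        (starRingEnd ℂ) (greenHat S.c₀ (ω / ε) x₁ z) *
        (starRingEnd ℂ) (greenHat S.c₀ (ω / ε) z y) *
        greenHat S.c₀ (ω / ε) x₂ y *
        Complex.exp (-Complex.I * ((ω * τ / ε : ℝ) : ℂ))
      = (((4 * Real.pi) ^ 3)⁻¹ : ℝ) * (((‖x₁ - z‖⁻¹ : ℝ) : ℂ) * ((S.K y : ℂ) *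
        (((‖z - y‖ * ‖x₂ - y‖ : ℝ) : ℂ)⁻¹ * osc (ddspec S B)
          (-((‖x₁ - z‖ + ‖z - y‖ - ‖x₂ - y‖) / (S.c₀ * ε) + τ / ε))))) := by
  rw [osc, ← integral_const_mul, ← integral_const_mul, ← integral_const_mul, ← integral_const_mul]
  refine integral_congr_ae (Eventually.of_forall fun ω => ?_)
  beta_reduce
  have e1 : Complex.exp (Complex.I *
        ((ω * (-((‖x₁ - z‖ + ‖z - y‖ - ‖x₂ - y‖) / (S.c₀ * ε) + τ / ε)) : ℝ) : ℂ))
      = Complex.exp (-Complex.I * ((ω / ε / S.c₀ * ‖x₁ - z‖ : ℝ) : ℂ)) *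
        Complex.exp (-Complex.I * ((ω / ε / S.c₀ * ‖z - y‖ : ℝ) : ℂ)) *
        Complex.exp (Complex.I * ((ω / ε / S.c₀ * ‖x₂ - y‖ : ℝ) : ℂ)) *
        Complex.exp (-Complex.I * ((ω * τ / ε : ℝ) : ℂ)) := by
    rw [← Complex.exp_add, ← Complex.exp_add, ← Complex.exp_add]
    congr 1
    push_cast
    ring
  have e2 : ∀ x y : E3, (starRingEnd ℂ) (greenHat S.c₀ (ω / ε) x y) =
      Complex.exp (-Complex.I * ((ω / ε / S.c₀ * ‖x - y‖ : ℝ) : ℂ)) /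
        ((4 * Real.pi * ‖x - y‖ : ℝ) : ℂ) := by
    intro x y
    rw [greenHat, map_div₀, ← Complex.exp_conj, map_mul, Complex.conj_I, Complex.conj_ofReal,
      Complex.conj_ofReal]
  rw [e1, e2, e2, greenHat, ddspec]
  push_cast
  simp only [div_eq_mul_inv, mul_inv]
  ring

/-- Common form of the two kernels. -/
def kernelForm (S : Setup) (B : ℝ) (x x' : E3) (a s : ℝ) (z : E3) : ℂ :=
  ((‖x - z‖⁻¹ : ℝ) : ℂ) * ∫ y, (S.K y : ℂ) * (((‖z - y‖ * ‖x' - y‖ : ℝ) : ℂ)⁻¹ * osc (ddspec S B)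
      (a * (‖x - z‖ + s + ‖z - y‖ - ‖x' - y‖)))

theorem kernelI_eq_form (S : Setup) (B tg cs δ : ℝ) (u₁ u₂ : E2) (z : E3) :
    kernelI S B tg cs δ u₁ u₂ z = kernelForm S B (sensor S δ u₂) (sensor S δ u₁)
      ((S.c₀ * δ ^ 2)⁻¹) (-searchPath S tg cs δ u₁ u₂) z := by
  simp only [kernelI, kernelForm, ← sub_eq_add_neg]

theorem kernelII_eq_form (S : Setup) (B tg cs δ : ℝ) (u₁ u₂ : E2) (z : E3) :
    kernelII S B tg cs δ u₁ u₂ z = kernelForm S B (sensor S δ u₁) (sensor S δ u₂)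
      (-(S.c₀ * δ ^ 2)⁻¹) (searchPath S tg cs δ u₁ u₂) z := by
  simp only [kernelII, kernelForm, mul_neg, neg_mul]

theorem measurable_kernelForm {S : Setup} (hS : S.Admissible) {B : ℝ} (hB : 0 < B) :
    Measurable fun p : E3 × E3 × ℝ × ℝ × E3 => kernelForm S B p.1 p.2.1 p.2.2.1 p.2.2.2.1 p.2.2.2.2 := by
  unfold kernelForm
  refine Measurable.mul (by fun_prop) ?_
  refine (StronglyMeasurable.integral_prod_right (f := fun p : E3 × E3 × ℝ × ℝ × E3 => fun y : E3 =>
    (S.K y : ℂ) * (((‖p.2.2.2.2 - y‖ * ‖p.2.1 - y‖ : ℝ) : ℂ)⁻¹ * osc (ddspec S B)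
      (p.2.2.1 * (‖p.1 - p.2.2.2.2‖ + p.2.2.2.1 + ‖p.2.2.2.2 - y‖ - ‖p.2.1 - y‖))))
      (Measurable.stronglyMeasurable ?_)).measurable
  have hK := hS.K_smooth.continuous
  have h1 : Measurable fun q : (E3 × E3 × ℝ × ℝ × E3) × E3 => (S.K q.2 : ℂ) :=
    Continuous.measurable (by fun_prop)
  have h2 : Measurable fun q : (E3 × E3 × ℝ × ℝ × E3) × E3 =>
    ((‖q.1.2.2.2.2 - q.2‖ * ‖q.1.2.1 - q.2‖ : ℝ) : ℂ) := Continuous.measurable (by fun_prop)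
  have h3 : Measurable fun q : (E3 × E3 × ℝ × ℝ × E3) × E3 => osc (ddspec S B)
      (q.1.2.2.1 * (‖q.1.1 - q.1.2.2.2.2‖ + q.1.2.2.2.1 + ‖q.1.2.2.2.2 - q.2‖ - ‖q.1.2.1 - q.2‖)) :=
    ((continuous_osc_ddspec S hB).comp (by fun_prop)).measurable
  exact h1.mul (h2.inv.mul h3)

/-- The medium and the sources lie strictly on opposite sides of the plane of the array, so all
three distances in the denominators are bounded below. -/
theorem kernelForm_bound {S : Setup} (hS : S.Admissible) {d ρ a a' b b' U : ℝ}
    (hb : Bounds S d ρ a a' b b' U) {e ρ' k : ℝ} (hs : SourceBounds S e ρ' k) {B M : ℝ}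
    {x x' : E3} (hx : x 2 = 0) (hx' : x' 2 = 0) {α s : ℝ} {z : E3} (hz : z ∈ S.D)
    (h : ∀ y ∈ tsupport S.K, ‖osc (ddspec S B) (α * (‖x - z‖ + s + ‖z - y‖ - ‖x' - y‖))‖ ≤ M) :
    ‖kernelForm S B x x' α s z‖ ≤ d⁻¹ * ((∫ y, |S.K y|) * ((d * e)⁻¹ * M)) := by
  have hd := hb.d_pos
  have he := hs.d_pos
  have hz2 := hb.height z hz
  have hKi : Integrable fun y => |S.K y| :=
    (hS.K_smooth.continuous.integrable_of_hasCompactSupport hS.K_compact).abs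
  rw [kernelForm, norm_mul]
  have h1 : ‖((‖x - z‖⁻¹ : ℝ) : ℂ)‖ ≤ d⁻¹ := by
    rw [Complex.norm_real, Real.norm_of_nonneg (by positivity)]
    refine inv_anti₀ hd ?_
    have := abs_coord_le (x - z) 2
    simp only [PiLp.sub_apply, hx, zero_sub, abs_neg] at this
    exact hz2.trans ((le_abs_self _).trans this)
  refine mul_le_mul h1 ?_ (norm_nonneg _) (by positivity)
  rw [← integral_mul_const]
  refine norm_integral_le_of_norm_le (hKi.mul_const _) (Eventually.of_forall fun y => ?_)
  by_cases hy : y ∈ tsupport S.K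
  · rw [norm_mul, Complex.norm_real, norm_mul, Real.norm_eq_abs, norm_inv, Complex.norm_real,
      Real.norm_of_nonneg (by positivity)]
    have hy2 := hs.depth y hy
    have n1 : d ≤ ‖z - y‖ := by
      have := abs_coord_le (z - y) 2
      simp only [PiLp.sub_apply] at this
      have h3 := le_abs_self (z 2 - y 2)
      linarith
    have n2 : e ≤ ‖x' - y‖ := by
      have := abs_coord_le (x' - y) 2
      simp only [PiLp.sub_apply, hx'] at this
      have h3 := le_abs_self (0 - y 2)
      linarith
    have n3 := h y hy
    gcongr
  · rw [image_eq_zero_of_notMem_tsupport hy]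
    simp

/-- In this term the search path adds to the scattered path instead of compensating it. The total
length stays above c₀t_g, so the profile is evaluated at distance of order δ⁻² from the origin,
where it decays rapidly. -/
theorem kernelII_bound {S : Setup} (hS : S.Admissible) {B tg cs : ℝ} (hB : 0 < B) (htg : 0 < tg)
    (hcs : 0 < cs) : ∃ C δ₀ : ℝ, 0 < C ∧ 0 < δ₀ ∧ ∀ δ, 0 < δ → δ ≤ δ₀ → ∀ u₁ ∈ S.A₀, ∀ u₂ ∈ S.A₀,
      ∀ z ∈ S.D, ‖kernelII S B tg cs δ u₁ u₂ z‖ ≤ C * δ ^ 8 := by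
  obtain ⟨d, ρ, a, a', b, b', U, hb⟩ := exists_bounds hS
  obtain ⟨e, ρ', k, hs⟩ := exists_sourceBounds hS
  obtain ⟨f, hf⟩ := exists_schwartz_ddspec S hB
  -- Decay of order 4 in a variable of size δ⁻² gives δ⁸, more than the normalisation δ⁻² of the
  -- local kernel and the volume factor δ⁻⁴ of the local coordinates consume.
  obtain ⟨C, hC, hdec⟩ := osc_decay f 4
  rw [hf] at hdec
  have hd := hb.d_pos
  have he := hs.d_pos
  have hc0 := hS.c₀_pos
  have ha0 := hS.a₀_pos
  have hU := hb.U_nonneg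
  set I := ∫ y, |S.K y| with hI
  have hI0 : 0 ≤ I := integral_nonneg fun y => abs_nonneg _
  -- The threshold on δ keeps every sensor within c₀t_g/2 of the origin, so that the negative term
  -- of the path is absorbed.
  refine ⟨d⁻¹ * (I * ((d * e)⁻¹ * (C / tg ^ 4))) + 1, S.c₀ * tg / (2 * (S.a₀ * U + 1)),
    by positivity, by positivity, fun δ hδ hδ0 u₁ hu₁ u₂ hu₂ z hz => ?_⟩
  rw [kernelII_eq_form]
  refine (kernelForm_bound hS hb hs (sensor_two S δ u₁) (sensor_two S δ u₂)
    (M := C / tg ^ 4 * δ ^ 8) hz fun y hy => ?_).trans ?_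
  · set P := ‖sensor S δ u₁ - z‖ + searchPath S tg cs δ u₁ u₂ + ‖z - y‖ - ‖sensor S δ u₂ - y‖ with hP
    have hPl : S.c₀ * tg ≤ P := by
      have h1 : 2 * (S.c₀ * tg) ≤ searchPath S tg cs δ u₁ u₂ := by
        have h2 : ∀ u, cs * tg ≤ ‖searchPoint cs tg - sensor S δ u‖ := by
          intro u
          rw [norm_searchPoint_sub_sensor S (by positivity)]
          have : 0 ≤ distExcess S.a₀ (cs * tg) δ u := by unfold distExcess; positivity
          nlinarith [sq_nonneg δ]
        unfold searchPath
        calc 2 * (S.c₀ * tg) = S.c₀ / cs * (cs * tg + cs * tg) := by field_simp; ring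
          _ ≤ _ := by gcongr <;> exact h2 _
      have hn : ∀ u ∈ S.A₀, ‖sensor S δ u‖ ≤ S.c₀ * tg / 2 := by
        intro u hu
        rw [norm_sensor S ha0 hδ.le]
        calc δ * S.a₀ * ‖u‖ ≤ δ * S.a₀ * U := by gcongr; exact hb.array u hu
          _ ≤ S.c₀ * tg / (2 * (S.a₀ * U + 1)) * (S.a₀ * U) := by rw [mul_assoc]; gcongr
          _ ≤ S.c₀ * tg / 2 := by
            rw [div_mul_eq_mul_div, div_le_div_iff₀ (by positivity) (by positivity)]
            nlinarith [mul_pos hc0 htg]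
      have h3 : ‖sensor S δ u₂ - y‖ ≤ ‖sensor S δ u₂‖ + ‖sensor S δ u₁‖ + (‖sensor S δ u₁ - z‖ + ‖z - y‖) := by
        calc _ = ‖sensor S δ u₂ + -sensor S δ u₁ + ((sensor S δ u₁ - z) + (z - y))‖ := by congr 1; abel
          _ ≤ _ := by
            refine (norm_add_le _ _).trans (add_le_add ((norm_add_le _ _).trans ?_) (norm_add_le _ _))
            rw [norm_neg]
      have h4 := hn u₁ hu₁
      have h5 := hn u₂ hu₂
      rw [hP]
      linarith
    have hs4 := hdec (-(S.c₀ * δ ^ 2)⁻¹ * P)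
    have hP4 : (tg / δ ^ 2) ^ 4 ≤ |-(S.c₀ * δ ^ 2)⁻¹ * P| ^ 4 := by
      gcongr
      rw [abs_mul, abs_neg, abs_of_pos (by positivity : 0 < (S.c₀ * δ ^ 2)⁻¹),
        abs_of_pos (lt_of_lt_of_le (by positivity) hPl)]
      calc tg / δ ^ 2 = (S.c₀ * δ ^ 2)⁻¹ * (S.c₀ * tg) := by field_simp
        _ ≤ _ := by gcongr
    have h6 : (tg / δ ^ 2) ^ 4 * ‖osc (ddspec S B) (-(S.c₀ * δ ^ 2)⁻¹ * P)‖ ≤ C :=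
      (mul_le_mul_of_nonneg_right hP4 (norm_nonneg _)).trans hs4
    calc _ = (tg / δ ^ 2) ^ 4 * ‖osc (ddspec S B) (-(S.c₀ * δ ^ 2)⁻¹ * P)‖ * (δ ^ 8 / tg ^ 4) := by
          field_simp
      _ ≤ C * (δ ^ 8 / tg ^ 4) := by gcongr
      _ = _ := by ring
  · have : 0 ≤ δ ^ 8 := by positivity
    calc _ = d⁻¹ * (I * ((d * e)⁻¹ * (C / tg ^ 4))) * δ ^ 8 := by ring
      _ ≤ _ := by gcongr; linarith

/-! ### The image as a linear functional of the medium -/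

def pairKernel (S : Setup) (B tg cs δ : ℝ) (u₁ u₂ : E2) (z : E3) : ℂ :=
  kernelI S B tg cs δ u₁ u₂ z + kernelII S B tg cs δ u₁ u₂ z

/-- The scalings of the two array integrals cancel against the normalisation by the squared area,
leaving the reference area. The remaining factors come from the Born formula with ε = δ² and from
three Green's functions. -/
def kernelConst (S : Setup) (δ : ℝ) : ℝ :=
  (S.N : ℝ) ^ 2 / (volume.real S.A₀) ^ 2 * (1 / (2 * Real.pi * S.c₀ ^ 2 * (δ ^ 2) ^ 2)) *
    ((4 * Real.pi) ^ 3)⁻¹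

/-- The kernel of the imaging functional, as a linear functional of the medium. -/
def imagingKernel (S : Setup) (B tg cs δ : ℝ) (z : E3) : ℂ :=
  (kernelConst S δ : ℂ) * ∫ u₁ in S.A₀, ∫ u₂ in S.A₀, pairKernel S B tg cs δ u₁ u₂ z

theorem continuous_searchPath (S : Setup) (tg cs δ : ℝ) :
    Continuous fun p : E2 × E2 => searchPath S tg cs δ p.1 p.2 := by
  have := continuous_sensor S δ
  unfold searchPath; fun_prop

theorem measurable_kernelI {S : Setup} (hS : S.Admissible) {B : ℝ} (hB : 0 < B) (tg cs δ : ℝ) :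
    Measurable fun p : (E2 × E2) × E3 => kernelI S B tg cs δ p.1.1 p.1.2 p.2 := by
  have hs := (continuous_sensor S δ).measurable
  have hp := (continuous_searchPath S tg cs δ).measurable
  have hk := measurable_kernelForm hS hB
  simp only [kernelI_eq_form]
  have h1 : Measurable fun p : (E2 × E2) × E3 => (sensor S δ p.1.2, sensor S δ p.1.1,
    (S.c₀ * δ ^ 2)⁻¹, -searchPath S tg cs δ p.1.1 p.1.2, p.2) :=
    (hs.comp (measurable_snd.comp measurable_fst)).prodMk ((hs.comp (measurable_fst.comp
      measurable_fst)).prodMk (measurable_const.prodMk ((hp.comp measurable_fst).neg.prodMk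
        measurable_snd)))
  have h3 := hk.comp h1
  simpa only [Function.comp_def] using h3

theorem measurable_kernelII {S : Setup} (hS : S.Admissible) {B : ℝ} (hB : 0 < B) (tg cs δ : ℝ) :
    Measurable fun p : (E2 × E2) × E3 => kernelII S B tg cs δ p.1.1 p.1.2 p.2 := by
  have hs := (continuous_sensor S δ).measurable
  have hp := (continuous_searchPath S tg cs δ).measurable
  have hk := measurable_kernelForm hS hB
  simp only [kernelII_eq_form]
  have h2 : Measurable fun p : (E2 × E2) × E3 => (sensor S δ p.1.1, sensor S δ p.1.2,
    -(S.c₀ * δ ^ 2)⁻¹, searchPath S tg cs δ p.1.1 p.1.2, p.2) :=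
    (hs.comp (measurable_fst.comp measurable_fst)).prodMk ((hs.comp (measurable_snd.comp
      measurable_fst)).prodMk (measurable_const.prodMk ((hp.comp measurable_fst).prodMk
        measurable_snd)))
  have h4 := hk.comp h2
  simpa only [Function.comp_def] using h4

theorem measurable_pairKernel {S : Setup} (hS : S.Admissible) {B : ℝ} (hB : 0 < B) (tg cs δ : ℝ) :
    Measurable fun p : (E2 × E2) × E3 => pairKernel S B tg cs δ p.1.1 p.1.2 p.2 :=
  (measurable_kernelI hS hB tg cs δ).add (measurable_kernelII hS hB tg cs δ)

theorem kernel_bound {S : Setup} (hS : S.Admissible) {B : ℝ} (hB : 0 < B) (tg cs : ℝ) :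
    ∃ C : ℝ, ∀ δ u₁ u₂, ∀ z ∈ S.D, ‖kernelI S B tg cs δ u₁ u₂ z‖ ≤ C ∧
      ‖kernelII S B tg cs δ u₁ u₂ z‖ ≤ C := by
  obtain ⟨d, ρ, a, a', b, b', U, hb⟩ := exists_bounds hS
  obtain ⟨e, ρ', k, hs⟩ := exists_sourceBounds hS
  obtain ⟨f, hf⟩ := exists_schwartz_ddspec S hB
  obtain ⟨C, hC, hosc⟩ := osc_le f
  rw [hf] at hosc
  have hosc' : ∀ s, ‖osc (ddspec S B) s‖ ≤ C := fun s => (hosc s).trans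
    (div_le_self hC.le (by nlinarith [sq_nonneg s]))
  refine ⟨d⁻¹ * ((∫ y, |S.K y|) * ((d * e)⁻¹ * C)), fun δ u₁ u₂ z hz => ?_⟩
  rw [kernelI_eq_form, kernelII_eq_form]
  exact ⟨
    kernelForm_bound hS hb hs (sensor_two S δ _) (sensor_two S δ _) hz fun y _ => hosc' _,
    kernelForm_bound hS hb hs (sensor_two S δ _) (sensor_two S δ _) hz fun y _ => hosc' _⟩

theorem pairKernel_bound {S : Setup} (hS : S.Admissible) {B : ℝ} (hB : 0 < B) (tg cs : ℝ) :
    ∃ C : ℝ, ∀ δ u₁ u₂, ∀ z ∈ S.D, ‖pairKernel S B tg cs δ u₁ u₂ z‖ ≤ C := by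
  obtain ⟨C, hC⟩ := kernel_bound hS hB tg cs
  exact ⟨C + C, fun δ u₁ u₂ z hz => (norm_add_le _ _).trans
    (add_le_add (hC δ u₁ u₂ z hz).1 (hC δ u₁ u₂ z hz).2)⟩

theorem measurable_imagingKernel {S : Setup} (hS : S.Admissible) {B : ℝ} (hB : 0 < B) (tg cs δ : ℝ) :
    Measurable (imagingKernel S B tg cs δ) := by
  unfold imagingKernel
  have hm := measurable_pairKernel hS hB tg cs δ
  refine measurable_const.mul ?_
  refine (StronglyMeasurable.integral_prod_right (f := fun z : E3 => fun u₁ : E2 =>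
    ∫ u₂ in S.A₀, pairKernel S B tg cs δ u₁ u₂ z) ?_).measurable
  exact StronglyMeasurable.integral_prod_right (f := fun p : E3 × E2 => fun u₂ : E2 =>
    pairKernel S B tg cs δ p.2 u₂ p.1)
    (hm.comp (f := fun q : (E3 × E2) × E2 => ((q.1.2, q.2), q.1.1)) (by fun_prop)).stronglyMeasurable

theorem imagingKernel_bound {S : Setup} (hS : S.Admissible) {B : ℝ} (hB : 0 < B) (tg cs δ : ℝ) :
    ∃ C : ℝ, ∀ z ∈ S.D, ‖imagingKernel S B tg cs δ z‖ ≤ C := by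
  obtain ⟨C, hC⟩ := pairKernel_bound hS hB tg cs
  refine ⟨‖(kernelConst S δ : ℂ)‖ * (C * volume.real S.A₀ * volume.real S.A₀), fun z hz => ?_⟩
  unfold imagingKernel
  rw [norm_mul]
  refine mul_le_mul_of_nonneg_left ?_ (norm_nonneg _)
  exact norm_setIntegral_le_of_norm_le_const hS.A₀_bdd.measure_lt_top fun u₁ _ =>
    norm_setIntegral_le_of_norm_le_const hS.A₀_bdd.measure_lt_top fun u₂ _ => hC δ u₁ u₂ z hz

open scoped Pointwise in
theorem setIntegral_array (S : Setup) (ha : 0 < S.a₀) {δ : ℝ} (hδ : 0 < δ) (f : E2 → ℂ) :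
    ∫ x in S.array (δ ^ 2), f x = ((δ * S.a₀) ^ 2 : ℝ) • ∫ u in S.A₀, f ((δ * S.a₀) • u) := by
  have h0 : 0 < δ * S.a₀ := by positivity
  have hset : S.array (δ ^ 2) = (δ * S.a₀) • S.A₀ := by
    unfold Setup.array
    rw [Real.sqrt_sq hδ.le]; rfl
  have hfin : Module.finrank ℝ E2 = 2 := by simp
  rw [Measure.setIntegral_comp_smul_of_pos volume f S.A₀ h0, hfin, hset, smul_smul,
    mul_inv_cancel₀ (by positivity), one_smul]

open scoped Pointwise in
theorem volume_array (S : Setup) (ha : 0 < S.a₀) {δ : ℝ} (hδ : 0 < δ) :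
    volume.real (S.array (δ ^ 2)) = (δ * S.a₀) ^ 2 * volume.real S.A₀ := by
  have h0 : 0 < δ * S.a₀ := by positivity
  have hset : S.array (δ ^ 2) = (δ * S.a₀) • S.A₀ := by
    unfold Setup.array
    rw [Real.sqrt_sq hδ.le]; rfl
  have hfin : Module.finrank ℝ E2 = 2 := by simp
  rw [hset, Measure.real, Measure.addHaar_smul_of_nonneg _ h0.le, hfin, ENNReal.toReal_mul,
    ENNReal.toReal_ofReal (by positivity), Measure.real]

theorem crossCorr_sensor (S : Setup) (hc : S.c₀ ≠ 0) (B tg cs : ℝ) {δ : ℝ} (hδ : 0 < δ)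
    (ρ : E3 → ℝ) (u₁ u₂ : E2) :
    S.crossCorr B (δ ^ 2) ρ (travelTime cs (searchPoint cs tg) (sensor S δ u₂) +
      travelTime cs (searchPoint cs tg) (sensor S δ u₁)) (sensor S δ u₁) (sensor S δ u₂)
    = ((1 / (2 * Real.pi * S.c₀ ^ 2 * (δ ^ 2) ^ 2) * ((4 * Real.pi) ^ 3)⁻¹ : ℝ) : ℂ) *
      ((∫ z in S.D, (ρ z : ℂ) * kernelI S B tg cs δ u₁ u₂ z) +
        ∫ z in S.D, (ρ z : ℂ) * kernelII S B tg cs δ u₁ u₂ z) := by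
  have hτ : ∀ X : ℝ, X / (S.c₀ * δ ^ 2) - (travelTime cs (searchPoint cs tg) (sensor S δ u₂) +
      travelTime cs (searchPoint cs tg) (sensor S δ u₁)) / δ ^ 2
      = (S.c₀ * δ ^ 2)⁻¹ * (X - searchPath S tg cs δ u₁ u₂) := by
    intro X
    unfold travelTime searchPath
    field_simp
    ring
  have hτ2 : ∀ X : ℝ, -(X / (S.c₀ * δ ^ 2) + (travelTime cs (searchPoint cs tg) (sensor S δ u₂) +
      travelTime cs (searchPoint cs tg) (sensor S δ u₁)) / δ ^ 2)
      = (S.c₀ * δ ^ 2)⁻¹ * (-(X + searchPath S tg cs δ u₁ u₂)) := by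
    intro X
    unfold travelTime searchPath
    field_simp
    ring
  unfold Setup.crossCorr Setup.crossCorrI Setup.crossCorrII
  simp_rw [crossCorrI_inner, crossCorrII_inner, integral_const_mul, hτ, hτ2]
  rw [← mul_add, Complex.ofReal_mul, mul_assoc (_ : ℂ)]
  congr 1
  rw [mul_add, ← integral_const_mul, ← integral_const_mul]
  congr 1
  · refine integral_congr_ae (Eventually.of_forall fun z => ?_)
    beta_reduce
    rw [mul_left_comm, kernelI]
    congr 5
    ext y
    congr 4
    ring
  · refine integral_congr_ae (Eventually.of_forall fun z => ?_)
    beta_reduce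
    rw [mul_left_comm, kernelII]
    congr 5
    ext y
    congr 4
    ring

/-- Fubini between the array and the medium. The pair kernel is bounded on D, so an integrable
medium is enough. -/
theorem imaging_eq {S : Setup} (hS : S.Admissible) {B : ℝ} (hB : 0 < B) (tg cs : ℝ) {δ : ℝ}
    (hδ : 0 < δ) {ρ : E3 → ℝ} (hρ : IntegrableOn ρ S.D) :
    S.imaging B (δ ^ 2) ρ (searchPoint cs tg) cs
      = ∫ z in S.D, (ρ z : ℂ) * imagingKernel S B tg cs δ z := by
  have ha0 := hS.a₀_pos
  have hc0 := hS.c₀_pos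
  obtain ⟨C, hC⟩ := pairKernel_bound hS hB tg cs
  have hm := measurable_pairKernel hS hB tg cs δ
  have hA : IsFiniteMeasure (volume.restrict S.A₀) :=
    ⟨by simpa using hS.A₀_bdd.measure_lt_top⟩
  obtain ⟨C', hC'⟩ := kernel_bound hS hB tg cs
  have hmI : ∀ (u₁ u₂ : E2), Measurable (kernelI S B tg cs δ u₁ u₂) ∧
      Measurable (kernelII S B tg cs δ u₁ u₂) := by
    intro u₁ u₂
    have hk := measurable_kernelForm hS hB
    constructor
    · have : kernelI S B tg cs δ u₁ u₂ = _ := funext (kernelI_eq_form S B tg cs δ u₁ u₂)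
      rw [this]
      have := hk.comp (f := fun z : E3 => (sensor S δ u₂, sensor S δ u₁, (S.c₀ * δ ^ 2)⁻¹,
        -searchPath S tg cs δ u₁ u₂, z)) (by fun_prop)
      simpa only [Function.comp_def] using this
    · have : kernelII S B tg cs δ u₁ u₂ = _ := funext (kernelII_eq_form S B tg cs δ u₁ u₂)
      rw [this]
      have := hk.comp (f := fun z : E3 => (sensor S δ u₁, sensor S δ u₂, -(S.c₀ * δ ^ 2)⁻¹,
        searchPath S tg cs δ u₁ u₂, z)) (by fun_prop)
      simpa only [Function.comp_def] using this
  have hpair : ∀ u₁ u₂ : E2, (∫ z in S.D, (ρ z : ℂ) * kernelI S B tg cs δ u₁ u₂ z) +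
        (∫ z in S.D, (ρ z : ℂ) * kernelII S B tg cs δ u₁ u₂ z)
      = ∫ z in S.D, (ρ z : ℂ) * pairKernel S B tg cs δ u₁ u₂ z := by
    intro u₁ u₂
    have hρc : IntegrableOn (fun z => (ρ z : ℂ)) S.D := hρ.ofReal
    rw [← integral_add]
    · simp only [pairKernel, mul_add]
    · refine Integrable.mul_bdd (c := C') hρc (hmI u₁ u₂).1.aestronglyMeasurable ?_
      filter_upwards [ae_restrict_mem hS.D_meas] with z hz using (hC' δ u₁ u₂ z hz).1
    · refine Integrable.mul_bdd (c := C') hρc (hmI u₁ u₂).2.aestronglyMeasurable ?_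
      filter_upwards [ae_restrict_mem hS.D_meas] with z hz using (hC' δ u₁ u₂ z hz).2
  set H : (E2 × E2) × E3 → ℂ := fun q => (ρ q.2 : ℂ) * pairKernel S B tg cs δ q.1.1 q.1.2 q.2 with hH
  have hint : Integrable H (((volume.restrict S.A₀).prod (volume.restrict S.A₀)).prod
      (volume.restrict S.D)) := by
    have h1 : Integrable (fun q : (E2 × E2) × E3 => (ρ q.2 : ℂ))
        (((volume.restrict S.A₀).prod (volume.restrict S.A₀)).prod (volume.restrict S.D)) :=
      (Integrable.comp_snd (show Integrable (fun z => (ρ z : ℂ)) (volume.restrict S.D) from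
        hρ.ofReal) _)
    refine h1.mul_bdd (c := C) hm.aestronglyMeasurable ?_
    rw [Measure.prod_restrict, Measure.prod_restrict]
    filter_upwards [ae_restrict_mem ((hS.A₀_meas.prod hS.A₀_meas).prod hS.D_meas)] with q hq
    exact hC δ q.1.1 q.1.2 q.2 hq.2
  have hsens : ∀ u : E2, embed ((δ * S.a₀) • u) = sensor S δ u := fun u => rfl
  unfold Setup.imaging
  rw [volume_array S ha0 hδ, setIntegral_array S ha0 hδ]
  simp_rw [setIntegral_array S ha0 hδ, hsens, crossCorr_sensor S hc0.ne' B tg cs hδ, hpair]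
  simp_rw [Complex.real_smul, integral_const_mul]
  have e1 : ∫ u₁ in S.A₀, ∫ u₂ in S.A₀, ∫ z in S.D, (ρ z : ℂ) * pairKernel S B tg cs δ u₁ u₂ z
      = ∫ z in S.D, (ρ z : ℂ) * ∫ u₁ in S.A₀, ∫ u₂ in S.A₀, pairKernel S B tg cs δ u₁ u₂ z := by
    have h1 : ∫ u₁ in S.A₀, ∫ u₂ in S.A₀, ∫ z in S.D, H ((u₁, u₂), z)
        = ∫ p : E2 × E2, (∫ z in S.D, H (p, z)) ∂((volume.restrict S.A₀).prod (volume.restrict S.A₀)) :=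
      (integral_prod _ hint.integral_prod_left).symm
    refine h1.trans ?_
    rw [integral_integral_swap hint]
    have h2 : Integrable (fun p : (E2 × E2) × E3 => pairKernel S B tg cs δ p.1.1 p.1.2 p.2)
        (((volume.restrict S.A₀).prod (volume.restrict S.A₀)).prod (volume.restrict S.D)) := by
      have : IsFiniteMeasure (volume.restrict S.D) := ⟨by simpa using hS.D_bdd.measure_lt_top⟩
      refine Integrable.of_bound hm.aestronglyMeasurable C ?_
      rw [Measure.prod_restrict, Measure.prod_restrict]
      filter_upwards [ae_restrict_mem ((hS.A₀_meas.prod hS.A₀_meas).prod hS.D_meas)] with q hq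
      exact hC δ q.1.1 q.1.2 q.2 hq.2
    refine integral_congr_ae ?_
    filter_upwards [h2.prod_left_ae] with z hz
    simp only [hH]
    rw [integral_const_mul, integral_prod _ hz]
  rw [e1]
  unfold imagingKernel
  have hA0 : 0 < volume.real S.A₀ :=
    ENNReal.toReal_pos hS.A₀_pos.ne' hS.A₀_bdd.measure_lt_top.ne
  have hcoef : (((S.N : ℝ) ^ 2 / ((δ * S.a₀) ^ 2 * volume.real S.A₀) ^ 2 : ℝ) : ℂ) *
      (((δ * S.a₀) ^ 2 : ℝ) * (((δ * S.a₀) ^ 2 : ℝ) *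
        ((1 / (2 * Real.pi * S.c₀ ^ 2 * (δ ^ 2) ^ 2) * ((4 * Real.pi) ^ 3)⁻¹ : ℝ) : ℂ)))
      = (kernelConst S δ : ℂ) := by
    rw [← Complex.ofReal_mul, ← Complex.ofReal_mul, ← Complex.ofReal_mul, kernelConst]
    congr 1
    have := Real.pi_pos
    field_simp
  rw [← hcoef, ← integral_const_mul, ← integral_const_mul, ← integral_const_mul,
    ← integral_const_mul]
  refine integral_congr_ae (Eventually.of_forall fun z => ?_)
  beta_reduce
  ring

/-! ### Dispersion of the remainder -/

/-- The profile `1/(1 + x²)`. -/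
def wgt (x : ℝ) : ENNReal := ENNReal.ofReal ((1 + x ^ 2)⁻¹)

theorem measurable_wgt : Measurable wgt := by
  unfold wgt; fun_prop

theorem wgt_le_one (x : ℝ) : wgt x ≤ 1 := by
  unfold wgt
  rw [← ENNReal.ofReal_one]
  exact ENNReal.ofReal_le_ofReal (inv_le_one_of_one_le₀ (by nlinarith [sq_nonneg x]))

theorem wgt_anti {x y : ℝ} (h : |x| ≤ |y|) : wgt y ≤ wgt x := by
  unfold wgt
  have : x ^ 2 ≤ y ^ 2 := sq_le_sq.2 h
  gcongr

theorem lintegral_wgt_affine {y : ℝ} (hy : 0 < y) (N : ℝ) :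
    ∫⁻ q, wgt (y * q - N) = ENNReal.ofReal (Real.pi / y) := by
  have h0 : Integrable (fun x : ℝ => (1 + x ^ 2)⁻¹) := integrable_inv_one_add_sq
  have h1 : Integrable (fun x : ℝ => (1 + (y * x - N) ^ 2)⁻¹) := by
    have := (h0.comp_sub_right N).comp_mul_left' hy.ne'
    exact this
  unfold wgt
  rw [← ofReal_integral_eq_lintegral_ofReal h1 (Eventually.of_forall fun x => by positivity)]
  congr 1
  rw [Measure.integral_comp_mul_left (fun x : ℝ => (1 + (x - N) ^ 2)⁻¹),
    integral_sub_right_eq_self (fun x : ℝ => (1 + x ^ 2)⁻¹), integral_univ_inv_one_add_sq,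
    abs_of_pos (inv_pos.2 hy), smul_eq_mul, div_eq_inv_mul]

/-- Eliminating q between yq - N and y'q - N gives N(y - y') = y'(yq - N) - y(y'q - N). Hence the
two arguments cannot both be small, and the larger one is at least N|y - y'|/4. -/
theorem wgt_mul_le {y y' : ℝ} (hy : 0 < y) (hy2 : y ≤ 2) (hy' : 0 < y') (hy2' : y' ≤ 2) {N : ℝ}
    (hN : 0 ≤ N) (q : ℝ) : wgt (y * q - N) * wgt (y' * q - N) ≤
      (wgt (y * q - N) + wgt (y' * q - N)) * wgt (N * |y - y'| / 4) := by
  have key : N * |y - y'| ≤ 2 * (|y * q - N| + |y' * q - N|) := by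
    have e : N * (y - y') = y' * (y * q - N) - y * (y' * q - N) := by ring
    calc N * |y - y'| = |N * (y - y')| := by rw [abs_mul, abs_of_nonneg hN]
      _ ≤ |y' * (y * q - N)| + |y * (y' * q - N)| := by rw [e]; exact abs_sub _ _
      _ = y' * |y * q - N| + y * |y' * q - N| := by
        rw [abs_mul, abs_mul, abs_of_pos hy, abs_of_pos hy']
      _ ≤ _ := by nlinarith [abs_nonneg (y * q - N), abs_nonneg (y' * q - N)]
  have hm : |N * |y - y'| / 4| = N * |y - y'| / 4 := abs_of_nonneg (by positivity)
  rcases le_total |y * q - N| |y' * q - N| with h | h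
  · have h1 : wgt (y' * q - N) ≤ wgt (N * |y - y'| / 4) := wgt_anti (by rw [hm]; linarith)
    calc _ ≤ wgt (y * q - N) * wgt (N * |y - y'| / 4) := by gcongr
      _ ≤ _ := by gcongr; exact le_self_add
  · have h1 : wgt (y * q - N) ≤ wgt (N * |y - y'| / 4) := wgt_anti (by rw [hm]; linarith)
    calc _ ≤ wgt (N * |y - y'| / 4) * wgt (y' * q - N) := by gcongr
      _ = wgt (y' * q - N) * wgt (N * |y - y'| / 4) := mul_comm _ _
      _ ≤ _ := by gcongr; exact le_add_self

theorem tendsto_wgt_atTop {a : ℝ} (ha : 0 < a) : Tendsto (fun N : ℝ => wgt (N * a / 4)) atTop (𝓝 0) := by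
  unfold wgt
  rw [← ENNReal.ofReal_zero]
  refine ENNReal.tendsto_ofReal (Tendsto.inv_tendsto_atTop ?_)
  refine tendsto_atTop_add_const_left _ _ ?_
  refine (tendsto_pow_atTop (by norm_num)).comp ?_
  exact (tendsto_id.atTop_mul_const ha).atTop_div_const (by norm_num)

theorem pathExcess_le {τ : ℝ} (hτ : 0 ≤ τ) (α : ℝ) : 1 + pathExcess τ α ≤ 2 := by
  have : sideLength 1 τ α ≤ 1 + τ := by
    unfold sideLength
    refine Real.sqrt_le_iff.2 ⟨by positivity, ?_⟩
    nlinarith [Real.cos_le_one α]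
  unfold pathExcess; linarith

/-- For a fixed distance τ > 0 the excess determines cos α and therefore α, so each fibre of the
level set has at most one point. -/
theorem volume_level_pathExcess (c T v : ℝ) :
    volume (remSet c T ∩ {p : ℝ × ℝ | pathExcess p.1 p.2 = v}) = 0 := by
  have hm : MeasurableSet (remSet c T ∩ {p : ℝ × ℝ | pathExcess p.1 p.2 = v}) :=
    (measurableSet_remSet c T).inter (continuous_pathExcess.measurable (measurableSet_singleton v))
  rw [Measure.volume_eq_prod, Measure.measure_prod_null hm]
  refine Eventually.of_forall fun τ => ?_
  refine Set.Subsingleton.measure_zero (fun α hα β hβ => ?_) _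
  have hτ : 0 < τ := hα.1.1.1.1
  have h1 : pathExcess τ α = v := hα.2
  have h2 : pathExcess τ β = v := hβ.2
  have h3 : sideLength 1 τ α ^ 2 = sideLength 1 τ β ^ 2 := by
    congr 1
    unfold pathExcess at h1 h2
    linarith
  rw [sideLength_sq, sideLength_sq] at h3
  have h4 : Real.cos α = Real.cos β := by
    have : τ * (Real.cos α - Real.cos β) = 0 := by linarith
    rcases mul_eq_zero.1 this with h | h
    · exact (hτ.ne' h).elim
    · linarith
  exact Real.injOn_cos ⟨hα.1.1.2.1.le, hα.1.1.2.2.le⟩ ⟨hβ.1.1.2.1.le, hβ.1.1.2.2.le⟩ h4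

/-- The energy of a superposition of profiles with distinct speeds vanishes far away. -/
theorem tendsto_dispersion {c : ℝ} (hc : 0 < c) (T : ℝ) :
    Tendsto (fun N : ℝ => ∫⁻ q, (∫⁻ p in remSet c T, wgt ((1 + pathExcess p.1 p.2) * q - N)) ^ 2)
      atTop (𝓝 0) := by
  set m := volume.restrict (remSet c T) with hm
  have hfin : IsFiniteMeasure m := ⟨by simpa [hm] using volume_remSet_lt_top c T⟩
  have hpe : Measurable fun p : ℝ × ℝ => pathExcess p.1 p.2 := continuous_pathExcess.measurable
  have hmem : ∀ᵐ p ∂m, p ∈ remSet c T := ae_restrict_mem (measurableSet_remSet c T)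
  set Y : ℝ × ℝ → ℝ := fun p => 1 + pathExcess p.1 p.2 with hY
  have hYm : Measurable Y := measurable_const.add hpe
  have hYb : ∀ p ∈ remSet c T, 0 < Y p ∧ c ≤ Y p ∧ Y p ≤ 2 := fun p hp =>
    ⟨hc.trans_le hp.2, hp.2, pathExcess_le hp.1.1.1.le _⟩
  -- The square is a double integral over pairs of source positions. Integrating in q first, with
  -- `wgt_mul_le`, leaves a weight that tends to 0 off the diagonal of equal speeds.
  have hup : ∀ N : ℝ, 0 ≤ N → ∫⁻ q, (∫⁻ p, wgt (Y p * q - N) ∂m) ^ 2 ≤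
      ENNReal.ofReal (2 * Real.pi / c) * ∫⁻ z, wgt (N * |Y z.1 - Y z.2| / 4) ∂(m.prod m) := by
    intro N hN
    have hw : Measurable fun z : (ℝ × (ℝ × ℝ)) => wgt (Y z.2 * z.1 - N) :=
      measurable_wgt.comp (by fun_prop)
    have e1 : ∀ q, (∫⁻ p, wgt (Y p * q - N) ∂m) ^ 2
        = ∫⁻ z, wgt (Y z.1 * q - N) * wgt (Y z.2 * q - N) ∂(m.prod m) := by
      intro q
      have hwq : Measurable fun p => wgt (Y p * q - N) := measurable_wgt.comp (by fun_prop)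
      rw [sq, lintegral_prod_mul hwq.aemeasurable hwq.aemeasurable]
    have hz1 : Measurable fun x : ℝ × ((ℝ × ℝ) × (ℝ × ℝ)) => wgt (Y x.2.1 * x.1 - N) :=
      measurable_wgt.comp (by fun_prop)
    have hz2 : Measurable fun x : ℝ × ((ℝ × ℝ) × (ℝ × ℝ)) => wgt (Y x.2.2 * x.1 - N) :=
      measurable_wgt.comp (by fun_prop)
    have hz3 : Measurable fun z : (ℝ × ℝ) × (ℝ × ℝ) => wgt (N * |Y z.1 - Y z.2| / 4) :=
      measurable_wgt.comp (by fun_prop)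
    simp_rw [e1]
    rw [lintegral_lintegral_swap (hz1.mul hz2).aemeasurable, ← lintegral_const_mul _ hz3]
    refine lintegral_mono_ae ?_
    have hmem2 : ∀ᵐ z ∂(m.prod m), z.1 ∈ remSet c T ∧ z.2 ∈ remSet c T := by
      rw [hm, Measure.prod_restrict]
      filter_upwards [ae_restrict_mem ((measurableSet_remSet c T).prod (measurableSet_remSet c T))]
        with z hz using hz
    filter_upwards [hmem2] with z hz
    obtain ⟨a1, a2, a3⟩ := hYb _ hz.1
    obtain ⟨b1, b2, b3⟩ := hYb _ hz.2
    have w1 : Measurable fun q => wgt (Y z.1 * q - N) := measurable_wgt.comp (by fun_prop)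
    have w2 : Measurable fun q => wgt (Y z.2 * q - N) := measurable_wgt.comp (by fun_prop)
    calc _ ≤ ∫⁻ q, (wgt (Y z.1 * q - N) + wgt (Y z.2 * q - N)) * wgt (N * |Y z.1 - Y z.2| / 4) :=
          lintegral_mono fun q => wgt_mul_le a1 a3 b1 b3 hN q
      _ = (ENNReal.ofReal (Real.pi / Y z.1) + ENNReal.ofReal (Real.pi / Y z.2)) *
            wgt (N * |Y z.1 - Y z.2| / 4) := by
          rw [lintegral_mul_const _ (by exact w1.add w2 : Measurable fun q =>
            wgt (Y z.1 * q - N) + wgt (Y z.2 * q - N)), lintegral_add_left w1, lintegral_wgt_affine a1,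
            lintegral_wgt_affine b1]
      _ ≤ _ := by
          gcongr
          have := Real.pi_pos
          rw [← ENNReal.ofReal_add (by positivity) (by positivity)]
          refine ENNReal.ofReal_le_ofReal ?_
          calc Real.pi / Y z.1 + Real.pi / Y z.2 ≤ Real.pi / c + Real.pi / c := by gcongr
            _ = _ := by ring
  have hlim : Tendsto (fun N : ℝ => ∫⁻ z, wgt (N * |Y z.1 - Y z.2| / 4) ∂(m.prod m)) atTop (𝓝 0) := by
    have h := tendsto_lintegral_filter_of_dominated_convergence (μ := m.prod m) (l := (atTop : Filter ℝ))
      (F := fun N z => wgt (N * |Y z.1 - Y z.2| / 4)) (f := fun _ => 0) (fun _ => 1)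
      (Eventually.of_forall fun N => measurable_wgt.comp (by fun_prop))
      (Eventually.of_forall fun N => Eventually.of_forall fun z => wgt_le_one _) (by simp) ?_
    · simpa using h
    -- Pairs with equal speeds form a null set by `volume_level_pathExcess`.
    have hne : ∀ᵐ z ∂(m.prod m), Y z.1 ≠ Y z.2 := by
      have hms : MeasurableSet {z : (ℝ × ℝ) × (ℝ × ℝ) | Y z.1 ≠ Y z.2} :=
        (measurableSet_eq_fun (by fun_prop) (by fun_prop)).compl
      rw [Measure.ae_prod_iff_ae_ae hms]
      refine Eventually.of_forall fun p => ?_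
      rw [ae_iff]
      have := volume_level_pathExcess c T (pathExcess p.1 p.2)
      rw [hm, Measure.restrict_apply' (measurableSet_remSet c T), Set.inter_comm]
      convert this using 3
      ext p'
      simp [hY, eq_comm]
    filter_upwards [hne] with z hz
    exact tendsto_wgt_atTop (abs_pos.2 (sub_ne_zero.2 hz))
  have hlim' := ENNReal.Tendsto.const_mul (a := ENNReal.ofReal (2 * Real.pi / c)) hlim
    (Or.inr ENNReal.ofReal_ne_top)
  rw [mul_zero] at hlim'
  refine tendsto_of_tendsto_of_tendsto_of_le_of_le' tendsto_const_nhds hlim'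
    (Eventually.of_forall fun _ => bot_le) ?_
  filter_upwards [eventually_ge_atTop 0] with N hN using hup N hN

/-! ### Coordinates around the virtual guide star -/

/-- The point with rescaled offset `η` from the guide star, at scale `δ = √ε`. -/
def scalePt (S : Setup) (tg δ : ℝ) (η : E3) : E3 :=
  S.guideStar tg + mk3 (δ • hor η) (δ ^ 2 * η 2)

theorem scalePt_two (S : Setup) (tg δ : ℝ) (η : E3) :
    scalePt S tg δ η 2 = S.c₀ * tg + δ ^ 2 * η 2 := by
  simp [scalePt, Setup.guideStar, mk3]

theorem hor_scalePt (S : Setup) (tg δ : ℝ) (η : E3) : hor (scalePt S tg δ η) = δ • hor η := by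
  ext i; fin_cases i <;> simp [scalePt, Setup.guideStar, mk3, hor]

theorem hor_sub_sensor (S : Setup) (δ : ℝ) (u : E2) (z : E3) :
    hor (z - sensor S δ u) = hor z - (δ * S.a₀) • u := by
  ext i; fin_cases i <;> simp [sensor, embed, hor]

theorem continuous_scalePt (S : Setup) (tg δ : ℝ) : Continuous (scalePt S tg δ) := by
  unfold scalePt mk3 hor; fun_prop

theorem tendsto_scalePt (S : Setup) (tg : ℝ) (η : E3) :
    Tendsto (fun δ => scalePt S tg δ η) (𝓝 0) (𝓝 (S.guideStar tg)) := by
  have h : Continuous fun δ : ℝ => scalePt S tg δ η := by unfold scalePt mk3 hor; fun_prop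
  have := h.tendsto 0
  convert this using 2
  ext i; fin_cases i <;> simp [scalePt, mk3, hor]

theorem lintegral_comp_mul_real (H : ℝ → ENNReal) {c : ℝ} (hc : 0 < c) :
    ∫⁻ x, H x = ENNReal.ofReal c * ∫⁻ t, H (c * t) := by
  have hemb : MeasurableEmbedding (fun x : ℝ => c • x) :=
    (Homeomorph.smulOfNeZero c hc.ne').measurableEmbedding
  have h := hemb.lintegral_map (μ := volume) H
  rw [Measure.map_addHaar_smul volume hc.ne', lintegral_smul_measure, smul_eq_mul,
    Module.finrank_self, pow_one, abs_of_pos (by positivity)] at h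
  simp only [smul_eq_mul] at h
  rw [← h, ← mul_assoc, ← ENNReal.ofReal_mul hc.le, mul_inv_cancel₀ hc.ne']
  simp

theorem lintegral_scalePt (S : Setup) (tg : ℝ) {δ : ℝ} (hδ : 0 < δ) {F : E3 → ENNReal}
    (hF : Measurable F) : ∫⁻ z, F z = ENNReal.ofReal (δ ^ 4) * ∫⁻ η, F (scalePt S tg δ η) := by
  rw [← lintegral_add_left_eq_self F (S.guideStar tg)]
  have hF' : Measurable fun z => F (S.guideStar tg + z) := hF.comp (measurable_const_add _)
  have h2 : Measurable fun η => F (scalePt S tg δ η) := hF.comp (continuous_scalePt S tg δ).measurable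
  rw [lintegral_mk3 hF', lintegral_mk3 h2, lintegral_comp_smul_E2 _ hδ]
  simp_rw [fun x : E2 => lintegral_comp_mul_real (fun t => F (S.guideStar tg + mk3 (δ • x) t))
    (sq_pos_of_pos hδ)]
  rw [lintegral_const_mul' _ _ ENNReal.ofReal_ne_top, ← mul_assoc, ← ENNReal.ofReal_mul (by positivity)]
  congr 2
  ring

theorem lintegral_sq_le {X : Type*} [MeasurableSpace X] (m : Measure X) {g : X → ENNReal}
    (hg : AEMeasurable g m) : (∫⁻ x, g x ∂m) ^ 2 ≤ m Set.univ * ∫⁻ x, g x ^ 2 ∂m := by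
  have h2 := ENNReal.lintegral_mul_le_Lp_mul_Lq m Real.HolderConjugate.two_two
    hg (aemeasurable_const (b := (1 : ENNReal)))
  simp only [Pi.mul_apply, mul_one, ENNReal.one_rpow, lintegral_one] at h2
  have h3 : ∀ y : ENNReal, (y ^ (1 / 2 : ℝ)) ^ 2 = y := by
    intro y
    rw [← ENNReal.rpow_natCast, ← ENNReal.rpow_mul]; norm_num
  refine (pow_le_pow_left' h2 2).trans_eq ?_
  rw [mul_pow, h3, h3, mul_comm]
  simp

/-- Distance between a sensor and a point near the guide star. -/
theorem norm_scalePt_sub_sensor (S : Setup) (tg δ : ℝ) (u : E2) {η : E3}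
    (h : 0 < S.c₀ * tg + δ ^ 2 * η 2) :
    ‖scalePt S tg δ η - sensor S δ u‖ = S.c₀ * tg + δ ^ 2 * (η 2 + ‖hor η - S.a₀ • u‖ ^ 2 /
      (‖scalePt S tg δ η - sensor S δ u‖ + (S.c₀ * tg + δ ^ 2 * η 2))) := by
  have h1 : ‖scalePt S tg δ η - sensor S δ u‖ ^ 2
      = (S.c₀ * tg + δ ^ 2 * η 2) ^ 2 + δ ^ 2 * ‖hor η - S.a₀ • u‖ ^ 2 := by
    rw [norm_sq_E3, norm_sq_E2]
    simp [scalePt, Setup.guideStar, sensor, embed, mk3, hor]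
    ring
  have h0 := norm_nonneg (scalePt S tg δ η - sensor S δ u)
  generalize ‖scalePt S tg δ η - sensor S δ u‖ = r at *
  have : 0 < r + (S.c₀ * tg + δ ^ 2 * η 2) := by linarith
  field_simp
  linarith

/-- The slice at scale `δ` in the coordinates around the guide star. -/
def localSlice (S : Setup) (B tg cs δ σ : ℝ) (u₁ : E2) (η : E3) : ℂ :=
  S.D.indicator (slice S B tg cs δ σ u₁) (scalePt S tg δ η)

theorem measurable_localSlice {S : Setup} (hS : S.Admissible) {B : ℝ} (hB : 0 < B) (tg cs δ : ℝ) :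
    Measurable fun p : ℝ × E2 × E3 => localSlice S B tg cs δ p.1 p.2.1 p.2.2 := by
  have h1 := measurable_slice S hB tg cs δ
  have hc := continuous_scalePt S tg δ
  have h2 : Measurable fun p : ℝ × E2 × E3 => (p.1, p.2.1, scalePt S tg δ p.2.2) :=
    Continuous.measurable (by fun_prop)
  have h3 : MeasurableSet {p : ℝ × E2 × E3 | scalePt S tg δ p.2.2 ∈ S.D} :=
    (show Measurable fun p : ℝ × E2 × E3 => scalePt S tg δ p.2.2 from
      Continuous.measurable (by fun_prop)) hS.D_meas
  have := (h1.comp h2).indicator h3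
  convert this using 2 with p
  simp only [localSlice, Set.indicator]
  rfl

/-- A transcription of `slice_energy`: the Jacobian δ⁴ of the local coordinates cancels the δ⁴ of
the energy. The sensor is displaced from the axis by at most δa₀U, which shifts the radius R by a₀U.
-/
theorem localSlice_tail {S : Setup} (hS : S.Admissible) {B tg cs c : ℝ} (hB : 0 < B) (htg : 0 < tg)
    (hcs : 0 < cs) (hc : 0 < c) : ∃ τ : ℝ → ENNReal, Tendsto τ atTop (𝓝 0) ∧ (∀ R, τ R ≠ ⊤) ∧
      ∀ δ, 0 < δ → δ ≤ 1 → ∀ u₁ ∈ S.A₀, ∀ σ, c ≤ 1 + σ → ∀ R,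
      ∫⁻ η in {η | R < ‖hor η‖}, ‖localSlice S B tg cs δ σ u₁ η‖ₑ ^ 2 ≤ τ R := by
  obtain ⟨T, C, m, hm, hTm, hTi, hC, hT⟩ := slice_energy hS hB htg hcs hc
  obtain ⟨d, ρ, a, a', b, b', U, hb⟩ := exists_bounds hS
  have hhor := continuous_hor
  have ha0 := hS.a₀_pos
  refine ⟨fun R => C * ∫⁻ ζ in {ζ | R - S.a₀ * U < m * ‖ζ‖}, T ζ, ?_, fun R => ?_, ?_⟩
  · have hms : ∀ R : ℝ, MeasurableSet {ζ : E2 | R - S.a₀ * U < m * ‖ζ‖} := fun R =>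
      measurableSet_lt measurable_const (by fun_prop)
    have ht : Tendsto (fun R : ℝ => ∫⁻ ζ, {ζ : E2 | R - S.a₀ * U < m * ‖ζ‖}.indicator T ζ) atTop
        (𝓝 (∫⁻ _ : E2, 0)) := by
      refine tendsto_lintegral_filter_of_dominated_convergence T
        (Eventually.of_forall fun R => hTm.indicator (hms R))
        (Eventually.of_forall fun R => Eventually.of_forall fun ζ => Set.indicator_le_self _ _ _)
        hTi.ne (Eventually.of_forall fun ζ => tendsto_const_nhds.congr' ?_)
      filter_upwards [eventually_ge_atTop (m * ‖ζ‖ + S.a₀ * U)] with R hR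
      rw [Set.indicator_of_notMem]
      simp only [Set.mem_ofPred_eq, not_lt]; linarith
    have := ENNReal.Tendsto.const_mul ht (Or.inr hC)
    simpa only [lintegral_zero, mul_zero, lintegral_indicator (hms _)] using this
  · exact ENNReal.mul_ne_top hC ((setLIntegral_le_lintegral _ _).trans_lt hTi).ne
  · intro δ hδ hδ1 u₁ hu σ hσ R
    have h1 := hT δ hδ hδ1 u₁ hu σ hσ (R - S.a₀ * U)
    have hsl : Measurable (slice S B tg cs δ σ u₁) :=
      (measurable_slice S hB tg cs δ).comp (f := fun z : E3 => (σ, u₁, z)) (by fun_prop)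
    have hms : MeasurableSet (S.D ∩ {z : E3 | R * δ < ‖hor z‖}) :=
      hS.D_meas.inter (measurableSet_lt measurable_const (by fun_prop))
    have h2 := lintegral_scalePt S tg hδ
      (F := (S.D ∩ {z : E3 | R * δ < ‖hor z‖}).indicator fun z => ‖slice S B tg cs δ σ u₁ z‖ₑ ^ 2)
      ((hsl.enorm.pow_const 2).indicator hms)
    rw [lintegral_indicator hms] at h2
    have h3 : ∫⁻ η, (S.D ∩ {z : E3 | R * δ < ‖hor z‖}).indicator
        (fun z => ‖slice S B tg cs δ σ u₁ z‖ₑ ^ 2) (scalePt S tg δ η)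
        = ∫⁻ η in {η | R < ‖hor η‖}, ‖localSlice S B tg cs δ σ u₁ η‖ₑ ^ 2 := by
      rw [← lintegral_indicator (measurableSet_lt measurable_const (by fun_prop))]
      refine lintegral_congr fun η => ?_
      have he : R * δ < ‖hor (scalePt S tg δ η)‖ ↔ R < ‖hor η‖ := by
        rw [hor_scalePt, norm_smul, Real.norm_eq_abs, abs_of_pos hδ, mul_comm]
        exact mul_lt_mul_iff_right₀ hδ
      unfold localSlice
      by_cases hD : scalePt S tg δ η ∈ S.D <;> by_cases hR : R < ‖hor η‖ <;>
        simp [Set.indicator, hD, hR, he]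
    rw [h3] at h2
    have h4 : ∫⁻ z in S.D ∩ {z | R * δ < ‖hor z‖}, ‖slice S B tg cs δ σ u₁ z‖ₑ ^ 2 ≤
        ∫⁻ z in S.D ∩ {z | (R - S.a₀ * U) * δ < ‖hor (z - sensor S δ u₁)‖},
          ‖slice S B tg cs δ σ u₁ z‖ₑ ^ 2 := by
      refine lintegral_mono_set (Set.inter_subset_inter_right _ fun z hz => ?_)
      simp only [Set.mem_ofPred_eq] at hz ⊢
      rw [hor_sub_sensor]
      have h5 := norm_sub_norm_le (hor z) ((δ * S.a₀) • u₁)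
      rw [norm_smul, Real.norm_eq_abs, abs_of_pos (by positivity : 0 < δ * S.a₀)] at h5
      have h6 : δ * S.a₀ * ‖u₁‖ ≤ δ * S.a₀ * U :=
        mul_le_mul_of_nonneg_left (hb.array u₁ hu) (by positivity)
      linarith
    have h7 := (h2.symm.le.trans h4).trans h1
    have hne : ENNReal.ofReal (δ ^ 4) ≠ 0 := by simp; positivity
    rw [mul_comm C, mul_assoc] at h7
    exact (ENNReal.mul_le_mul_iff_right hne ENNReal.ofReal_ne_top).1 h7

/-- A dilation and a bounded shift of the argument change the profile 1/(1 + Q²) only by a constant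
factor. -/
theorem one_add_sq_le {Q c E M : ℝ} (hc : 0 < c) (hE : |E| ≤ M) :
    1 + Q ^ 2 ≤ (1 + 2 * c ^ 2 + 2 * c ^ 2 * M ^ 2) * (1 + (Q / c + E) ^ 2) := by
  have hE : E ^ 2 ≤ M ^ 2 := sq_le_sq' (by linarith [(abs_le.1 hE).1]) (abs_le.1 hE).2
  have h2 : Q = c * ((Q / c + E) - E) := by field_simp; ring
  generalize Q / c + E = y at h2 ⊢
  rw [h2]
  have h3 : (y - E) ^ 2 ≤ 2 * y ^ 2 + 2 * M ^ 2 := by nlinarith [sq_nonneg (y + E)]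
  have h4 : c ^ 2 * (y - E) ^ 2 ≤ c ^ 2 * (2 * y ^ 2 + 2 * M ^ 2) :=
    mul_le_mul_of_nonneg_left h3 (by positivity)
  have h5 : 0 ≤ c ^ 2 * M ^ 2 * y ^ 2 := by positivity
  have h6 : 0 ≤ y ^ 2 := by positivity
  have h7 : 0 ≤ c ^ 2 := by positivity
  rw [mul_pow]
  linarith

/-- At bounded horizontal offset the distance to a sensor differs from the height by O(δ²), and so
does the search distance from c_s t_g. Divided by c₀δ², the phase is thus an explicit affine
function of η₃ plus a bounded error, absorbed by `one_add_sq_le`. For σ < 1 the centre of the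
profile drifts to infinity as δ → 0; for σ = 1 it does not move. -/
theorem localSlice_le {S : Setup} (hS : S.Admissible) {B tg cs : ℝ} (hB : 0 < B) (htg : 0 < tg)
    (hcs : 0 < cs) (R : ℝ) : ∃ C : ENNReal, C ≠ ⊤ ∧ ∀ δ, 0 < δ → δ ≤ 1 → ∀ u₁ ∈ S.A₀, ∀ σ, |σ| ≤ 1 →
      ∀ η, ‖hor η‖ ≤ R → ‖localSlice S B tg cs δ σ u₁ η‖ₑ ≤
        C * wgt ((1 + σ) * (η 2 + S.c₀ * tg / δ ^ 2) - 2 * (S.c₀ * tg) / δ ^ 2) := by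
  obtain ⟨Co, hCo, hosc⟩ := exists_osc_dspec_bound S hB
  obtain ⟨d, ρ, a, a', b, b', U, hb⟩ := exists_bounds hS
  have ha0 := hS.a₀_pos
  have hc0 := hS.c₀_pos
  have hd := hb.d_pos
  have hU := hb.U_nonneg
  have hl : 0 < cs * tg := by positivity
  set M : ℝ := (2 * ((|R| + S.a₀ * U) ^ 2 / d) + S.c₀ / cs * (2 * (S.a₀ ^ 2 * U ^ 2 / (cs * tg)))) / S.c₀
    with hM
  have hM0 : 0 ≤ M := by positivity
  set K : ℝ := 1 + 2 * S.c₀ ^ 2 + 2 * S.c₀ ^ 2 * M ^ 2 with hK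
  have hK0 : 0 < K := by positivity
  refine ⟨ENNReal.ofReal (d⁻¹ * (Co * K) * volume.real S.A₀), ENNReal.ofReal_ne_top, ?_⟩
  intro δ hδ hδ1 u₁ hu₁ σ hσ η hη
  by_cases hD : scalePt S tg δ η ∈ S.D
  swap
  · simp [localSlice, hD]
  set Q := (1 + σ) * (η 2 + S.c₀ * tg / δ ^ 2) - 2 * (S.c₀ * tg) / δ ^ 2 with hQ
  have hz := hb.height _ hD
  rw [scalePt_two] at hz
  have hpos : 0 < S.c₀ * tg + δ ^ 2 * η 2 := hd.trans_le hz
  have hdist : ∀ u ∈ S.A₀, ∃ e, 0 ≤ e ∧ e ≤ (|R| + S.a₀ * U) ^ 2 / d ∧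
      ‖scalePt S tg δ η - sensor S δ u‖ = S.c₀ * tg + δ ^ 2 * (η 2 + e) := by
    intro u hu
    refine ⟨_, ?_, ?_, norm_scalePt_sub_sensor S tg δ u hpos⟩
    · positivity
    · have h1 : ‖hor η - S.a₀ • u‖ ≤ |R| + S.a₀ * U := by
        refine (norm_sub_le _ _).trans ?_
        rw [norm_smul, Real.norm_eq_abs, abs_of_pos ha0]
        have := hb.array u hu
        have := le_abs_self R
        gcongr
        linarith
      gcongr
      linarith [norm_nonneg (scalePt S tg δ η - sensor S δ u)]
  have hex : ∀ u ∈ S.A₀, 0 ≤ distExcess S.a₀ (cs * tg) δ u ∧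
      distExcess S.a₀ (cs * tg) δ u ≤ S.a₀ ^ 2 * U ^ 2 / (cs * tg) := by
    intro u hu
    have := hb.array u hu
    unfold distExcess
    refine ⟨by positivity, ?_⟩
    gcongr
    linarith [Real.sqrt_nonneg ((cs * tg) ^ 2 + δ ^ 2 * S.a₀ ^ 2 * ‖u‖ ^ 2)]
  have key : ∀ u₂ ∈ S.A₀, ‖((‖sensor S δ u₂ - scalePt S tg δ η‖⁻¹ : ℝ) : ℂ) * osc (dspec S B)
    ((‖scalePt S tg δ η - sensor S δ u₁‖ * σ + ‖sensor S δ u₂ - scalePt S tg δ η‖ -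
      S.c₀ / cs * (‖searchPoint cs tg - sensor S δ u₁‖ + ‖searchPoint cs tg - sensor S δ u₂‖)) /
        (S.c₀ * δ ^ 2))‖ ≤ d⁻¹ * (Co * K) * (1 + Q ^ 2)⁻¹ := by
    intro u₂ hu₂
    have hX := le_norm_sensor_sub hb δ u₂ hD
    rw [norm_mul, Complex.norm_real, Real.norm_eq_abs, abs_of_nonneg (by positivity), mul_assoc]
    refine mul_le_mul (inv_anti₀ hd hX) ?_ (norm_nonneg _) (by positivity)
    refine (hosc _).trans ?_
    rw [div_eq_mul_inv, mul_assoc]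
    refine mul_le_mul_of_nonneg_left ?_ hCo.le
    obtain ⟨e₁, he₁, he₁', hr₁⟩ := hdist u₁ hu₁
    obtain ⟨e₂, he₂, he₂', hr₂⟩ := hdist u₂ hu₂
    obtain ⟨hx₁, hx₁'⟩ := hex u₁ hu₁
    obtain ⟨hx₂, hx₂'⟩ := hex u₂ hu₂
    rw [norm_sub_rev (sensor S δ u₂), norm_searchPoint_sub_sensor S hl,
      norm_searchPoint_sub_sensor S hl, hr₁, hr₂]
    generalize distExcess S.a₀ (cs * tg) δ u₁ = x₁ at *
    generalize distExcess S.a₀ (cs * tg) δ u₂ = x₂ at *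
    have hΦ : ((S.c₀ * tg + δ ^ 2 * (η 2 + e₁)) * σ + (S.c₀ * tg + δ ^ 2 * (η 2 + e₂)) -
        S.c₀ / cs * (cs * tg + δ ^ 2 * x₁ + (cs * tg + δ ^ 2 * x₂))) / (S.c₀ * δ ^ 2)
        = Q / S.c₀ + (σ * e₁ + e₂ - S.c₀ / cs * (x₁ + x₂)) / S.c₀ := by
      rw [hQ]; field_simp; ring
    clear_value Q M K
    rw [hΦ]
    have herr : |(σ * e₁ + e₂ - S.c₀ / cs * (x₁ + x₂)) / S.c₀| ≤ M := by
      rw [abs_div, abs_of_pos hc0, hM]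
      refine div_le_div_of_nonneg_right ?_ hc0.le
      refine (abs_sub _ _).trans (add_le_add ?_ ?_)
      · refine (abs_add_le _ _).trans ?_
        rw [abs_mul, abs_of_nonneg he₁, abs_of_nonneg he₂]
        have := mul_le_mul_of_nonneg_right hσ he₁
        linarith
      · rw [abs_of_nonneg (by positivity)]
        refine mul_le_mul_of_nonneg_left ?_ (by positivity)
        linarith
    generalize (σ * e₁ + e₂ - S.c₀ / cs * (x₁ + x₂)) / S.c₀ = E at herr
    have h1 := one_add_sq_le (Q := Q) hc0 herr
    rw [← hK] at h1
    rw [← div_eq_mul_inv, le_div_iff₀ (by positivity), inv_mul_le_iff₀ (by positivity)]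
    linarith
  have hfin : volume S.A₀ < ⊤ := hS.A₀_bdd.measure_lt_top
  have := norm_setIntegral_le_of_norm_le_const hfin key
  rw [localSlice, Set.indicator_of_mem hD, wgt, ← ENNReal.ofReal_mul (by positivity), ← ofReal_norm]
  refine ENNReal.ofReal_le_ofReal ?_
  unfold slice
  refine this.trans_eq ?_
  ring

/-! ### Limits of the main part of the kernel -/

theorem norm_guideStar (S : Setup) {tg : ℝ} (h : 0 ≤ S.c₀ * tg) : ‖S.guideStar tg‖ = S.c₀ * tg := by
  have h1 : ‖S.guideStar tg‖ ^ 2 = (S.c₀ * tg) ^ 2 := by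
    rw [norm_sq_E3]; simp [Setup.guideStar]
  exact (sq_eq_sq₀ (norm_nonneg _) h).1 h1

theorem tendsto_sensor (S : Setup) (u : E2) : Tendsto (fun δ => sensor S δ u) (𝓝 0) (𝓝 0) := by
  have h : Continuous fun δ : ℝ => sensor S δ u := by unfold sensor embed; fun_prop
  have := h.tendsto 0
  convert this using 2
  ext i; fin_cases i <;> simp [sensor, embed]

theorem tendsto_norm_scalePt_sub_sensor (S : Setup) {tg : ℝ} (h : 0 ≤ S.c₀ * tg) (η : E3) (u : E2) :
    Tendsto (fun δ => ‖scalePt S tg δ η - sensor S δ u‖) (𝓝 0) (𝓝 (S.c₀ * tg)) := by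
  have := ((tendsto_scalePt S tg η).sub (tendsto_sensor S u)).norm
  rwa [sub_zero, norm_guideStar S h] at this

/-- Limit of the scaled phase of the imaging functional at the offset `η`. -/
def limitPhase (S : Setup) (tg cs : ℝ) (η : E3) (u₁ u₂ : E2) : ℝ :=
  (2 * η 2 + ‖hor η - S.a₀ • u₁‖ ^ 2 / (2 * (S.c₀ * tg)) + ‖hor η - S.a₀ • u₂‖ ^ 2 / (2 * (S.c₀ * tg)) -
    S.c₀ / cs * (S.a₀ ^ 2 * ‖u₁‖ ^ 2 / (2 * (cs * tg)) + S.a₀ ^ 2 * ‖u₂‖ ^ 2 / (2 * (cs * tg)))) / S.c₀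

theorem tendsto_distExcess {a₀ l : ℝ} (hl : 0 < l) (u : E2) :
    Tendsto (fun δ => distExcess a₀ l δ u) (𝓝 0) (𝓝 (a₀ ^ 2 * ‖u‖ ^ 2 / (2 * l))) := by
  unfold distExcess
  have h : Continuous fun δ : ℝ => Real.sqrt (l ^ 2 + δ ^ 2 * a₀ ^ 2 * ‖u‖ ^ 2) + l := by fun_prop
  have h2 := h.tendsto 0
  simp only [ne_eq, OfNat.ofNat_ne_zero, not_false_eq_true, zero_pow, zero_mul, add_zero,
    Real.sqrt_sq hl.le, ← two_mul] at h2
  exact tendsto_const_nhds.div h2 (by positivity)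

/-- The leading terms cancel, (c₀/c_s) · 2c_s t_g being twice the depth of the guide star; this is
why the search point images z_g. All that is left has a factor δ², whose coefficient converges. -/
theorem tendsto_phase {S : Setup} (hS : S.Admissible) {tg cs : ℝ} (htg : 0 < tg) (hcs : 0 < cs)
    (η : E3) (u₁ u₂ : E2) : Tendsto (fun δ => (‖scalePt S tg δ η - sensor S δ u₁‖ * 1 +
      ‖sensor S δ u₂ - scalePt S tg δ η‖ - S.c₀ / cs * (‖searchPoint cs tg - sensor S δ u₁‖ +
      ‖searchPoint cs tg - sensor S δ u₂‖)) / (S.c₀ * δ ^ 2)) (𝓝[>] 0)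
      (𝓝 (limitPhase S tg cs η u₁ u₂)) := by
  have hc0 := hS.c₀_pos
  have hl : 0 < cs * tg := by positivity
  have hL : 0 < S.c₀ * tg := by positivity
  have hL2 : Tendsto (fun δ : ℝ => S.c₀ * tg + δ ^ 2 * η 2) (𝓝 0) (𝓝 (S.c₀ * tg)) := by
    have : Continuous fun δ : ℝ => S.c₀ * tg + δ ^ 2 * η 2 := by fun_prop
    simpa using this.tendsto 0
  have hq : ∀ u : E2, Tendsto (fun δ => ‖hor η - S.a₀ • u‖ ^ 2 /
      (‖scalePt S tg δ η - sensor S δ u‖ + (S.c₀ * tg + δ ^ 2 * η 2))) (𝓝 0)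
      (𝓝 (‖hor η - S.a₀ • u‖ ^ 2 / (2 * (S.c₀ * tg)))) := fun u => by
    have := (tendsto_norm_scalePt_sub_sensor S hL.le η u).add hL2
    rw [← two_mul] at this
    exact tendsto_const_nhds.div this (by positivity)
  have hlim := (((tendsto_const_nhds (x := 2 * η 2)).add (hq u₁)).add (hq u₂)).sub
    ((tendsto_const_nhds (x := S.c₀ / cs)).mul ((tendsto_distExcess (a₀ := S.a₀) hl u₁).add
      (tendsto_distExcess (a₀ := S.a₀) hl u₂)))
  refine ((hlim.div_const S.c₀).mono_left nhdsWithin_le_nhds).congr' ?_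
  filter_upwards [self_mem_nhdsWithin,
    nhdsWithin_le_nhds (hL2.eventually (eventually_gt_nhds hL))] with δ hδ hpos
  have hδ : 0 < δ := hδ
  have e1 := norm_scalePt_sub_sensor S tg δ u₁ hpos
  have e2 := norm_scalePt_sub_sensor S tg δ u₂ hpos
  rw [norm_sub_rev (sensor S δ u₂), norm_searchPoint_sub_sensor S hl, norm_searchPoint_sub_sensor S hl]
  generalize ‖hor η - S.a₀ • u₁‖ ^ 2 /
      (‖scalePt S tg δ η - sensor S δ u₁‖ + (S.c₀ * tg + δ ^ 2 * η 2)) = p at *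
  generalize ‖hor η - S.a₀ • u₂‖ ^ 2 /
      (‖scalePt S tg δ η - sensor S δ u₂‖ + (S.c₀ * tg + δ ^ 2 * η 2)) = q at *
  rw [e1, e2]
  field_simp
  ring

/-- Limit of the slice of unit excess. -/
def limitSlice (S : Setup) (B tg cs : ℝ) (η : E3) (u₁ : E2) : ℂ :=
  (((S.c₀ * tg)⁻¹ : ℝ) : ℂ) * ∫ u₂ in S.A₀, osc (dspec S B) (limitPhase S tg cs η u₁ u₂)

theorem eventually_scalePt_mem {S : Setup} {tg : ℝ} (hzg : S.guideStar tg ∈ interior S.D) (η : E3) :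
    ∀ᶠ δ in 𝓝[>] (0:ℝ), scalePt S tg δ η ∈ S.D :=
  nhdsWithin_le_nhds ((tendsto_scalePt S tg η).eventually (mem_interior_iff_mem_nhds.1 hzg))

/-- Dominated convergence over the array. The guide star being interior to D, the cutoff equals one
for small δ. -/
theorem localSlice_tendsto {S : Setup} (hS : S.Admissible) {B tg cs : ℝ} (hB : 0 < B) (htg : 0 < tg)
    (hcs : 0 < cs) (hzg : S.guideStar tg ∈ interior S.D) (u₁ : E2) (η : E3) :
    Tendsto (fun δ => localSlice S B tg cs δ 1 u₁ η) (𝓝[>] 0) (𝓝 (limitSlice S B tg cs η u₁)) := by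
  obtain ⟨Co, hCo, hosc⟩ := exists_osc_dspec_bound S hB
  obtain ⟨d, ρ, a, a', b, b', U, hb⟩ := exists_bounds hS
  have hd := hb.d_pos
  have hc0 := hS.c₀_pos
  have hL : 0 < S.c₀ * tg := by positivity
  have hosc' : ∀ s, ‖osc (dspec S B) s‖ ≤ Co := fun s => (hosc s).trans
    (div_le_self hCo.le (by nlinarith [sq_nonneg s]))
  have hoscc := continuous_osc_dspec S hB
  have hev := eventually_scalePt_mem hzg η
  have h1 : (fun δ => slice S B tg cs δ 1 u₁ (scalePt S tg δ η)) =ᶠ[𝓝[>] 0]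
      fun δ => localSlice S B tg cs δ 1 u₁ η := by
    filter_upwards [hev] with δ h
    rw [localSlice, Set.indicator_of_mem h]
  refine Tendsto.congr' h1 ?_
  unfold slice limitSlice
  rw [← integral_const_mul]
  have hfin : IsFiniteMeasure (volume.restrict S.A₀) := ⟨by simpa using hS.A₀_bdd.measure_lt_top⟩
  refine tendsto_integral_filter_of_dominated_convergence (fun _ => d⁻¹ * Co) ?_ ?_
    (integrable_const _) (Eventually.of_forall fun u₂ => ?_)
  · refine Eventually.of_forall fun δ => Measurable.aestronglyMeasurable ?_
    have hs := continuous_sensor S δ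
    refine Measurable.mul (Complex.measurable_ofReal.comp (Measurable.inv (Continuous.measurable
      (by fun_prop)))) (hoscc.measurable.comp (Continuous.measurable (by fun_prop)))
  · filter_upwards [hev] with δ h
    refine Eventually.of_forall fun u₂ => ?_
    rw [norm_mul, Complex.norm_real, Real.norm_eq_abs, abs_of_nonneg (by positivity)]
    exact mul_le_mul (inv_anti₀ hd (le_norm_sensor_sub hb δ u₂ h)) (hosc' _) (norm_nonneg _)
      (by positivity)
  · refine Tendsto.mul ?_ ((hoscc.tendsto _).comp (tendsto_phase hS htg hcs η u₁ u₂))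
    have := (tendsto_norm_scalePt_sub_sensor S hL.le η u₂).inv₀ hL.ne'
    simp_rw [norm_sub_rev (sensor S _ u₂)]
    exact (Complex.continuous_ofReal.tendsto _).comp (this.mono_left nhdsWithin_le_nhds)

/-! ### Ray integrals of the source density -/

/-- The ray has unit speed, so it leaves the ball containing the sources within length ρ + M. The
majorant does not depend on the direction, as dominated convergence requires. -/
theorem norm_ray_integrand_le {S : Setup} {e ρ k C : ℝ} (hs : SourceBounds S e ρ k)
    (hC : ∀ y, ‖S.K y‖ ≤ C) {x z : E3} (hxz : x ≠ z) {M : ℝ} (hx : ‖x‖ ≤ M) {l : ℝ} (hl : 0 < l) :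
    ‖S.K (x + (l / ‖x - z‖) • (x - z))‖ ≤ (Set.Ioc 0 (ρ + M)).indicator (fun _ => C) l := by
  by_cases h : l ≤ ρ + M
  · rw [Set.indicator_of_mem (show l ∈ Set.Ioc 0 (ρ + M) from ⟨hl, h⟩)]; exact hC _
  · rw [Set.indicator_of_notMem fun h' => h h'.2]
    have h0 : 0 < ‖x - z‖ := norm_pos_iff.2 (sub_ne_zero.2 hxz)
    suffices h : x + (l / ‖x - z‖) • (x - z) ∉ tsupport S.K by
      rw [image_eq_zero_of_notMem_tsupport h, norm_zero]
    intro hm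
    have h1 := hs.norm_le _ hm
    have h2 : ‖(l / ‖x - z‖) • (x - z)‖ = l := by
      rw [norm_smul, Real.norm_eq_abs, abs_of_pos (by positivity), div_mul_cancel₀ _ h0.ne']
    have h3 := norm_sub_le (x + (l / ‖x - z‖) • (x - z)) x
    rw [add_sub_cancel_left, h2] at h3
    linarith

theorem exists_rayIntegral_bound {S : Setup} (hS : S.Admissible) (M : ℝ) :
    ∃ C : ℝ, ∀ x z, x ≠ z → ‖x‖ ≤ M → |S.rayIntegral x z| ≤ C := by
  obtain ⟨e, ρ, k, hs⟩ := exists_sourceBounds hS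
  obtain ⟨C, hC⟩ := hS.K_compact.exists_bound_of_continuous hS.K_smooth.continuous
  refine ⟨∫ l in Set.Ioi (0:ℝ), (Set.Ioc 0 (ρ + M)).indicator (fun _ => C) l, fun x z hxz hx => ?_⟩
  rw [← Real.norm_eq_abs]
  refine norm_integral_le_of_norm_le ?_ ?_
  · exact ((integrable_indicator_iff measurableSet_Ioc).2
      (integrableOn_const measure_Ioc_lt_top.ne)).integrableOn
  · filter_upwards [ae_restrict_mem measurableSet_Ioi] with l hl
    exact norm_ray_integrand_le hs hC hxz hx hl

theorem tendsto_rayIntegral {S : Setup} (hS : S.Admissible) {α : Type*} {l : Filter α}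
    [l.IsCountablyGenerated] {X Z : α → E3} {x z : E3} (hxz : x ≠ z) (hX : Tendsto X l (𝓝 x))
    (hZ : Tendsto Z l (𝓝 z)) : Tendsto (fun i => S.rayIntegral (X i) (Z i)) l (𝓝 (S.rayIntegral x z)) := by
  obtain ⟨e, ρ, k, hs⟩ := exists_sourceBounds hS
  obtain ⟨C, hC⟩ := hS.K_compact.exists_bound_of_continuous hS.K_smooth.continuous
  have hK := hS.K_smooth.continuous
  have hsub := hX.sub hZ
  have h0 : ‖x - z‖ ≠ 0 := norm_ne_zero_iff.2 (sub_ne_zero.2 hxz)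
  unfold Setup.rayIntegral
  refine tendsto_integral_filter_of_dominated_convergence
    ((Set.Ioc 0 (ρ + (‖x‖ + 1))).indicator (fun _ => C)) ?_ ?_ ?_ ?_
  · exact Eventually.of_forall fun i => Continuous.aestronglyMeasurable (by fun_prop)
  · filter_upwards [hsub.norm.eventually_ne h0, hX.norm.eventually (eventually_le_nhds (lt_add_one ‖x‖))]
      with i hi hi'
    filter_upwards [ae_restrict_mem measurableSet_Ioi] with l hl
    exact norm_ray_integrand_le hs hC (sub_ne_zero.1 (norm_ne_zero_iff.1 hi)) hi' hl
  · exact ((integrable_indicator_iff measurableSet_Ioc).2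
      (integrableOn_const measure_Ioc_lt_top.ne)).integrableOn
  · refine Eventually.of_forall fun l => (hK.tendsto _).comp ?_
    exact hX.add ((tendsto_const_nhds.div hsub.norm h0).smul hsub)

/-! ### A criterion for convergence in `L²` -/

/-- Convergence on cylinders of bounded horizontal radius, unbounded in height, together with tails
that are small uniformly in the index. -/
theorem tendsto_lintegral_sq_of_local {α : Type*} {l : Filter α} {f : α → E3 → ENNReal}
    (hloc : ∀ R : ℝ, Tendsto (fun i => ∫⁻ η in {η | ‖hor η‖ ≤ R}, f i η ^ 2) l (𝓝 0))
    {τ : ℝ → ENNReal} (hτ : Tendsto τ atTop (𝓝 0))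
    (htail : ∀ᶠ i in l, ∀ R, ∫⁻ η in {η | R < ‖hor η‖}, f i η ^ 2 ≤ τ R) :
    Tendsto (fun i => ∫⁻ η, f i η ^ 2) l (𝓝 0) := by
  rw [ENNReal.tendsto_nhds_zero]
  intro ε hε
  have hε2 : 0 < ε / 2 := ENNReal.half_pos hε.ne'
  obtain ⟨R, hR⟩ := ((ENNReal.tendsto_nhds_zero.1 hτ) _ hε2).exists
  filter_upwards [ENNReal.tendsto_nhds_zero.1 (hloc R) _ hε2, htail] with i h1 h2
  have hhor := continuous_hor
  rw [← lintegral_add_compl _ (measurableSet_le (by fun_prop) measurable_const :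
    MeasurableSet {η : E3 | ‖hor η‖ ≤ R}), ← ENNReal.add_halves ε]
  refine add_le_add h1 (le_trans (le_of_eq ?_) ((h2 R).trans hR))
  congr 2
  ext η; simp

theorem lintegral_slab {G : ℝ → ENNReal} (hG : Measurable G) (R : ℝ) :
    ∫⁻ η in {η : E3 | ‖hor η‖ ≤ R}, G (η 2) = volume (Metric.closedBall (0 : E2) R) * ∫⁻ t, G t := by
  have hhor := continuous_hor
  have hms : MeasurableSet {η : E3 | ‖hor η‖ ≤ R} := measurableSet_le (by fun_prop) measurable_const
  have hG' : Measurable fun η : E3 => G (η 2) := hG.comp (by fun_prop)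
  rw [← lintegral_indicator hms, lintegral_mk3 (hG'.indicator hms), mul_comm,
    ← setLIntegral_const, ← lintegral_indicator Metric.isClosed_closedBall.measurableSet]
  refine lintegral_congr fun x => ?_
  by_cases hx : ‖x‖ ≤ R <;> simp [Set.indicator, hx]

/-! ### Vanishing of the remainder in `L²` -/

/-- The measure over sensors and polar positions of the sources. -/
def remMeasure (S : Setup) (c T : ℝ) : Measure (E2 × (ℝ × ℝ)) :=
  (volume.restrict S.A₀).prod (volume.restrict (remSet c T))

theorem isFiniteMeasure_remMeasure {S : Setup} (hS : S.Admissible) (c T : ℝ) :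
    IsFiniteMeasure (remMeasure S c T) := by
  have h1 : IsFiniteMeasure (volume.restrict S.A₀) := ⟨by simpa using hS.A₀_bdd.measure_lt_top⟩
  have h2 : IsFiniteMeasure (volume.restrict (remSet c T)) :=
    ⟨by simpa using volume_remSet_lt_top c T⟩
  unfold remMeasure; infer_instance

theorem ae_remMeasure {S : Setup} (hS : S.Admissible) (c T : ℝ) :
    ∀ᵐ q ∂(remMeasure S c T), q.1 ∈ S.A₀ ∧ q.2 ∈ remSet c T := by
  rw [remMeasure, Measure.prod_restrict]
  filter_upwards [ae_restrict_mem (hS.A₀_meas.prod (measurableSet_remSet c T))] with q hq using hq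

/-- The remainder of the kernel. -/
def remainder (S : Setup) (B tg cs c T δ : ℝ) (η : E3) : ENNReal :=
  ∫⁻ q, ‖localSlice S B tg cs δ (pathExcess q.2.1 q.2.2) q.1 η‖ₑ ∂(remMeasure S c T)

theorem measurable_remIntegrand {S : Setup} (hS : S.Admissible) {B : ℝ} (hB : 0 < B) (tg cs δ : ℝ) :
    Measurable fun x : E3 × (E2 × (ℝ × ℝ)) =>
      ‖localSlice S B tg cs δ (pathExcess x.2.2.1 x.2.2.2) x.2.1 x.1‖ₑ := by
  have hpe := continuous_pathExcess
  have := (measurable_localSlice hS hB tg cs δ).comp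
    (f := fun x : E3 × (E2 × (ℝ × ℝ)) => (pathExcess x.2.2.1 x.2.2.2, x.2.1, x.1))
    (Continuous.measurable (by fun_prop))
  simp only [Function.comp_def] at this
  exact this.enorm

theorem measurable_remainder {S : Setup} (hS : S.Admissible) {B : ℝ} (hB : 0 < B) (tg cs c T δ : ℝ) :
    Measurable (remainder S B tg cs c T δ) := by
  have := isFiniteMeasure_remMeasure hS c T
  exact (measurable_remIntegrand hS hB tg cs δ).lintegral_prod_right'

/-- Cauchy–Schwarz for the finite measure of sensors and source positions reduces to
`localSlice_tail`. No smallness in δ arises here; it comes from `remainder_local`. -/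
theorem remainder_tail {S : Setup} (hS : S.Admissible) {B tg cs c : ℝ} (hB : 0 < B) (htg : 0 < tg)
    (hcs : 0 < cs) (hc : 0 < c) (T : ℝ) : ∃ τ : ℝ → ENNReal, Tendsto τ atTop (𝓝 0) ∧
      ∀ δ, 0 < δ → δ ≤ 1 → ∀ R, ∫⁻ η in {η | R < ‖hor η‖}, remainder S B tg cs c T δ η ^ 2 ≤ τ R := by
  obtain ⟨τ, hτ, hτt, h⟩ := localSlice_tail hS hB htg hcs hc
  have hfin := isFiniteMeasure_remMeasure hS c T
  set M := remMeasure S c T with hM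
  refine ⟨fun R => (M Set.univ * M Set.univ) * τ R, ?_, fun δ hδ hδ1 R => ?_⟩
  · rw [← mul_zero (M Set.univ * M Set.univ)]
    exact ENNReal.Tendsto.const_mul hτ (Or.inr (ENNReal.mul_ne_top (measure_ne_top _ _)
      (measure_ne_top _ _)))
  · have hm := measurable_remIntegrand hS hB tg cs δ
    calc ∫⁻ η in {η | R < ‖hor η‖}, remainder S B tg cs c T δ η ^ 2
        ≤ ∫⁻ η in {η | R < ‖hor η‖}, M Set.univ * ∫⁻ q,
            ‖localSlice S B tg cs δ (pathExcess q.2.1 q.2.2) q.1 η‖ₑ ^ 2 ∂M :=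
          lintegral_mono fun η => lintegral_sq_le M
            (hm.comp (f := fun q => (η, q)) (by fun_prop)).aemeasurable
      _ = M Set.univ * ∫⁻ q, ∫⁻ η in {η : E3 | R < ‖hor η‖},
            ‖localSlice S B tg cs δ (pathExcess q.2.1 q.2.2) q.1 η‖ₑ ^ 2 ∂(volume) ∂M := by
          rw [lintegral_const_mul' _ _ (measure_ne_top _ _), lintegral_lintegral_swap]
          exact (hm.pow_const 2).aemeasurable
      _ ≤ M Set.univ * ∫⁻ _, τ R ∂M := by
          refine mul_le_mul_right (lintegral_mono_ae ?_) _
          filter_upwards [ae_remMeasure hS c T] with q hq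
          exact h δ hδ hδ1 q.1 hq.1 _ hq.2.2 R
      _ = _ := by rw [lintegral_const]; ring

/-- On a cylinder `localSlice_le` bounds the remainder by a function of the height alone. Up to a
translation by c₀t_g/δ² this is the superposition of `tendsto_dispersion` with N = 2c₀t_g/δ², which
tends to infinity. -/
theorem remainder_local {S : Setup} (hS : S.Admissible) {B tg cs c : ℝ} (hB : 0 < B) (htg : 0 < tg)
    (hcs : 0 < cs) (hc : 0 < c) (T R : ℝ) :
    Tendsto (fun δ => ∫⁻ η in {η | ‖hor η‖ ≤ R}, remainder S B tg cs c T δ η ^ 2) (𝓝[>] 0) (𝓝 0) := by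
  obtain ⟨C, hC, h⟩ := localSlice_le hS hB htg hcs R
  have hhor := continuous_hor
  have hpe := continuous_pathExcess
  have hc0 := hS.c₀_pos
  have hA : volume S.A₀ ≠ ⊤ := hS.A₀_bdd.measure_lt_top.ne
  have hL : 0 < S.c₀ * tg := by positivity
  have hN : Tendsto (fun δ : ℝ => 2 * (S.c₀ * tg) / δ ^ 2) (𝓝[>] 0) atTop := by
    simp_rw [div_eq_mul_inv]
    refine Tendsto.const_mul_atTop (by positivity) (Tendsto.inv_tendsto_nhdsGT_zero ?_)
    refine tendsto_nhdsWithin_iff.2 ⟨?_, ?_⟩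
    · have : Continuous fun δ : ℝ => δ ^ 2 := by fun_prop
      have := this.tendsto 0
      simp only [ne_eq, OfNat.ofNat_ne_zero, not_false_eq_true, zero_pow] at this
      exact this.mono_left nhdsWithin_le_nhds
    · filter_upwards [self_mem_nhdsWithin] with δ hδ
      exact sq_pos_of_pos (Set.mem_Ioi.1 hδ)
  have hdisp := (tendsto_dispersion hc T).comp hN
  set K : ENNReal := (C * volume S.A₀) ^ 2 * volume (Metric.closedBall (0 : E2) R) with hK
  have hKt : K ≠ ⊤ := ENNReal.mul_ne_top (ENNReal.pow_ne_top (ENNReal.mul_ne_top hC hA))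
    measure_closedBall_lt_top.ne
  have hlim := ENNReal.Tendsto.const_mul (a := K) hdisp (Or.inr hKt)
  rw [mul_zero] at hlim
  refine tendsto_of_tendsto_of_tendsto_of_le_of_le' tendsto_const_nhds hlim
    (Eventually.of_forall fun _ => bot_le) ?_
  filter_upwards [Ioc_mem_nhdsGT (zero_lt_one' ℝ)] with δ hδ
  set N := 2 * (S.c₀ * tg) / δ ^ 2 with hNd
  have hGm : Measurable fun q : ℝ => ∫⁻ p in remSet c T, wgt ((1 + pathExcess p.1 p.2) * q - N) := by
    refine Measurable.lintegral_prod_right' (f := fun x : ℝ × (ℝ × ℝ) =>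
      wgt ((1 + pathExcess x.2.1 x.2.2) * x.1 - N)) (measurable_wgt.comp (Continuous.measurable ?_))
    fun_prop
  have hbd : ∀ η : E3, ‖hor η‖ ≤ R → remainder S B tg cs c T δ η ≤ C * volume S.A₀ *
      ∫⁻ p in remSet c T, wgt ((1 + pathExcess p.1 p.2) * (η 2 + S.c₀ * tg / δ ^ 2) - N) := by
    intro η hη
    have hwm : Measurable fun p : ℝ × ℝ =>
        wgt ((1 + pathExcess p.1 p.2) * (η 2 + S.c₀ * tg / δ ^ 2) - N) :=
      measurable_wgt.comp (Continuous.measurable (by fun_prop))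
    calc remainder S B tg cs c T δ η
        ≤ ∫⁻ q, C * wgt ((1 + pathExcess q.2.1 q.2.2) * (η 2 + S.c₀ * tg / δ ^ 2) - N)
            ∂(remMeasure S c T) := by
          refine lintegral_mono_ae ?_
          filter_upwards [ae_remMeasure hS c T] with q hq
          refine h δ hδ.1 hδ.2 q.1 hq.1 _ ?_ η hη
          have h1 := pathExcess_le hq.2.1.1.1.le q.2.2
          have h2 := hq.2.2
          simp only [Set.mem_ofPred_eq] at h2
          rw [abs_le]
          constructor <;> linarith
      _ = _ := by
          have hs : SFinite (volume.restrict (remSet c T)) := inferInstance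
          rw [remMeasure, lintegral_prod _ (by
            exact ((hwm.comp measurable_snd).const_mul C).aemeasurable)]
          simp only [lintegral_const, Measure.restrict_apply_univ]
          rw [lintegral_const_mul' _ _ hC]
          ring
  calc ∫⁻ η in {η | ‖hor η‖ ≤ R}, remainder S B tg cs c T δ η ^ 2
      ≤ ∫⁻ η in {η : E3 | ‖hor η‖ ≤ R}, (C * volume S.A₀) ^ 2 * (∫⁻ p in remSet c T,
          wgt ((1 + pathExcess p.1 p.2) * (η 2 + S.c₀ * tg / δ ^ 2) - N)) ^ 2 := by
        refine setLIntegral_mono' (measurableSet_le (by fun_prop) measurable_const) fun η hη => ?_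
        rw [← mul_pow]
        exact pow_le_pow_left' (hbd η hη) 2
    _ = (C * volume S.A₀) ^ 2 * (volume (Metric.closedBall (0 : E2) R) * ∫⁻ t : ℝ,
          (∫⁻ p in remSet c T, wgt ((1 + pathExcess p.1 p.2) * (t + S.c₀ * tg / δ ^ 2) - N)) ^ 2) := by
        rw [lintegral_const_mul' _ _ (ENNReal.pow_ne_top (ENNReal.mul_ne_top hC hA))]
        congr 1
        exact lintegral_slab (G := fun t => (∫⁻ p in remSet c T,
          wgt ((1 + pathExcess p.1 p.2) * (t + S.c₀ * tg / δ ^ 2) - N)) ^ 2)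
          ((hGm.comp (measurable_add_const _)).pow_const 2) R
    _ = _ := by
        rw [lintegral_add_right_eq_self (fun t => (∫⁻ p in remSet c T,
          wgt ((1 + pathExcess p.1 p.2) * t - N)) ^ 2), ← mul_assoc]
        rfl

theorem tendsto_remainder {S : Setup} (hS : S.Admissible) {B tg cs c : ℝ} (hB : 0 < B) (htg : 0 < tg)
    (hcs : 0 < cs) (hc : 0 < c) (T : ℝ) :
    Tendsto (fun δ => ∫⁻ η, remainder S B tg cs c T δ η ^ 2) (𝓝[>] 0) (𝓝 0) := by
  obtain ⟨τ, hτ, h⟩ := remainder_tail hS hB htg hcs hc T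
  refine tendsto_lintegral_sq_of_local (remainder_local hS hB htg hcs hc T) hτ ?_
  filter_upwards [Ioc_mem_nhdsGT (zero_lt_one' ℝ)] with δ hδ using h δ hδ.1 hδ.2

/-! ### Convergence of the main part in `L²` -/

/-- The constant `kernelConst` stripped of δ⁻⁴, times the c₀ of the prefactor c₀δ² in `kernelI_eq`.
-/
def mainConst (S : Setup) : ℝ :=
  (S.N : ℝ) ^ 2 / (volume.real S.A₀) ^ 2 * (1 / (2 * Real.pi * S.c₀ ^ 2)) * ((4 * Real.pi) ^ 3)⁻¹ * S.c₀

def rayFactor (S : Setup) (tg δ : ℝ) (u : E2) (η : E3) : ℝ :=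
  2 * Real.pi * S.rayIntegral (sensor S δ u) (scalePt S tg δ η) / ‖scalePt S tg δ η - sensor S δ u‖

/-- The main part of the rescaled kernel. -/
def mainKernel (S : Setup) (B tg cs δ : ℝ) (η : E3) : ℂ :=
  (mainConst S : ℂ) * ∫ u in S.A₀, (rayFactor S tg δ u η : ℂ) * localSlice S B tg cs δ 1 u η

/-- The limit of the rescaled kernel. -/
def limitKernel (S : Setup) (B tg cs : ℝ) (η : E3) : ℂ :=
  (mainConst S : ℂ) * ∫ u in S.A₀,
    ((2 * Real.pi * S.rayIntegral 0 (S.guideStar tg) / (S.c₀ * tg) : ℝ) : ℂ) *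
      limitSlice S B tg cs η u

theorem measurable_rayFactor {S : Setup} (hS : S.Admissible) (tg δ : ℝ) :
    Measurable fun p : E3 × E2 => rayFactor S tg δ p.2 p.1 := by
  have hK := hS.K_smooth.continuous
  have hs := continuous_sensor S δ
  have hz := continuous_scalePt S tg δ
  have h1 : Measurable fun p : E3 × E2 => S.rayIntegral (sensor S δ p.2) (scalePt S tg δ p.1) := by
    unfold Setup.rayIntegral
    refine (StronglyMeasurable.integral_prod_right (f := fun p : E3 × E2 => fun l : ℝ =>
      S.K (sensor S δ p.2 + (l / ‖sensor S δ p.2 - scalePt S tg δ p.1‖) •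
        (sensor S δ p.2 - scalePt S tg δ p.1))) (Measurable.stronglyMeasurable ?_)).measurable
    refine hK.measurable.comp (Measurable.add (Continuous.measurable (by fun_prop)) (Measurable.smul
      (Measurable.div measurable_snd (Continuous.measurable (by fun_prop)))
      (Continuous.measurable (by fun_prop))))
  exact (h1.const_mul _).div (Continuous.measurable (by fun_prop))

theorem measurable_mainIntegrand {S : Setup} (hS : S.Admissible) {B : ℝ} (hB : 0 < B) (tg cs δ : ℝ) :
    Measurable fun p : E3 × E2 => (rayFactor S tg δ p.2 p.1 : ℂ) * localSlice S B tg cs δ 1 p.2 p.1 := by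
  have := (measurable_localSlice hS hB tg cs δ).comp (f := fun p : E3 × E2 => ((1 : ℝ), p.2, p.1))
    (by fun_prop)
  simp only [Function.comp_def] at this
  exact (Complex.measurable_ofReal.comp (measurable_rayFactor hS tg δ)).mul this

theorem measurable_mainKernel {S : Setup} (hS : S.Admissible) {B : ℝ} (hB : 0 < B) (tg cs δ : ℝ) :
    Measurable (mainKernel S B tg cs δ) := by
  unfold mainKernel
  exact measurable_const.mul (StronglyMeasurable.integral_prod_right
    (f := fun η : E3 => fun u : E2 => (rayFactor S tg δ u η : ℂ) * localSlice S B tg cs δ 1 u η)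
    (measurable_mainIntegrand hS hB tg cs δ).stronglyMeasurable).measurable

theorem exists_rayFactor_bound {S : Setup} (hS : S.Admissible) (tg : ℝ) : ∃ C : ℝ, 0 ≤ C ∧
    ∀ δ, 0 < δ → δ ≤ 1 → ∀ u ∈ S.A₀, ∀ η, scalePt S tg δ η ∈ S.D → |rayFactor S tg δ u η| ≤ C := by
  obtain ⟨d, ρ, a, a', b, b', U, hb⟩ := exists_bounds hS
  have hd := hb.d_pos
  have ha0 := hS.a₀_pos
  have hpi := Real.pi_pos
  obtain ⟨C, hC⟩ := exists_rayIntegral_bound hS (S.a₀ * U)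
  refine ⟨2 * Real.pi * |C| / d, by positivity, fun δ hδ hδ1 u hu η hη => ?_⟩
  have h1 := le_norm_sensor_sub hb δ u hη
  have h2 : sensor S δ u ≠ scalePt S tg δ η := by
    intro h; rw [h, sub_self, norm_zero] at h1; linarith
  have h3 : ‖sensor S δ u‖ ≤ S.a₀ * U := by
    rw [norm_sensor S ha0 hδ.le, mul_assoc]
    have := mul_le_mul_of_nonneg_left (hb.array u hu) ha0.le
    nlinarith [mul_nonneg ha0.le (norm_nonneg u)]
  have h4 := (hC _ _ h2 h3).trans (le_abs_self C)
  rw [rayFactor, abs_div, abs_mul, abs_of_nonneg (by positivity : 0 ≤ 2 * Real.pi), abs_norm,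
    norm_sub_rev]
  gcongr

/-- Dominated convergence over the first sensor. As sensors and points collapse to 0 and z_g, the
ray integrals become the single ray through the guide star. -/
theorem tendsto_mainKernel_pointwise {S : Setup} (hS : S.Admissible) {B tg cs : ℝ} (hB : 0 < B)
    (htg : 0 < tg) (hcs : 0 < cs) (hzg : S.guideStar tg ∈ interior S.D) (η : E3) :
    Tendsto (fun δ => mainKernel S B tg cs δ η) (𝓝[>] 0) (𝓝 (limitKernel S B tg cs η)) := by
  obtain ⟨Cr, hCr0, hCr⟩ := exists_rayFactor_bound hS tg
  obtain ⟨C, hC, hsl⟩ := localSlice_le hS hB htg hcs ‖hor η‖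
  have hc0 := hS.c₀_pos
  have hL : 0 < S.c₀ * tg := by positivity
  have hfin : IsFiniteMeasure (volume.restrict S.A₀) := ⟨by simpa using hS.A₀_bdd.measure_lt_top⟩
  unfold mainKernel limitKernel
  refine Tendsto.const_mul _ ?_
  refine tendsto_integral_filter_of_dominated_convergence (fun _ => Cr * C.toReal) ?_ ?_
    (integrable_const _) (Eventually.of_forall fun u => ?_)
  · refine Eventually.of_forall fun δ => Measurable.aestronglyMeasurable ?_
    have := (measurable_mainIntegrand hS hB tg cs δ).comp (f := fun u : E2 => (η, u)) (by fun_prop)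
    simpa only [Function.comp_def] using this
  · filter_upwards [Ioc_mem_nhdsGT (zero_lt_one' ℝ), eventually_scalePt_mem hzg η] with δ hδ hD
    filter_upwards [ae_restrict_mem hS.A₀_meas] with u hu
    rw [norm_mul, Complex.norm_real, Real.norm_eq_abs]
    refine mul_le_mul (hCr δ hδ.1 hδ.2 u hu η hD) ?_ (norm_nonneg _) hCr0
    have h1 := (hsl δ hδ.1 hδ.2 u hu 1 (by simp) η le_rfl).trans
      ((mul_le_mul_right (wgt_le_one _) C).trans_eq (mul_one C))
    rw [← toReal_enorm]
    exact ENNReal.toReal_mono hC h1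
  · refine Tendsto.mul ?_ (localSlice_tendsto hS hB htg hcs hzg u η)
    refine (Complex.continuous_ofReal.tendsto _).comp ?_
    unfold rayFactor
    have h0 : (0 : E3) ≠ S.guideStar tg := by
      intro h
      have := norm_guideStar S hL.le
      rw [← h, norm_zero] at this
      linarith
    exact Tendsto.div (Tendsto.const_mul _ (tendsto_rayIntegral hS h0
      ((tendsto_sensor S u).mono_left nhdsWithin_le_nhds)
      ((tendsto_scalePt S tg η).mono_left nhdsWithin_le_nhds)))
      ((tendsto_norm_scalePt_sub_sensor S hL.le η u).mono_left nhdsWithin_le_nhds) hL.ne'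

/-! ### Convergence of the rescaled kernel in `L²` -/

theorem mainKernel_le {S : Setup} (hS : S.Admissible) {B : ℝ} (tg cs : ℝ) :
    ∃ C : ENNReal, C ≠ ⊤ ∧ ∀ δ, 0 < δ → δ ≤ 1 → ∀ η, ‖mainKernel S B tg cs δ η‖ₑ ≤
      C * ∫⁻ u in S.A₀, ‖localSlice S B tg cs δ 1 u η‖ₑ := by
  obtain ⟨Cr, hCr0, hCr⟩ := exists_rayFactor_bound hS tg
  refine ⟨‖(mainConst S : ℂ)‖ₑ * ENNReal.ofReal Cr, ENNReal.mul_ne_top enorm_ne_top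
    ENNReal.ofReal_ne_top, fun δ hδ hδ1 η => ?_⟩
  rw [mainKernel, enorm_mul, mul_assoc]
  refine mul_le_mul_right ((enorm_integral_le_lintegral_enorm _).trans ?_) _
  rw [← lintegral_const_mul' _ _ ENNReal.ofReal_ne_top]
  refine setLIntegral_mono' hS.A₀_meas fun u hu => ?_
  rw [enorm_mul]
  by_cases hD : scalePt S tg δ η ∈ S.D
  · refine mul_le_mul_left ?_ _
    rw [← ofReal_norm, Complex.norm_real, Real.norm_eq_abs]
    exact ENNReal.ofReal_le_ofReal (hCr δ hδ hδ1 u hu η hD)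
  · simp [localSlice, hD]

theorem mainKernel_tail {S : Setup} (hS : S.Admissible) {B tg cs : ℝ} (hB : 0 < B) (htg : 0 < tg)
    (hcs : 0 < cs) : ∃ τ : ℝ → ENNReal, Tendsto τ atTop (𝓝 0) ∧ (∀ R, τ R ≠ ⊤) ∧
      ∀ δ, 0 < δ → δ ≤ 1 → ∀ R,
        ∫⁻ η in {η | R < ‖hor η‖}, ‖mainKernel S B tg cs δ η‖ₑ ^ 2 ≤ τ R := by
  obtain ⟨C, hC, hle⟩ := mainKernel_le hS (B := B) tg cs
  obtain ⟨τ, hτ, hτt, h⟩ := localSlice_tail hS (c := 1) hB htg hcs one_pos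
  have hA : volume S.A₀ ≠ ⊤ := hS.A₀_bdd.measure_lt_top.ne
  have hK : C ^ 2 * (volume S.A₀ * volume S.A₀) ≠ ⊤ :=
    ENNReal.mul_ne_top (ENNReal.pow_ne_top hC) (ENNReal.mul_ne_top hA hA)
  refine ⟨fun R => C ^ 2 * (volume S.A₀ * volume S.A₀) * τ R, ?_,
    fun R => ENNReal.mul_ne_top hK (hτt R), fun δ hδ hδ1 R => ?_⟩
  · rw [← mul_zero (C ^ 2 * (volume S.A₀ * volume S.A₀))]
    exact ENNReal.Tendsto.const_mul hτ (Or.inr hK)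
  · have hm : Measurable fun x : E3 × E2 => ‖localSlice S B tg cs δ 1 x.2 x.1‖ₑ := by
      have := (measurable_localSlice hS hB tg cs δ).comp (f := fun p : E3 × E2 => ((1 : ℝ), p.2, p.1))
        (by fun_prop)
      simp only [Function.comp_def] at this
      exact this.enorm
    calc ∫⁻ η in {η | R < ‖hor η‖}, ‖mainKernel S B tg cs δ η‖ₑ ^ 2
        ≤ ∫⁻ η in {η : E3 | R < ‖hor η‖}, C ^ 2 * (volume S.A₀ *
            ∫⁻ u in S.A₀, ‖localSlice S B tg cs δ 1 u η‖ₑ ^ 2) := by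
          refine lintegral_mono fun η => (pow_le_pow_left' (hle δ hδ hδ1 η) 2).trans ?_
          rw [mul_pow]
          refine mul_le_mul_right ?_ _
          have := lintegral_sq_le (volume.restrict S.A₀) (g := fun u => ‖localSlice S B tg cs δ 1 u η‖ₑ)
            (hm.comp (f := fun u => (η, u)) (by fun_prop)).aemeasurable
          rwa [Measure.restrict_apply_univ] at this
      _ = C ^ 2 * (volume S.A₀ * ∫⁻ u in S.A₀, ∫⁻ η in {η : E3 | R < ‖hor η‖},
            ‖localSlice S B tg cs δ 1 u η‖ₑ ^ 2) := by
          rw [lintegral_const_mul' _ _ (ENNReal.pow_ne_top hC), lintegral_const_mul' _ _ hA,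
            lintegral_lintegral_swap]
          exact (hm.pow_const 2).aemeasurable
      _ ≤ C ^ 2 * (volume S.A₀ * ∫⁻ u in S.A₀, τ R) := by
          refine mul_le_mul_right (mul_le_mul_right (setLIntegral_mono' hS.A₀_meas fun u hu => ?_) _) _
          exact h δ hδ hδ1 u hu 1 (by norm_num) R
      _ = _ := by rw [setLIntegral_const]; ring

/-- The case σ = 1 of `localSlice_le`, in which the two large terms cancel. The resulting bound does
not involve δ and is square integrable on cylinders, so it serves as a majorant. -/
theorem mainKernel_local {S : Setup} (hS : S.Admissible) {B tg cs : ℝ} (hB : 0 < B) (htg : 0 < tg)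
    (hcs : 0 < cs) (R : ℝ) : ∃ C : ENNReal, C ≠ ⊤ ∧ ∀ δ, 0 < δ → δ ≤ 1 → ∀ η, ‖hor η‖ ≤ R →
      ‖mainKernel S B tg cs δ η‖ₑ ≤ C * wgt (2 * η 2) := by
  obtain ⟨C, hC, hle⟩ := mainKernel_le hS (B := B) tg cs
  obtain ⟨C', hC', hsl⟩ := localSlice_le hS hB htg hcs R
  have hA : volume S.A₀ ≠ ⊤ := hS.A₀_bdd.measure_lt_top.ne
  refine ⟨C * (C' * volume S.A₀), ENNReal.mul_ne_top hC (ENNReal.mul_ne_top hC' hA),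
    fun δ hδ hδ1 η hη => (hle δ hδ hδ1 η).trans ?_⟩
  rw [mul_assoc]
  refine mul_le_mul_right ?_ _
  calc ∫⁻ u in S.A₀, ‖localSlice S B tg cs δ 1 u η‖ₑ
      ≤ ∫⁻ u in S.A₀, C' * wgt (2 * η 2) := by
        refine setLIntegral_mono' hS.A₀_meas fun u hu => (hsl δ hδ hδ1 u hu 1 (by simp) η hη).trans_eq ?_
        congr 2; ring
    _ = _ := by rw [setLIntegral_const]; ring

theorem measurable_limitKernel {S : Setup} (hS : S.Admissible) {B tg cs : ℝ} (hB : 0 < B) (htg : 0 < tg)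
    (hcs : 0 < cs) (hzg : S.guideStar tg ∈ interior S.D) : Measurable (limitKernel S B tg cs) :=
  measurable_of_tendsto_metrizable' (𝓝[>] (0 : ℝ)) (fun δ => measurable_mainKernel hS hB tg cs δ)
    (tendsto_pi_nhds.2 fun η => tendsto_mainKernel_pointwise hS hB htg hcs hzg η)

theorem lintegral_wgt_sq_lt_top {c : ℝ} (hc : 0 < c) : ∫⁻ t, wgt (c * t) ^ 2 < ⊤ := by
  have h := lintegral_wgt_affine hc 0
  simp only [sub_zero] at h
  refine lt_of_le_of_lt (lintegral_mono fun t => ?_) (h.trans_lt ENNReal.ofReal_lt_top)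
  rw [sq]
  exact (mul_le_mul_right (wgt_le_one _) _).trans_eq (mul_one _)

/-- Fatou's lemma along a sequence of scales tending to 0. -/
theorem limitKernel_tail {S : Setup} (hS : S.Admissible) {B tg cs : ℝ} (hB : 0 < B) (htg : 0 < tg)
    (hcs : 0 < cs) (hzg : S.guideStar tg ∈ interior S.D) {τ : ℝ → ENNReal}
    (h : ∀ δ, 0 < δ → δ ≤ 1 → ∀ R,
        ∫⁻ η in {η | R < ‖hor η‖}, ‖mainKernel S B tg cs δ η‖ₑ ^ 2 ≤ τ R) (R : ℝ) :
    ∫⁻ η in {η | R < ‖hor η‖}, ‖limitKernel S B tg cs η‖ₑ ^ 2 ≤ τ R := by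
  obtain ⟨δ, hδ, hδt⟩ : ∃ δ : ℕ → ℝ, (∀ n, δ n ∈ Set.Ioc (0:ℝ) 1) ∧ Tendsto δ atTop (𝓝[>] 0) := by
    refine ⟨fun n => 1 / ((n : ℝ) + 1), fun n => ⟨by positivity, ?_⟩, tendsto_nhdsWithin_iff.2
      ⟨tendsto_one_div_add_atTop_nhds_zero_nat, Eventually.of_forall fun n => ?_⟩⟩
    · rw [div_le_one (by positivity)]; linarith [(Nat.cast_nonneg n : (0:ℝ) ≤ n)]
    · exact Set.mem_Ioi.2 (by positivity)
  have hp : ∀ η, Tendsto (fun n => ‖mainKernel S B tg cs (δ n) η‖ₑ ^ 2) atTop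
      (𝓝 (‖limitKernel S B tg cs η‖ₑ ^ 2)) := fun η =>
    ENNReal.Tendsto.pow ((continuous_enorm.tendsto _).comp
      ((tendsto_mainKernel_pointwise hS hB htg hcs hzg η).comp hδt))
  calc ∫⁻ η in {η | R < ‖hor η‖}, ‖limitKernel S B tg cs η‖ₑ ^ 2
      = ∫⁻ η in {η | R < ‖hor η‖}, liminf (fun n => ‖mainKernel S B tg cs (δ n) η‖ₑ ^ 2) atTop :=
        lintegral_congr fun η => (hp η).liminf_eq.symm
    _ ≤ liminf (fun n => ∫⁻ η in {η | R < ‖hor η‖}, ‖mainKernel S B tg cs (δ n) η‖ₑ ^ 2) atTop :=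
        lintegral_liminf_le fun n => (measurable_mainKernel hS hB tg cs _).enorm.pow_const 2
    _ ≤ τ R := by
        refine (liminf_le_liminf (Eventually.of_forall fun n =>
          h (δ n) (hδ n).1 (hδ n).2 R)).trans_eq (liminf_const _)

theorem enorm_sub_sq_le (x y : ℂ) : ‖x - y‖ₑ ^ 2 ≤ 2 * (‖x‖ₑ ^ 2 + ‖y‖ₑ ^ 2) := by
  have h : ‖x - y‖ ^ 2 ≤ 2 * (‖x‖ ^ 2 + ‖y‖ ^ 2) := by
    have := norm_sub_le x y
    have h0 := norm_nonneg (x - y)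
    nlinarith [sq_nonneg (‖x‖ - ‖y‖)]
  simp only [← ofReal_norm]
  rw [← ENNReal.ofReal_pow (norm_nonneg _), ← ENNReal.ofReal_pow (norm_nonneg _),
    ← ENNReal.ofReal_pow (norm_nonneg _), ← ENNReal.ofReal_add (by positivity) (by positivity),
    show (2 : ENNReal) = ENNReal.ofReal 2 by simp, ← ENNReal.ofReal_mul (by norm_num)]
  exact ENNReal.ofReal_le_ofReal h

theorem tendsto_mainKernel {S : Setup} (hS : S.Admissible) {B tg cs : ℝ} (hB : 0 < B) (htg : 0 < tg)
    (hcs : 0 < cs) (hzg : S.guideStar tg ∈ interior S.D) :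
    Tendsto (fun δ => ∫⁻ η, ‖mainKernel S B tg cs δ η - limitKernel S B tg cs η‖ₑ ^ 2) (𝓝[>] 0) (𝓝 0) ∧
      ∫⁻ η, ‖limitKernel S B tg cs η‖ₑ ^ 2 < ⊤ := by
  obtain ⟨τ, hτ, hτt, htail⟩ := mainKernel_tail hS hB htg hcs
  have hlt := limitKernel_tail hS hB htg hcs hzg htail
  have hml := measurable_limitKernel hS hB htg hcs hzg
  have hhor := continuous_hor
  have hev : ∀ᶠ δ in 𝓝[>] (0:ℝ), δ ∈ Set.Ioc (0:ℝ) 1 := Ioc_mem_nhdsGT (zero_lt_one' ℝ)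
  constructor
  · refine tendsto_lintegral_sq_of_local (τ := fun R => 2 * (τ R + τ R)) (fun R => ?_) ?_ ?_
    · obtain ⟨C, hC, hle⟩ := mainKernel_local hS hB htg hcs R
      have hle' : ∀ η, ‖hor η‖ ≤ R → ‖limitKernel S B tg cs η‖ₑ ≤ C * wgt (2 * η 2) := fun η hη =>
        le_of_tendsto ((continuous_enorm.tendsto _).comp
          (tendsto_mainKernel_pointwise hS hB htg hcs hzg η))
          (hev.mono fun δ hδ => hle δ hδ.1 hδ.2 η hη)
      have hms : MeasurableSet {η : E3 | ‖hor η‖ ≤ R} := measurableSet_le (by fun_prop) measurable_const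
      rw [← lintegral_zero (μ := volume.restrict {η : E3 | ‖hor η‖ ≤ R})]
      refine tendsto_lintegral_filter_of_dominated_convergence
        (fun η => 2 * ((C * wgt (2 * η 2)) ^ 2 + (C * wgt (2 * η 2)) ^ 2)) ?_ ?_ ?_ ?_
      · exact Eventually.of_forall fun δ =>
          ((measurable_mainKernel hS hB tg cs δ).sub hml).enorm.pow_const 2
      · filter_upwards [hev] with δ hδ
        filter_upwards [ae_restrict_mem hms] with η hη
        refine (enorm_sub_sq_le _ _).trans ?_
        gcongr
        · exact hle δ hδ.1 hδ.2 η hη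
        · exact hle' η hη
      · have hw : Measurable fun t : ℝ => wgt (2 * t) := measurable_wgt.comp (by fun_prop)
        have := lintegral_slab (G := fun t => 2 * ((C * wgt (2 * t)) ^ 2 + (C * wgt (2 * t)) ^ 2))
          (by fun_prop) R
        rw [this]
        refine ENNReal.mul_ne_top measure_closedBall_lt_top.ne ?_
        rw [lintegral_const_mul' _ _ (by norm_num), lintegral_add_left (by fun_prop)]
        simp_rw [mul_pow]
        rw [lintegral_const_mul' _ _ (ENNReal.pow_ne_top hC)]
        have h2 := ENNReal.mul_ne_top (ENNReal.pow_ne_top (n := 2) hC)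
          (lintegral_wgt_sq_lt_top (c := 2) (by norm_num)).ne
        exact ENNReal.mul_ne_top (by norm_num) (ENNReal.add_ne_top.2 ⟨h2, h2⟩)
      · refine Eventually.of_forall fun η => ?_
        have h1 := ((tendsto_mainKernel_pointwise hS hB htg hcs hzg η).sub_const
          (limitKernel S B tg cs η))
        rw [sub_self] at h1
        have h2 := ENNReal.Tendsto.pow (n := 2) ((continuous_enorm.tendsto _).comp h1)
        simpa using h2
    · have := ENNReal.Tendsto.const_mul (a := 2) (hτ.add hτ) (Or.inr (by norm_num))
      simpa using this
    · filter_upwards [hev] with δ hδ R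
      calc ∫⁻ η in {η | R < ‖hor η‖}, ‖mainKernel S B tg cs δ η - limitKernel S B tg cs η‖ₑ ^ 2
          ≤ ∫⁻ η in {η | R < ‖hor η‖}, 2 * (‖mainKernel S B tg cs δ η‖ₑ ^ 2 +
              ‖limitKernel S B tg cs η‖ₑ ^ 2) := lintegral_mono fun η => enorm_sub_sq_le _ _
        _ ≤ _ := by
          rw [lintegral_const_mul' _ _ (by norm_num), lintegral_add_right _ (hml.enorm.pow_const 2)]
          gcongr
          · exact htail δ hδ.1 hδ.2 R
          · exact hlt R
  -- For R = -1 the tail is the whole space, so the tail bound is also a bound of the full norm.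
  · refine lt_of_eq_of_lt ?_ ((hlt (-1)).trans_lt (lt_top_iff_ne_top.2 (hτt (-1))))
    rw [← setLIntegral_univ]
    congr 2
    ext η
    simp only [Set.mem_univ, Set.mem_ofPred_eq, true_iff]
    linarith [norm_nonneg (hor η)]

/-- The kernel of the imaging functional in the coordinates around the guide star. -/
def localKernel (S : Setup) (B tg cs δ : ℝ) (η : E3) : ℂ :=
  ((δ ^ 2 : ℝ) : ℂ) * S.D.indicator (imagingKernel S B tg cs δ) (scalePt S tg δ η)

theorem measurable_localKernel {S : Setup} (hS : S.Admissible) {B : ℝ} (hB : 0 < B) (tg cs δ : ℝ) :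
    Measurable (localKernel S B tg cs δ) := by
  have := ((measurable_imagingKernel hS hB tg cs δ).indicator hS.D_meas).comp
    (continuous_scalePt S tg δ).measurable
  exact measurable_const.mul this

theorem mainKernel_eq {S : Setup} {B tg cs δ : ℝ} {η : E3} (h : scalePt S tg δ η ∈ S.D) :
    mainKernel S B tg cs δ η = (mainConst S : ℂ) * ∫ u in S.A₀,
      ((2 * Real.pi * S.rayIntegral (sensor S δ u) (scalePt S tg δ η) /
        ‖scalePt S tg δ η - sensor S δ u‖ : ℝ) : ℂ) * slice S B tg cs δ 1 u (scalePt S tg δ η) := by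
  simp only [mainKernel, rayFactor, localSlice, Set.indicator_of_mem h]

/-- With `kernelConst` of order δ⁻⁴ and the local factor δ², a net δ⁻² remains. It cancels the δ² of
`kernelI_remainder` and turns the δ⁸ of `kernelII_bound` into δ⁶. -/
theorem localKernel_sub_mainKernel {S : Setup} (hS : S.Admissible) {B tg cs : ℝ} (hB : 0 < B)
    (htg : 0 < tg) (hcs : 0 < cs) : ∃ (C C' : ENNReal) (c T δ₀ : ℝ), C ≠ ⊤ ∧ C' ≠ ⊤ ∧ 0 < c ∧ 0 < δ₀ ∧
      ∀ δ, 0 < δ → δ ≤ δ₀ → ∀ η, ‖localKernel S B tg cs δ η - mainKernel S B tg cs δ η‖ₑ ≤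
        C * remainder S B tg cs c T δ η + C' * ENNReal.ofReal (δ ^ 6) *
          S.D.indicator (fun _ => 1) (scalePt S tg δ η) := by
  obtain ⟨C, c, T, hC, hc, hI⟩ := kernelI_remainder hS hB tg cs
  obtain ⟨C₂, δ₀, hC₂, hδ₀, hII⟩ := kernelII_bound hS hB htg hcs
  obtain ⟨Cb, hCb⟩ := kernel_bound hS hB tg cs
  have hc0 := hS.c₀_pos
  have hpi := Real.pi_pos
  have hfin : IsFiniteMeasure (volume.restrict S.A₀) := ⟨by simpa using hS.A₀_bdd.measure_lt_top⟩
  have hfin' : IsFiniteMeasure (volume.restrict (remSet c T)) :=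
    ⟨by simpa using volume_remSet_lt_top c T⟩
  set k : ℝ := (S.N : ℝ) ^ 2 / (volume.real S.A₀) ^ 2 * (1 / (2 * Real.pi * S.c₀ ^ 2)) *
    ((4 * Real.pi) ^ 3)⁻¹ with hk
  refine ⟨‖(k : ℂ)‖ₑ * C, ‖(k : ℂ)‖ₑ * ENNReal.ofReal (C₂ * volume.real S.A₀ * volume.real S.A₀),
    c, T, min δ₀ 1, ENNReal.mul_ne_top enorm_ne_top hC,
    ENNReal.mul_ne_top enorm_ne_top ENNReal.ofReal_ne_top, hc, by positivity, ?_⟩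
  intro δ hδ hδ' η
  have hδ1 : δ ≤ 1 := hδ'.trans (min_le_right _ _)
  have hδ2 : δ ≤ δ₀ := hδ'.trans (min_le_left _ _)
  by_cases hD : scalePt S tg δ η ∈ S.D
  swap
  · have h1 : localKernel S B tg cs δ η = 0 := by simp [localKernel, hD]
    have h2 : mainKernel S B tg cs δ η = 0 := by simp [mainKernel, localSlice, hD]
    rw [h1, h2, sub_zero, enorm_zero]
    exact bot_le
  set z := scalePt S tg δ η with hz
  have hmI : Measurable fun p : E2 × E2 => kernelI S B tg cs δ p.1 p.2 z := by
    have := (measurable_kernelI hS hB tg cs δ).comp (f := fun p : E2 × E2 => (p, z)) (by fun_prop)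
    simpa only [Function.comp_def] using this
  have hmII : Measurable fun p : E2 × E2 => kernelII S B tg cs δ p.1 p.2 z := by
    have := (measurable_kernelII hS hB tg cs δ).comp (f := fun p : E2 × E2 => (p, z)) (by fun_prop)
    simpa only [Function.comp_def] using this
  have hint1 : ∀ u₁, IntegrableOn (fun u₂ => kernelI S B tg cs δ u₁ u₂ z) S.A₀ := fun u₁ =>
    Integrable.of_bound (by
      have := hmI.comp (f := fun u₂ : E2 => (u₁, u₂)) (by fun_prop)
      simp only [Function.comp_def] at this
      exact this.aestronglyMeasurable) Cb (Eventually.of_forall fun u₂ => (hCb δ u₁ u₂ z hD).1)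
  have hint2 : ∀ u₁, IntegrableOn (fun u₂ => kernelII S B tg cs δ u₁ u₂ z) S.A₀ := fun u₁ =>
    Integrable.of_bound (by
      have := hmII.comp (f := fun u₂ : E2 => (u₁, u₂)) (by fun_prop)
      simp only [Function.comp_def] at this
      exact this.aestronglyMeasurable) Cb (Eventually.of_forall fun u₂ => (hCb δ u₁ u₂ z hD).2)
  have hA : volume S.A₀ < ⊤ := hS.A₀_bdd.measure_lt_top
  have hint1' : IntegrableOn (fun u₁ => ∫ u₂ in S.A₀, kernelI S B tg cs δ u₁ u₂ z) S.A₀ :=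
    Integrable.of_bound (StronglyMeasurable.integral_prod_right
      (f := fun u₁ => fun u₂ => kernelI S B tg cs δ u₁ u₂ z) hmI.stronglyMeasurable).aestronglyMeasurable
      (Cb * volume.real S.A₀) (Eventually.of_forall fun u₁ =>
        norm_setIntegral_le_of_norm_le_const hA fun u₂ _ => (hCb δ u₁ u₂ z hD).1)
  have hint2' : IntegrableOn (fun u₁ => ∫ u₂ in S.A₀, kernelII S B tg cs δ u₁ u₂ z) S.A₀ :=
    Integrable.of_bound (StronglyMeasurable.integral_prod_right
      (f := fun u₁ => fun u₂ => kernelII S B tg cs δ u₁ u₂ z) hmII.stronglyMeasurable).aestronglyMeasurable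
      (Cb * volume.real S.A₀) (Eventually.of_forall fun u₁ =>
        norm_setIntegral_le_of_norm_le_const hA fun u₂ _ => (hCb δ u₁ u₂ z hD).2)
  set m : E2 → ℂ := fun u => ((2 * Real.pi * S.rayIntegral (sensor S δ u) z /
        ‖z - sensor S δ u‖ : ℝ) : ℂ) * slice S B tg cs δ 1 u z with hm
  have hint3 : IntegrableOn m S.A₀ := by
    obtain ⟨Cr, hCr0, hCr⟩ := exists_rayFactor_bound hS tg
    obtain ⟨Cs, hCs, hsl⟩ := localSlice_le hS hB htg hcs ‖hor η‖
    have h1 := (measurable_mainIntegrand hS hB tg cs δ).comp (f := fun u : E2 => (η, u)) (by fun_prop)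
    have h2 : (fun u => (rayFactor S tg δ u η : ℂ) * localSlice S B tg cs δ 1 u η) = m := by
      funext u
      rw [localSlice, ← hz, Set.indicator_of_mem hD]
      rfl
    simp only [Function.comp_def] at h1
    rw [h2] at h1
    refine Integrable.of_bound h1.aestronglyMeasurable (Cr * Cs.toReal) ?_
    filter_upwards [ae_restrict_mem hS.A₀_meas] with u hu
    rw [← h2, norm_mul, Complex.norm_real, Real.norm_eq_abs]
    refine mul_le_mul (hCr δ hδ hδ1 u hu η hD) ?_ (norm_nonneg _) hCr0
    have h1 := (hsl δ hδ hδ1 u hu 1 (by simp) η le_rfl).trans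
      ((mul_le_mul_right (wgt_le_one _) Cs).trans_eq (mul_one Cs))
    rw [← toReal_enorm]
    exact ENNReal.toReal_mono hCs h1
  have hsplit : localKernel S B tg cs δ η - mainKernel S B tg cs δ η = (k : ℂ) *
      ((((δ ^ 2)⁻¹ : ℝ) : ℂ) * (∫ u₁ in S.A₀, ((∫ u₂ in S.A₀, kernelI S B tg cs δ u₁ u₂ z) -
        ((S.c₀ * δ ^ 2 : ℝ) : ℂ) * m u₁)) + (((δ ^ 2)⁻¹ : ℝ) : ℂ) *
        ∫ u₁ in S.A₀, ∫ u₂ in S.A₀, kernelII S B tg cs δ u₁ u₂ z) := by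
    have h1 : ∫ u₁ in S.A₀, ∫ u₂ in S.A₀, pairKernel S B tg cs δ u₁ u₂ z
        = (∫ u₁ in S.A₀, ∫ u₂ in S.A₀, kernelI S B tg cs δ u₁ u₂ z) +
          ∫ u₁ in S.A₀, ∫ u₂ in S.A₀, kernelII S B tg cs δ u₁ u₂ z := by
      rw [← integral_add hint1' hint2']
      refine integral_congr_ae (Eventually.of_forall fun u₁ => ?_)
      exact integral_add (hint1 u₁) (hint2 u₁)
    have hmain : mainKernel S B tg cs δ η = (mainConst S : ℂ) * ∫ u in S.A₀, m u := mainKernel_eq hD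
    rw [integral_sub hint1' (hint3.const_mul _), integral_const_mul, hmain, localKernel,
      ← hz, Set.indicator_of_mem hD, imagingKernel, h1]
    have h2 : kernelConst S δ = k * (δ ^ 2)⁻¹ * (δ ^ 2)⁻¹ := by
      rw [kernelConst, hk]; field_simp
    have h3 : mainConst S = k * S.c₀ := by rw [mainConst, hk]
    rw [h2, h3]
    have hδc : (δ : ℂ) ≠ 0 := Complex.ofReal_ne_zero.2 hδ.ne'
    push_cast
    field_simp
    ring
  rw [hsplit, enorm_mul, Set.indicator_of_mem hD, mul_one, mul_assoc, mul_assoc,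
    ← mul_add ‖(k : ℂ)‖ₑ (C * _)]
  refine mul_le_mul_right ((enorm_add_le _ _).trans (add_le_add ?_ ?_)) _
  · rw [enorm_mul]
    have h1 : ‖∫ u₁ in S.A₀, ((∫ u₂ in S.A₀, kernelI S B tg cs δ u₁ u₂ z) -
        ((S.c₀ * δ ^ 2 : ℝ) : ℂ) * m u₁)‖ₑ ≤ C * ENNReal.ofReal (δ ^ 2) *
          remainder S B tg cs c T δ η := by
      refine (enorm_integral_le_lintegral_enorm _).trans ?_
      have hmr := ((measurable_remIntegrand hS hB tg cs δ).comp
        (f := fun q : E2 × (ℝ × ℝ) => (η, q)) (by fun_prop))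
      simp only [Function.comp_def] at hmr
      rw [remainder, remMeasure, lintegral_prod _ hmr.aemeasurable,
        ← lintegral_const_mul' _ _ (ENNReal.mul_ne_top hC ENNReal.ofReal_ne_top)]
      refine setLIntegral_mono' hS.A₀_meas fun u hu => (hI δ hδ hδ1 u hu z hD).trans_eq ?_
      simp only [localSlice, ← hz, Set.indicator_of_mem hD]
    refine (mul_le_mul_right h1 _).trans_eq ?_
    rw [← ofReal_norm, Complex.norm_real, Real.norm_eq_abs, abs_of_pos (by positivity),
      mul_comm C, ← mul_assoc, ← mul_assoc, ← ENNReal.ofReal_mul (by positivity),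
      inv_mul_cancel₀ (by positivity), ENNReal.ofReal_one, one_mul]
  · have h1 : ‖∫ u₁ in S.A₀, ∫ u₂ in S.A₀, kernelII S B tg cs δ u₁ u₂ z‖ ≤
        C₂ * δ ^ 8 * volume.real S.A₀ * volume.real S.A₀ :=
      norm_setIntegral_le_of_norm_le_const hA fun u₁ h₁ =>
        norm_setIntegral_le_of_norm_le_const hA fun u₂ h₂ => hII δ hδ hδ2 u₁ h₁ u₂ h₂ z hD
    rw [← ofReal_norm, ← ENNReal.ofReal_mul (by positivity)]
    refine ENNReal.ofReal_le_ofReal ?_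
    rw [norm_mul, Complex.norm_real, Real.norm_eq_abs, abs_of_pos (by positivity)]
    refine (mul_le_mul_of_nonneg_left h1 (by positivity)).trans_eq ?_
    field_simp

theorem tendsto_localKernel {S : Setup} (hS : S.Admissible) {B tg cs : ℝ} (hB : 0 < B) (htg : 0 < tg)
    (hcs : 0 < cs) (hzg : S.guideStar tg ∈ interior S.D) :
    Tendsto (fun δ => ∫⁻ η, ‖localKernel S B tg cs δ η - limitKernel S B tg cs η‖ₑ ^ 2) (𝓝[>] 0)
      (𝓝 0) := by
  obtain ⟨C, C', c, T, δ₀, hC, hC', hc, hδ₀, h⟩ := localKernel_sub_mainKernel hS hB htg hcs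
  have h1 := (tendsto_mainKernel hS hB htg hcs hzg).1
  have h2 := tendsto_remainder hS hB htg hcs hc T
  have hml := measurable_limitKernel hS hB htg hcs hzg
  have h3 : Tendsto (fun δ : ℝ => ENNReal.ofReal (δ ^ 8)) (𝓝[>] 0) (𝓝 0) := by
    have : Continuous fun δ : ℝ => ENNReal.ofReal (δ ^ 8) :=
      ENNReal.continuous_ofReal.comp (by fun_prop)
    have := this.tendsto 0
    simp only [ne_eq, OfNat.ofNat_ne_zero, not_false_eq_true, zero_pow, ENNReal.ofReal_zero] at this
    exact this.mono_left nhdsWithin_le_nhds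
  have hK1 : 4 * C ^ 2 ≠ ⊤ := ENNReal.mul_ne_top (by norm_num) (ENNReal.pow_ne_top hC)
  have hK2 : 4 * C' ^ 2 * volume S.D ≠ ⊤ :=
    ENNReal.mul_ne_top (ENNReal.mul_ne_top (by norm_num) (ENNReal.pow_ne_top hC'))
      hS.D_bdd.measure_lt_top.ne
  have hlim := ((ENNReal.Tendsto.const_mul (a := 4 * C ^ 2) h2 (Or.inr hK1)).add
    (ENNReal.Tendsto.const_mul (a := 4 * C' ^ 2 * volume S.D) h3 (Or.inr hK2))).add
    (ENNReal.Tendsto.const_mul (a := 2) h1 (Or.inr (by norm_num)))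
  simp only [mul_zero, add_zero] at hlim
  refine tendsto_of_tendsto_of_tendsto_of_le_of_le' tendsto_const_nhds hlim
    (Eventually.of_forall fun _ => bot_le) ?_
  filter_upwards [Ioc_mem_nhdsGT hδ₀] with δ hδ
  have hpt : ∀ η, ‖localKernel S B tg cs δ η - limitKernel S B tg cs η‖ₑ ^ 2 ≤
      4 * C ^ 2 * remainder S B tg cs c T δ η ^ 2 + 4 * C' ^ 2 * ENNReal.ofReal (δ ^ 12) *
        S.D.indicator (fun _ => 1) (scalePt S tg δ η) +
      2 * ‖mainKernel S B tg cs δ η - limitKernel S B tg cs η‖ₑ ^ 2 := by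
    intro η
    have e1 := h δ hδ.1 hδ.2 η
    have hadd : ∀ x y : ENNReal, (x + y) ^ 2 ≤ 2 * (x ^ 2 + y ^ 2) := fun x y => by
      have := ENNReal.rpow_add_le_mul_rpow_add_rpow x y (p := 2) (by norm_num)
      rw [show (2 - 1 : ℝ) = 1 by norm_num] at this
      simpa only [ENNReal.rpow_two, ENNReal.rpow_one] using this
    calc ‖localKernel S B tg cs δ η - limitKernel S B tg cs η‖ₑ ^ 2
        ≤ (‖localKernel S B tg cs δ η - mainKernel S B tg cs δ η‖ₑ +
            ‖mainKernel S B tg cs δ η - limitKernel S B tg cs η‖ₑ) ^ 2 := by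
          refine pow_le_pow_left' ?_ 2
          rw [← sub_add_sub_cancel _ (mainKernel S B tg cs δ η)]
          exact enorm_add_le _ _
      _ ≤ 2 * (‖localKernel S B tg cs δ η - mainKernel S B tg cs δ η‖ₑ ^ 2 +
            ‖mainKernel S B tg cs δ η - limitKernel S B tg cs η‖ₑ ^ 2) := hadd _ _
      _ ≤ 2 * (2 * ((C * remainder S B tg cs c T δ η) ^ 2 + (C' * ENNReal.ofReal (δ ^ 6) *
            S.D.indicator (fun _ => 1) (scalePt S tg δ η)) ^ 2) +
            ‖mainKernel S B tg cs δ η - limitKernel S B tg cs η‖ₑ ^ 2) := by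
          gcongr
          exact (pow_le_pow_left' e1 2).trans (hadd _ _)
      _ = _ := by
          have e2 : ENNReal.ofReal (δ ^ 12) = ENNReal.ofReal (δ ^ 6) ^ 2 := by
            rw [← ENNReal.ofReal_pow (by have := hδ.1; positivity)]; congr 1; ring
          have e3 : (S.D.indicator (fun _ => (1 : ENNReal)) (scalePt S tg δ η)) ^ 2
              = S.D.indicator (fun _ => 1) (scalePt S tg δ η) := by
            by_cases hD : scalePt S tg δ η ∈ S.D <;> simp [hD]
          rw [mul_pow, mul_pow, mul_pow, e2, e3]
          ring
  have hmr := measurable_remainder hS hB tg cs c T δ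
  have hmi : Measurable fun η => S.D.indicator (fun _ => (1 : ENNReal)) (scalePt S tg δ η) :=
    (measurable_const.indicator hS.D_meas).comp (continuous_scalePt S tg δ).measurable
  have hvol := lintegral_scalePt S tg hδ.1 (F := S.D.indicator (fun _ => (1 : ENNReal)))
    (measurable_const.indicator hS.D_meas)
  rw [lintegral_indicator hS.D_meas, setLIntegral_const, one_mul] at hvol
  refine (lintegral_mono hpt).trans ?_
  rw [lintegral_add_left (by fun_prop), lintegral_add_left (by fun_prop),
    lintegral_const_mul' _ _ hK1, lintegral_const_mul' (4 * C' ^ 2 * ENNReal.ofReal (δ ^ 12)) _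
      (ENNReal.mul_ne_top (ENNReal.mul_ne_top (by norm_num) (ENNReal.pow_ne_top hC'))
        ENNReal.ofReal_ne_top), lintegral_const_mul' 2 _ (by norm_num)]
  refine add_le_add (add_le_add le_rfl (le_of_eq ?_)) le_rfl
  -- In local coordinates D has volume |D| δ⁻⁴, so the second Born term contributes energy of order
  -- δ⁸.
  rw [hvol, show δ ^ 12 = δ ^ 8 * δ ^ 4 by ring,
    ENNReal.ofReal_mul (by have := hδ.1; positivity)]
  ring

section

variable {Ω : Type*} [MeasurableSpace Ω] {P : Measure Ω} [IsProbabilityMeasure P] {μ : E3 → Ω → ℝ}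

/-! ### Autocorrelation of square integrable functions -/

/-- The autocorrelation of `f` at the shift `h`. -/
def autocorr (f : E3 → ℂ) (h : E3) : ℂ := ∫ η, f η * (starRingEnd ℂ) (f (η - h))

/-- Expressed through the translation action on L², which is isometric and continuous. The first
property bounds autocorrelations, the second gives their convergence for vanishing shifts. -/
theorem autocorr_eq_inner {f : E3 → ℂ} (hf : MemLp f 2) (h : E3) :
    autocorr f h = inner ℂ (DomAddAct.mk (-h) +ᵥ hf.toLp f) (hf.toLp f) := by
  rw [DomAddAct.mk_vadd_toLp, L2.inner_def, autocorr]
  refine integral_congr_ae ?_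
  filter_upwards [hf.coeFn_toLp, MemLp.coeFn_toLp (hf.comp_measurePreserving
    (measurePreserving_vadd (-h) (volume : Measure E3)))] with x h1 h2
  have h2' : (MemLp.toLp (fun x => f (-h +ᵥ x)) (hf.comp_measurePreserving
    (measurePreserving_vadd (-h) (volume : Measure E3)))) x = f (-h +ᵥ x) := h2
  rw [RCLike.inner_apply, h1, h2', vadd_eq_add, neg_add_eq_sub]

theorem norm_autocorr_le {f : E3 → ℂ} (hf : MemLp f 2) (h : E3) :
    ‖autocorr f h‖ ≤ ‖hf.toLp f‖ * ‖hf.toLp f‖ := by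
  rw [autocorr_eq_inner hf]
  refine (norm_inner_le_norm _ _).trans_eq ?_
  rw [DomAddAct.norm_vadd_Lp]

theorem autocorr_zero (f : E3 → ℂ) : autocorr f 0 = ((∫ η, ‖f η‖ ^ 2 : ℝ) : ℂ) := by
  rw [autocorr, ← integral_complex_ofReal]
  refine integral_congr_ae (Eventually.of_forall fun η => ?_)
  simp only [sub_zero, Complex.mul_conj']
  push_cast; rfl

theorem tendsto_autocorr {α : Type*} {l : Filter α} {F : α → E3 → ℂ} {f : E3 → ℂ}
    (hF : ∀ i, MemLp (F i) 2) (hf : MemLp f 2)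
    (hlim : Tendsto (fun i => (hF i).toLp (F i)) l (𝓝 (hf.toLp f))) {H : α → E3}
    (hH : Tendsto H l (𝓝 0)) : Tendsto (fun i => autocorr (F i) (H i)) l (𝓝 (autocorr f 0)) := by
  have h2 : Fact ((2 : ENNReal) ≠ ⊤) := ⟨by norm_num⟩
  simp_rw [fun i => autocorr_eq_inner (hF i) (H i), autocorr_eq_inner hf]
  refine Tendsto.inner (Tendsto.vadd ?_ hlim) hlim
  exact (DomAddAct.continuous_mk.tendsto _).comp hH.neg

/-! ### The covariance function -/

theorem covariance_eq (hμ : IsFluctuation P μ) (x y : E3) :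
    ∫ w, μ x w * μ y w ∂P = covFun P μ (x - y) := by
  have h1 := hμ.stationary (x - y) 0 y
  rw [sub_add_cancel, zero_add, ProbabilityTheory.covariance_eq_sub (hμ.memLp x) (hμ.memLp y),
    hμ.mean_zero x, zero_mul, sub_zero] at h1
  exact h1

theorem measurable_covFun (hμ : IsFluctuation P μ) : Measurable (covFun P μ) := by
  have h : covFun P μ = fun x => ∫ w, μ x w * μ 0 w ∂P := by
    funext x; rw [covariance_eq hμ, sub_zero]
  rw [h]
  have hm := hμ.measurable
  have h1 : Measurable fun p : E3 × Ω => μ p.1 p.2 := hm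
  have h2 : Measurable fun p : E3 × Ω => μ 0 p.2 := hm.comp (f := fun p : E3 × Ω => ((0 : E3), p.2))
    (by fun_prop)
  exact (StronglyMeasurable.integral_prod_right (f := fun x : E3 => fun w => μ x w * μ 0 w)
    (h1.mul h2).stronglyMeasurable).measurable

/-- The decay exponent 4 + η exceeds the dimension 3. -/
theorem integrable_covFun (hμ : IsFluctuation P μ) : Integrable (covFun P μ) := by
  obtain ⟨C, η, hη, h⟩ := hμ.decay
  have h1 : Integrable (fun x : E3 => (1 + ‖x‖) ^ (-(4 + η))) :=
    integrable_one_add_norm (by simp; linarith)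
  refine (h1.const_mul C).mono' (measurable_covFun hμ).aestronglyMeasurable
    (Eventually.of_forall fun x => ?_)
  rw [Real.norm_eq_abs, neg_add']
  exact h x

/-! ### Random linear functionals of the medium -/

/-- Stationarity makes the variance the same at every point, so the second moment has a constant,
hence integrable, integral along the fibres. -/
theorem integrable_sq_field (hμ : IsFluctuation P μ) {X : Type*} [MeasurableSpace X] (m : Measure X)
    [IsFiniteMeasure m] {f : X → E3} (hf : Measurable f) :
    Integrable (fun q : X × Ω => μ (f q.1) q.2 ^ 2) (m.prod P) := by
  have hm : Measurable fun p : E3 × Ω => μ p.1 p.2 := hμ.measurable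
  have hsq : ∀ x, ∫ w, ‖μ x w ^ 2‖ ∂P = covFun P μ 0 := fun x => by
    rw [← sub_self x, ← covariance_eq hμ x x]
    refine integral_congr_ae (Eventually.of_forall fun w => ?_)
    simp only [Real.norm_eq_abs, abs_pow, sq_abs]
    exact sq _
  have hmf : Measurable fun q : X × Ω => μ (f q.1) q.2 :=
    hm.comp (f := fun q : X × Ω => (f q.1, q.2)) (by fun_prop)
  rw [integrable_prod_iff (hmf.pow_const 2).aestronglyMeasurable]
  refine ⟨Eventually.of_forall fun z => (hμ.memLp (f z)).integrable_sq, ?_⟩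
  simp only [hsq]
  exact integrable_const _

theorem integrable_pair (hμ : IsFluctuation P μ) {ℓ : ℝ} {m : Measure E3} [IsFiniteMeasure m]
    {g : E3 → ℂ} (hg : Measurable g) {C : ℝ} (hC : ∀ z, ‖g z‖ ≤ C) :
    Integrable (fun q : (E3 × E3) × Ω => ((μ (ℓ⁻¹ • q.1.1) q.2 : ℂ) * g q.1.1) *
      (starRingEnd ℂ) ((μ (ℓ⁻¹ • q.1.2) q.2 : ℂ) * g q.1.2)) ((m.prod m).prod P) := by
  have hm : Measurable fun p : E3 × Ω => μ p.1 p.2 := hμ.measurable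
  have hC0 : 0 ≤ C := (norm_nonneg _).trans (hC 0)
  have h1 : Measurable fun q : (E3 × E3) × Ω => μ (ℓ⁻¹ • q.1.1) q.2 :=
    hm.comp (f := fun q : (E3 × E3) × Ω => (ℓ⁻¹ • q.1.1, q.2)) (by fun_prop)
  have h2 : Measurable fun q : (E3 × E3) × Ω => μ (ℓ⁻¹ • q.1.2) q.2 :=
    hm.comp (f := fun q : (E3 × E3) × Ω => (ℓ⁻¹ • q.1.2, q.2)) (by fun_prop)
  refine (((integrable_sq_field hμ (m.prod m) (f := fun z => ℓ⁻¹ • z.1) (by fun_prop)).add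
    (integrable_sq_field hμ (m.prod m) (f := fun z => ℓ⁻¹ • z.2) (by fun_prop))).const_mul (C * C)).mono' ?_ ?_
  · exact ((Complex.measurable_ofReal.comp h1).mul (hg.comp (by fun_prop))).mul
      (Complex.continuous_conj.measurable.comp ((Complex.measurable_ofReal.comp h2).mul
        (hg.comp (by fun_prop)))) |>.aestronglyMeasurable
  · refine Eventually.of_forall fun q => ?_
    simp only [norm_mul, RCLike.norm_conj, Complex.norm_real, Real.norm_eq_abs, Pi.add_apply]
    have e1 := hC q.1.1
    have e2 := hC q.1.2
    generalize μ (ℓ⁻¹ • q.1.1) q.2 = a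
    generalize μ (ℓ⁻¹ • q.1.2) q.2 = b
    have h3 : |a| * |b| ≤ a ^ 2 + b ^ 2 := by
      nlinarith [sq_nonneg (|a| - |b|), sq_abs a, sq_abs b, sq_nonneg a, sq_nonneg b]
    calc |a| * ‖g q.1.1‖ * (|b| * ‖g q.1.2‖) = (‖g q.1.1‖ * ‖g q.1.2‖) * (|a| * |b|) := by ring
      _ ≤ (C * C) * (a ^ 2 + b ^ 2) := by gcongr

/-- The value on the random medium of the functional with kernel `g`. -/
def functional {Ω : Type*} (μ : E3 → Ω → ℝ) (m : Measure E3) (g : E3 → ℂ) (ℓ : ℝ) (w : Ω) : ℂ :=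
  ∫ z, (μ (ℓ⁻¹ • z) w : ℂ) * g z ∂m

theorem norm_sq_functional {Ω : Type*} {μ : E3 → Ω → ℝ} (m : Measure E3) [SFinite m] (g : E3 → ℂ) (ℓ : ℝ) (w : Ω) :
    ((‖functional μ m g ℓ w‖ ^ 2 : ℝ) : ℂ) = ∫ z : E3 × E3, ((μ (ℓ⁻¹ • z.1) w : ℂ) * g z.1) *
      (starRingEnd ℂ) ((μ (ℓ⁻¹ • z.2) w : ℂ) * g z.2) ∂(m.prod m) := by
  rw [integral_prod_mul (fun z => (μ (ℓ⁻¹ • z) w : ℂ) * g z)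
    (fun z => (starRingEnd ℂ) ((μ (ℓ⁻¹ • z) w : ℂ) * g z)), integral_conj, Complex.mul_conj']
  push_cast; rfl

/-- The squared modulus is a double integral over the medium; `integrable_pair` permits taking the
expectation inside, where stationarity makes the covariance a function of the difference. -/
theorem functional_moments (hμ : IsFluctuation P μ) {ℓ : ℝ} {m : Measure E3} [IsFiniteMeasure m]
    {g : E3 → ℂ} (hg : Measurable g) {C : ℝ} (hC : ∀ z, ‖g z‖ ≤ C) :
    MemLp (functional μ m g ℓ) 2 P ∧ ((∫ w, ‖functional μ m g ℓ w‖ ^ 2 ∂P : ℝ) : ℂ) =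
      ∫ z : E3 × E3, (covFun P μ (ℓ⁻¹ • (z.1 - z.2)) : ℂ) * (g z.1 * (starRingEnd ℂ) (g z.2))
        ∂(m.prod m) := by
  have hm : Measurable fun p : E3 × Ω => μ p.1 p.2 := hμ.measurable
  have hint := integrable_pair hμ (ℓ := ℓ) (m := m) hg hC
  have hmeas : Measurable (functional μ m g ℓ) := by
    have h1 : Measurable fun p : Ω × E3 => μ (ℓ⁻¹ • p.2) p.1 :=
      hm.comp (f := fun p : Ω × E3 => (ℓ⁻¹ • p.2, p.1)) (by fun_prop)
    exact (StronglyMeasurable.integral_prod_right (f := fun w => fun z : E3 => (μ (ℓ⁻¹ • z) w : ℂ) * g z)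
      ((Complex.measurable_ofReal.comp h1).mul (hg.comp measurable_snd)).stronglyMeasurable).measurable
  constructor
  · rw [memLp_two_iff_integrable_sq_norm hmeas.aestronglyMeasurable]
    have h1 := hint.integral_prod_right
    simp_rw [← norm_sq_functional] at h1
    exact h1.re
  · rw [← integral_complex_ofReal]
    simp_rw [norm_sq_functional]
    rw [← integral_integral_swap hint]
    refine integral_congr_ae (Eventually.of_forall fun z => ?_)
    beta_reduce
    have h1 : ∀ w, ((μ (ℓ⁻¹ • z.1) w : ℂ) * g z.1) * (starRingEnd ℂ) ((μ (ℓ⁻¹ • z.2) w : ℂ) * g z.2)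
        = ((μ (ℓ⁻¹ • z.1) w * μ (ℓ⁻¹ • z.2) w : ℝ) : ℂ) * (g z.1 * (starRingEnd ℂ) (g z.2)) := by
      intro w
      rw [map_mul, Complex.conj_ofReal]; push_cast; ring
    simp_rw [h1]
    rw [integral_mul_const, integral_complex_ofReal, covariance_eq hμ, smul_sub]

end

section

variable {Ω : Type*} [MeasurableSpace Ω] {P : Measure Ω} [IsProbabilityMeasure P] {μ : E3 → Ω → ℝ}

/-! ### The second moment of the image -/

theorem exists_covFun_bound {Ω : Type*} [MeasurableSpace Ω] {P : Measure Ω} {μ : E3 → Ω → ℝ}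
    (hμ : IsFluctuation P μ) : ∃ C : ℝ, ∀ x, |covFun P μ x| ≤ C := by
  obtain ⟨C, η, hη, h⟩ := hμ.decay
  have h0 := h 0
  have hC : 0 ≤ C := by
    have := (abs_nonneg _).trans h0
    simpa using this
  refine ⟨C, fun x => (h x).trans (mul_le_of_le_one_right hC ?_)⟩
  exact Real.rpow_le_one_of_one_le_of_nonpos (by linarith [norm_nonneg x]) (by linarith)

/-- The kernel of the imaging functional, extended by zero. -/
def extKernel (S : Setup) (B tg cs δ : ℝ) : E3 → ℂ := S.D.indicator (imagingKernel S B tg cs δ)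

theorem measurable_extKernel {S : Setup} (hS : S.Admissible) {B : ℝ} (hB : 0 < B) (tg cs δ : ℝ) :
    Measurable (extKernel S B tg cs δ) :=
  (measurable_imagingKernel hS hB tg cs δ).indicator hS.D_meas

theorem extKernel_bound {S : Setup} (hS : S.Admissible) {B : ℝ} (hB : 0 < B) (tg cs δ : ℝ) :
    ∃ C : ℝ, ∀ z, ‖extKernel S B tg cs δ z‖ ≤ C := by
  obtain ⟨C, hC⟩ := imagingKernel_bound hS hB tg cs δ
  refine ⟨max C 0, fun z => ?_⟩
  by_cases hz : z ∈ S.D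
  · rw [extKernel, Set.indicator_of_mem hz]; exact (hC z hz).trans (le_max_left _ _)
  · rw [extKernel, Set.indicator_of_notMem hz, norm_zero]; exact le_max_right _ _

theorem integrable_extKernel {S : Setup} (hS : S.Admissible) {B : ℝ} (hB : 0 < B) (tg cs δ : ℝ) :
    Integrable (extKernel S B tg cs δ) := by
  obtain ⟨C, hC⟩ := imagingKernel_bound hS hB tg cs δ
  rw [extKernel, integrable_indicator_iff hS.D_meas]
  refine Measure.integrableOn_of_bounded (M := C) hS.D_bdd.measure_lt_top.ne
    (measurable_imagingKernel hS hB tg cs δ).aestronglyMeasurable ?_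
  filter_upwards [ae_restrict_mem hS.D_meas] with z hz using hC z hz

/-- Almost every realisation of the medium is integrable on the bounded set D, which is what the
linear representation `imaging_eq` asks for. -/
theorem randomImage_ae_eq {S : Setup} (hS : S.Admissible) (hμ : IsFluctuation P μ) {B : ℝ} (hB : 0 < B)
    (tg cs : ℝ) {ε : ℝ} (hε : 0 < ε) (ℓ : ℝ) : S.randomImage μ B tg cs ε ℓ =ᵐ[P]
      functional μ (volume.restrict S.D) (extKernel S B tg cs (Real.sqrt ε)) ℓ := by
  have hfin : IsFiniteMeasure (volume.restrict S.D) := ⟨by simpa using hS.D_bdd.measure_lt_top⟩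
  have hm : Measurable fun p : E3 × Ω => μ p.1 p.2 := hμ.measurable
  have hm1 : Measurable fun q : E3 × Ω => μ (ℓ⁻¹ • q.1) q.2 :=
    hm.comp (f := fun q : E3 × Ω => (ℓ⁻¹ • q.1, q.2)) (by fun_prop)
  have h1 := integrable_sq_field hμ (volume.restrict S.D) (f := fun z => ℓ⁻¹ • z) (by fun_prop)
  have h2 := ((memLp_two_iff_integrable_sq hm1.aestronglyMeasurable).2 h1).integrable (by norm_num)
  filter_upwards [h2.prod_left_ae] with w hw
  have h3 := imaging_eq hS hB tg cs (Real.sqrt_pos.2 hε) (ρ := fun z => μ (ℓ⁻¹ • z) w) hw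
  rw [Real.sq_sqrt hε.le] at h3
  rw [Setup.randomImage, h3, functional]
  refine setIntegral_congr_fun hS.D_meas fun z hz => ?_
  simp only [extKernel, Set.indicator_of_mem hz]

/-- Integration of the covariance against the autocorrelation of a kernel. -/
theorem integral_covFun_prod (hμ : IsFluctuation P μ) {g : E3 → ℂ} (hgi : Integrable g)
    (hgm : Measurable g) {C : ℝ} (hC : ∀ z, ‖g z‖ ≤ C) {ℓ : ℝ} (hℓ : 0 < ℓ) :
    ∫ z : E3 × E3, (covFun P μ (ℓ⁻¹ • (z.1 - z.2)) : ℂ) * (g z.1 * (starRingEnd ℂ) (g z.2)) =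
      ((ℓ ^ 3 : ℝ) : ℂ) * ∫ x, (covFun P μ x : ℂ) * autocorr g (ℓ • x) := by
  obtain ⟨K, hK⟩ := exists_covFun_bound hμ
  have hcm := measurable_covFun hμ
  have hcov := integrable_covFun hμ
  have hgc : Integrable fun z => (starRingEnd ℂ) (g z) :=
    hgi.congr' (Complex.continuous_conj.measurable.comp hgm).aestronglyMeasurable
      (Eventually.of_forall fun z => (RCLike.norm_conj _).symm)
  have hΦ : Integrable (fun z : E3 × E3 => (covFun P μ (ℓ⁻¹ • (z.1 - z.2)) : ℂ) *
      (g z.1 * (starRingEnd ℂ) (g z.2))) (volume.prod volume) := by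
    refine (hgi.mul_prod hgc).bdd_mul (c := K) ?_ (Eventually.of_forall fun z => ?_)
    · exact (Complex.measurable_ofReal.comp (hcm.comp (f := fun z : E3 × E3 => ℓ⁻¹ • (z.1 - z.2))
        (by fun_prop))).aestronglyMeasurable
    · rw [Complex.norm_real, Real.norm_eq_abs]; exact hK _
  rw [Measure.volume_eq_prod, integral_prod _ hΦ]
  have h1 : ∀ z, ∫ y, (covFun P μ (ℓ⁻¹ • (z - y)) : ℂ) * (g z * (starRingEnd ℂ) (g y)) =
      ((ℓ ^ 3 : ℝ) : ℂ) * ∫ x, (covFun P μ x : ℂ) * (g z * (starRingEnd ℂ) (g (z - ℓ • x))) := by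
    intro z
    rw [← integral_sub_left_eq_self _ volume z]
    have h2 := Measure.integral_comp_smul (volume : Measure E3)
      (fun y => (covFun P μ (ℓ⁻¹ • y) : ℂ) * (g z * (starRingEnd ℂ) (g (z - y)))) ℓ
    simp only [smul_smul, inv_mul_cancel₀ hℓ.ne', one_smul] at h2
    rw [h2, show Module.finrank ℝ E3 = 3 by simp, abs_of_pos (by positivity), Complex.real_smul,
      ← mul_assoc, ← Complex.ofReal_mul, mul_inv_cancel₀ (by positivity), Complex.ofReal_one, one_mul]
    simp only [sub_sub_cancel]
  simp_rw [h1]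
  rw [integral_const_mul]
  congr 1
  have hΨ : Integrable (fun q : E3 × E3 => (covFun P μ q.2 : ℂ) *
      (g q.1 * (starRingEnd ℂ) (g (q.1 - ℓ • q.2)))) (volume.prod volume) := by
    have h3 : Integrable (fun q : E3 × E3 => g q.1 * (covFun P μ q.2 : ℂ)) (volume.prod volume) :=
      hgi.mul_prod hcov.ofReal
    refine (h3.mul_bdd (c := C) (g := fun q => (starRingEnd ℂ) (g (q.1 - ℓ • q.2))) ?_
      (Eventually.of_forall fun q => ?_)).congr (Eventually.of_forall fun q => ?_)
    · exact (Complex.continuous_conj.measurable.comp (hgm.comp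
        (f := fun q : E3 × E3 => q.1 - ℓ • q.2) (by fun_prop))).aestronglyMeasurable
    · rw [RCLike.norm_conj]; exact hC _
    · beta_reduce; ring
  rw [integral_integral_swap hΨ]
  refine integral_congr_ae (Eventually.of_forall fun x => ?_)
  beta_reduce
  rw [integral_const_mul]
  rfl

/-- The shift by `ℓx` in the coordinates around the guide star. -/
def localShift (δ ℓ : ℝ) (x : E3) : E3 := mk3 ((ℓ / δ) • hor x) (ℓ / δ ^ 2 * x 2)

theorem scalePt_sub (S : Setup) (tg : ℝ) {δ : ℝ} (hδ : δ ≠ 0) (ℓ : ℝ) (η x : E3) :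
    scalePt S tg δ (η - localShift δ ℓ x) = scalePt S tg δ η - ℓ • x := by
  ext i
  fin_cases i <;> simp [scalePt, Setup.guideStar, mk3, hor, localShift] <;> field_simp <;> ring

theorem integral_scalePt (S : Setup) (tg : ℝ) {δ : ℝ} (hδ : 0 < δ) (F : E3 → ℂ) :
    ∫ z, F z = ((δ ^ 4 : ℝ) : ℂ) * ∫ η, F (scalePt S tg δ η) := by
  have hemb : MeasurableEmbedding (scalePt S tg δ) := by
    refine (continuous_scalePt S tg δ).measurableEmbedding fun a b hab => ?_
    have h2 := congrArg (fun z : E3 => z 2) hab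
    have h1 := congrArg hor hab
    simp only [scalePt_two, hor_scalePt] at h1 h2
    have h1' := smul_right_injective E2 hδ.ne' h1
    have h2' : a 2 = b 2 := by
      have := add_left_cancel h2
      exact mul_left_cancel₀ (by positivity) this
    rw [← mk3_hor a, ← mk3_hor b, h1', h2']
  have hv : (volume : Measure E3) = ENNReal.ofReal (δ ^ 4) • Measure.map (scalePt S tg δ) volume := by
    ext s hs
    have := lintegral_scalePt S tg hδ (F := s.indicator fun _ => 1) (measurable_const.indicator hs)
    rw [lintegral_indicator hs, setLIntegral_const, one_mul] at this
    rw [Measure.smul_apply, hemb.map_apply, this, smul_eq_mul]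
    congr 1
    rw [← one_mul (volume (scalePt S tg δ ⁻¹' s)), ← setLIntegral_const,
      ← lintegral_indicator (hemb.measurable hs)]
    rfl
  conv_lhs => rw [hv]
  rw [integral_smul_measure, hemb.integral_map, ENNReal.toReal_ofReal (by positivity), Complex.real_smul]

/-- The prefactor δ² of `localKernel` occurs twice and equals the Jacobian δ⁴ of the change of
coordinates. -/
theorem autocorr_extKernel (S : Setup) (B tg cs : ℝ) {δ : ℝ} (hδ : 0 < δ) (ℓ : ℝ) (x : E3) :
    autocorr (extKernel S B tg cs δ) (ℓ • x) = autocorr (localKernel S B tg cs δ) (localShift δ ℓ x) := by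
  unfold autocorr
  rw [integral_scalePt S tg hδ, ← integral_const_mul]
  refine integral_congr_ae (Eventually.of_forall fun η => ?_)
  simp only [localKernel, ← scalePt_sub S tg hδ.ne' ℓ η x, map_mul, Complex.conj_ofReal, extKernel]
  push_cast
  ring

theorem secondMoment_eq {S : Setup} (hS : S.Admissible) (hμ : IsFluctuation P μ) {B : ℝ} (hB : 0 < B)
    (tg cs : ℝ) {ε ℓ : ℝ} (hε : 0 < ε) (hℓ : 0 < ℓ) :
    MemLp (S.randomImage μ B tg cs ε ℓ) 2 P ∧ ((S.secondMoment P μ B tg cs ε ℓ / ℓ ^ 3 : ℝ) : ℂ) =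
      ∫ x, (covFun P μ x : ℂ) *
        autocorr (localKernel S B tg cs (Real.sqrt ε)) (localShift (Real.sqrt ε) ℓ x) := by
  have hfin : IsFiniteMeasure (volume.restrict S.D) := ⟨by simpa using hS.D_bdd.measure_lt_top⟩
  have hδ := Real.sqrt_pos.2 hε
  have hae := randomImage_ae_eq hS hμ hB tg cs hε ℓ
  set g := extKernel S B tg cs (Real.sqrt ε) with hg
  have hgm : Measurable g := measurable_extKernel hS hB tg cs _
  obtain ⟨C, hC⟩ := extKernel_bound hS hB tg cs (Real.sqrt ε)
  obtain ⟨h1, h2⟩ := functional_moments hμ (ℓ := ℓ) (m := volume.restrict S.D) hgm hC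
  refine ⟨(memLp_congr_ae hae).2 h1, ?_⟩
  have h3 : S.secondMoment P μ B tg cs ε ℓ = ∫ w, ‖functional μ (volume.restrict S.D) g ℓ w‖ ^ 2 ∂P := by
    refine integral_congr_ae ?_
    filter_upwards [hae] with w hw
    rw [hw]
  rw [Measure.prod_restrict, setIntegral_eq_integral_of_forall_compl_eq_zero] at h2
  · rw [← Measure.volume_eq_prod, integral_covFun_prod hμ (integrable_extKernel hS hB tg cs _) hgm hC hℓ]
      at h2
    rw [Complex.ofReal_div, h3, h2, mul_div_cancel_left₀ _ (Complex.ofReal_ne_zero.2 (by positivity))]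
    refine integral_congr_ae (Eventually.of_forall fun x => ?_)
    beta_reduce
    rw [autocorr_extKernel S B tg cs hδ]
  · rintro ⟨a, b⟩ hab
    rw [Set.mem_prod, not_and_or] at hab
    rcases hab with h | h <;> simp [hg, extKernel, Set.indicator_of_notMem h]

end

section

variable {Ω : Type*} [MeasurableSpace Ω] {P : Measure Ω} [IsProbabilityMeasure P] {μ : E3 → Ω → ℝ}

/-! ### The limit of the second moment -/

instance : IsCountablyGenerated regime := by unfold regime; infer_instance

theorem regime_tendsto_fst : Tendsto (fun p : ℝ × ℝ => p.1) regime (𝓝[>] 0) :=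
  tendsto_comap.mono_left inf_le_left

theorem regime_tendsto_ratio : Tendsto (fun p : ℝ × ℝ => p.2 / p.1) regime (𝓝[>] 0) :=
  tendsto_comap.mono_left inf_le_right

theorem regime_tendsto_sqrt : Tendsto (fun p : ℝ × ℝ => Real.sqrt p.1) regime (𝓝[>] 0) := by
  refine tendsto_nhdsWithin_iff.2 ⟨?_, ?_⟩
  · have h := (Real.continuous_sqrt.tendsto 0).comp (tendsto_nhds_of_tendsto_nhdsWithin regime_tendsto_fst)
    rwa [Real.sqrt_zero] at h
  · filter_upwards [regime_tendsto_fst.eventually self_mem_nhdsWithin] with p hp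
    exact Real.sqrt_pos.2 hp

theorem regime_pos : ∀ᶠ p : ℝ × ℝ in regime, 0 < p.1 ∧ 0 < p.2 := by
  filter_upwards [regime_tendsto_fst.eventually self_mem_nhdsWithin,
    regime_tendsto_ratio.eventually self_mem_nhdsWithin] with p h1 h2
  have h1 : 0 < p.1 := h1
  have h2 : 0 < p.2 / p.1 := h2
  exact ⟨h1, (div_pos_iff_of_pos_right h1).1 h2⟩

/-- The scaling regime is decisive here: the vertical shift carries ℓ/δ² = ℓ/ε, and the horizontal
one ℓ/δ = (ℓ/ε)√ε. -/
theorem tendsto_localShift (x : E3) :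
    Tendsto (fun p : ℝ × ℝ => localShift (Real.sqrt p.1) p.2 x) regime (𝓝 0) := by
  have h1 := tendsto_nhds_of_tendsto_nhdsWithin regime_tendsto_ratio
  have h2 := tendsto_nhds_of_tendsto_nhdsWithin regime_tendsto_sqrt
  have h3 : Tendsto (fun p : ℝ × ℝ => mk3 ((p.2 / p.1 * Real.sqrt p.1) • hor x) (p.2 / p.1 * x 2)) regime
      (𝓝 (mk3 (((0 : ℝ) * 0) • hor x) (0 * x 2))) :=
    (continuous_mk3.tendsto (((0 : ℝ) * 0) • hor x, 0 * x 2)).comp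
      (((h1.mul h2).smul_const _).prodMk_nhds (h1.mul_const _))
  have h4 : mk3 (((0 : ℝ) * 0) • hor x) (0 * x 2) = 0 := by
    ext i; fin_cases i <;> simp [mk3]
  rw [h4] at h3
  refine h3.congr' ?_
  filter_upwards [regime_pos] with p hp
  have h5 := Real.sqrt_pos.2 hp.1
  rw [localShift, Real.sq_sqrt hp.1.le]
  congr 2
  rw [div_mul_eq_mul_div, div_eq_div_iff hp.1.ne' h5.ne', mul_assoc, Real.mul_self_sqrt hp.1.le]

theorem eLpNorm_two_eq (f : E3 → ℂ) : eLpNorm f 2 volume = (∫⁻ η, ‖f η‖ₑ ^ 2) ^ (1 / 2 : ℝ) := by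
  rw [eLpNorm_eq_lintegral_rpow_enorm_toReal (by norm_num) (by norm_num)]
  simp

theorem memLp_two_of_lintegral {f : E3 → ℂ} (hf : Measurable f) (h : ∫⁻ η, ‖f η‖ₑ ^ 2 < ⊤) :
    MemLp f 2 :=
  ⟨hf.aestronglyMeasurable, by rw [eLpNorm_two_eq]; exact ENNReal.rpow_lt_top_of_nonneg (by norm_num) h.ne⟩

theorem memLp_localKernel {S : Setup} (hS : S.Admissible) {B : ℝ} (hB : 0 < B) (tg cs : ℝ) {δ : ℝ}
    (hδ : 0 ≤ δ) : MemLp (localKernel S B tg cs δ) 2 := by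
  have hm := measurable_localKernel hS hB tg cs δ
  rcases hδ.eq_or_lt with rfl | hδ
  · refine memLp_two_of_lintegral hm ?_
    simp [localKernel]
  obtain ⟨C, hC⟩ := imagingKernel_bound hS hB tg cs δ
  refine memLp_two_of_lintegral hm ?_
  have hvol := lintegral_scalePt S tg hδ (F := S.D.indicator (fun _ => (1 : ENNReal)))
    (measurable_const.indicator hS.D_meas)
  rw [lintegral_indicator hS.D_meas, setLIntegral_const, one_mul] at hvol
  have hfin : ∫⁻ η, S.D.indicator (fun _ => (1 : ENNReal)) (scalePt S tg δ η) ≠ ⊤ := by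
    intro h
    rw [h, ENNReal.mul_top (by simp; positivity)] at hvol
    exact hS.D_bdd.measure_lt_top.ne hvol
  calc ∫⁻ η, ‖localKernel S B tg cs δ η‖ₑ ^ 2
      ≤ ∫⁻ η, ENNReal.ofReal (δ ^ 2 * C) ^ 2 * S.D.indicator (fun _ => (1 : ENNReal)) (scalePt S tg δ η) := by
        refine lintegral_mono fun η => ?_
        by_cases hD : scalePt S tg δ η ∈ S.D
        · rw [localKernel, Set.indicator_of_mem hD, Set.indicator_of_mem hD, mul_one, ← ofReal_norm,
            norm_mul, Complex.norm_real, Real.norm_eq_abs, abs_of_pos (by positivity)]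
          have := hC _ hD
          gcongr
        · simp [localKernel, hD]
    _ < ⊤ := by
        rw [lintegral_const_mul' _ _ (ENNReal.pow_ne_top ENNReal.ofReal_ne_top)]
        exact ENNReal.mul_lt_top (ENNReal.pow_lt_top ENNReal.ofReal_lt_top) hfin.lt_top

theorem measurable_autocorr {f : E3 → ℂ} (hf : Measurable f) : Measurable (autocorr f) :=
  (StronglyMeasurable.integral_prod_right (f := fun h : E3 => fun η => f η * (starRingEnd ℂ) (f (η - h)))
    ((hf.comp measurable_snd).mul (Complex.continuous_conj.measurable.comp (hf.comp
      (f := fun q : E3 × E3 => q.2 - q.1) (by fun_prop)))).stronglyMeasurable).measurable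

/-- Dominated convergence in `secondMoment_eq`. Autocorrelations are bounded by squared L² norms,
which converge, so |Σ| up to a constant is a majorant; pointwise, the L² limit and the vanishing
shift give the autocorrelation of the limit at 0. -/
theorem tendsto_secondMoment {S : Setup} (hS : S.Admissible) (hμ : IsFluctuation P μ) {B tg cs : ℝ}
    (hB : 0 < B) (htg : 0 < tg) (hcs : 0 < cs) (hzg : S.guideStar tg ∈ interior S.D) :
    Tendsto (fun p : ℝ × ℝ => S.secondMoment P μ B tg cs p.1 p.2 / p.2 ^ 3) regime
      (𝓝 ((∫ x, covFun P μ x) * ∫ η, ‖limitKernel S B tg cs η‖ ^ 2)) := by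
  have hF : ∀ p : ℝ × ℝ, MemLp (localKernel S B tg cs (Real.sqrt p.1)) 2 := fun p =>
    memLp_localKernel hS hB tg cs (Real.sqrt_nonneg _)
  have hf : MemLp (limitKernel S B tg cs) 2 :=
    memLp_two_of_lintegral (measurable_limitKernel hS hB htg hcs hzg) (tendsto_mainKernel hS hB htg hcs hzg).2
  have hlim : Tendsto (fun p => (hF p).toLp (localKernel S B tg cs (Real.sqrt p.1))) regime
      (𝓝 (hf.toLp (limitKernel S B tg cs))) := by
    rw [Lp.tendsto_Lp_iff_tendsto_eLpNorm'']
    simp_rw [eLpNorm_two_eq, Pi.sub_apply]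
    have h1 := ((tendsto_localKernel hS hB htg hcs hzg).comp regime_tendsto_sqrt)
    have h2 := h1.ennrpow_const (1 / 2 : ℝ)
    rwa [ENNReal.zero_rpow_of_pos (by norm_num)] at h2
  have hcov := integrable_covFun hμ
  have hcl : Tendsto (fun p : ℝ × ℝ => ∫ x, (covFun P μ x : ℂ) * autocorr
      (localKernel S B tg cs (Real.sqrt p.1)) (localShift (Real.sqrt p.1) p.2 x)) regime
      (𝓝 (∫ x, (covFun P μ x : ℂ) * autocorr (limitKernel S B tg cs) 0)) := by
    have hM := (hlim.norm.mul hlim.norm).eventually (eventually_le_nhds (lt_add_one _))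
    refine tendsto_integral_filter_of_dominated_convergence (fun x => |covFun P μ x| *
      (‖hf.toLp (limitKernel S B tg cs)‖ * ‖hf.toLp (limitKernel S B tg cs)‖ + 1)) ?_ ?_
      (hcov.abs.mul_const _) ?_
    · refine Eventually.of_forall fun p => Measurable.aestronglyMeasurable ?_
      refine (Complex.measurable_ofReal.comp (measurable_covFun hμ)).mul ?_
      refine (measurable_autocorr (measurable_localKernel hS hB tg cs _)).comp ?_
      unfold localShift mk3 hor
      exact Continuous.measurable (by fun_prop)
    · filter_upwards [hM] with p hp
      refine Eventually.of_forall fun x => ?_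
      rw [norm_mul, Complex.norm_real, Real.norm_eq_abs]
      exact mul_le_mul_of_nonneg_left ((norm_autocorr_le (hF p) _).trans hp) (abs_nonneg _)
    · exact Eventually.of_forall fun x =>
        (tendsto_autocorr hF hf hlim (tendsto_localShift x)).const_mul _
  rw [integral_mul_const, autocorr_zero, integral_complex_ofReal, ← Complex.ofReal_mul] at hcl
  have hre := (Complex.continuous_re.tendsto _).comp hcl
  rw [Complex.ofReal_re] at hre
  refine hre.congr' ?_
  filter_upwards [regime_pos] with p hp
  simp only [Function.comp_apply]
  rw [← (secondMoment_eq hS hμ hB tg cs hp.1 hp.2).2, Complex.ofReal_re]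

end

/-! ### Array averages of quadratic exponentials -/

/-- Average over the array of `e^{i(⟨u, ζ⟩ + s|u|²)}`. -/
def avgExp (S : Setup) (ζ : E2) (s : ℝ) : ℂ :=
  ((1 / volume.real S.A₀ : ℝ) : ℂ) *
    ∫ u in S.A₀, Complex.exp (Complex.I * ((inner ℝ u ζ + s * ‖u‖ ^ 2 : ℝ) : ℂ))

/-- The function whose Fourier integral is `avgExp`. Its modulus does not depend on s, so by
Plancherel neither does the L² norm of the average. -/
def chirp (S : Setup) (s : ℝ) : E2 → ℂ := S.A₀.indicator fun u =>
  ((1 / volume.real S.A₀ : ℝ) : ℂ) * Complex.exp (Complex.I * ((s * ‖u‖ ^ 2 : ℝ) : ℂ))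

theorem area_pos {S : Setup} (hS : S.Admissible) : 0 < volume.real S.A₀ :=
  ENNReal.toReal_pos hS.A₀_pos.ne' hS.A₀_bdd.measure_lt_top.ne

theorem avgExp_eq {S : Setup} (hS : S.Admissible) (ζ : E2) (s : ℝ) : avgExp S ζ s =
    ∫ u, chirp S s u * Complex.exp (Complex.I * ((1 * inner ℝ u ζ : ℝ) : ℂ)) := by
  rw [avgExp, ← integral_const_mul, ← integral_indicator hS.A₀_meas]
  refine integral_congr_ae (Eventually.of_forall fun u => ?_)
  by_cases hu : u ∈ S.A₀
  · simp only [chirp, Set.indicator_of_mem hu]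
    rw [mul_assoc, ← Complex.exp_add]
    congr 2
    push_cast; ring
  · simp only [chirp, Set.indicator_of_notMem hu, zero_mul]

theorem norm_avgExp_le_one {S : Setup} (hS : S.Admissible) (ζ : E2) (s : ℝ) : ‖avgExp S ζ s‖ ≤ 1 := by
  have h0 := area_pos hS
  have h := norm_setIntegral_le_of_norm_le_const (μ := volume) (C := 1) hS.A₀_bdd.measure_lt_top
    (f := fun u => Complex.exp (Complex.I * ((inner ℝ u ζ + s * ‖u‖ ^ 2 : ℝ) : ℂ)))
    fun u _ => (norm_exp_I_mul _).le
  rw [avgExp, norm_mul, Complex.norm_real, Real.norm_eq_abs, abs_of_pos (by positivity),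
    one_div, inv_mul_le_iff₀ h0]
  linarith

theorem continuous_avgExp {S : Setup} (hS : S.Admissible) :
    Continuous fun p : E2 × ℝ => avgExp S p.1 p.2 := by
  have hfin : IsFiniteMeasure (volume.restrict S.A₀) := ⟨by simpa using hS.A₀_bdd.measure_lt_top⟩
  unfold avgExp
  refine continuous_const.mul (continuous_of_dominated (bound := fun _ => 1) (fun p => ?_) (fun p =>
    Eventually.of_forall fun u => (norm_exp_I_mul _).le) (integrable_const _)
    (Eventually.of_forall fun u => by fun_prop))
  exact Continuous.aestronglyMeasurable (by fun_prop)

theorem conj_avgExp (S : Setup) (ζ : E2) (s : ℝ) :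
    (starRingEnd ℂ) (avgExp S ζ s) = avgExp S (-ζ) (-s) := by
  rw [avgExp, avgExp, map_mul, Complex.conj_ofReal, ← integral_conj]
  congr 2
  funext u
  rw [← Complex.exp_conj, map_mul, Complex.conj_I, Complex.conj_ofReal, inner_neg_right]
  congr 1
  push_cast; ring

theorem measurable_chirp {S : Setup} (hS : S.Admissible) (s : ℝ) : Measurable (chirp S s) :=
  Measurable.indicator (Continuous.measurable (by fun_prop)) hS.A₀_meas

theorem norm_chirp {S : Setup} (hS : S.Admissible) (s : ℝ) (u : E2) :
    ‖chirp S s u‖ = S.A₀.indicator (fun _ => 1 / volume.real S.A₀) u := by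
  have h0 := area_pos hS
  by_cases hu : u ∈ S.A₀
  · simp only [chirp, Set.indicator_of_mem hu]
    rw [norm_mul, norm_exp_I_mul, mul_one, Complex.norm_real, Real.norm_eq_abs,
      abs_of_pos (by positivity)]
  · simp [chirp, Set.indicator_of_notMem hu]

theorem integrable_chirp {S : Setup} (hS : S.Admissible) (s : ℝ) :
    Integrable (chirp S s) ∧ MemLp (chirp S s) 2 := by
  have h1 : ∀ p, MemLp (S.A₀.indicator (fun _ => (1 / volume.real S.A₀ : ℝ))) p volume := fun p =>
    memLp_indicator_const p hS.A₀_meas _ (Or.inr hS.A₀_bdd.measure_lt_top.ne)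
  have hm := (measurable_chirp hS s).aestronglyMeasurable (μ := volume)
  exact ⟨(memLp_one_iff_integrable.1 (h1 1)).mono' hm
    (Eventually.of_forall fun u => (norm_chirp hS s u).le),
    (h1 2).mono' hm (Eventually.of_forall fun u => (norm_chirp hS s u).le)⟩

theorem lintegral_enorm_sq_avgExp {S : Setup} (hS : S.Admissible) (s : ℝ) :
    ∫⁻ ζ, ‖avgExp S ζ s‖ₑ ^ 2 = ENNReal.ofReal ((2 * Real.pi) ^ 2 / volume.real S.A₀) := by
  have h0 := area_pos hS
  have h := lintegral_enorm_sq_integral_exp (integrable_chirp hS s).1 (integrable_chirp hS s).2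
    (one_ne_zero (α := ℝ))
  simp_rw [← avgExp_eq hS] at h
  rw [h, show Module.finrank ℝ E2 = 2 by simp]
  have h1 : ∀ u, ‖chirp S s u‖ₑ ^ 2 =
      S.A₀.indicator (fun _ => ENNReal.ofReal ((1 / volume.real S.A₀) ^ 2)) u := by
    intro u
    rw [← ofReal_norm, norm_chirp hS]
    by_cases hu : u ∈ S.A₀
    · rw [Set.indicator_of_mem hu, Set.indicator_of_mem hu, ENNReal.ofReal_pow (by positivity)]
    · simp [Set.indicator_of_notMem hu]
  simp_rw [h1]
  have h2 : volume S.A₀ = ENNReal.ofReal (volume.real S.A₀) :=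
    (ENNReal.ofReal_toReal hS.A₀_bdd.measure_lt_top.ne).symm
  rw [lintegral_indicator hS.A₀_meas, setLIntegral_const, h2, ← ENNReal.ofReal_mul (by positivity),
    ← ENNReal.ofReal_mul (by positivity), abs_one, div_one]
  congr 1
  field_simp

theorem integral_sq_avgExp {S : Setup} (hS : S.Admissible) (s : ℝ) :
    Integrable (fun ζ => ‖avgExp S ζ s‖ ^ 2) ∧
      ∫ ζ, ‖avgExp S ζ s‖ ^ 2 = (2 * Real.pi) ^ 2 / volume.real S.A₀ := by
  have h0 := area_pos hS
  have hc : Continuous fun ζ => avgExp S ζ s := (continuous_avgExp hS).comp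
    (f := fun ζ : E2 => (ζ, s)) (by fun_prop)
  have h := lintegral_enorm_sq_avgExp hS s
  have h1 : ∀ ζ, ‖avgExp S ζ s‖ₑ ^ 2 = ENNReal.ofReal (‖avgExp S ζ s‖ ^ 2) := fun ζ => by
    rw [← ofReal_norm, ENNReal.ofReal_pow (norm_nonneg _)]
  simp_rw [h1] at h
  have hi : Integrable (fun ζ => ‖avgExp S ζ s‖ ^ 2) := by
    refine ⟨(hc.norm.pow 2).aestronglyMeasurable, ?_⟩
    rw [hasFiniteIntegral_iff_ofReal (Eventually.of_forall fun ζ => by positivity), h]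
    exact ENNReal.ofReal_lt_top
  refine ⟨hi, ?_⟩
  rw [integral_eq_lintegral_of_nonneg_ae (Eventually.of_forall fun ζ => by positivity)
    hi.aestronglyMeasurable, h, ENNReal.toReal_ofReal (by positivity)]

/-- The fourth moment of the array average. -/
def quarticMass (S : Setup) (s : ℝ) : ℝ := ∫ ζ, ‖avgExp S ζ s‖ ^ 4

/-- An average of unimodular numbers is at most 1, so fourth powers are dominated by squares. -/
theorem integrable_quartic {S : Setup} (hS : S.Admissible) (s : ℝ) :
    Integrable (fun ζ => ‖avgExp S ζ s‖ ^ 4) := by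
  have hc : Continuous fun ζ => avgExp S ζ s := (continuous_avgExp hS).comp
    (f := fun ζ : E2 => (ζ, s)) (by fun_prop)
  refine (integral_sq_avgExp hS s).1.mono' (hc.norm.pow 4).aestronglyMeasurable
    (Eventually.of_forall fun ζ => ?_)
  rw [Real.norm_eq_abs, abs_of_nonneg (by positivity)]
  exact pow_le_pow_of_le_one (norm_nonneg _) (norm_avgExp_le_one hS ζ s) (by norm_num)

theorem quarticMass_nonneg (S : Setup) (s : ℝ) : 0 ≤ quarticMass S s :=
  integral_nonneg fun ζ => by positivity

theorem quarticMass_le {S : Setup} (hS : S.Admissible) (s : ℝ) :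
    quarticMass S s ≤ (2 * Real.pi) ^ 2 / volume.real S.A₀ := by
  rw [← (integral_sq_avgExp hS s).2]
  exact integral_mono (integrable_quartic hS s) (integral_sq_avgExp hS s).1 fun ζ =>
    pow_le_pow_of_le_one (norm_nonneg _) (norm_avgExp_le_one hS ζ s) (by norm_num)

theorem quarticMass_neg (S : Setup) (s : ℝ) : quarticMass S (-s) = quarticMass S s := by
  rw [quarticMass, quarticMass, ← integral_neg_eq_self]
  refine integral_congr_ae (Eventually.of_forall fun ζ => ?_)
  simp only [← conj_avgExp, RCLike.norm_conj]

/-- Otherwise the average would vanish almost everywhere, against the positive value of its L² norm.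
-/
theorem quarticMass_pos {S : Setup} (hS : S.Admissible) (s : ℝ) : 0 < quarticMass S s := by
  have h0 := area_pos hS
  have hpi := Real.pi_pos
  refine (quarticMass_nonneg S s).lt_of_ne fun h => ?_
  have h1 := (integral_eq_zero_iff_of_nonneg (fun ζ => by positivity) (integrable_quartic hS s)).1 h.symm
  have h2 := (integral_sq_avgExp hS s).2
  rw [integral_eq_zero_of_ae] at h2
  · have : 0 < (2 * Real.pi) ^ 2 / volume.real S.A₀ := by positivity
    linarith
  · filter_upwards [h1] with ζ hζ
    have : ‖avgExp S ζ s‖ = 0 := by simpa using hζ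
    simp [this]

theorem lintegral_avgExp_sub {S : Setup} (hS : S.Admissible) (s t : ℝ) :
    ∫⁻ ζ, ‖avgExp S ζ s - avgExp S ζ t‖ₑ ^ 2 =
      ENNReal.ofReal ((2 * Real.pi) ^ 2) * ∫⁻ u, ‖chirp S s u - chirp S t u‖ₑ ^ 2 := by
  have h1 := integrable_chirp hS s
  have h2 := integrable_chirp hS t
  have h := lintegral_enorm_sq_integral_exp (h1.1.sub h2.1) (h1.2.sub h2.2) (one_ne_zero (α := ℝ))
  rw [show Module.finrank ℝ E2 = 2 by simp, abs_one, div_one] at h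
  refine Eq.trans (lintegral_congr fun ζ => ?_) h
  have hi : ∀ {f : E2 → ℂ}, Integrable f →
      Integrable fun u => f u * Complex.exp (Complex.I * ((1 * inner ℝ u ζ : ℝ) : ℂ)) := fun hf =>
    hf.mul_bdd (c := 1) (Continuous.aestronglyMeasurable (by fun_prop))
      (Eventually.of_forall fun u => (norm_exp_I_mul _).le)
  rw [avgExp_eq hS, avgExp_eq hS, ← integral_sub (hi h1.1) (hi h2.1)]
  simp only [Pi.sub_apply, sub_mul]

/-- Plancherel transfers the difference to the chirps, and on a bounded array e^{is|u|²} is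
uniformly Lipschitz in s. -/
theorem exists_avgExp_lipschitz {S : Setup} (hS : S.Admissible) : ∃ C : ℝ, 0 ≤ C ∧ ∀ s t,
    Integrable (fun ζ => ‖avgExp S ζ s - avgExp S ζ t‖ ^ 2) ∧
      ∫ ζ, ‖avgExp S ζ s - avgExp S ζ t‖ ^ 2 ≤ C * |s - t| ^ 2 := by
  obtain ⟨d, ρ, a, a', b, b', U, hb⟩ := exists_bounds hS
  have h0 := area_pos hS
  have hU := hb.U_nonneg
  refine ⟨(2 * Real.pi) ^ 2 * ((1 / volume.real S.A₀ * U ^ 2) ^ 2 * volume.real S.A₀), by positivity,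
    fun s t => ?_⟩
  have hc : ∀ s, Continuous fun ζ => avgExp S ζ s := fun s => (continuous_avgExp hS).comp
    (f := fun ζ : E2 => (ζ, s)) (by fun_prop)
  have hpt : ∀ u, ‖chirp S s u - chirp S t u‖ₑ ^ 2 ≤ S.A₀.indicator
      (fun _ => ENNReal.ofReal ((1 / volume.real S.A₀ * (U ^ 2 * |s - t|)) ^ 2)) u := by
    intro u
    by_cases hu : u ∈ S.A₀
    · simp only [chirp, Set.indicator_of_mem hu]
      rw [← ofReal_norm, ← ENNReal.ofReal_pow (norm_nonneg _), ← mul_sub, norm_mul, Complex.norm_real,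
        Real.norm_eq_abs, abs_of_pos (by positivity : 0 < 1 / volume.real S.A₀)]
      have h1 : Complex.exp (Complex.I * ((s * ‖u‖ ^ 2 : ℝ) : ℂ)) -
          Complex.exp (Complex.I * ((t * ‖u‖ ^ 2 : ℝ) : ℂ)) = Complex.exp (Complex.I *
            ((t * ‖u‖ ^ 2 : ℝ) : ℂ)) * (Complex.exp (Complex.I * (((s - t) * ‖u‖ ^ 2 : ℝ) : ℂ)) - 1) := by
        rw [mul_sub, ← Complex.exp_add, mul_one]
        congr 2
        push_cast; ring
      have h2 := Real.norm_exp_I_mul_ofReal_sub_one_le (x := (s - t) * ‖u‖ ^ 2)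
      rw [Real.norm_eq_abs, abs_mul, abs_of_nonneg (by positivity : 0 ≤ ‖u‖ ^ 2)] at h2
      have h3 : ‖u‖ ^ 2 ≤ U ^ 2 := pow_le_pow_left₀ (norm_nonneg _) (hb.array u hu) 2
      have h4 : |s - t| * ‖u‖ ^ 2 ≤ U ^ 2 * |s - t| := by
        rw [mul_comm]; exact mul_le_mul_of_nonneg_right h3 (abs_nonneg _)
      rw [h1, norm_mul, norm_exp_I_mul, one_mul]
      have h5 := h2.trans h4
      gcongr
    · simp [chirp, Set.indicator_of_notMem hu]
  have hA : volume S.A₀ = ENNReal.ofReal (volume.real S.A₀) :=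
    (ENNReal.ofReal_toReal hS.A₀_bdd.measure_lt_top.ne).symm
  have hle : ∫⁻ ζ, ENNReal.ofReal (‖avgExp S ζ s - avgExp S ζ t‖ ^ 2) ≤
      ENNReal.ofReal ((2 * Real.pi) ^ 2 * ((1 / volume.real S.A₀ * U ^ 2) ^ 2 * volume.real S.A₀) *
        |s - t| ^ 2) := by
    simp_rw [ENNReal.ofReal_pow (norm_nonneg _), ofReal_norm]
    rw [lintegral_avgExp_sub hS, mul_assoc, ENNReal.ofReal_mul (by positivity)]
    refine mul_le_mul_right ((lintegral_mono hpt).trans_eq ?_) _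
    rw [lintegral_indicator hS.A₀_meas, setLIntegral_const, hA, ← ENNReal.ofReal_mul (by positivity)]
    congr 1; ring
  have hi : Integrable (fun ζ => ‖avgExp S ζ s - avgExp S ζ t‖ ^ 2) := by
    refine ⟨(((hc s).sub (hc t)).norm.pow 2).aestronglyMeasurable, ?_⟩
    rw [hasFiniteIntegral_iff_ofReal (Eventually.of_forall fun ζ => by positivity)]
    exact hle.trans_lt ENNReal.ofReal_lt_top
  refine ⟨hi, ?_⟩
  rw [integral_eq_lintegral_of_nonneg_ae (Eventually.of_forall fun ζ => by positivity)
    hi.aestronglyMeasurable]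
  exact ENNReal.toReal_le_of_le_ofReal (by positivity) hle

/-- Factor the difference of fourth powers and apply Young's inequality with weight r. With r = |s -
t| both terms become linear in |s - t| after integration, which makes `quarticMass` Lipschitz. -/
theorem abs_pow_four_sub_le {x y r : ℝ} (hx : 0 ≤ x) (hx1 : x ≤ 1) (hy : 0 ≤ y) (hy1 : y ≤ 1)
    (hr : 0 < r) {d : ℝ} (hd : |x - y| ≤ d) :
    |x ^ 4 - y ^ 4| ≤ 2 * r * (x ^ 2 + y ^ 2) + r⁻¹ * d ^ 2 := by
  have h1 : |x ^ 4 - y ^ 4| = (x ^ 2 + y ^ 2) * (x + y) * |x - y| := by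
    rw [show x ^ 4 - y ^ 4 = ((x ^ 2 + y ^ 2) * (x + y)) * (x - y) by ring, abs_mul,
      abs_of_nonneg (by positivity)]
  have hd0 : 0 ≤ d := (abs_nonneg _).trans hd
  have h2 : (x ^ 2 + y ^ 2) * (x + y) * |x - y| ≤ 2 * (x + y) * d := by
    have : x ^ 2 + y ^ 2 ≤ 2 := by nlinarith
    gcongr
  have h3 : 2 * (x + y) * d ≤ r * (x + y) ^ 2 + r⁻¹ * d ^ 2 := by
    have h4 : r * (x + y) ^ 2 + r⁻¹ * d ^ 2 - 2 * (x + y) * d = r * (x + y - r⁻¹ * d) ^ 2 := by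
      field_simp; ring
    have : 0 ≤ r * (x + y - r⁻¹ * d) ^ 2 := by positivity
    linarith
  have h5 : r * (x + y) ^ 2 ≤ 2 * r * (x ^ 2 + y ^ 2) := by
    nlinarith [mul_nonneg hr.le (sq_nonneg (x - y))]
  linarith

theorem continuous_quarticMass {S : Setup} (hS : S.Admissible) : Continuous (quarticMass S) := by
  obtain ⟨C, hC, hlip⟩ := exists_avgExp_lipschitz hS
  have h0 := area_pos hS
  set W := (2 * Real.pi) ^ 2 / volume.real S.A₀ with hW
  have hW0 : 0 ≤ W := by positivity
  refine (LipschitzWith.of_dist_le_mul (K := (4 * W + C).toNNReal) fun s t => ?_).continuous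
  rw [Real.coe_toNNReal _ (by positivity), Real.dist_eq, Real.dist_eq]
  rcases eq_or_ne s t with rfl | hst
  · simp
  have hr : 0 < |s - t| := abs_pos.2 (sub_ne_zero.2 hst)
  obtain ⟨i1, e1⟩ := integral_sq_avgExp hS s
  obtain ⟨i2, e2⟩ := integral_sq_avgExp hS t
  obtain ⟨i3, e3⟩ := hlip s t
  rw [quarticMass, quarticMass, ← integral_sub (integrable_quartic hS s) (integrable_quartic hS t)]
  have i4 : Integrable (fun ζ => 2 * |s - t| * (‖avgExp S ζ s‖ ^ 2 + ‖avgExp S ζ t‖ ^ 2)) :=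
    (i1.add i2).const_mul _
  have i5 : Integrable (fun ζ => 2 * |s - t| * (‖avgExp S ζ s‖ ^ 2 + ‖avgExp S ζ t‖ ^ 2) +
      |s - t|⁻¹ * ‖avgExp S ζ s - avgExp S ζ t‖ ^ 2) := i4.add (i3.const_mul _)
  rw [← Real.norm_eq_abs]
  calc ‖∫ ζ, (‖avgExp S ζ s‖ ^ 4 - ‖avgExp S ζ t‖ ^ 4)‖
      ≤ ∫ ζ, (2 * |s - t| * (‖avgExp S ζ s‖ ^ 2 + ‖avgExp S ζ t‖ ^ 2) +
          |s - t|⁻¹ * ‖avgExp S ζ s - avgExp S ζ t‖ ^ 2) :=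
        norm_integral_le_of_norm_le i5
          (Eventually.of_forall fun ζ => abs_pow_four_sub_le (norm_nonneg _) (norm_avgExp_le_one hS ζ s)
            (norm_nonneg _) (norm_avgExp_le_one hS ζ t) hr (abs_norm_sub_norm_le _ _))
    _ = 2 * |s - t| * (W + W) + |s - t|⁻¹ * ∫ ζ, ‖avgExp S ζ s - avgExp S ζ t‖ ^ 2 := by
        rw [integral_add i4 (i3.const_mul _), integral_const_mul,
          integral_const_mul, integral_add i1 i2, e1, e2]
    _ ≤ 2 * |s - t| * (W + W) + |s - t|⁻¹ * (C * |s - t| ^ 2) := by gcongr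
    _ = (4 * W + C) * |s - t| := by field_simp; ring

theorem lintegral_quartic {S : Setup} (hS : S.Admissible) {c : ℝ} (hc : c ≠ 0) (s : ℝ) :
    ∫⁻ x : E2, ENNReal.ofReal (‖avgExp S (c • x) s‖ ^ 4) = ENNReal.ofReal (quarticMass S s / c ^ 2) := by
  have h1 : ∫⁻ ζ, ENNReal.ofReal (‖avgExp S ζ s‖ ^ 4) = ENNReal.ofReal (quarticMass S s) :=
    (ofReal_integral_eq_lintegral_ofReal (integrable_quartic hS s)
      (Eventually.of_forall fun ζ => by positivity)).symm
  have hpos : ∀ {c : ℝ}, 0 < c → ∫⁻ x : E2, ENNReal.ofReal (‖avgExp S (c • x) s‖ ^ 4) =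
      ENNReal.ofReal (quarticMass S s / c ^ 2) := by
    intro c hc
    rw [lintegral_comp_smul_E2 _ hc] at h1
    rw [div_eq_inv_mul, ENNReal.ofReal_mul (by positivity), ← h1, ← mul_assoc,
      ← ENNReal.ofReal_mul (by positivity), inv_mul_cancel₀ (by positivity), ENNReal.ofReal_one, one_mul]
  rcases lt_or_gt_of_ne hc with h | h
  · rw [← lintegral_neg_eq_self]
    simp_rw [smul_neg, ← neg_smul]
    rw [hpos (neg_pos.2 h), neg_sq]
  · exact hpos h

/-! ### The point spread function -/

/-- Inverse transverse resolution per unit of frequency. -/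
def transverseRate (S : Setup) (tg : ℝ) : ℝ := S.a₀ / (S.c₀ * (S.c₀ * tg))

/-- Defocusing per unit of frequency caused by the mismatch of the speeds. -/
def defocusRate (S : Setup) (tg cs : ℝ) : ℝ :=
  S.a₀ ^ 2 / (2 * S.c₀ * (S.c₀ * tg)) * ((S.c₀ / cs) ^ 2 - 1)

/-- The complex point spread function with defocusing rate `q`. -/
def psfC (S : Setup) (B tg q : ℝ) (η : E3) : ℂ :=
  ∫ ω : ℝ, dspec S B ω * Complex.exp (Complex.I * ((ω / S.c₀ * S.phase tg η : ℝ) : ℂ)) *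
    avgExp S (-(transverseRate S tg * ω) • hor η) (ω * q) ^ 2

theorem Gη_eq {S : Setup} (hc : 0 < S.c₀) {tg : ℝ} (htg : 0 < tg) (cs ω : ℝ) (η : E3) :
    S.Gη tg cs ω η = avgExp S (-(transverseRate S tg * ω) • hor η) (ω * defocusRate S tg cs) := by
  have hL : 0 < S.c₀ * tg := by positivity
  rw [Setup.Gη, Setup.G, avgExp, norm_guideStar S hL.le]
  congr 2
  funext u
  congr 1
  rw [norm_sq_E2, inner_smul_right]
  simp only [PiLp.inner_apply, Fin.sum_univ_two, hor_zero, hor_one, RCLike.inner_apply, conj_trivial,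
    transverseRate, defocusRate]
  push_cast
  ring

theorem psf_eq {S : Setup} (hc : 0 < S.c₀) {tg : ℝ} (htg : 0 < tg) (B cs : ℝ) (η : E3) :
    S.psf B tg cs η = (psfC S B tg (defocusRate S tg cs) η).re := by
  simp only [Setup.psf, psfC, Gη_eq hc htg, dspec]

theorem conj_dspec (S : Setup) (B ω : ℝ) : (starRingEnd ℂ) (dspec S B ω) = dspec S B (-ω) := by
  rw [dspec, dspec, Fhat_neg, map_mul, map_neg, Complex.conj_I, Complex.conj_ofReal]
  push_cast; ring

/-- The integrand is Hermitian under ω → -ω because F̂ is even and real. The integral is therefore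
real, and the real part taken in `Setup.psf` loses no energy. -/
theorem conj_psfC (S : Setup) (B tg q : ℝ) (η : E3) :
    (starRingEnd ℂ) (psfC S B tg q η) = psfC S B tg q η := by
  conv_rhs => rw [psfC, ← integral_neg_eq_self]
  rw [psfC, ← integral_conj]
  refine integral_congr_ae (Eventually.of_forall fun ω => ?_)
  simp only [map_mul, map_pow, conj_dspec, conj_avgExp, ← Complex.exp_conj, Complex.conj_I,
    Complex.conj_ofReal]
  congr 2
  · congr 1; push_cast; ring
  · congr 1 <;> simp

theorem norm_sq_psfC (S : Setup) (B tg q : ℝ) (η : E3) :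
    ‖psfC S B tg q η‖ ^ 2 = |(psfC S B tg q η).re| ^ 2 := by
  have h := Complex.conj_eq_iff_im.1 (conj_psfC S B tg q η)
  rw [Complex.sq_norm, Complex.normSq_apply, h, sq_abs]
  ring

theorem continuous_phase (S : Setup) (tg : ℝ) : Continuous (S.phase tg) := by
  unfold Setup.phase; fun_prop

theorem continuous_dspec (S : Setup) {B : ℝ} (hB : 0 < B) : Continuous (dspec S B) := by
  obtain ⟨f, hf⟩ := exists_schwartz_dspec S hB
  exact hf ▸ f.continuous

theorem measurable_psfC {S : Setup} (hS : S.Admissible) {B : ℝ} (hB : 0 < B) (tg q : ℝ) :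
    Measurable (psfC S B tg q) := by
  have h1 := continuous_phase S tg
  have h2 := continuous_dspec S hB
  have h3 := (continuous_avgExp hS).comp (f := fun p : E3 × ℝ =>
    (-(transverseRate S tg * p.2) • hor p.1, p.2 * q)) (by have := continuous_hor; fun_prop)
  simp only [Function.comp_def] at h3
  exact (StronglyMeasurable.integral_prod_right (f := fun η : E3 => fun ω : ℝ => dspec S B ω *
    Complex.exp (Complex.I * ((ω / S.c₀ * S.phase tg η : ℝ) : ℂ)) *
    avgExp S (-(transverseRate S tg * ω) • hor η) (ω * q) ^ 2)
    (Continuous.stronglyMeasurable (by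
      have h4 : Continuous fun p : E3 × ℝ => ((p.2 / S.c₀ * S.phase tg p.1 : ℝ) : ℂ) := by fun_prop
      exact ((h2.comp continuous_snd).mul (Complex.continuous_exp.comp (continuous_const.mul h4))).mul
        (h3.pow 2)))).measurable

/-- Expanding the squares separates the two sensors: the terms in |η_⊥|² complete the phase, the
cross terms are linear in each sensor, and the terms in |u|² combine with the search distances into
minus the defocusing rate. -/
theorem limitPhase_eq {S : Setup} (hc : S.c₀ ≠ 0) {tg cs : ℝ} (htg : 0 < tg) (hcs : cs ≠ 0)
    (hc0 : 0 < S.c₀) (ω : ℝ) (η : E3) (u₁ u₂ : E2) : ω * limitPhase S tg cs η u₁ u₂ =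
      ω / S.c₀ * S.phase tg η +
      ((inner ℝ u₁ (-(transverseRate S tg * ω) • hor η) + ω * -defocusRate S tg cs * ‖u₁‖ ^ 2) +
      (inner ℝ u₂ (-(transverseRate S tg * ω) • hor η) + ω * -defocusRate S tg cs * ‖u₂‖ ^ 2)) := by
  have hL : 0 < S.c₀ * tg := by positivity
  rw [limitPhase, Setup.phase, norm_guideStar S hL.le, inner_smul_right, inner_smul_right,
    norm_sub_sq_real, norm_sub_sq_real, norm_smul, norm_smul, inner_smul_right, inner_smul_right,
    real_inner_comm u₁, real_inner_comm u₂, mul_pow, mul_pow, Real.norm_eq_abs, sq_abs,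
    transverseRate, defocusRate, show η 0 ^ 2 + η 1 ^ 2 = ‖hor η‖ ^ 2 by rw [norm_sq_E2]; rfl]
  field_simp
  ring

/-- By `limitPhase_eq` the double array integral factorises at each frequency into the square of one
average. The defocusing appears with the sign opposite to that in `Setup.psf`; only the energies
agree, by `psfEnergy_neg`. -/
theorem limitKernel_eq {S : Setup} (hS : S.Admissible) {B tg cs : ℝ} (hB : 0 < B) (htg : 0 < tg)
    (hcs : 0 < cs) (η : E3) :
    limitKernel S B tg cs η = (S.amplitude tg : ℂ) * psfC S B tg (-defocusRate S tg cs) η := by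
  have hc0 := hS.c₀_pos
  have h0 := area_pos hS
  have hpi := Real.pi_pos
  have hL : 0 < S.c₀ * tg := by positivity
  obtain ⟨f, hf⟩ := exists_schwartz_dspec S hB
  have hfi : Integrable (dspec S B) := hf ▸ f.integrable
  have hfin : IsFiniteMeasure (volume.restrict S.A₀) := ⟨by simpa using hS.A₀_bdd.measure_lt_top⟩
  set m : Measure E2 := volume.restrict S.A₀ with hm
  have hlc : Continuous fun u : E2 × E2 => limitPhase S tg cs η u.1 u.2 := by
    unfold limitPhase; fun_prop
  have hint : Integrable (fun p : (E2 × E2) × ℝ => dspec S B p.2 *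
      Complex.exp (Complex.I * ((p.2 * limitPhase S tg cs η p.1.1 p.1.2 : ℝ) : ℂ)))
      ((m.prod m).prod volume) := by
    refine (hfi.comp_snd (m.prod m)).mul_bdd (c := 1) ?_
      (Eventually.of_forall fun p => (norm_exp_I_mul _).le)
    exact Continuous.aestronglyMeasurable (by fun_prop)
  have h1 : ∫ u₁ in S.A₀, ∫ u₂ in S.A₀, osc (dspec S B) (limitPhase S tg cs η u₁ u₂) =
      ((volume.real S.A₀ : ℝ) : ℂ) ^ 2 * psfC S B tg (-defocusRate S tg cs) η := by
    have e1 := integral_prod (μ := m) (ν := m)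
      (fun u : E2 × E2 => osc (dspec S B) (limitPhase S tg cs η u.1 u.2)) hint.integral_prod_left
    refine e1.symm.trans ?_
    have e2 := integral_integral_swap (f := fun (u : E2 × E2) (ω : ℝ) => dspec S B ω *
      Complex.exp (Complex.I * ((ω * limitPhase S tg cs η u.1 u.2 : ℝ) : ℂ))) hint
    refine e2.trans ?_
    rw [psfC, ← integral_const_mul]
    refine integral_congr_ae (Eventually.of_forall fun ω => ?_)
    beta_reduce
    have e3 : ∀ u : E2 × E2, dspec S B ω *
        Complex.exp (Complex.I * ((ω * limitPhase S tg cs η u.1 u.2 : ℝ) : ℂ)) =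
        (dspec S B ω * Complex.exp (Complex.I * ((ω / S.c₀ * S.phase tg η : ℝ) : ℂ))) *
        (Complex.exp (Complex.I * ((inner ℝ u.1 (-(transverseRate S tg * ω) • hor η) +
          ω * -defocusRate S tg cs * ‖u.1‖ ^ 2 : ℝ) : ℂ)) *
        Complex.exp (Complex.I * ((inner ℝ u.2 (-(transverseRate S tg * ω) • hor η) +
          ω * -defocusRate S tg cs * ‖u.2‖ ^ 2 : ℝ) : ℂ))) := by
      intro u
      rw [limitPhase_eq hc0.ne' htg hcs.ne' hc0, mul_assoc (dspec S B ω), ← Complex.exp_add,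
        ← Complex.exp_add, Complex.ofReal_add (S.phase tg η |> (ω / S.c₀ * ·)),
        Complex.ofReal_add (_ + _)]
      congr 2
      ring
    simp_rw [e3]
    rw [integral_const_mul, integral_prod_mul (fun u : E2 => Complex.exp (Complex.I *
      ((inner ℝ u (-(transverseRate S tg * ω) • hor η) + ω * -defocusRate S tg cs * ‖u‖ ^ 2 : ℝ) : ℂ)))
      (fun u : E2 => Complex.exp (Complex.I *
      ((inner ℝ u (-(transverseRate S tg * ω) • hor η) + ω * -defocusRate S tg cs * ‖u‖ ^ 2 : ℝ) : ℂ))),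
      avgExp, ← hm]
    have hA : ((volume.real S.A₀ : ℝ) : ℂ) ≠ 0 := Complex.ofReal_ne_zero.2 h0.ne'
    rw [Complex.ofReal_div, Complex.ofReal_one]
    field_simp
  rw [limitKernel]
  simp only [limitSlice]
  rw [integral_const_mul, integral_const_mul, h1, ← mul_assoc, ← mul_assoc, ← mul_assoc,
    ← Complex.ofReal_pow, ← Complex.ofReal_mul, ← Complex.ofReal_mul, ← Complex.ofReal_mul]
  congr 2
  rw [mainConst, Setup.amplitude, norm_guideStar S hL.le]
  field_simp
  ring

theorem integrable_Fhat_sq (S : Setup) {B : ℝ} (hB : 0 < B) : Integrable fun ω => S.Fhat B ω ^ 2 := by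
  obtain ⟨f, hf⟩ := exists_schwartz_Fhat S hB
  have h := (f.memLp 2 volume).integrable_norm_pow (by norm_num)
  refine h.congr (Eventually.of_forall fun ω => ?_)
  simp only [hf, Complex.norm_real, Real.norm_eq_abs]
  norm_num

/-! ### The energy of the point spread function -/

theorem phase_mk3 {S : Setup} (hc : 0 < S.c₀) {tg : ℝ} (htg : 0 < tg) (x : E2) (t : ℝ) :
    S.phase tg (mk3 x t) = 2 * (t + ‖x‖ ^ 2 / (2 * (S.c₀ * tg))) := by
  have hL : 0 < S.c₀ * tg := by positivity
  rw [Setup.phase, norm_guideStar S hL.le, norm_sq_E2, mk3_zero, mk3_one, mk3_two]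
  field_simp

theorem transverseRate_pos {S : Setup} (hS : S.Admissible) {tg : ℝ} (htg : 0 < tg) :
    0 < transverseRate S tg := by
  have := hS.c₀_pos
  have := hS.a₀_pos
  unfold transverseRate; positivity

theorem integrable_Fhat_sq_mul {S : Setup} (hS : S.Admissible) {B : ℝ} (hB : 0 < B) (q : ℝ) :
    Integrable fun ω => S.Fhat B ω ^ 2 * quarticMass S (ω * q) := by
  refine (integrable_Fhat_sq S hB).mul_bdd (c := (2 * Real.pi) ^ 2 / volume.real S.A₀)
    ((continuous_quarticMass hS).comp (by fun_prop)).aestronglyMeasurable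
    (Eventually.of_forall fun ω => ?_)
  rw [Real.norm_of_nonneg (quarticMass_nonneg S _)]
  exact quarticMass_le hS _

theorem enorm_sq_eq_ofReal (z : ℂ) : ‖z‖ₑ ^ 2 = ENNReal.ofReal (‖z‖ ^ 2) := by
  rw [ENNReal.ofReal_pow (norm_nonneg _), ofReal_norm]

/-- The squared `L²` norm of the point spread function with defocusing rate `q`. -/
def psfEnergy (S : Setup) (B tg q : ℝ) : ℝ :=
  Real.pi * S.c₀ / transverseRate S tg ^ 2 * ∫ ω, S.Fhat B ω ^ 2 * quarticMass S (ω * q)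

theorem psfEnergy_nonneg {S : Setup} (hS : S.Admissible) (B tg q : ℝ) : 0 ≤ psfEnergy S B tg q := by
  have := hS.c₀_pos
  have := Real.pi_pos
  refine mul_nonneg (by positivity) (integral_nonneg fun ω => ?_)
  exact mul_nonneg (sq_nonneg _) (quarticMass_nonneg S _)

theorem psfEnergy_neg (S : Setup) (B tg q : ℝ) : psfEnergy S B tg (-q) = psfEnergy S B tg q := by
  simp only [psfEnergy, mul_neg, quarticMass_neg]

/-- For fixed horizontal part the paraxial term of the phase is a mere translation in height, so
Plancherel applies there. At each frequency the horizontal integral is then a dilation of the fourth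
moment by bω, where b is the transverse rate; the resulting (bω)⁻² cancels the ω² of the spectrum.
-/
theorem lintegral_psfC {S : Setup} (hS : S.Admissible) {B tg : ℝ} (hB : 0 < B) (htg : 0 < tg) (q : ℝ) :
    ∫⁻ η, ‖psfC S B tg q η‖ₑ ^ 2 = ENNReal.ofReal (psfEnergy S B tg q) := by
  have hc := hS.c₀_pos
  have hb := transverseRate_pos hS htg
  have hpi := Real.pi_pos
  set b := transverseRate S tg with hbdef
  obtain ⟨f, hf⟩ := exists_schwartz_dspec S hB
  have hG : Continuous fun p : E2 × ℝ => dspec S B p.2 * avgExp S (-(b * p.2) • p.1) (p.2 * q) ^ 2 := by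
    have h3 := (continuous_avgExp hS).comp (f := fun p : E2 × ℝ =>
      (-(b * p.2) • p.1, p.2 * q)) (by fun_prop)
    exact ((continuous_dspec S hB).comp continuous_snd).mul (h3.pow 2)
  have hslice : ∀ x : E2, ∫⁻ t, ‖psfC S B tg q (mk3 x t)‖ₑ ^ 2 =
      ENNReal.ofReal (Real.pi * S.c₀) *
        ∫⁻ ω, ‖dspec S B ω * avgExp S (-(b * ω) • x) (ω * q) ^ 2‖ₑ ^ 2 := by
    intro x
    set g : ℝ → ℂ := fun ω => dspec S B ω * avgExp S (-(b * ω) • x) (ω * q) ^ 2 with hg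
    have hgc : Continuous g := hG.comp (f := fun ω : ℝ => (x, ω)) (by fun_prop)
    have hle : ∀ ω, ‖g ω‖ ≤ ‖f ω‖ := fun ω => by
      rw [hg, norm_mul, norm_pow, hf]
      exact mul_le_of_le_one_right (norm_nonneg _)
        (pow_le_one₀ (norm_nonneg _) (norm_avgExp_le_one hS _ _))
    have h1 : Integrable g := f.integrable.mono hgc.aestronglyMeasurable (Eventually.of_forall hle)
    have h2 : MemLp g 2 := (f.memLp 2 volume).mono hgc.aestronglyMeasurable (Eventually.of_forall hle)
    have h3 := lintegral_osc_sq h1 h2 (κ := 2 / S.c₀) (by positivity)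
    rw [show 2 * Real.pi / (2 / S.c₀) = Real.pi * S.c₀ by field_simp] at h3
    rw [← h3, ← lintegral_add_right_eq_self (fun s => ‖osc g (2 / S.c₀ * s)‖ₑ ^ 2)
      (‖x‖ ^ 2 / (2 * (S.c₀ * tg)))]
    refine lintegral_congr fun t => ?_
    rw [psfC, osc]
    congr 3
    funext ω
    rw [phase_mk3 hc htg, hor_mk3, hg, mul_right_comm]
    congr 4
    ring
  have hm := measurable_psfC hS hB tg q
  rw [lintegral_mk3 (by fun_prop)]
  simp_rw [hslice]
  rw [lintegral_const_mul' _ _ ENNReal.ofReal_ne_top, lintegral_lintegral_swap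
    (by have := hG.measurable; exact (Measurable.pow_const (by fun_prop) 2).aemeasurable)]
  have hω : ∀ᵐ ω : ℝ, ∫⁻ x : E2, ‖dspec S B ω * avgExp S (-(b * ω) • x) (ω * q) ^ 2‖ₑ ^ 2 =
      ENNReal.ofReal (S.Fhat B ω ^ 2 * quarticMass S (ω * q) / b ^ 2) := by
    filter_upwards [Measure.ae_ne volume (0 : ℝ)] with ω h0
    have e : ∀ x : E2, ‖dspec S B ω * avgExp S (-(b * ω) • x) (ω * q) ^ 2‖ₑ ^ 2 =
        ENNReal.ofReal (‖dspec S B ω‖ ^ 2) *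
          ENNReal.ofReal (‖avgExp S (-(b * ω) • x) (ω * q)‖ ^ 4) := fun x => by
      rw [enorm_sq_eq_ofReal, ← ENNReal.ofReal_mul (by positivity), norm_mul, norm_pow]
      congr 1; ring
    simp_rw [e]
    rw [lintegral_const_mul' _ _ ENNReal.ofReal_ne_top,
      lintegral_quartic hS (neg_ne_zero.2 (mul_ne_zero hb.ne' h0)),
      ← ENNReal.ofReal_mul (by positivity)]
    congr 1
    rw [dspec, norm_mul, norm_neg, Complex.norm_I, one_mul, Complex.norm_real, Real.norm_eq_abs, sq_abs]
    field_simp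
  have hi := integrable_Fhat_sq_mul hS hB q
  rw [lintegral_congr_ae hω, ← ofReal_integral_eq_lintegral_ofReal (hi.div_const _)
    (Eventually.of_forall fun ω => div_nonneg (mul_nonneg (sq_nonneg _) (quarticMass_nonneg S _))
      (by positivity)), ← ENNReal.ofReal_mul (by positivity), integral_div, psfEnergy]
  congr 1
  ring

theorem integrable_of_lintegral_ofReal_eq {α : Type*} [MeasurableSpace α] {ν : Measure α} {f : α → ℝ}
    {c : ℝ} (hf : Measurable f) (h0 : ∀ x, 0 ≤ f x) (hc : 0 ≤ c)
    (h : ∫⁻ x, ENNReal.ofReal (f x) ∂ν = ENNReal.ofReal c) : Integrable f ν ∧ ∫ x, f x ∂ν = c := by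
  refine ⟨(lintegral_ofReal_ne_top_iff_integrable hf.aestronglyMeasurable
    (Eventually.of_forall h0)).1 (h ▸ ENNReal.ofReal_ne_top), ?_⟩
  rw [integral_eq_lintegral_of_nonneg_ae (Eventually.of_forall h0) hf.aestronglyMeasurable, h,
    ENNReal.toReal_ofReal hc]

theorem integral_norm_sq_psfC {S : Setup} (hS : S.Admissible) {B tg : ℝ} (hB : 0 < B) (htg : 0 < tg)
    (q : ℝ) : (Integrable fun η => ‖psfC S B tg q η‖ ^ 2) ∧
      ∫ η, ‖psfC S B tg q η‖ ^ 2 = psfEnergy S B tg q := by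
  have hm := measurable_psfC hS hB tg q
  refine integrable_of_lintegral_ofReal_eq (by fun_prop) (fun η => by positivity)
    (psfEnergy_nonneg hS B tg q) ?_
  simp_rw [← enorm_sq_eq_ofReal]
  exact lintegral_psfC hS hB htg q

theorem integral_psf_sq {S : Setup} (hS : S.Admissible) {B tg : ℝ} (hB : 0 < B) (htg : 0 < tg) (cs : ℝ) :
    (Integrable fun η => |S.psf B tg cs η| ^ 2) ∧
      ∫ η, |S.psf B tg cs η| ^ 2 = psfEnergy S B tg (defocusRate S tg cs) := by
  simp_rw [psf_eq hS.c₀_pos htg, ← norm_sq_psfC]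
  exact integral_norm_sq_psfC hS hB htg _

theorem integral_norm_sq_limitKernel {S : Setup} (hS : S.Admissible) {B tg cs : ℝ} (hB : 0 < B)
    (htg : 0 < tg) (hcs : 0 < cs) : ∫ η, ‖limitKernel S B tg cs η‖ ^ 2 =
      S.amplitude tg ^ 2 * psfEnergy S B tg (defocusRate S tg cs) := by
  simp_rw [limitKernel_eq hS hB htg hcs, norm_mul, mul_pow]
  rw [integral_const_mul, (integral_norm_sq_psfC hS hB htg _).2, psfEnergy_neg, Complex.norm_real,
    Real.norm_eq_abs, sq_abs]

/-! ### The narrow-band regime -/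

/-- The integral of the narrow-band intensity. -/
def narrowEnergy (S : Setup) (B tg cs : ℝ) : ℝ :=
  S.c₀ / (4 * Real.pi * B) * (∫ v, S.Fhat₀ v ^ 2) *
    (quarticMass S (S.ω₀ * defocusRate S tg cs) / (transverseRate S tg * S.ω₀) ^ 2)

theorem F₀_eq_osc (S : Setup) (t : ℝ) :
    S.F₀ t = (1 / (2 * Real.pi : ℝ) : ℂ) * osc (fun ω => (S.Fhat₀ ω : ℂ)) (-t) := by
  rw [Setup.F₀, osc]
  congr 2
  funext ω
  congr 2
  push_cast; ring

theorem integral_Fhat₀_sq_nonneg (S : Setup) : 0 ≤ ∫ v, S.Fhat₀ v ^ 2 :=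
  integral_nonneg fun _ => sq_nonneg _

theorem integrable_Fhat₀_sq (S : Setup) : Integrable fun v => S.Fhat₀ v ^ 2 := by
  have h := (S.Fhat₀.memLp 2 volume).integrable_norm_pow (by norm_num)
  refine h.congr (Eventually.of_forall fun ω => ?_)
  norm_num

/-- The computation of `lintegral_psfC` with the transverse factor frozen at ω₀: the height sees
only F₀, whose L² norm is given by Plancherel, and the horizontal part gives the fourth moment at
ω₀. -/
theorem integral_narrowIntegrand {S : Setup} (hS : S.Admissible) {B tg : ℝ} (hB : 0 < B) (htg : 0 < tg)
    (cs : ℝ) : Integrable (S.narrowIntegrand B tg cs) ∧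
      ∫ η, S.narrowIntegrand B tg cs η = narrowEnergy S B tg cs := by
  have hc := hS.c₀_pos
  have hb := transverseRate_pos hS htg
  have hω := hS.ω₀_pos
  have hpi := Real.pi_pos
  have hM := quarticMass_nonneg S (S.ω₀ * defocusRate S tg cs)
  have hQ := integral_Fhat₀_sq_nonneg S
  set f : ℝ → ℂ := fun ω => (S.Fhat₀ ω : ℂ) with hf
  have hfc : Continuous f := Complex.continuous_ofReal.comp S.Fhat₀.continuous
  have hf1 : Integrable f := S.Fhat₀.integrable.ofReal
  have hf2 : MemLp f 2 := (S.Fhat₀.memLp 2 volume).ofReal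
  have hF₀ : Measurable S.F₀ := by
    have h : Measurable (osc f) := (StronglyMeasurable.integral_prod_right
      (f := fun s : ℝ => fun ω : ℝ => f ω * Complex.exp (Complex.I * ((ω * s : ℝ) : ℂ)))
      (Continuous.stronglyMeasurable (by fun_prop))).measurable
    rw [funext (F₀_eq_osc S)]
    fun_prop
  have hm : Measurable (S.narrowIntegrand B tg cs) := by
    have h1 := continuous_phase S tg
    have h2 := continuous_hor
    have h3 := (continuous_avgExp hS).comp (f := fun η : E3 =>
      (-(transverseRate S tg * S.ω₀) • hor η, S.ω₀ * defocusRate S tg cs)) (by fun_prop)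
    simp only [Function.comp_def] at h3
    unfold Setup.narrowIntegrand
    simp only [Gη_eq hc htg]
    exact ((hF₀.comp (continuous_const.mul h1).measurable).norm.pow_const 2).mul
      (h3.measurable.norm.pow_const 4)
  refine integrable_of_lintegral_ofReal_eq hm (fun η => by unfold Setup.narrowIntegrand; positivity)
    (by unfold narrowEnergy; positivity) ?_
  have hslice : ∀ x : E2, ∫⁻ t, ENNReal.ofReal (S.narrowIntegrand B tg cs (mk3 x t)) =
      ENNReal.ofReal (S.c₀ / (4 * Real.pi * B) * ∫ v, S.Fhat₀ v ^ 2) * ENNReal.ofReal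
        (‖avgExp S (-(transverseRate S tg * S.ω₀) • x) (S.ω₀ * defocusRate S tg cs)‖ ^ 4) := by
    intro x
    simp only [Setup.narrowIntegrand, Gη_eq hc htg, hor_mk3, phase_mk3 hc htg]
    simp_rw [ENNReal.ofReal_mul (sq_nonneg _)]
    rw [lintegral_mul_const' _ _ ENNReal.ofReal_ne_top]
    congr 1
    rw [lintegral_add_right_eq_self (fun s => ENNReal.ofReal (‖S.F₀ (B / S.c₀ * (2 * s))‖ ^ 2)),
      ← lintegral_neg_eq_self]
    have e : ∀ s : ℝ, ENNReal.ofReal (‖S.F₀ (B / S.c₀ * (2 * -s))‖ ^ 2) =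
        ENNReal.ofReal ((1 / (2 * Real.pi)) ^ 2) * ‖osc f (2 * B / S.c₀ * s)‖ₑ ^ 2 := by
      intro s
      rw [F₀_eq_osc, norm_mul, mul_pow, enorm_sq_eq_ofReal, ← ENNReal.ofReal_mul (by positivity)]
      congr 2
      · rw [← Complex.ofReal_one, ← Complex.ofReal_div, Complex.norm_real, Real.norm_eq_abs, sq_abs]
      · congr 3; ring
    simp_rw [e]
    rw [lintegral_const_mul' _ _ ENNReal.ofReal_ne_top, lintegral_osc_sq hf1 hf2 (by positivity)]
    simp_rw [enorm_sq_eq_ofReal]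
    have e2 : ∀ ω, ‖f ω‖ ^ 2 = S.Fhat₀ ω ^ 2 := fun ω => by
      rw [hf, Complex.norm_real, Real.norm_eq_abs, sq_abs]
    simp_rw [e2]
    rw [← ofReal_integral_eq_lintegral_ofReal (integrable_Fhat₀_sq S)
      (Eventually.of_forall fun _ => sq_nonneg _), ← ENNReal.ofReal_mul (by positivity),
      ← ENNReal.ofReal_mul (by positivity)]
    congr 1
    field_simp
    ring
  rw [lintegral_mk3 hm.ennreal_ofReal]
  simp_rw [hslice]
  rw [lintegral_const_mul' _ _ ENNReal.ofReal_ne_top, lintegral_quartic hS (neg_ne_zero.2 (by positivity)),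
    ← ENNReal.ofReal_mul (by positivity), neg_sq, narrowEnergy]

/-- The two spectral bumps at ±ω₀ are exchanged by ω → -ω, so the integrand is g(ω) + g(-ω), with g
carrying one bump. Centring it by ω = ω₀ - Bv makes the dependence on B explicit. -/
theorem bandwidth_integral (S : Setup) {B C : ℝ} (hB : 0 < B) {h : ℝ → ℝ} (hh : Continuous h)
    (hC : ∀ ω, ‖h ω‖ ≤ C) (heven : ∀ ω, h (-ω) = h ω) :
    B * ∫ ω, S.Fhat B ω ^ 2 * h ω =
      2 * ∫ v, S.Fhat₀ v * ((S.Fhat₀ v + S.Fhat₀ (2 * S.ω₀ / B - v)) * h (S.ω₀ - B * v)) := by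
  have hf := S.Fhat₀.continuous
  set M := SchwartzMap.seminorm ℝ 0 0 S.Fhat₀
  have hM : ∀ v, ‖S.Fhat₀ v‖ ≤ M := fun v => SchwartzMap.norm_le_seminorm ℝ S.Fhat₀ v
  have hM0 := (norm_nonneg _).trans (hM 0)
  set g : ℝ → ℝ := fun ω => S.Fhat₀ ((S.ω₀ - ω) / B) *
    ((S.Fhat₀ ((S.ω₀ - ω) / B) + S.Fhat₀ ((S.ω₀ + ω) / B)) * h ω) with hg
  have hgi : Integrable g := by
    have h1 : Integrable fun ω => S.Fhat₀ ((S.ω₀ - ω) / B) :=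
      (S.Fhat₀.integrable.comp_div hB.ne').comp_sub_left S.ω₀
    refine h1.mul_bdd (c := (M + M) * C) (Continuous.aestronglyMeasurable (by fun_prop))
      (Eventually.of_forall fun ω => ?_)
    rw [norm_mul]
    exact mul_le_mul ((norm_add_le _ _).trans (add_le_add (hM _) (hM _))) (hC _) (norm_nonneg _)
      (by positivity)
  have e1 : ∀ ω, S.Fhat B ω ^ 2 * h ω = (1 / B) ^ 2 * (g ω + g (-ω)) := fun ω => by
    simp only [hg, Setup.Fhat, heven]
    rw [sub_neg_eq_add, ← sub_eq_add_neg]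
    ring
  have e2 := Measure.integral_comp_mul_left (fun y => g (S.ω₀ - y)) B
  rw [integral_sub_left_eq_self g volume S.ω₀, abs_of_pos (inv_pos.2 hB), smul_eq_mul] at e2
  have e3 : ∀ v, g (S.ω₀ - B * v) =
      S.Fhat₀ v * ((S.Fhat₀ v + S.Fhat₀ (2 * S.ω₀ / B - v)) * h (S.ω₀ - B * v)) := fun v => by
    simp only [hg]
    rw [sub_sub_cancel, mul_div_cancel_left₀ _ hB.ne',
      show (S.ω₀ + (S.ω₀ - B * v)) / B = 2 * S.ω₀ / B - v by field_simp; ring]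
  simp_rw [e3] at e2
  simp_rw [e1]
  rw [e2, integral_const_mul, integral_add hgi hgi.comp_neg, integral_neg_eq_self]
  field_simp
  ring

/-- In the centred form of `bandwidth_integral` the overlap of the bumps is evaluated at 2ω₀/B - v,
which escapes to infinity, while h is evaluated ever closer to ω₀. -/
theorem tendsto_bandwidth {S : Setup} (hω : 0 < S.ω₀) {C : ℝ} {h : ℝ → ℝ} (hh : Continuous h)
    (hC : ∀ ω, ‖h ω‖ ≤ C) (heven : ∀ ω, h (-ω) = h ω) :
    Tendsto (fun B => B * ∫ ω, S.Fhat B ω ^ 2 * h ω) (𝓝[>] 0)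
      (𝓝 (2 * ((∫ v, S.Fhat₀ v ^ 2) * h S.ω₀))) := by
  have hf := S.Fhat₀.continuous
  set M := SchwartzMap.seminorm ℝ 0 0 S.Fhat₀
  have hM : ∀ v, ‖S.Fhat₀ v‖ ≤ M := fun v => SchwartzMap.norm_le_seminorm ℝ S.Fhat₀ v
  have hM0 := (norm_nonneg _).trans (hM 0)
  rw [tendsto_congr' (eventually_nhdsWithin_of_forall fun B hB =>
    bandwidth_integral S (Set.mem_Ioi.1 hB) hh hC heven), ← integral_mul_const]
  refine Tendsto.const_mul 2 (tendsto_integral_filter_of_dominated_convergence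
    (fun v => ‖S.Fhat₀ v‖ * ((M + M) * C)) (Eventually.of_forall fun B =>
      Continuous.aestronglyMeasurable (by fun_prop)) (Eventually.of_forall fun B =>
      Eventually.of_forall fun v => ?_) (S.Fhat₀.integrable.norm.mul_const _)
    (Eventually.of_forall fun v => ?_))
  · rw [norm_mul, norm_mul]
    gcongr
    · exact (norm_add_le _ _).trans (add_le_add (hM _) (hM _))
    · exact hC _
  · have h1 : Tendsto (fun B : ℝ => 2 * S.ω₀ / B - v) (𝓝[>] 0) atTop := by
      have h0 : Tendsto (fun B : ℝ => 2 * S.ω₀ * B⁻¹) (𝓝[>] 0) atTop :=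
        tendsto_inv_nhdsGT_zero.const_mul_atTop (by positivity)
      exact tendsto_atTop_add_const_right _ (-v) h0
    have h2 : Tendsto (fun B : ℝ => S.Fhat₀ (2 * S.ω₀ / B - v)) (𝓝[>] 0) (𝓝 0) :=
      ((zero_at_infty S.Fhat₀).mono_left atTop_le_cocompact).comp h1
    have h3 : Tendsto (fun B : ℝ => h (S.ω₀ - B * v)) (𝓝[>] 0) (𝓝 (h S.ω₀)) := by
      have : Continuous fun B : ℝ => h (S.ω₀ - B * v) := by fun_prop
      simpa using (this.tendsto 0).mono_left nhdsWithin_le_nhds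
    have h4 := ((h2.const_add (S.Fhat₀ v)).mul h3).const_mul (S.Fhat₀ v)
    rwa [add_zero, ← mul_assoc, ← sq] at h4

theorem randomImage_eq_zero {Ω : Type*} {S : Setup} (h : S.Fhat₀ = 0) (μ : E3 → Ω → ℝ)
    (B tg cs ε ℓ : ℝ) (w : Ω) : S.randomImage μ B tg cs ε ℓ w = 0 := by
  have h0 : ∀ ω, S.Fhat B ω = 0 := fun ω => by simp [Setup.Fhat, h]
  simp [Setup.randomImage, Setup.imaging, Setup.crossCorr, Setup.crossCorrI, Setup.crossCorrII, h0]

theorem integral_Fhat₀_sq_pos {S : Setup} (h : S.Fhat₀ ≠ 0) : 0 < ∫ v, S.Fhat₀ v ^ 2 := by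
  obtain ⟨v, hv⟩ := DFunLike.ne_iff.1 h
  have hv : S.Fhat₀ v ≠ 0 := hv
  rw [integral_pos_iff_support_of_nonneg (fun _ => sq_nonneg _) (integrable_Fhat₀_sq S)]
  exact ((S.Fhat₀.continuous.pow 2).isOpen_support).measure_pos volume ⟨v, by simpa using hv⟩

/-- Both energies blow up like 1/B, so closeness has to be relative. After division by the common
factor πc₀/(b²B), with b the transverse rate, the difference is that of `tendsto_bandwidth`, and the
tolerance is a fixed positive number because the profile and the fourth moment are nonzero. -/
theorem exists_bandwidth_energy_close {S : Setup} (hS : S.Admissible) {tg cs : ℝ} (htg : 0 < tg)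
    (hF : S.Fhat₀ ≠ 0) {κ : ℝ} (hκ : 0 < κ) : ∃ r : ℝ, 0 < r ∧ ∀ B : ℝ, 0 < B → B < r →
      |psfEnergy S B tg (defocusRate S tg cs) - 8 * Real.pi ^ 2 * S.ω₀ ^ 2 * narrowEnergy S B tg cs| ≤
        κ * narrowEnergy S B tg cs := by
  have hc := hS.c₀_pos
  have hb := transverseRate_pos hS htg
  have hω := hS.ω₀_pos
  have hpi := Real.pi_pos
  have hA := area_pos hS
  have hQ := integral_Fhat₀_sq_pos hF
  set q := defocusRate S tg cs
  have hM := quarticMass_pos hS (S.ω₀ * q)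
  have hlim := tendsto_bandwidth (S := S) hω (h := fun ω => quarticMass S (ω * q))
    ((continuous_quarticMass hS).comp (by fun_prop)) (fun ω => by
      rw [Real.norm_of_nonneg (quarticMass_nonneg S _)]; exact quarticMass_le hS _)
    (fun ω => by rw [neg_mul, quarticMass_neg])
  beta_reduce at hlim
  have hev := (Metric.tendsto_nhds.1 hlim (κ * (∫ v, S.Fhat₀ v ^ 2) * quarticMass S (S.ω₀ * q) /
    (4 * Real.pi ^ 2 * S.ω₀ ^ 2)) (by positivity))
  obtain ⟨r, hr, hsub⟩ := mem_nhdsGT_iff_exists_Ioo_subset.1 hev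
  refine ⟨r, hr, fun B hB hBr => ?_⟩
  have h1 : dist _ _ < _ := hsub ⟨hB, hBr⟩
  rw [Real.dist_eq] at h1
  unfold psfEnergy narrowEnergy
  set Q := ∫ v, S.Fhat₀ v ^ 2
  set b := transverseRate S tg
  set I := ∫ ω, S.Fhat B ω ^ 2 * quarticMass S (ω * q)
  set m := quarticMass S (S.ω₀ * q)
  have e1 : Real.pi * S.c₀ / b ^ 2 * I -
      8 * Real.pi ^ 2 * S.ω₀ ^ 2 * (S.c₀ / (4 * Real.pi * B) * Q * (m / (b * S.ω₀) ^ 2)) =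
      Real.pi * S.c₀ / (b ^ 2 * B) * (B * I - 2 * (Q * m)) := by
    field_simp
    ring
  have e2 : κ * (S.c₀ / (4 * Real.pi * B) * Q * (m / (b * S.ω₀) ^ 2)) =
      Real.pi * S.c₀ / (b ^ 2 * B) * (κ * Q * m / (4 * Real.pi ^ 2 * S.ω₀ ^ 2)) := by
    field_simp
  rw [e1, e2, abs_mul, abs_of_pos (a := Real.pi * S.c₀ / (b ^ 2 * B)) (by positivity)]
  exact mul_le_mul_of_nonneg_left h1.le (by positivity)

theorem narrowEnergy_pos {S : Setup} (hS : S.Admissible) {B tg : ℝ} (hB : 0 < B) (htg : 0 < tg) (cs : ℝ)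
    (hF : S.Fhat₀ ≠ 0) : 0 < narrowEnergy S B tg cs := by
  have hc := hS.c₀_pos
  have hb := transverseRate_pos hS htg
  have hω := hS.ω₀_pos
  have hpi := Real.pi_pos
  have hM := quarticMass_pos hS (S.ω₀ * defocusRate S tg cs)
  have hQ := integral_Fhat₀_sq_pos hF
  unfold narrowEnergy
  positivity

end

end PassiveImaging

/-! ### The second order moment. -/

theorem mainTheorem5 {Ω : Type*} [MeasurableSpace Ω] (P : Measure Ω) [IsProbabilityMeasure P]
    (S : PassiveImaging.Setup) (hS : S.Admissible)
    (tg cs : ℝ) (htg : 0 < tg) (hcs : 0 < cs) (hzg : S.guideStar tg ∈ interior S.D)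
    (μ : PassiveImaging.E3 → Ω → ℝ) (hμ : PassiveImaging.IsFluctuation P μ) :
    -- the second moments are finite, and `∫ Σ = ‖Σ‖_{L¹}` for a nonnegative covariance function
    (∀ B ε ℓ : ℝ, 0 < B → 0 < ε → 0 < ℓ → MemLp (S.randomImage μ B tg cs ε ℓ) 2 P) ∧
    Integrable (PassiveImaging.covFun P μ) ∧
    ((∀ x, 0 ≤ PassiveImaging.covFun P μ x) →
      ENNReal.ofReal (∫ x, PassiveImaging.covFun P μ x)
        = eLpNorm (PassiveImaging.covFun P μ) 1 volume) ∧
    -- the asymptotic second moment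
    (∀ B : ℝ, 0 < B →
      Integrable (fun η => |S.psf B tg cs η| ^ 2) ∧
      Tendsto (fun p : ℝ × ℝ => S.secondMoment P μ B tg cs p.1 p.2 / p.2 ^ 3)
        PassiveImaging.regime
        (𝓝 (S.amplitude tg ^ 2 * (∫ x, PassiveImaging.covFun P μ x) *
          ∫ η, |S.psf B tg cs η| ^ 2))) ∧
    -- the regime `B ≪ ω₀`
    (∀ θ : ℝ, 0 < θ → ∃ b : ℝ, 0 < b ∧ ∀ B : ℝ, 0 < B → B / S.ω₀ < b →
      Integrable (S.narrowIntegrand B tg cs) ∧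
      ∀ᶠ p : ℝ × ℝ in PassiveImaging.regime,
        |S.secondMoment P μ B tg cs p.1 p.2 / p.2 ^ 3
            - 8 * Real.pi ^ 2 * S.ω₀ ^ 2 * S.amplitude tg ^ 2 *
              (∫ x, PassiveImaging.covFun P μ x) * ∫ η, S.narrowIntegrand B tg cs η|
          ≤ θ * ∫ η, S.narrowIntegrand B tg cs η) := by
  have hc := hS.c₀_pos
  have hω := hS.ω₀_pos
  have hlim : ∀ B : ℝ, 0 < B →
      Tendsto (fun p : ℝ × ℝ => S.secondMoment P μ B tg cs p.1 p.2 / p.2 ^ 3) PassiveImaging.regime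
        (𝓝 (S.amplitude tg ^ 2 * (∫ x, PassiveImaging.covFun P μ x) *
          PassiveImaging.psfEnergy S B tg (PassiveImaging.defocusRate S tg cs))) := fun B hB => by
    have h := PassiveImaging.tendsto_secondMoment hS hμ hB htg hcs hzg
    rw [PassiveImaging.integral_norm_sq_limitKernel hS hB htg hcs] at h
    convert h using 2
    ring
  refine ⟨fun B ε ℓ hB hε hℓ => (PassiveImaging.secondMoment_eq hS hμ hB tg cs hε hℓ).1,
    PassiveImaging.integrable_covFun hμ, fun h0 => ?_, fun B hB => ?_, fun θ hθ => ?_⟩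
  · rw [eLpNorm_one_eq_lintegral_enorm, ofReal_integral_eq_lintegral_ofReal
      (PassiveImaging.integrable_covFun hμ) (Eventually.of_forall h0)]
    exact lintegral_congr fun x => (Real.enorm_of_nonneg (h0 x)).symm
  · obtain ⟨h1, h2⟩ := PassiveImaging.integral_psf_sq hS hB htg cs
    exact ⟨h1, h2 ▸ hlim B hB⟩
  -- For a zero profile the tolerance θJ is zero, so the estimate must be an equality; it is one,
  -- since the image vanishes identically.
  · by_cases hF : S.Fhat₀ = 0
    · refine ⟨1, one_pos, fun B hB _ => ?_⟩
      obtain ⟨h1, h2⟩ := PassiveImaging.integral_narrowIntegrand hS hB htg cs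
      refine ⟨h1, Eventually.of_forall fun p => ?_⟩
      have h3 : PassiveImaging.narrowEnergy S B tg cs = 0 := by
        simp [PassiveImaging.narrowEnergy, hF]
      simp [h2, h3, PassiveImaging.Setup.secondMoment, PassiveImaging.randomImage_eq_zero hF]
    · set T := ∫ x, PassiveImaging.covFun P μ x
      set M := S.amplitude tg ^ 2 * T with hM
      have hK : 0 < |M| + 1 := by positivity
      -- Half of θ is spent on the bandwidth and half on the limit in (ε, ℓ). Using |M| + 1 instead
      -- of |M| avoids dividing by zero when the amplitude or ∫Σ vanishes.
      obtain ⟨r, hr, hclose⟩ := PassiveImaging.exists_bandwidth_energy_close (cs := cs) hS htg hF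
        (κ := θ / (2 * (|M| + 1))) (by positivity)
      refine ⟨r / S.ω₀, by positivity, fun B hB hBr => ?_⟩
      obtain ⟨h1, h2⟩ := PassiveImaging.integral_narrowIntegrand hS hB htg cs
      have hJ := PassiveImaging.narrowEnergy_pos hS hB htg cs hF
      have hcl := hclose B hB ((div_lt_div_iff_of_pos_right hω).1 hBr)
      refine ⟨h1, ?_⟩
      rw [h2]
      set J := PassiveImaging.narrowEnergy S B tg cs
      filter_upwards [Metric.tendsto_nhds.1 (hlim B hB) (θ / 2 * J) (by positivity)] with p hp
      rw [Real.dist_eq] at hp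
      set W := PassiveImaging.psfEnergy S B tg (PassiveImaging.defocusRate S tg cs)
      have h3 : |M * (W - 8 * Real.pi ^ 2 * S.ω₀ ^ 2 * J)| ≤ θ / 2 * J := by
        rw [abs_mul]
        refine (mul_le_mul (by linarith : |M| ≤ |M| + 1) hcl (abs_nonneg _) hK.le).trans_eq ?_
        field_simp
      rw [hM] at h3
      refine abs_le.2 ⟨?_, ?_⟩
      · linarith [(abs_lt.1 hp).1, (abs_le.1 h3).1]
      · linarith [(abs_lt.1 hp).2, (abs_le.1 h3).2]
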